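/- Let $d\ge 1$ and let $E\subset\mathbb R^{2d}$ be a bounded set. There is a constant $C=C(d,E)>0$ such that the following holds. Put $Q=(\tfrac14,1)\times\mathbb R^{2d}$, with points $(t,x,v)$, $x,v\in\mathbb R^d$. Let $\mathfrak a\colon Q\to\mathbb R^{d\times d}$ be measurable, and let $\lambda>0$ and $\Lambda$ be constants such that for almost every $(t,x,v)\in Q$ and all $\xi\in\mathbb R^d$ $$\lambda|\xi|^2\le\langle\mathfrak a(t,x,v)\xi,\xi\rangle,\qquad |\mathfrak a(t,x,v)\xi|^2\le\Lambda\,\langle\mathfrak a(t,x,v)\xi,\xi\rangle .$$ Let $f$ be an almost everywhere positive weak supersolution in $Q$ of the Kolmogorov equation $$(\partial_t+v\cdot\nabla_x)f-\nabla_v\cdot(\mathfrak a\nabla_v f)=0,$$ that is, $f\in L^2_{\mathrm{loc}}(Q)$, the weak gradient $\nabla_v f$ exists in $L^2_{\mathrm{loc}}(Q;\mathbb R^d)$, and $$-\int_Q f\,(\partial_t+v\cdot\nabla_x)\phi\;\mathrm d(t,x,v)+\int_Q\langle\mathfrak a\nabla_v f,\nabla_v\phi\rangle\;\mathrm d(t,x,v)\ge0\qquad\text{for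 all }0\le\phi\in C_c^\infty(Q).$$ Suppose that $f$ has a trace $f(1,\cdot,\cdot)\in L^1_{\mathrm{loc}}(\mathbb R^{2d})$ at time $1$, in the sense that $\int f(t,y,w)\psi(y,w)\,\mathrm d(y,w)\to\int f(1,y,w)\psi(y,w)\,\mathrm d(y,w)$ for every $\psi\in C_c^\infty(\mathbb R^{2d})$ as $t\to1^-$ outside a null set of times. Then the mean $$c(f)=\int_{\mathbb R^{2d}}\log f(1,y,w)\;\mathrm e^{-\pi(|y|^2+|w|^2)}\,\mathrm d(y,w)\in(-\infty,+\infty]$$ is well defined, i.e. the negative part of $\log f(1,\cdot,\cdot)$ (where $\log u=-\infty$ for $u\le 0$) has a finite integral against the Gaussian weight, and for all $s>0$ $$s\,\Bigl|\Bigl\{(t,x,v)\in\bigl(\tfrac14,\tfrac34\bigr)\times E:\ \log f(t,x,v)-c(f)>s\Bigr\}\Bigr|\le C\Bigl(\frac1\lambda+\Lambda\Bigr),$$ where $|\cdot|$ is Lebesgue (outer) measure. -/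

import Mathlib

open MeasureTheory Set Filter Topology
open scoped ContDiff ENNReal

noncomputable section

namespace Kolmogorov

/-- The position space and the velocity space `ℝᵈ`, with the Euclidean norm. -/
abbrev Space (d : ℕ) := EuclideanSpace ℝ (Fin d)

/-- The phase space `ℝ²ᵈ` of pairs `(x, v)`; its `volume` is Lebesgue measure. -/
abbrev Phase (d : ℕ) := Space d × Space d

/-- Time and phase space: points `(t, x, v)`. -/
abbrev TimePhase (d : ℕ) := ℝ × Phase d

/-- The slab `(t₀, t₁) × ℝ²ᵈ`. -/
def slab (d : ℕ) (t₀ t₁ : ℝ) : Set (TimePhase d) := Ioo t₀ t₁ ×ˢ univ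

/-- The action `𝔞 ξ` of a `d × d` matrix on a Euclidean vector. -/
def act {d : ℕ} (A : Matrix (Fin d) (Fin d) ℝ) (ξ : Space d) : Space d :=
  Matrix.toEuclideanLin A ξ

/-- The diffusion matrix `a` is measurable on `Q` and, almost everywhere on `Q`,
`lam |ξ|² ≤ ⟨a ξ, ξ⟩` and `|a ξ|² ≤ Lam ⟨a ξ, ξ⟩` for all `ξ`.
(The second bound implies `|a ξ| ≤ Lam |ξ|`, so `a` is essentially bounded on `Q`.) -/
structure IsElliptic {d : ℕ} (Q : Set (TimePhase d))
    (a : TimePhase d → Matrix (Fin d) (Fin d) ℝ) (lam Lam : ℝ) : Prop where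
  aemeasurable : ∀ i j, AEMeasurable (fun z => a z i j) (volume.restrict Q)
  lower : ∀ᵐ z ∂(volume.restrict Q), ∀ ξ : Space d,
    lam * ‖ξ‖ ^ 2 ≤ inner ℝ (act (a z) ξ) ξ
  upper : ∀ᵐ z ∂(volume.restrict Q), ∀ ξ : Space d,
    ‖act (a z) ξ‖ ^ 2 ≤ Lam * inner ℝ (act (a z) ξ) ξ

/-- Test functions on `Q`: smooth with compact support contained in `Q`. -/
structure IsTestFunction {d : ℕ} (Q : Set (TimePhase d)) (φ : TimePhase d → ℝ) : Prop where
  smooth : ContDiff ℝ ∞ φ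
  compact : HasCompactSupport φ
  supp : tsupport φ ⊆ Q

/-- `h` is square integrable on every compact subset of `Q`. -/
def IsL2Loc {d : ℕ} {F : Type*} [NormedAddCommGroup F] (Q : Set (TimePhase d))
    (h : TimePhase d → F) : Prop :=
  ∀ K : Set (TimePhase d), IsCompact K → K ⊆ Q → MemLp h 2 (volume.restrict K)

/-- `g` is the weak velocity gradient `∇ᵥ f` on `Q`. Note that
`fderiv ℝ φ z (0, 0, e)` is the derivative of `φ` in the velocity direction `e`. -/
def IsWeakVelocityGradient {d : ℕ} (Q : Set (TimePhase d)) (f : TimePhase d → ℝ)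
    (g : TimePhase d → Space d) : Prop :=
  ∀ φ : TimePhase d → ℝ, IsTestFunction Q φ → ∀ e : Space d,
    ∫ z, f z * fderiv ℝ φ z (0, 0, e) = - ∫ z, inner ℝ (g z) e * φ z

/-- `f` is a weak supersolution in the open set `Q` of
`(∂ₜ + v · ∇ₓ) f - ∇ᵥ · (a ∇ᵥ f) = 0`: it lies in `L²_loc`, so does its weak velocity gradient
`g`, and `-∫ f (∂ₜ + v · ∇ₓ) φ + ∫ ⟨a ∇ᵥ f, ∇ᵥ φ⟩ ≥ 0` for all test functions `φ ≥ 0`.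
Here `fderiv ℝ φ z (1, v, 0) = (∂ₜ + v · ∇ₓ) φ (z)` for `z = (t, x, v)`, and
`fderiv ℝ φ z (0, 0, a g) = ⟨a g, ∇ᵥ φ (z)⟩`. -/
def IsWeakSupersolution {d : ℕ} (Q : Set (TimePhase d))
    (a : TimePhase d → Matrix (Fin d) (Fin d) ℝ) (f : TimePhase d → ℝ) : Prop :=
  IsL2Loc Q f ∧
  ∃ g : TimePhase d → Space d, IsL2Loc Q g ∧ IsWeakVelocityGradient Q f g ∧
    ∀ φ : TimePhase d → ℝ, IsTestFunction Q φ → (∀ z, 0 ≤ φ z) →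
      0 ≤ - (∫ z, f z * fderiv ℝ φ z (1, z.2.2, 0))
        + ∫ z, fderiv ℝ φ z (0, 0, act (a z) (g z))

/-- The values `f (T, ·)` are the trace of `f` at the final time `T`: `f (T, ·)` is locally
integrable and is the limit of `f (t, ·)` in the sense of distributions as `t → T` from the left
(an essential limit: a null set of times `t` is ignored). Functions that are continuous in time
up to `T` with values in `L²` or in `L¹_loc` have this property. -/
def HasFinalTrace {d : ℕ} (f : TimePhase d → ℝ) (T : ℝ) : Prop :=
  LocallyIntegrable (fun p : Phase d => f (T, p)) ∧
  ∀ φ : Phase d → ℝ, ContDiff ℝ ∞ φ → HasCompactSupport φ →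
    Tendsto (fun t : ℝ => ∫ p, f (t, p) * φ p) (𝓝[<] T ⊓ ae volume)
      (𝓝 (∫ p, f (T, p) * φ p))

/-- The Gaussian weight `exp (-π (|y|² + |w|²))`, of total mass one. -/
def gaussWeight {d : ℕ} (p : Phase d) : ℝ :=
  Real.exp (-Real.pi * (‖p.1‖ ^ 2 + ‖p.2‖ ^ 2))

/-- The logarithm with values in `[-∞, ∞]`: equal to `Real.log u` for `u > 0`, and to `-∞` for
`u ≤ 0`. -/
def elog (u : ℝ) : EReal := ENNReal.log (ENNReal.ofReal u)

/-- The Gaussian integral of the positive part of `log F`. -/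
def logMeanPos {d : ℕ} (F : Phase d → ℝ) : ℝ≥0∞ :=
  ∫⁻ p, (elog (F p)).toENNReal * ENNReal.ofReal (gaussWeight p)

/-- The Gaussian integral of the negative part of `log F`. -/
def logMeanNeg {d : ℕ} (F : Phase d → ℝ) : ℝ≥0∞ :=
  ∫⁻ p, (-elog (F p)).toENNReal * ENNReal.ofReal (gaussWeight p)

/-- The Gaussian mean `∫ log F(y, w) exp (-π (|y|² + |w|²)) d(y, w)`, well defined as an extended
real number when one of the integrals of the positive and negative parts is finite. -/
def logMean {d : ℕ} (F : Phase d → ℝ) : EReal :=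
  (logMeanPos F : EReal) - (logMeanNeg F : EReal)

/-- The mean `c(f)` of `log f` at time `1`. -/
def cMean {d : ℕ} (f : TimePhase d → ℝ) : EReal :=
  logMean (fun p => f (1, p))

end Kolmogorov

end

/-! Formally, `log f` is a supersolution with a quadratic gain: `(∂ₜ + v·∇ₓ) log f - ∇ᵥ·(𝔞 ∇ᵥ log f)
≥ ⟨𝔞 ∇ᵥ log f, ∇ᵥ log f⟩`. Test this with a density `ρ ≥ 0` that is moved by free transport and by a
current `J` in velocity only, `(∂ₜ + v·∇ₓ) ρ + ∇ᵥ·J = β`. Young's inequality absorbs every term with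
`∇ᵥ log f` into the gain, and what remains is, up to numerical factors, `∫ β log f ≤ ∫ ρ(1) log f(1)
+ Λ ∫ |∇ᵥρ|²/ρ + (1/λ) ∫ |J|²/ρ`. Let `β` approximate the indicator of a compact subset `K` of the
superlevel set `{log f > c + s}`, and let `ρ(1)` be `|K|` times the Gaussian weight. The left side
is at least `|K| (c + s)`, the first term on the right is `|K| c`, and so `s |K|` is at most the
cost. It remains to find a flow whose cost does not depend on `K`.

Every point of the source emits unit mass, which spreads by Kolmogorov's fundamental solution up to
time `7/8` (there `J = -∇ᵥρ`) and is then steered through Gaussians to the standard weight, reached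
at time `15/16` (`kern`, `drift`, `kern_continuity_equation`). The Fisher information of one kernel
is of order `1/s` at age `s`, which is not integrable at `s = 0`, so the bound cannot come from
convexity alone. But a source bounded by one produces a density bounded by `1/2`
(`IsSource.dens_le_half`), and then the production of the concave entropy `∫ √ρ` controls the Fisher
information: `4 d/dt ∫ √ρ ≥ ∫ |∇ᵥρ|² ρ^(-3/2) ≥ ∫ |∇ᵥρ|²/ρ`. Hence the early cost is bounded by `∫
√ρ` at a later time, where Gaussian bounds are available (`IsSource.fisher_early`). After time
`13/16` all emitted mass has age at least `1/16`, and Gaussian bounds control both costs. This gives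
`exists_density_flow`.

To make this rigorous, `log` is replaced by the bounded concave function `logQ a b`, which still
satisfies `G'' ≤ -G'²` (`logQ₂_le`). The inequality for `logQ a b f` is obtained by mollification
(`renormalized`, `cost_bound`). Concavity makes `∫ logQ(f(t)) φ` upper semicontinuous at the final
time although the trace is only a distributional limit (`trace_logQ_le`). Removing cutoffs and
delays yields `exists_compact_cost_le` on compact sets. Letting `logQ` tend to `log` gives first the
finiteness of the negative part of the mean and then the weak-type bound. -/

noncomputable section

namespace Kolmogorov

/-! ### Mollification in `L²`. -/

section Mollify

variable {V : Type*} [NormedAddCommGroup V] [NormedSpace ℝ V] [FiniteDimensional ℝ V]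
  [MeasureSpace V] [BorelSpace V] [(volume : Measure V).IsAddHaarMeasure]

/-- The square of the `L²` seminorm as a lower integral. -/
theorem eLpNorm_two_sq {α : Type*} [MeasurableSpace α] {μ : Measure α} (f : α → ℝ) :
    eLpNorm f 2 μ ^ 2 = ∫⁻ z, ‖f z‖ₑ ^ 2 ∂μ := by
  have h := eLpNorm_nnreal_pow_eq_lintegral (μ := μ) (f := f) (p := 2) (by norm_num)
  simpa using h

/-- Translations act continuously on `L²`. -/
theorem translation_continuous_L2 {f : V → ℝ} (hf : MemLp f 2 volume) {ε : ℝ≥0∞} (hε : 0 < ε) :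
    ∃ δ > 0, ∀ y : V, ‖y‖ < δ → ∫⁻ z, ‖f (z - y) - f z‖ₑ ^ 2 ≤ ε := by
  let g : V → C(V, V) := fun y => ⟨fun z => z - y, by fun_prop⟩
  have hg : Continuous g := ContinuousMap.continuous_of_continuous_uncurry _ (by
    simp only [g, Function.uncurry_def]; exact continuous_snd.sub continuous_fst)
  have hgm : ∀ y, MeasurePreserving (g y) volume volume := fun y =>
    measurePreserving_sub_right volume y
  have : Fact ((1 : ℝ≥0∞) ≤ 2) := ⟨by norm_num⟩
  have hc : Continuous fun y => Lp.compMeasurePreserving (g y) (hgm y) (hf.toLp f) :=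
    Continuous.compMeasurePreservingLp (f := fun _ => hf.toLp f) continuous_const hg hgm
      (by norm_num)
  have h0 : Lp.compMeasurePreserving (g 0) (hgm 0) (hf.toLp f) = hf.toLp f := by
    apply Lp.ext
    filter_upwards [Lp.coeFn_compMeasurePreserving (hf.toLp f) (hgm 0)] with z hz
    rw [hz]; simp [g]
  have ht := (tendsto_iff_edist_tendsto_0).1 (hc.tendsto 0)
  rw [h0] at ht
  have hev : ∀ᶠ y in 𝓝 (0 : V), edist (Lp.compMeasurePreserving (g y) (hgm y) (hf.toLp f))
      (hf.toLp f) ^ 2 < ε := by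
    have h2 := ENNReal.Tendsto.pow (n := 2) ht
    rw [zero_pow two_ne_zero] at h2
    exact h2.eventually_lt_const hε
  obtain ⟨δ, hδ, hδ'⟩ := Metric.eventually_nhds_iff.1 hev
  refine ⟨δ, hδ, fun y hy => ?_⟩
  have h1 := (hδ' (y := y) (by simpa using hy)).le
  rw [Lp.edist_def, eLpNorm_two_sq] at h1
  refine le_trans (le_of_eq ?_) h1
  apply lintegral_congr_ae
  filter_upwards [Lp.coeFn_compMeasurePreserving (hf.toLp f) (hgm y), hf.coeFn_toLp,
    (hgm y).quasiMeasurePreserving.ae_eq_comp hf.coeFn_toLp] with z h1 h2 h3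
  rw [Pi.sub_apply, h1, h3, h2]
  rfl

/-- The `L¹`-normalized dilation `n ^ dim · k (n ·)`, at scale `n + 1`. -/
def dil (k : V → ℝ) (n : ℕ) (z : V) : ℝ :=
  ((n : ℝ) + 1) ^ Module.finrank ℝ V * k (((n : ℝ) + 1) • z)

/-- The mollification `f * k`. -/
def mol (f k : V → ℝ) (z : V) : ℝ := ∫ t, f t * k (z - t)

/-- The substitution `y ↦ (n + 1) • y` moves the scale from the kernel to the argument of `f`, so
that only small translations of `f` have to be controlled. -/
theorem mol_dil (f k : V → ℝ) (n : ℕ) (z : V) :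
    mol f (dil k n) z = ∫ y, f (z - ((n : ℝ) + 1)⁻¹ • y) * k y := by
  have hn : (0 : ℝ) < (n : ℝ) + 1 := by positivity
  have h1 : mol f (dil k n) z = ∫ y, f (z - y) * dil k n y := by
    rw [mol, ← integral_sub_left_eq_self _ volume z]; simp
  rw [h1]
  have h2 := Measure.integral_comp_smul_of_nonneg (volume : Measure V)
    (fun y => f (z - ((n : ℝ) + 1)⁻¹ • y) * k y) ((n : ℝ) + 1) (hR := hn.le)
  simp only [smul_smul, inv_mul_cancel₀ hn.ne', one_smul, smul_eq_mul] at h2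
  have h3 : ∀ y, f (z - y) * dil k n y
      = ((n : ℝ) + 1) ^ Module.finrank ℝ V * (f (z - y) * k (((n : ℝ) + 1) • y)) := by
    intro y; simp only [dil]; ring
  simp_rw [h3]
  rw [integral_const_mul, h2, ← mul_assoc, mul_inv_cancel₀ (by positivity), one_mul]

theorem MemLp.mollify_integrable {f : V → ℝ} (hf : MemLp f 2 volume) {k : V → ℝ}
    (hk : Continuous k) (hkc : HasCompactSupport k) (z : V) (c : ℝ) (hc : c ≠ 0) :
    Integrable (fun y => f (z - c • y) * k y) := by
  have h1 : LocallyIntegrable f volume := hf.locallyIntegrable (by norm_num)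
  have h2 : Integrable (fun t => f t * k (c⁻¹ • (z - t))) := by
    have hkc' : HasCompactSupport (fun t => k (c⁻¹ • (z - t))) :=
      hkc.comp_homeomorph ((Homeomorph.subLeft z).trans (Homeomorph.smulOfNeZero c⁻¹ (by simpa)))
    simpa using h1.integrable_smul_right_of_hasCompactSupport (by fun_prop) hkc'
  have h3 := (h2.comp_sub_left z).comp_smul hc
  simpa [smul_smul, inv_mul_cancel₀ hc] using h3

/-- Mollification converges in `L²`, also for kernels of arbitrary mass. -/
theorem tendsto_mollify {f : V → ℝ} (hf : MemLp f 2 volume) {k : V → ℝ}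
    (hk : Continuous k) (hkc : HasCompactSupport k) :
    Tendsto (fun n : ℕ => eLpNorm (fun z => mol f (dil k n) z - (∫ y, k y) * f z) 2 volume)
      atTop (𝓝 0) := by
  -- Tonelli needs joint measurability of `f (z - y)`. Neither the mollification nor the seminorm
  -- sees a change of `f` on a null set.
  wlog hm : Measurable f generalizing f
  · have hmk := hf.1.ae_eq_mk
    have h2 : MemLp (hf.1.mk f) 2 volume := (memLp_congr_ae hmk).1 hf
    have h3 := this h2 hf.1.stronglyMeasurable_mk.measurable
    refine h3.congr fun n => ?_
    apply eLpNorm_congr_ae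
    filter_upwards [hmk] with z hz
    have h4 : mol (hf.1.mk f) (dil k n) z = mol f (dil k n) z := by
      apply integral_congr_ae
      filter_upwards [hmk] with t ht
      rw [ht]
    rw [h4, hz]
  set B := tsupport k with hB
  have hBc : IsCompact B := hkc
  set K : ℝ≥0∞ := ∫⁻ y, ‖k y‖ₑ ^ 2 with hK
  have hKt : K < ⊤ := by
    have h1 : MemLp k 2 volume := hk.memLp_of_hasCompactSupport hkc
    rw [hK, ← eLpNorm_two_sq]
    exact ENNReal.pow_lt_top h1.2
  obtain ⟨r, hr0, hr⟩ : ∃ r > 0, ∀ y ∈ B, ‖y‖ ≤ r := by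
    obtain ⟨r, hr⟩ := hBc.isBounded.exists_norm_le
    exact ⟨max r 1, by positivity, fun y hy => (hr y hy).trans (le_max_left _ _)⟩
  -- Cauchy–Schwarz in `y` followed by Tonelli: the error is an integral, over the support of the
  -- kernel, of squared `L²` distances between `f` and its translates.
  have key : ∀ n : ℕ, eLpNorm (fun z => mol f (dil k n) z - (∫ y, k y) * f z) 2 volume ^ 2
      ≤ K * ∫⁻ y in B, ∫⁻ z, ‖f (z - ((n : ℝ) + 1)⁻¹ • y) - f z‖ₑ ^ 2 := by
    intro n
    have hn : ((n : ℝ) + 1)⁻¹ ≠ 0 := by positivity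
    rw [eLpNorm_two_sq]
    have hmeas : Measurable (fun p : V × V => ‖f (p.1 - ((n : ℝ) + 1)⁻¹ • p.2) - f p.1‖ₑ ^ 2) :=
      ((hm.comp (by fun_prop)).sub (hm.comp measurable_fst)).enorm.pow_const 2
    calc ∫⁻ z, ‖mol f (dil k n) z - (∫ y, k y) * f z‖ₑ ^ 2
        ≤ ∫⁻ z, K * ∫⁻ y in B, ‖f (z - ((n : ℝ) + 1)⁻¹ • y) - f z‖ₑ ^ 2 := by
          apply lintegral_mono
          intro z
          have h1 : mol f (dil k n) z - (∫ y, k y) * f z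
              = ∫ y, k y * (f (z - ((n : ℝ) + 1)⁻¹ • y) - f z) := by
            rw [mol_dil, ← integral_mul_const, ← integral_sub
              (MemLp.mollify_integrable hf hk hkc z _ hn)
              ((hk.integrable_of_hasCompactSupport hkc).mul_const _)]
            congr 1; ext y; ring
          beta_reduce
          rw [h1]
          have h2 : ‖∫ y, k y * (f (z - ((n : ℝ) + 1)⁻¹ • y) - f z)‖ₑ
              ≤ ∫⁻ y in B, ‖k y‖ₑ * ‖f (z - ((n : ℝ) + 1)⁻¹ • y) - f z‖ₑ := by
            refine (enorm_integral_le_lintegral_enorm _).trans ?_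
            rw [← lintegral_indicator hBc.measurableSet]
            apply lintegral_mono
            intro y
            by_cases hy : y ∈ B
            · simp [hy]
            · simp [image_eq_zero_of_notMem_tsupport hy]
          have hmy : Measurable fun y => f (z - ((n : ℝ) + 1)⁻¹ • y) - f z :=
            (hm.comp (by fun_prop)).sub_const _
          have h3 := ENNReal.lintegral_mul_le_Lp_mul_Lq (volume.restrict B)
            (p := 2) (q := 2) (by constructor <;> norm_num)
            (f := fun y => ‖k y‖ₑ) (g := fun y => ‖f (z - ((n : ℝ) + 1)⁻¹ • y) - f z‖ₑ)
            hk.measurable.enorm.aemeasurable hmy.enorm.aemeasurable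
          have h4 := pow_le_pow_left₀ (zero_le) (h2.trans h3) 2
          refine h4.trans ?_
          rw [mul_pow, ← ENNReal.rpow_natCast, ← ENNReal.rpow_natCast, ← ENNReal.rpow_mul,
            ← ENNReal.rpow_mul]
          norm_num
          gcongr
          exact setLIntegral_le_lintegral _ _
      _ = K * ∫⁻ z, ∫⁻ y in B, ‖f (z - ((n : ℝ) + 1)⁻¹ • y) - f z‖ₑ ^ 2 := by
          rw [lintegral_const_mul' _ _ hKt.ne]
      _ = _ := by
          congr 1
          rw [lintegral_lintegral_swap]
          exact hmeas.aemeasurable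
  have hsq : Tendsto (fun n : ℕ => eLpNorm (fun z => mol f (dil k n) z - (∫ y, k y) * f z) 2
      volume ^ 2) atTop (𝓝 0) := by
    rw [ENNReal.tendsto_nhds_zero]
    intro ε hε
    have hV : volume B < ⊤ := hBc.measure_lt_top
    obtain ⟨ε', hε', hle⟩ : ∃ ε' : ℝ≥0∞, 0 < ε' ∧ K * (ε' * volume B) ≤ ε := by
      have ht : Tendsto (fun e : ℝ≥0∞ => K * (e * volume B)) (𝓝 0) (𝓝 0) := by
        have h1 := ENNReal.Tendsto.const_mul (a := K) (ENNReal.Tendsto.mul_const (b := volume B)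
          (tendsto_id (α := ℝ≥0∞) (x := 𝓝 0)) (Or.inr hV.ne)) (Or.inr hKt.ne)
        simpa using h1
      have h2 : ∀ᶠ e in 𝓝[>] (0 : ℝ≥0∞), K * (e * volume B) ≤ ε :=
        (ht.mono_left nhdsWithin_le_nhds).eventually_le_const hε
      obtain ⟨e, he1, he2⟩ := (h2.and self_mem_nhdsWithin).exists
      exact ⟨e, he2, he1⟩
    obtain ⟨δ, hδ, hδ'⟩ := translation_continuous_L2 hf hε'
    have hlim : Tendsto (fun n : ℕ => ((n : ℝ) + 1)⁻¹ * r) atTop (𝓝 0) := by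
      have := (tendsto_one_div_add_atTop_nhds_zero_nat (𝕜 := ℝ)).mul_const r
      simpa using this
    filter_upwards [hlim.eventually_lt_const hδ] with n hn
    refine (key n).trans (le_trans ?_ hle)
    gcongr
    calc _ ≤ ∫⁻ y in B, ε' := by
          apply setLIntegral_mono measurable_const
          intro y hy
          apply hδ'
          rw [norm_smul, norm_inv, Real.norm_of_nonneg (by positivity)]
          refine lt_of_le_of_lt ?_ hn
          gcongr
          exact hr y hy
      _ = _ := by simp
  have h5 := hsq.ennrpow_const (1 / 2 : ℝ)
  rw [ENNReal.zero_rpow_of_pos (by norm_num)] at h5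
  refine h5.congr fun n => ?_
  rw [← ENNReal.rpow_natCast, ← ENNReal.rpow_mul]
  norm_num

end Mollify
end Kolmogorov

namespace Kolmogorov

/-! ### Limits of integrals of products -/

section Limits

variable {α : Type*} [MeasurableSpace α] {μ : Measure α}

/-- Hölder's inequality applied to each term of `(h - h₀)(k - k₀) + (h - h₀) k₀ + h₀ (k - k₀)`. -/
theorem tendsto_lintegral_mul_sub_mul {h k : ℕ → α → ℝ} {h₀ k₀ : α → ℝ}
    (hm : ∀ n, AEStronglyMeasurable (h n) μ) (km : ∀ n, AEStronglyMeasurable (k n) μ)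
    (hL : MemLp h₀ 2 μ) (kL : MemLp k₀ 2 μ)
    (ht : Tendsto (fun n => eLpNorm (fun z => h n z - h₀ z) 2 μ) atTop (𝓝 0))
    (kt : Tendsto (fun n => eLpNorm (fun z => k n z - k₀ z) 2 μ) atTop (𝓝 0)) :
    Tendsto (fun n => ∫⁻ z, ‖h n z * k n z - h₀ z * k₀ z‖ₑ ∂μ) atTop (𝓝 0) := by
  have hold : ∀ u v : α → ℝ, AEStronglyMeasurable u μ → AEStronglyMeasurable v μ →
      ∫⁻ z, ‖u z * v z‖ₑ ∂μ ≤ eLpNorm u 2 μ * eLpNorm v 2 μ := by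
    intro u v hu hv
    have h := eLpNorm_smul_le_mul_eLpNorm (p := 2) (q := 2) (r := 1) hv hu
    rw [eLpNorm_one_eq_lintegral_enorm] at h
    simpa [smul_eq_mul] using h
  have hb : ∀ n, ∫⁻ z, ‖h n z * k n z - h₀ z * k₀ z‖ₑ ∂μ ≤
      eLpNorm (fun z => h n z - h₀ z) 2 μ * eLpNorm (fun z => k n z - k₀ z) 2 μ
      + eLpNorm (fun z => h n z - h₀ z) 2 μ * eLpNorm k₀ 2 μ
      + eLpNorm h₀ 2 μ * eLpNorm (fun z => k n z - k₀ z) 2 μ := by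
    intro n
    have hd : AEStronglyMeasurable (fun z => h n z - h₀ z) μ := (hm n).sub hL.1
    have kd : AEStronglyMeasurable (fun z => k n z - k₀ z) μ := (km n).sub kL.1
    calc _ ≤ ∫⁻ z, (‖(h n z - h₀ z) * (k n z - k₀ z)‖ₑ + ‖(h n z - h₀ z) * k₀ z‖ₑ
            + ‖h₀ z * (k n z - k₀ z)‖ₑ) ∂μ := by
          apply lintegral_mono
          intro z
          have : h n z * k n z - h₀ z * k₀ z = (h n z - h₀ z) * (k n z - k₀ z)
            + (h n z - h₀ z) * k₀ z + h₀ z * (k n z - k₀ z) := by ring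
          beta_reduce
          rw [this]
          exact (enorm_add_le _ _).trans (add_le_add_left (enorm_add_le _ _) _)
      _ = _ := by
          have m1 : AEStronglyMeasurable (fun z => h₀ z * (k n z - k₀ z)) μ := hL.1.mul kd
          have m2 : AEStronglyMeasurable (fun z => (h n z - h₀ z) * k₀ z) μ := hd.mul kL.1
          rw [lintegral_add_right' _ m1.enorm, lintegral_add_right' _ m2.enorm]
      _ ≤ _ := by
          gcongr
          · exact hold _ _ hd kd
          · exact hold _ _ hd kL.1
          · exact hold _ _ hL.1 kd
  refine tendsto_of_tendsto_of_tendsto_of_le_of_le tendsto_const_nhds ?_ (fun _ => zero_le) hb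
  have h1 := ENNReal.Tendsto.mul ht (Or.inr ENNReal.zero_ne_top) kt (Or.inr ENNReal.zero_ne_top)
  have h2 := ENNReal.Tendsto.mul_const ht (b := eLpNorm k₀ 2 μ) (Or.inr kL.2.ne)
  have h3 := ENNReal.Tendsto.const_mul kt (a := eLpNorm h₀ 2 μ) (Or.inr hL.2.ne)
  simpa using (h1.add h2).add h3

/-- `L²` convergence of two factors together with bounded a.e. convergence of a third one. -/
theorem tendsto_integral_mul_mul {h k w : ℕ → α → ℝ} {h₀ k₀ w₀ : α → ℝ} {M : ℝ}
    (hm : ∀ n, AEStronglyMeasurable (h n) μ) (km : ∀ n, AEStronglyMeasurable (k n) μ)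
    (wm : ∀ n, AEStronglyMeasurable (w n) μ)
    (hL : MemLp h₀ 2 μ) (kL : MemLp k₀ 2 μ)
    (ht : Tendsto (fun n => eLpNorm (fun z => h n z - h₀ z) 2 μ) atTop (𝓝 0))
    (kt : Tendsto (fun n => eLpNorm (fun z => k n z - k₀ z) 2 μ) atTop (𝓝 0))
    (wb : ∀ n, ∀ᵐ z ∂μ, |w n z| ≤ M)
    (wt : ∀ᵐ z ∂μ, Tendsto (fun n => w n z) atTop (𝓝 (w₀ z))) :
    Tendsto (fun n => ∫ z, h n z * k n z * w n z ∂μ) atTop (𝓝 (∫ z, h₀ z * k₀ z * w₀ z ∂μ)) := by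
  have w0m : AEStronglyMeasurable w₀ μ := aestronglyMeasurable_of_tendsto_ae atTop wm wt
  have w0b : ∀ᵐ z ∂μ, |w₀ z| ≤ M := by
    filter_upwards [ae_all_iff.2 wb, wt] with z h1 h2
    exact le_of_tendsto h2.abs (Eventually.of_forall h1)
  have hkI : Integrable (fun z => h₀ z * k₀ z) μ := hL.integrable_mul kL
  have hI : Integrable (fun z => h₀ z * k₀ z * w₀ z) μ :=
    hkI.mul_bdd (c := M) w0m (by simpa [Real.norm_eq_abs] using w0b)
  have hL1 := tendsto_lintegral_mul_sub_mul hm km hL kL ht kt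
  -- Here the factor `w` converges only almost everywhere; since `h₀ k₀` is a fixed integrable
  -- function, dominated convergence applies.
  have hdiff : Tendsto (fun n => ∫⁻ z, ‖h₀ z * k₀ z * (w n z - w₀ z)‖ₑ ∂μ) atTop (𝓝 0) := by
    have : Tendsto (fun n => ∫⁻ z, ‖h₀ z * k₀ z * (w n z - w₀ z)‖ₑ ∂μ) atTop
        (𝓝 (∫⁻ z, 0 ∂μ)) := by
      refine tendsto_lintegral_of_dominated_convergence' (fun z => ‖h₀ z * k₀ z * (2 * M)‖ₑ)
        (fun n => (hkI.1.mul ((wm n).sub w0m)).enorm) (fun n => ?_)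
        (hkI.mul_const _).2.ne ?_
      · filter_upwards [wb n, w0b] with z h1 h2
        rw [enorm_le_iff_norm_le, norm_mul, norm_mul (h₀ z * k₀ z)]
        refine mul_le_mul_of_nonneg_left ?_ (norm_nonneg _)
        rw [Real.norm_eq_abs]
        refine (abs_sub _ _).trans (le_trans ?_ (le_abs_self _))
        linarith
      · filter_upwards [wt] with z hz
        have h1 : Tendsto (fun n => h₀ z * k₀ z * (w n z - w₀ z)) atTop (𝓝 0) := by
          simpa using (hz.sub_const (w₀ z)).const_mul (h₀ z * k₀ z)
        simpa using h1.enorm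
    simpa using this
  have hb : ∀ n, ∫⁻ z, ‖h n z * k n z * w n z - h₀ z * k₀ z * w₀ z‖ₑ ∂μ ≤
      ENNReal.ofReal M * ∫⁻ z, ‖h n z * k n z - h₀ z * k₀ z‖ₑ ∂μ
        + ∫⁻ z, ‖h₀ z * k₀ z * (w n z - w₀ z)‖ₑ ∂μ := by
    intro n
    have m1 : AEStronglyMeasurable (fun z => h₀ z * k₀ z * (w n z - w₀ z)) μ :=
      hkI.1.mul ((wm n).sub w0m)
    rw [← lintegral_const_mul' _ _ ENNReal.ofReal_ne_top, ← lintegral_add_right' _ m1.enorm]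
    apply lintegral_mono_ae
    filter_upwards [wb n] with z hz
    have : h n z * k n z * w n z - h₀ z * k₀ z * w₀ z
      = w n z * (h n z * k n z - h₀ z * k₀ z) + h₀ z * k₀ z * (w n z - w₀ z) := by ring
    rw [this]
    refine (enorm_add_le _ _).trans ?_
    gcongr
    rw [enorm_mul]
    gcongr
    rw [Real.enorm_eq_ofReal_abs]
    exact ENNReal.ofReal_le_ofReal hz
  have hz : Tendsto (fun n => ∫⁻ z, ‖h n z * k n z * w n z - h₀ z * k₀ z * w₀ z‖ₑ ∂μ) atTop
      (𝓝 0) := by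
    refine tendsto_of_tendsto_of_tendsto_of_le_of_le tendsto_const_nhds ?_ (fun _ => zero_le) hb
    have := (ENNReal.Tendsto.const_mul hL1 (a := ENNReal.ofReal M)
      (Or.inr ENNReal.ofReal_ne_top)).add hdiff
    simpa using this
  refine tendsto_integral_of_L1 _ hI.1 ?_ hz
  -- The approximants are integrable as soon as their distance to the integrable limit is finite,
  -- which is known for large `n`.
  have hlt : ∀ᶠ n in atTop, ∫⁻ z, ‖h n z * k n z * w n z - h₀ z * k₀ z * w₀ z‖ₑ ∂μ < 1 :=
    hz.eventually_lt_const (by norm_num)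
  filter_upwards [hlt] with n hn
  have hs : Integrable (fun z => h n z * k n z * w n z - h₀ z * k₀ z * w₀ z) μ :=
    ⟨(((hm n).mul (km n)).mul (wm n)).sub hI.1, hn.trans ENNReal.one_lt_top⟩
  refine (hs.add hI).congr (Eventually.of_forall fun z => ?_)
  simp

end Limits

/-! ### Directional derivatives on time and phase space -/

variable {d : ℕ}

instance : (volume : Measure (Phase d)).IsAddHaarMeasure :=
  Measure.prod.instIsAddHaarMeasure (volume : Measure (Space d)) (volume : Measure (Space d))

instance : (volume : Measure (TimePhase d)).IsAddHaarMeasure :=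
  Measure.prod.instIsAddHaarMeasure (volume : Measure ℝ) (volume : Measure (Phase d))

theorem isNegInvariant_volume (V : Type*) [NormedAddCommGroup V] [NormedSpace ℝ V]
    [FiniteDimensional ℝ V] [MeasureSpace V] [BorelSpace V]
    [(volume : Measure V).IsAddHaarMeasure] : (volume : Measure V).IsNegInvariant :=
  inferInstance

instance : (volume : Measure (Phase d)).IsNegInvariant := isNegInvariant_volume _

/-- The direction of the transport operator `∂ₜ + v · ∇ₓ` at a point. -/
def dirT (z : TimePhase d) : TimePhase d := (1, z.2.2, 0)

/-- The `i`-th velocity direction. -/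
def dirV (i : Fin d) : TimePhase d := (0, 0, EuclideanSpace.single i 1)

theorem integral_fderiv_eq_zero {V : Type*} [NormedAddCommGroup V] [NormedSpace ℝ V]
    [FiniteDimensional ℝ V] [MeasureSpace V] [BorelSpace V] [(volume : Measure V).IsAddHaarMeasure]
    {h : V → ℝ} (hh : ContDiff ℝ 1 h) (hc : HasCompactSupport h) (e : V) :
    ∫ z, fderiv ℝ h z e = 0 := by
  have hi : Integrable (fun z => fderiv ℝ h z e) :=
    ((hh.continuous_fderiv one_ne_zero).clm_apply continuous_const).integrable_of_hasCompactSupport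
      (hc.fderiv_apply (𝕜 := ℝ) e)
  have := integral_mul_fderiv_eq_neg_fderiv_mul_of_integrable (μ := (volume : Measure V))
    (f := fun _ => (1 : ℝ)) (g := h) (v := e) (by simp) (by simpa using hi)
    (by simpa using hh.continuous.integrable_of_hasCompactSupport hc)
    (fun x _ => (differentiable_const _) x) (fun x _ => (hh.differentiable one_ne_zero) x)
  simpa using this

/-- Integration by parts, in a constant direction. -/
theorem integral_mul_fderiv_const {V : Type*} [NormedAddCommGroup V] [NormedSpace ℝ V]
    [FiniteDimensional ℝ V] [MeasureSpace V] [BorelSpace V] [(volume : Measure V).IsAddHaarMeasure]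
    {u h : V → ℝ} (hu : ContDiff ℝ 1 u) (hh : ContDiff ℝ 1 h) (hc : HasCompactSupport h) (e : V) :
    ∫ z, u z * fderiv ℝ h z e = - ∫ z, fderiv ℝ u z e * h z := by
  have hu' : Continuous fun z => fderiv ℝ u z e :=
    (hu.continuous_fderiv one_ne_zero).clm_apply continuous_const
  have hh' : Continuous fun z => fderiv ℝ h z e :=
    (hh.continuous_fderiv one_ne_zero).clm_apply continuous_const
  apply integral_mul_fderiv_eq_neg_fderiv_mul_of_integrable
  · exact (hu'.mul hh.continuous).integrable_of_hasCompactSupport hc.mul_left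
  · exact (hu.continuous.mul hh').integrable_of_hasCompactSupport
      (hc.fderiv_apply (𝕜 := ℝ) e).mul_left
  · exact (hu.continuous.mul hh.continuous).integrable_of_hasCompactSupport hc.mul_left
  · exact fun x _ => (hu.differentiable one_ne_zero) x
  · exact fun x _ => (hh.differentiable one_ne_zero) x

/-- A constant vector plus velocity coordinates times constant vectors: this reduces integration by
parts for the transport operator to constant directions. -/
theorem dirT_eq (z : TimePhase d) : dirT z = ((1, 0, 0) : TimePhase d)
    + ∑ i, z.2.2 i • ((0, EuclideanSpace.single i 1, 0) : TimePhase d) := by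
  have h : z.2.2 = ∑ i, z.2.2 i • EuclideanSpace.single i (1 : ℝ) := by
    ext j
    simp [Pi.single_apply]
  simp only [dirT, Prod.smul_mk, smul_zero]
  ext
  · simp [Prod.fst_sum]
  · simp only [Prod.snd_add, Prod.fst_add, Prod.snd_sum, Prod.fst_sum, zero_add]
    conv_lhs => rw [h]
  · simp [Prod.snd_sum]

theorem continuous_dirT : Continuous (dirT (d := d)) := by
  unfold dirT; fun_prop

/-- The transport field is divergence free, because the coefficient `vᵢ` of `∂/∂xᵢ` does not depend
on `x`. -/
theorem integral_transport_eq_zero {h : TimePhase d → ℝ} (hh : ContDiff ℝ 1 h)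
    (hc : HasCompactSupport h) : ∫ z, fderiv ℝ h z (dirT z) = 0 := by
  have hd : ∀ e, Continuous fun z => fderiv ℝ h z e := fun e =>
    (hh.continuous_fderiv one_ne_zero).clm_apply continuous_const
  have hcoord : ∀ i : Fin d, ContDiff ℝ 1 fun z : TimePhase d => z.2.2 i := fun i => by fun_prop
  have hI : ∀ i : Fin d, Integrable fun z : TimePhase d => z.2.2 i *
      fderiv ℝ h z (0, EuclideanSpace.single i 1, 0) := fun i =>
    ((hcoord i).continuous.mul (hd _)).integrable_of_hasCompactSupport
      (hc.fderiv_apply (𝕜 := ℝ) _).mul_left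
  have h1 : ∀ z : TimePhase d, fderiv ℝ h z (dirT z) = fderiv ℝ h z (1, 0, 0)
      + ∑ i, z.2.2 i * fderiv ℝ h z (0, EuclideanSpace.single i 1, 0) := by
    intro z
    rw [dirT_eq, map_add, map_sum]
    simp only [map_smul, smul_eq_mul]
  simp_rw [h1]
  rw [integral_add ((hd _).integrable_of_hasCompactSupport (hc.fderiv_apply (𝕜 := ℝ) _))
    (integrable_finsetSum _ fun i _ => hI i), integral_fderiv_eq_zero hh hc,
    integral_finsetSum _ fun i _ => hI i, zero_add]
  apply Finset.sum_eq_zero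
  intro i _
  rw [integral_mul_fderiv_const (hcoord i) hh hc]
  have h2 : ∀ z : TimePhase d, fderiv ℝ (fun z : TimePhase d => z.2.2 i) z
      (0, EuclideanSpace.single i 1, 0) = 0 := by
    intro z
    have h3 : HasFDerivAt (fun z : TimePhase d => z.2.2 i)
        ((EuclideanSpace.proj (𝕜 := ℝ) i).comp
          ((ContinuousLinearMap.snd ℝ (Space d) (Space d)).comp
            (ContinuousLinearMap.snd ℝ ℝ (Phase d)))) z :=
      ((EuclideanSpace.proj (𝕜 := ℝ) i).comp
          ((ContinuousLinearMap.snd ℝ (Space d) (Space d)).comp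
            (ContinuousLinearMap.snd ℝ ℝ (Phase d)))).hasFDerivAt
    rw [h3.fderiv]
    simp
  simp [h2]

/-- Integration by parts for the transport operator. -/
theorem integral_mul_transport {u h : TimePhase d → ℝ} (hu : ContDiff ℝ 1 u)
    (hh : ContDiff ℝ 1 h) (hc : HasCompactSupport h) :
    ∫ z, u z * fderiv ℝ h z (dirT z) = - ∫ z, fderiv ℝ u z (dirT z) * h z := by
  have h0 := integral_transport_eq_zero (hu.mul hh) (h := fun z => u z * h z) hc.mul_left
  have h1 : ∀ z, fderiv ℝ (fun z => u z * h z) z (dirT z)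
      = u z * fderiv ℝ h z (dirT z) + fderiv ℝ u z (dirT z) * h z := by
    intro z
    rw [fderiv_fun_mul ((hu.differentiable one_ne_zero) z) ((hh.differentiable one_ne_zero) z)]
    simp [mul_comm]
  simp_rw [h1] at h0
  have hcont : ∀ w : TimePhase d → ℝ, ContDiff ℝ 1 w →
      Continuous fun z => fderiv ℝ w z (dirT z) := fun w hw =>
    (hw.continuous_fderiv one_ne_zero).clm_apply continuous_dirT
  have hs : HasCompactSupport fun z => fderiv ℝ h z (dirT z) :=
    (hc.fderiv (𝕜 := ℝ)).mono fun z hz => by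
      rw [Function.mem_support] at hz ⊢
      intro h; apply hz; rw [h]; simp
  have i1 : Integrable fun z => u z * fderiv ℝ h z (dirT z) :=
    (hu.continuous.mul (hcont h hh)).integrable_of_hasCompactSupport hs.mul_left
  have i2 : Integrable fun z => fderiv ℝ u z (dirT z) * h z :=
    ((hcont u hu).mul hh.continuous).integrable_of_hasCompactSupport hc.mul_left
  rw [integral_add i1 i2] at h0
  linarith

end Kolmogorov

namespace Kolmogorov

/-! ### The bounded concave nonlinearity `log ((1 + a u) / (1 + b u))` -/

/-- The function `log ((1 + a u) / (1 + b u))`, a bounded substitute of `log u + log a`. -/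
def logQ (a b u : ℝ) : ℝ := Real.log (1 + a * u) - Real.log (1 + b * u)

/-- The derivative of `logQ a b`. -/
def logQ₁ (a b u : ℝ) : ℝ := a / (1 + a * u) - b / (1 + b * u)

/-- The second derivative of `logQ a b`. -/
def logQ₂ (a b u : ℝ) : ℝ := -(a / (1 + a * u)) ^ 2 + (b / (1 + b * u)) ^ 2

section LogQ

variable {a b : ℝ}

theorem hasDerivAt_logQ (ha : 0 < a) (hb : 0 < b) {u : ℝ} (hu : 0 ≤ u) :
    HasDerivAt (logQ a b) (logQ₁ a b u) u := by
  have h : ∀ c : ℝ, 0 < c → HasDerivAt (fun u => Real.log (1 + c * u)) (c / (1 + c * u)) u := by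
    intro c hc
    have h1 : HasDerivAt (fun u : ℝ => 1 + c * u) c u := by
      simpa using ((hasDerivAt_id u).const_mul c).const_add 1
    exact h1.log (by positivity)
  exact (h a ha).sub (h b hb)

theorem hasDerivAt_logQ₁ (ha : 0 < a) (hb : 0 < b) {u : ℝ} (hu : 0 ≤ u) :
    HasDerivAt (logQ₁ a b) (logQ₂ a b u) u := by
  have h : ∀ c : ℝ, 0 < c →
      HasDerivAt (fun u => c / (1 + c * u)) (-(c / (1 + c * u)) ^ 2) u := by
    intro c hc
    have h1 : HasDerivAt (fun u : ℝ => 1 + c * u) c u := by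
      simpa using ((hasDerivAt_id u).const_mul c).const_add 1
    have h0 : 1 + c * u ≠ 0 := by positivity
    exact ((hasDerivAt_const u c).div h1 h0).congr_deriv (by field_simp; ring)
  exact ((h a ha).sub (h b hb)).congr_deriv (by rw [logQ₂]; ring)

theorem logQ_aux (hb : 0 < b) (hab : b < a) {u : ℝ} (hu : 0 ≤ u) :
    0 < b / (1 + b * u) ∧ b / (1 + b * u) ≤ a / (1 + a * u) ∧ a / (1 + a * u) ≤ a := by
  have ha : 0 < a := hb.trans hab
  refine ⟨by positivity, ?_, ?_⟩
  · rw [div_le_div_iff₀ (by positivity) (by positivity)]; nlinarith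
  · rw [div_le_iff₀ (by positivity)]; nlinarith [mul_nonneg ha.le (mul_nonneg ha.le hu)]

theorem logQ_nonneg (hb : 0 < b) (hab : b < a) {u : ℝ} (hu : 0 ≤ u) : 0 ≤ logQ a b u := by
  rw [logQ, sub_nonneg]
  apply Real.log_le_log (by positivity)
  gcongr

theorem logQ_le (hb : 0 < b) (hab : b < a) {u : ℝ} (hu : 0 ≤ u) :
    logQ a b u ≤ Real.log a - Real.log b := by
  have ha : 0 < a := hb.trans hab
  rw [logQ, ← Real.log_div (by positivity) (by positivity),
    ← Real.log_div (by positivity) (by positivity)]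
  apply Real.log_le_log (by positivity)
  rw [div_le_div_iff₀ (by positivity) (by positivity)]
  nlinarith

theorem logQ_mono (hb : 0 < b) (hab : b < a) {u w : ℝ} (hu : 0 ≤ u) (huw : u ≤ w) :
    logQ a b u ≤ logQ a b w := by
  have ha : 0 < a := hb.trans hab
  have hw : 0 ≤ w := hu.trans huw
  rw [logQ, logQ, ← Real.log_div (by positivity) (by positivity),
    ← Real.log_div (by positivity) (by positivity)]
  apply Real.log_le_log (by positivity)
  rw [div_le_div_iff₀ (by positivity) (by positivity)]
  nlinarith

theorem logQ₁_nonneg (hb : 0 < b) (hab : b < a) {u : ℝ} (hu : 0 ≤ u) : 0 ≤ logQ₁ a b u := by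
  have := logQ_aux hb hab hu
  rw [logQ₁]; linarith [this.2.1]

theorem logQ₁_le (hb : 0 < b) (hab : b < a) {u : ℝ} (hu : 0 ≤ u) : logQ₁ a b u ≤ a := by
  have := logQ_aux hb hab hu
  rw [logQ₁]; linarith [this.1, this.2.2]

theorem abs_logQ₂_le (hb : 0 < b) (hab : b < a) {u : ℝ} (hu : 0 ≤ u) :
    |logQ₂ a b u| ≤ a ^ 2 := by
  obtain ⟨h1, h2, h3⟩ := logQ_aux hb hab hu
  rw [logQ₂, abs_le]
  constructor <;> nlinarith

/-- The property of the logarithm that the whole argument needs, where it holds with equality. If `p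
≥ r > 0` are the two quotients in the first derivative, then `-p² + r² ≤ -(p - r)²` amounts to `2r(r
- p) ≤ 0`. -/
theorem logQ₂_le (hb : 0 < b) (hab : b < a) {u : ℝ} (hu : 0 ≤ u) :
    logQ₂ a b u ≤ -(logQ₁ a b u) ^ 2 := by
  obtain ⟨h1, h2, h3⟩ := logQ_aux hb hab hu
  rw [logQ₂, logQ₁]
  nlinarith

/-- With `x` and `y` the ratios of the two affine factors at `u` and at `w`, the increment is `log
(x / y)` and the tangent term is exactly `x - y`. So it suffices that `log (x / y) ≤ x / y - 1 ≤ x -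
y`. -/
theorem logQ_concave (hb : 0 < b) (hab : b < a) {u w : ℝ} (hu : 0 ≤ u) (hw : 0 ≤ w) :
    logQ a b u ≤ logQ a b w + logQ₁ a b w * (u - w) := by
  have ha : 0 < a := hb.trans hab
  have pu : 0 < 1 + a * u := by positivity
  have pw : 0 < 1 + a * w := by positivity
  have qu : 0 < 1 + b * u := by positivity
  have qw : 0 < 1 + b * w := by positivity
  set x := (1 + a * u) / (1 + a * w) with hx
  set y := (1 + b * u) / (1 + b * w) with hy
  have x0 : 0 < x := by positivity
  have y0 : 0 < y := by positivity
  have e1 : logQ a b u - logQ a b w = Real.log (x / y) := by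
    rw [Real.log_div x0.ne' y0.ne', hx, hy, Real.log_div pu.ne' pw.ne',
      Real.log_div qu.ne' qw.ne', logQ, logQ]
    ring
  have e2 : logQ₁ a b w * (u - w) = x - y := by
    rw [logQ₁, hx, hy]; field_simp; ring
  -- Since `a > b`, the factor `x - y` has the sign of `u - w` and `1 - y` the opposite sign. This
  -- is what turns `x / y - 1` into `x - y`.
  have e3 : (x - y) * (1 - y) ≤ 0 := by
    have h1 : x - y = (a - b) * (u - w) / ((1 + a * w) * (1 + b * w)) := by
      rw [hx, hy]; field_simp; ring
    have h2 : 1 - y = -(b * (u - w) / (1 + b * w)) := by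
      rw [hy]; field_simp; ring
    have h3 : (x - y) * (1 - y)
        = -((a - b) * b * (u - w) ^ 2 / ((1 + a * w) * (1 + b * w) ^ 2)) := by
      rw [h1, h2]; field_simp
    rw [h3]
    have : 0 ≤ (a - b) * b * (u - w) ^ 2 / ((1 + a * w) * (1 + b * w) ^ 2) := by
      have := sub_pos.2 hab
      positivity
    linarith
  have e4 : Real.log (x / y) ≤ x / y - 1 := Real.log_le_sub_one_of_pos (by positivity)
  have e5 : x / y - 1 ≤ x - y := by
    rw [div_sub_one y0.ne', div_le_iff₀ y0]
    nlinarith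
  linarith

theorem contDiff_logQ (ha : 0 < a) (hb : 0 < b) {V : Type*} [NormedAddCommGroup V]
    [NormedSpace ℝ V] {h : V → ℝ} {n : WithTop ℕ∞} (hh : ContDiff ℝ n h) (h0 : ∀ z, 0 ≤ h z) :
    ContDiff ℝ n (fun z => logQ a b (h z)) := by
  have : ∀ c : ℝ, 0 < c → ContDiff ℝ n fun z => Real.log (1 + c * h z) := fun c hc =>
    (contDiff_const.add (contDiff_const.mul hh)).log fun z => by
      have := h0 z; positivity
  exact (this a ha).sub (this b hb)

theorem contDiff_logQ₁ (ha : 0 < a) (hb : 0 < b) {V : Type*} [NormedAddCommGroup V]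
    [NormedSpace ℝ V] {h : V → ℝ} {n : WithTop ℕ∞} (hh : ContDiff ℝ n h) (h0 : ∀ z, 0 ≤ h z) :
    ContDiff ℝ n (fun z => logQ₁ a b (h z)) := by
  have : ∀ c : ℝ, 0 < c → ContDiff ℝ n fun z => c / (1 + c * h z) := fun c hc =>
    contDiff_const.div (contDiff_const.add (contDiff_const.mul hh)) fun z => by
      have := h0 z; positivity
  exact (this a ha).sub (this b hb)

theorem measurable_logQ : Measurable (logQ a b) := by unfold logQ; fun_prop

theorem measurable_logQ₁ : Measurable (logQ₁ a b) := by unfold logQ₁; fun_prop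

theorem measurable_logQ₂ : Measurable (logQ₂ a b) := by unfold logQ₂; fun_prop

theorem continuousAt_logQ₂ (ha : 0 < a) (hb : 0 < b) {u : ℝ} (hu : 0 ≤ u) :
    ContinuousAt (logQ₂ a b) u := by
  unfold logQ₂
  have h1 : 1 + a * u ≠ 0 := by positivity
  have h2 : 1 + b * u ≠ 0 := by positivity
  fun_prop (disch := assumption)

end LogQ

/-! ### Smooth mollifications -/

section Mol

variable {V : Type*} [NormedAddCommGroup V] [NormedSpace ℝ V] [FiniteDimensional ℝ V]
  [MeasureSpace V] [BorelSpace V] [(volume : Measure V).IsAddHaarMeasure]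

omit [NormedSpace ℝ V] [FiniteDimensional ℝ V] [BorelSpace V]
  [(volume : Measure V).IsAddHaarMeasure] in
theorem mol_eq_convolution (f k : V → ℝ) :
    mol f k = convolution f k (ContinuousLinearMap.lsmul ℝ ℝ) volume := by
  ext z; simp [mol, convolution]

omit [FiniteDimensional ℝ V] [(volume : Measure V).IsAddHaarMeasure] in
theorem contDiff_mol {f k : V → ℝ} (hf : LocallyIntegrable f volume) (hk : ContDiff ℝ ∞ k)
    (hc : HasCompactSupport k) : ContDiff ℝ ∞ (mol f k) := by
  rw [mol_eq_convolution]
  exact_mod_cast hc.contDiff_convolution_right (n := ⊤) _ hf hk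

theorem fderiv_mol {f k : V → ℝ} (hf : LocallyIntegrable f volume) (hk : ContDiff ℝ ∞ k)
    (hc : HasCompactSupport k) (z e : V) :
    fderiv ℝ (mol f k) z e = mol f (fun y => fderiv ℝ k y e) z := by
  have hk1 : ContDiff ℝ 1 k := hk.of_le (by exact_mod_cast le_top)
  rw [mol_eq_convolution, mol_eq_convolution,
    (hc.hasFDerivAt_convolution_right (ContinuousLinearMap.lsmul ℝ ℝ) hf hk1 z).fderiv]
  exact convolution_precompR_apply _ hf (hc.fderiv (𝕜 := ℝ))
    (hk1.continuous_fderiv one_ne_zero) z e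

omit [NormedSpace ℝ V] [FiniteDimensional ℝ V] [BorelSpace V]
  [(volume : Measure V).IsAddHaarMeasure] in
theorem mol_nonneg {f k : V → ℝ} (hf : ∀ᵐ z, 0 ≤ f z) (hk : ∀ z, 0 ≤ k z) (z : V) :
    0 ≤ mol f k z := by
  apply integral_nonneg_of_ae
  filter_upwards [hf] with t ht
  exact mul_nonneg ht (hk _)

omit [FiniteDimensional ℝ V] [MeasureSpace V] [BorelSpace V]
  [(volume : Measure V).IsAddHaarMeasure] in
theorem contDiff_dil {k : V → ℝ} (hk : ContDiff ℝ ∞ k) (n : ℕ) : ContDiff ℝ ∞ (dil k n) := by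
  unfold dil
  exact contDiff_const.mul (hk.comp (contDiff_const_smul _))

omit [FiniteDimensional ℝ V] [MeasureSpace V] [BorelSpace V]
  [(volume : Measure V).IsAddHaarMeasure] in
theorem hasCompactSupport_dil {k : V → ℝ} (hk : HasCompactSupport k) (n : ℕ) :
    HasCompactSupport (dil k n) := by
  have h : HasCompactSupport fun z : V => k (((n : ℝ) + 1) • z) :=
    hk.comp_smul (by positivity)
  exact h.mul_left

omit [FiniteDimensional ℝ V] [MeasureSpace V] [BorelSpace V]
  [(volume : Measure V).IsAddHaarMeasure] in
theorem dil_nonneg {k : V → ℝ} (hk : ∀ z, 0 ≤ k z) (n : ℕ) (z : V) : 0 ≤ dil k n z := by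
  unfold dil
  have := hk (((n : ℝ) + 1) • z)
  positivity

omit [FiniteDimensional ℝ V] [MeasureSpace V] [BorelSpace V]
  [(volume : Measure V).IsAddHaarMeasure] in
theorem fderiv_dil {k : V → ℝ} (hk : ContDiff ℝ ∞ k) (n : ℕ) (y e : V) :
    fderiv ℝ (dil k n) y e = ((n : ℝ) + 1) ^ Module.finrank ℝ V *
      fderiv ℝ k (((n : ℝ) + 1) • y) (((n : ℝ) + 1) • e) := by
  have h1 : HasFDerivAt k (fderiv ℝ k (((n : ℝ) + 1) • y)) (((n : ℝ) + 1) • y) :=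
    ((hk.differentiable (by simp)) _).hasFDerivAt
  have h2 : HasFDerivAt (fun y : V => ((n : ℝ) + 1) • y)
      (((n : ℝ) + 1) • ContinuousLinearMap.id ℝ V) y := (hasFDerivAt_id y).const_smul _
  have h3 := (h1.comp y h2).const_mul (((n : ℝ) + 1) ^ Module.finrank ℝ V)
  have h4 : fderiv ℝ (dil k n) y = _ := h3.fderiv
  rw [h4]
  simp

end Mol

/-- A smooth nonnegative kernel of mass one. -/
theorem exists_kernel (d : ℕ) : ∃ k : TimePhase d → ℝ, ContDiff ℝ ∞ k ∧ HasCompactSupport k ∧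
    (∀ z, 0 ≤ k z) ∧ (∫ z, k z) = 1 ∧ ∀ z, 2 < ‖z‖ → k z = 0 := by
  let φ : ContDiffBump (0 : TimePhase d) := ⟨1, 2, by norm_num, by norm_num⟩
  refine ⟨φ.normed volume, φ.contDiff_normed, φ.hasCompactSupport_normed, φ.nonneg_normed,
    φ.integral_normed, fun z hz => ?_⟩
  have : z ∉ Function.support (φ.normed volume) := by
    rw [φ.support_normed_eq]
    simp only [Metric.mem_ball, dist_zero_right, not_lt]
    exact hz.le
  simpa using this

end Kolmogorov

/-! ### The renormalized inequality for `logQ a b f`. -/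

namespace Kolmogorov

variable {d : ℕ}

theorem eq_zero_of_notMem_of_tsupport_subset {V W : Type*} [TopologicalSpace V] [Zero W]
    {h : V → W} {K : Set V} (hK : tsupport h ⊆ K) {z : V} (hz : z ∉ K) : h z = 0 :=
  image_eq_zero_of_notMem_tsupport fun h' => hz (hK h')

/-- The renormalized inequality for smooth functions. -/
theorem renormalized_smooth {a b : ℝ} (hb : 0 < b) (hab : b < a) {K : Set (TimePhase d)}
    {u r : TimePhase d → ℝ} {F g : Fin d → TimePhase d → ℝ}
    (hu : ContDiff ℝ ∞ u) (hu0 : ∀ z, 0 ≤ u z) (hF : ∀ i, ContDiff ℝ 1 (F i))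
    (hg : ∀ i, Continuous (g i)) (hr : Continuous r)
    (hgrad : ∀ z ∈ K, ∀ i, fderiv ℝ u z (dirV i) = g i z)
    (hsup : ∀ z ∈ K, (∑ i, fderiv ℝ (F i) z (dirV i)) + r z ≤ fderiv ℝ u z (dirT z))
    {ρ : TimePhase d → ℝ} {J : Fin d → TimePhase d → ℝ}
    (hρ : ContDiff ℝ 1 ρ) (hρc : HasCompactSupport ρ) (hρK : tsupport ρ ⊆ K) (hρ0 : ∀ z, 0 ≤ ρ z)
    (hJ : ∀ i, ContDiff ℝ 1 (J i)) (hJc : ∀ i, HasCompactSupport (J i))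
    (hJK : ∀ i, tsupport (J i) ⊆ K) :
    ∫ z, logQ a b (u z) * (fderiv ℝ ρ z (dirT z) + ∑ i, fderiv ℝ (J i) z (dirV i)) ≤
      (∑ i, ∫ z, F i z * fderiv ℝ ρ z (dirV i) * logQ₁ a b (u z))
      + (∑ i, ∫ z, F i z * g i z * (ρ z * logQ₂ a b (u z)))
      - (∫ z, r z * ρ z * logQ₁ a b (u z))
      - ∑ i, ∫ z, g i z * J i z * logQ₁ a b (u z) := by
  have ha : 0 < a := hb.trans hab
  have hu1 : ContDiff ℝ 1 u := hu.of_le (by exact_mod_cast le_top)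
  have hG : ContDiff ℝ 1 fun z => logQ a b (u z) := contDiff_logQ ha hb hu1 hu0
  have hG1 : ContDiff ℝ 1 fun z => logQ₁ a b (u z) := contDiff_logQ₁ ha hb hu1 hu0
  have cG2 : Continuous fun z => logQ₂ a b (u z) := by
    rw [continuous_iff_continuousAt]
    exact fun z => (continuousAt_logQ₂ ha hb (hu0 z)).comp hu.continuous.continuousAt
  have dG : ∀ z e, fderiv ℝ (fun z => logQ a b (u z)) z e = logQ₁ a b (u z) * fderiv ℝ u z e := by
    intro z e
    have := (hasDerivAt_logQ ha hb (hu0 z)).comp_hasFDerivAt z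
      ((hu1.differentiable one_ne_zero) z).hasFDerivAt
    have h2 : fderiv ℝ (fun z => logQ a b (u z)) z = _ := this.fderiv
    rw [h2]; simp
  have dG1 : ∀ z e, fderiv ℝ (fun z => logQ₁ a b (u z)) z e
      = logQ₂ a b (u z) * fderiv ℝ u z e := by
    intro z e
    have := (hasDerivAt_logQ₁ ha hb (hu0 z)).comp_hasFDerivAt z
      ((hu1.differentiable one_ne_zero) z).hasFDerivAt
    have h2 : fderiv ℝ (fun z => logQ₁ a b (u z)) z = _ := this.fderiv
    rw [h2]; simp
  have cd : ∀ (w : TimePhase d → ℝ), ContDiff ℝ 1 w → ∀ e, Continuous fun z => fderiv ℝ w z e :=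
    fun w hw e => (hw.continuous_fderiv one_ne_zero).clm_apply continuous_const
  have cT : ∀ (w : TimePhase d → ℝ), ContDiff ℝ 1 w → Continuous fun z => fderiv ℝ w z (dirT z) :=
    fun w hw => (hw.continuous_fderiv one_ne_zero).clm_apply continuous_dirT
  have ci : ∀ {w : TimePhase d → ℝ}, Continuous w → HasCompactSupport w → Integrable w :=
    fun hw hc => hw.integrable_of_hasCompactSupport hc
  have iT : Integrable fun z => logQ a b (u z) * fderiv ℝ ρ z (dirT z) := by
    refine ci (hG.continuous.mul (cT ρ hρ)) (HasCompactSupport.mul_left ?_)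
    exact (hρc.fderiv (𝕜 := ℝ)).mono fun z hz => by
      rw [Function.mem_support] at hz ⊢
      intro h; apply hz; rw [h]; simp
  have iJ : ∀ i, Integrable fun z => logQ a b (u z) * fderiv ℝ (J i) z (dirV i) := fun i =>
    ci (hG.continuous.mul (cd _ (hJ i) _)) ((hJc i).fderiv_apply (𝕜 := ℝ) _).mul_left
  have e0 : ∫ z, logQ a b (u z) * (fderiv ℝ ρ z (dirT z) + ∑ i, fderiv ℝ (J i) z (dirV i))
      = (∫ z, logQ a b (u z) * fderiv ℝ ρ z (dirT z))
        + ∑ i, ∫ z, logQ a b (u z) * fderiv ℝ (J i) z (dirV i) := by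
    rw [← integral_finsetSum _ fun i _ => iJ i, ← integral_add iT (integrable_finsetSum _ fun i _ =>
      iJ i)]
    congr 1; ext z; rw [mul_add, Finset.mul_sum]
  have eJ : ∀ i, ∫ z, logQ a b (u z) * fderiv ℝ (J i) z (dirV i)
      = - ∫ z, g i z * J i z * logQ₁ a b (u z) := by
    intro i
    rw [integral_mul_fderiv_const hG (hJ i) (hJc i)]
    congr 1
    apply integral_congr_ae
    refine Eventually.of_forall fun z => ?_
    beta_reduce
    rw [dG]
    by_cases hz : z ∈ K
    · rw [hgrad z hz i]; ring
    · simp [eq_zero_of_notMem_of_tsupport_subset (hJK i) hz]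
  -- The inequality for `u` multiplied by `ρ G'(u)` is the one for `G(u)`. Moving the divergence of
  -- `F` onto this weight produces the term with `G''`.
  set φ : TimePhase d → ℝ := fun z => ρ z * logQ₁ a b (u z) with hφ
  have hφ1 : ContDiff ℝ 1 φ := hρ.mul hG1
  have hφc : HasCompactSupport φ := hρc.mul_right
  have eF : ∀ i, ∫ z, fderiv ℝ (F i) z (dirV i) * φ z
      = -((∫ z, F i z * fderiv ℝ ρ z (dirV i) * logQ₁ a b (u z))
        + ∫ z, F i z * g i z * (ρ z * logQ₂ a b (u z))) := by
    intro i
    have h1 := integral_mul_fderiv_const (hF i) hφ1 hφc (dirV i)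
    rw [← neg_eq_iff_eq_neg] at h1
    rw [← h1, neg_inj, ← integral_add]
    · apply integral_congr_ae
      refine Eventually.of_forall fun z => ?_
      have h2 : fderiv ℝ φ z (dirV i) = fderiv ℝ ρ z (dirV i) * logQ₁ a b (u z)
          + ρ z * (logQ₂ a b (u z) * fderiv ℝ u z (dirV i)) := by
        rw [hφ, fderiv_fun_mul ((hρ.differentiable one_ne_zero) z)
          ((hG1.differentiable one_ne_zero) z)]
        simp only [add_apply, FunLike.coe_smul, Pi.smul_apply, smul_eq_mul, dG1]
        ring
      beta_reduce
      rw [h2]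
      by_cases hz : z ∈ K
      · rw [hgrad z hz i]; ring
      · simp only [eq_zero_of_notMem_of_tsupport_subset hρK hz]; ring
    · exact ci (((hF i).continuous.mul (cd _ hρ _)).mul hG1.continuous)
        ((hρc.fderiv_apply (𝕜 := ℝ) _).mul_left.mul_right)
    · exact ci (((hF i).continuous.mul (hg i)).mul (hρ.continuous.mul cG2))
        hρc.mul_right.mul_left
  have iF : ∀ i, Integrable fun z => fderiv ℝ (F i) z (dirV i) * φ z := fun i =>
    ci ((cd _ (hF i) _).mul hφ1.continuous) hφc.mul_left
  have ir : Integrable fun z => r z * ρ z * logQ₁ a b (u z) :=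
    ci ((hr.mul hρ.continuous).mul hG1.continuous) hρc.mul_left.mul_right
  have eT : ∫ z, logQ a b (u z) * fderiv ℝ ρ z (dirT z)
      ≤ -((∑ i, ∫ z, fderiv ℝ (F i) z (dirV i) * φ z)
        + ∫ z, r z * ρ z * logQ₁ a b (u z)) := by
    rw [integral_mul_transport hG hρ hρc, neg_le_neg_iff, ← integral_finsetSum _ fun i _ => iF i,
      ← integral_add (integrable_finsetSum _ fun i _ => iF i) ir]
    apply integral_mono ((integrable_finsetSum _ fun i _ => iF i).add ir)
    · exact ci ((cT _ hG).mul hρ.continuous) hρc.mul_left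
    · intro z
      simp only [Pi.add_apply, dG]
      by_cases hz : z ∈ K
      -- The differential inequality may be multiplied by the weight because `ρ ≥ 0` and `G' ≥ 0`.
      · have h3 := mul_le_mul_of_nonneg_right (hsup z hz)
          (mul_nonneg (hρ0 z) (logQ₁_nonneg hb hab (hu0 z)))
        rw [← Finset.sum_mul]
        calc _ = ((∑ i, fderiv ℝ (F i) z (dirV i)) + r z) * (ρ z * logQ₁ a b (u z)) := by
              simp only [hφ]; ring
          _ ≤ _ := h3
          _ = _ := by ring
      · simp [hφ, eq_zero_of_notMem_of_tsupport_subset hρK hz]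
  rw [e0]
  simp_rw [eJ, Finset.sum_neg_distrib]
  simp_rw [eF, Finset.sum_neg_distrib, Finset.sum_add_distrib] at eT
  linarith

/-- The renormalized inequality: if `f` is a nonnegative supersolution near `K`, with flux `F` and
velocity gradient `g`, then `log ((1 + a f) / (1 + b f))` satisfies the expected inequality. -/
theorem renormalized {a b : ℝ} (hb : 0 < b) (hab : b < a) {K : Set (TimePhase d)}
    {f : TimePhase d → ℝ} {F g : Fin d → TimePhase d → ℝ}
    (hf : MemLp f 2 volume) (hf0 : ∀ᵐ z, 0 ≤ f z) (hF : ∀ i, MemLp (F i) 2 volume)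
    (hg : ∀ i, MemLp (g i) 2 volume) {δ : ℝ} (hδ : 0 < δ)
    (hgrad : ∀ z ∈ K, ∀ φ : TimePhase d → ℝ, ContDiff ℝ ∞ φ → HasCompactSupport φ →
      (∀ y, δ < dist y z → φ y = 0) → ∀ i,
      ∫ y, f y * fderiv ℝ φ y (dirV i) = - ∫ y, g i y * φ y)
    (hsup : ∀ z ∈ K, ∀ φ : TimePhase d → ℝ, ContDiff ℝ ∞ φ → HasCompactSupport φ →
      (∀ y, δ < dist y z → φ y = 0) → (∀ y, 0 ≤ φ y) →
      0 ≤ -(∫ y, f y * fderiv ℝ φ y (dirT y)) + ∑ i, ∫ y, F i y * fderiv ℝ φ y (dirV i))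
    {ρ : TimePhase d → ℝ} {J : Fin d → TimePhase d → ℝ}
    (hρ : ContDiff ℝ 1 ρ) (hρc : HasCompactSupport ρ) (hρK : tsupport ρ ⊆ K) (hρ0 : ∀ z, 0 ≤ ρ z)
    (hJ : ∀ i, ContDiff ℝ 1 (J i)) (hJc : ∀ i, HasCompactSupport (J i))
    (hJK : ∀ i, tsupport (J i) ⊆ K) :
    ∫ z, logQ a b (f z) * (fderiv ℝ ρ z (dirT z) + ∑ i, fderiv ℝ (J i) z (dirV i)) ≤
      (∑ i, ∫ z, F i z * fderiv ℝ ρ z (dirV i) * logQ₁ a b (f z))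
      + (∑ i, ∫ z, F i z * g i z * (ρ z * logQ₂ a b (f z)))
      - ∑ i, ∫ z, g i z * J i z * logQ₁ a b (f z) := by
  have ha : 0 < a := hb.trans hab
  obtain ⟨k, hk, hkc, hk0, hk1, hks⟩ := exists_kernel d
  have li : ∀ {w : TimePhase d → ℝ}, MemLp w 2 volume → LocallyIntegrable w volume :=
    fun hw => hw.locallyIntegrable (by norm_num)
  -- The commutator kernel. Convolution does not commute with `v · ∇ₓ`; the defect is convolution
  -- with the kernel `y ↦ v_y · ∇ₓ k(y)`.
  set κ : TimePhase d → ℝ := fun y => fderiv ℝ k y (0, y.2.2, 0) with hκ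
  have hk1' : ContDiff ℝ 1 k := hk.of_le (by exact_mod_cast le_top)
  have cκ : Continuous κ := (hk1'.continuous_fderiv one_ne_zero).clm_apply (by fun_prop)
  have sκ : HasCompactSupport κ := (hkc.fderiv (𝕜 := ℝ)).mono fun z hz => by
    rw [Function.mem_support] at hz ⊢
    intro h; apply hz; simp only [hκ]; rw [h]; simp
  -- `κ` is the difference of two derivatives of `k` along divergence free fields. Mass zero makes
  -- the mollifications by `κ` tend to zero in `L²`, so ordinary isotropic mollification is enough.
  have zκ : ∫ y, κ y = 0 := by
    have h1 := integral_transport_eq_zero hk1' hkc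
    have h2 := integral_fderiv_eq_zero hk1' hkc ((1, 0, 0) : TimePhase d)
    have h3 : ∀ y : TimePhase d, κ y = fderiv ℝ k y (dirT y) - fderiv ℝ k y (1, 0, 0) := by
      intro y
      rw [← map_sub]
      simp [hκ, dirT]
    simp_rw [h3]
    rw [integral_sub, h1, h2, sub_zero]
    · refine ((hk1'.continuous_fderiv one_ne_zero).clm_apply
        continuous_dirT).integrable_of_hasCompactSupport ?_
      exact (hkc.fderiv (𝕜 := ℝ)).mono fun z hz => by
        rw [Function.mem_support] at hz ⊢
        intro h; apply hz; rw [h]; simp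
    · exact ((hk1'.continuous_fderiv one_ne_zero).clm_apply
        continuous_const).integrable_of_hasCompactSupport (hkc.fderiv_apply (𝕜 := ℝ) _)
  set D : ℕ → TimePhase d → ℝ := fun n => dil k n with hD
  have sD : ∀ n, HasCompactSupport (D n) := fun n => hasCompactSupport_dil hkc n
  have cD : ∀ n, ContDiff ℝ ∞ (D n) := fun n => contDiff_dil hk n
  have cD1 : ∀ n, ContDiff ℝ 1 (D n) := fun n => (cD n).of_le (by exact_mod_cast le_top)
  -- The factor `n + 1` gained by differentiating is cancelled by the velocity factor, so the
  -- commutator kernel at scale `n` is again an `L¹`-normalized dilation.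
  have dκ : ∀ n y, dil κ n y = fderiv ℝ (D n) y (0, y.2.2, 0) := by
    intro n y
    rw [hD, fderiv_dil hk]
    simp [dil, hκ]
  have cu : ∀ {w : TimePhase d → ℝ}, MemLp w 2 volume → ∀ n, ContDiff ℝ ∞ (mol w (D n)) :=
    fun hw n => contDiff_mol (li hw) (cD n) (sD n)
  have cr : ∀ n, Continuous (mol f (dil κ n)) := by
    intro n
    rw [mol_eq_convolution]
    refine HasCompactSupport.continuous_convolution_right _ (hasCompactSupport_dil sκ n) (li hf) ?_
    unfold dil; fun_prop
  have hD0 : ∀ n y, 0 ≤ D n y := fun n y => dil_nonneg hk0 n y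
  have u0 : ∀ n z, 0 ≤ mol f (D n) z := fun n z => mol_nonneg hf0 (hD0 n) z
  have L2 : ∀ {w : TimePhase d → ℝ}, MemLp w 2 volume →
      Tendsto (fun n => eLpNorm (fun z => mol w (D n) z - w z) 2 volume) atTop (𝓝 0) := by
    intro w hw
    have := tendsto_mollify hw hk.continuous hkc
    simpa [hk1] using this
  -- The nonlinear factors converge only pointwise, so almost everywhere convergence of the
  -- mollifications is needed, and it is available along a subsequence.
  obtain ⟨ns, hns, hae⟩ := (tendstoInMeasure_of_tendsto_eLpNorm (p := 2) (by norm_num)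
    (fun n => ((cu hf n).continuous.aestronglyMeasurable)) hf.1
    (L2 hf)).exists_seq_tendsto_ae
  -- `k` vanishes outside the ball of radius `2`, hence `D n` outside radius `2 / (n + 1)`, which is
  -- eventually below `δ`.
  have hev : ∀ᶠ n : ℕ in atTop, ∀ z ∈ K, ∀ y, δ < dist y z → D n (z - y) = 0 := by
    have hlim : Tendsto (fun n : ℕ => ((n : ℝ) + 1) * δ) atTop atTop :=
      (tendsto_atTop_add_const_right _ _ tendsto_natCast_atTop_atTop).atTop_mul_const hδ
    filter_upwards [hlim.eventually_gt_atTop 2] with n hn z hz y hy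
    simp only [hD, dil]
    rw [hks, mul_zero]
    rw [norm_smul, Real.norm_of_nonneg (by positivity), ← dist_eq_norm, dist_comm]
    refine hn.trans_le ?_
    gcongr
  have hineq : ∀ᶠ n : ℕ in atTop,
      ∫ z, logQ a b (mol f (D n) z) *
        (fderiv ℝ ρ z (dirT z) + ∑ i, fderiv ℝ (J i) z (dirV i)) ≤
      (∑ i, ∫ z, mol (F i) (D n) z * fderiv ℝ ρ z (dirV i) * logQ₁ a b (mol f (D n) z))
      + (∑ i, ∫ z, mol (F i) (D n) z * mol (g i) (D n) z * (ρ z * logQ₂ a b (mol f (D n) z)))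
      - (∫ z, mol f (dil κ n) z * ρ z * logQ₁ a b (mol f (D n) z))
      - ∑ i, ∫ z, mol (g i) (D n) z * J i z * logQ₁ a b (mol f (D n) z) := by
    filter_upwards [hev] with n hn
    have hφ : ∀ z, ContDiff ℝ ∞ fun y => D n (z - y) := fun z => (cD n).comp (by fun_prop)
    have hφc : ∀ z, HasCompactSupport fun y => D n (z - y) := fun z =>
      (sD n).comp_homeomorph (Homeomorph.subLeft z)
    have dφ : ∀ z y e, fderiv ℝ (fun y => D n (z - y)) y e = - fderiv ℝ (D n) (z - y) e := by
      intro z y e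
      have h1 : HasFDerivAt (D n) (fderiv ℝ (D n) (z - y)) (z - y) :=
        ((cD n).differentiable (by simp) _).hasFDerivAt
      have h2 := h1.comp y ((hasFDerivAt_id y).const_sub z)
      have h3 : fderiv ℝ (fun y => D n (z - y)) y = _ := h2.fderiv
      rw [h3]
      simp
    refine renormalized_smooth hb hab (K := K) (cu hf n) (u0 n)
      (fun i => (cu (hF i) n).of_le (by exact_mod_cast le_top))
      (fun i => (cu (hg i) n).continuous) (cr n) ?_ ?_ hρ hρc hρK hρ0 hJ hJc hJK
    · intro z hz i
      rw [fderiv_mol (li hf) (cD n) (sD n)]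
      have h1 := hgrad z hz _ (hφ z) (hφc z) (hn z hz) i
      simp only [dφ, mul_neg, integral_neg, neg_inj] at h1
      exact h1
    · intro z hz
      have h1 := hsup z hz _ (hφ z) (hφc z) (hn z hz) (fun y => hD0 n _)
      simp only [dφ, mul_neg, integral_neg, neg_neg, Finset.sum_neg_distrib] at h1
      have h2 : ∀ i, fderiv ℝ (mol (F i) (D n)) z (dirV i)
          = ∫ y, F i y * fderiv ℝ (D n) (z - y) (dirV i) := fun i =>
        fderiv_mol (li (hF i)) (cD n) (sD n) z _
      -- Write `dirT z = dirT y + (0, z.2.2 - y.2.2, 0)`: the first part is what the weak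
      -- formulation tests, the second is the commutator.
      have h3 : fderiv ℝ (mol f (D n)) z (dirT z)
          = (∫ y, f y * fderiv ℝ (D n) (z - y) (dirT y)) + mol f (dil κ n) z := by
        rw [fderiv_mol (li hf) (cD n) (sD n), mol, mol, ← integral_add]
        · congr 1
          ext y
          rw [dκ, ← mul_add, ← map_add]
          congr 2
          simp [dirT]
        · have hcs : HasCompactSupport fun y => fderiv ℝ (D n) (z - y) (dirT y) := by
            have h4 : HasCompactSupport fun y => fderiv ℝ (D n) (z - y) :=
              ((sD n).fderiv (𝕜 := ℝ)).comp_homeomorph (Homeomorph.subLeft z)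
            exact h4.mono fun y hy => by
              rw [Function.mem_support] at hy ⊢
              intro h; apply hy; rw [h]; simp
          have hcc : Continuous fun y => fderiv ℝ (D n) (z - y) (dirT y) :=
            (((cD1 n).continuous_fderiv one_ne_zero).comp (by fun_prop)).clm_apply continuous_dirT
          simpa using (li hf).integrable_smul_right_of_hasCompactSupport hcc hcs
        · have hcs : HasCompactSupport fun y => dil κ n (z - y) :=
            (hasCompactSupport_dil sκ n).comp_homeomorph (Homeomorph.subLeft z)
          have hcc : Continuous fun y => dil κ n (z - y) := by unfold dil; fun_prop
          simpa using (li hf).integrable_smul_right_of_hasCompactSupport hcc hcs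
      simp_rw [h2]
      rw [h3]
      linarith
  have cd : ∀ (w : TimePhase d → ℝ), ContDiff ℝ 1 w → ∀ e, Continuous fun z => fderiv ℝ w z e :=
    fun w hw e => (hw.continuous_fderiv one_ne_zero).clm_apply continuous_const
  have cT : ∀ (w : TimePhase d → ℝ), ContDiff ℝ 1 w → Continuous fun z => fderiv ℝ w z (dirT z) :=
    fun w hw => (hw.continuous_fderiv one_ne_zero).clm_apply continuous_dirT
  have sub2 : ∀ {w : TimePhase d → ℝ}, MemLp w 2 volume →
      Tendsto (fun n => eLpNorm (fun z => mol w (D (ns n)) z - w z) 2 volume) atTop (𝓝 0) :=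
    fun hw => (L2 hw).comp hns.tendsto_atTop
  have mu : ∀ {w : TimePhase d → ℝ}, MemLp w 2 volume → ∀ n,
      AEStronglyMeasurable (mol w (D (ns n))) volume :=
    fun hw n => (cu hw _).continuous.aestronglyMeasurable
  have const2 : ∀ w : TimePhase d → ℝ,
      Tendsto (fun _ : ℕ => eLpNorm (fun z => w z - w z) 2 volume) atTop (𝓝 0) := by
    intro w; simp
  have c2 : ∀ {w : TimePhase d → ℝ}, Continuous w → HasCompactSupport w → MemLp w 2 volume :=
    fun hw hc => hw.memLp_of_hasCompactSupport hc
  have g1m : ∀ n, AEStronglyMeasurable (fun z => logQ₁ a b (mol f (D (ns n)) z)) volume :=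
    fun n => (measurable_logQ₁.comp (cu hf _).continuous.measurable).aestronglyMeasurable
  have g1b : ∀ n, ∀ᵐ z, |logQ₁ a b (mol f (D (ns n)) z)| ≤ a := fun n =>
    Eventually.of_forall fun z => by
      rw [abs_of_nonneg (logQ₁_nonneg hb hab (u0 _ z))]
      exact logQ₁_le hb hab (u0 _ z)
  have g1t : ∀ᵐ z, Tendsto (fun n => logQ₁ a b (mol f (D (ns n)) z)) atTop
      (𝓝 (logQ₁ a b (f z))) := by
    filter_upwards [hae, hf0] with z h1 h2
    exact (hasDerivAt_logQ₁ ha hb h2).continuousAt.tendsto.comp h1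
  have t1 : ∀ i, Tendsto (fun n => ∫ z, mol (F i) (D (ns n)) z * fderiv ℝ ρ z (dirV i) *
      logQ₁ a b (mol f (D (ns n)) z)) atTop
      (𝓝 (∫ z, F i z * fderiv ℝ ρ z (dirV i) * logQ₁ a b (f z))) := fun i => by
    have m := c2 (cd ρ hρ (dirV i)) (hρc.fderiv_apply (𝕜 := ℝ) _)
    exact tendsto_integral_mul_mul (M := a) (mu (hF i)) (fun _ => m.1) g1m (hF i) m (sub2 (hF i))
      (const2 _) g1b g1t
  obtain ⟨Mρ, hMρ⟩ : ∃ M, ∀ z, |ρ z| ≤ M := by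
    obtain ⟨M, hM⟩ := hρ.continuous.bounded_above_of_compact_support hρc
    exact ⟨M, fun z => by simpa using hM z⟩
  -- The only term quadratic in the data. Both factors converge in `L²`, and the remaining one is
  -- bounded and converges almost everywhere.
  have t2 : ∀ i, Tendsto (fun n => ∫ z, mol (F i) (D (ns n)) z * mol (g i) (D (ns n)) z *
      (ρ z * logQ₂ a b (mol f (D (ns n)) z))) atTop
      (𝓝 (∫ z, F i z * g i z * (ρ z * logQ₂ a b (f z)))) := fun i => by
    refine tendsto_integral_mul_mul (M := Mρ * a ^ 2) (mu (hF i)) (mu (hg i)) (fun n => ?_) (hF i)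
      (hg i) (sub2 (hF i)) (sub2 (hg i)) (fun n => ?_) ?_
    · exact (hρ.continuous.measurable.mul
        (measurable_logQ₂.comp (cu hf _).continuous.measurable)).aestronglyMeasurable
    · refine Eventually.of_forall fun z => ?_
      rw [abs_mul]
      exact mul_le_mul (hMρ z) (abs_logQ₂_le hb hab (u0 _ z)) (abs_nonneg _)
        ((abs_nonneg _).trans (hMρ z))
    · filter_upwards [hae, hf0] with z h1 h2
      exact ((continuousAt_logQ₂ ha hb h2).tendsto.comp h1).const_mul _
  have t3 : Tendsto (fun n => ∫ z, mol f (dil κ (ns n)) z * ρ z *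
      logQ₁ a b (mol f (D (ns n)) z)) atTop (𝓝 0) := by
    have m := c2 hρ.continuous hρc
    have h0 : Tendsto (fun n => eLpNorm (fun z => mol f (dil κ (ns n)) z - 0) 2 volume) atTop
        (𝓝 0) := by
      have := (tendsto_mollify hf cκ sκ).comp hns.tendsto_atTop
      simpa [zκ, Function.comp_def] using this
    have := tendsto_integral_mul_mul (M := a) (h := fun n => mol f (dil κ (ns n)))
      (h₀ := fun _ => 0) (fun n => (cr _).aestronglyMeasurable) (fun _ => m.1) g1m
      (by simp) m h0 (const2 _) g1b g1t
    simpa using this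
  have t4 : ∀ i, Tendsto (fun n => ∫ z, mol (g i) (D (ns n)) z * J i z *
      logQ₁ a b (mol f (D (ns n)) z)) atTop
      (𝓝 (∫ z, g i z * J i z * logQ₁ a b (f z))) := fun i => by
    have m := c2 (hJ i).continuous (hJc i)
    exact tendsto_integral_mul_mul (M := a) (mu (hg i)) (fun _ => m.1) g1m (hg i) m (sub2 (hg i))
      (const2 _) g1b g1t
  have t0 : Tendsto (fun n => ∫ z, logQ a b (mol f (D (ns n)) z) *
        (fderiv ℝ ρ z (dirT z) + ∑ i, fderiv ℝ (J i) z (dirV i))) atTop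
      (𝓝 (∫ z, logQ a b (f z) * (fderiv ℝ ρ z (dirT z) + ∑ i, fderiv ℝ (J i) z (dirV i)))) := by
    set ψ : TimePhase d → ℝ := fun z => fderiv ℝ ρ z (dirT z) + ∑ i, fderiv ℝ (J i) z (dirV i)
      with hψ
    have hψi : Integrable ψ := by
      refine Integrable.add ?_ (integrable_finsetSum _ fun i _ => ?_)
      · refine (cT ρ hρ).integrable_of_hasCompactSupport ?_
        exact (hρc.fderiv (𝕜 := ℝ)).mono fun z hz => by
          rw [Function.mem_support] at hz ⊢
          intro h; apply hz; rw [h]; simp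
      · exact (cd _ (hJ i) _).integrable_of_hasCompactSupport ((hJc i).fderiv_apply (𝕜 := ℝ) _)
    refine tendsto_integral_of_dominated_convergence
      (fun z => (Real.log a - Real.log b) * |ψ z|) (fun n => ?_) (hψi.abs.const_mul _) (fun n => ?_)
      ?_
    · exact ((measurable_logQ.comp (cu hf _).continuous.measurable).aestronglyMeasurable).mul hψi.1
    · refine Eventually.of_forall fun z => ?_
      rw [Real.norm_eq_abs, abs_mul, abs_of_nonneg (logQ_nonneg hb hab (u0 _ z))]
      gcongr
      exact logQ_le hb hab (u0 _ z)
    · filter_upwards [hae, hf0] with z h1 h2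
      exact ((hasDerivAt_logQ ha hb h2).continuousAt.tendsto.comp h1).mul_const _
  have tR := (((tendsto_finsetSum Finset.univ fun i _ => t1 i).add
    (tendsto_finsetSum Finset.univ fun i _ => t2 i)).sub t3).sub
    (tendsto_finsetSum Finset.univ fun i _ => t4 i)
  rw [sub_zero] at tR
  exact le_of_tendsto_of_tendsto t0 tR (hns.tendsto_atTop.eventually hineq)

end Kolmogorov

/-! ### The cost inequality for compactly supported densities and currents. -/

namespace Kolmogorov

variable {d : ℕ}

theorem isOpen_slab (t₀ t₁ : ℝ) : IsOpen (slab d t₀ t₁) := isOpen_Ioo.prod isOpen_univ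

theorem volume_slab_ne_zero {t₀ t₁ : ℝ} (h : t₀ < t₁) : volume (slab d t₀ t₁) ≠ 0 :=
  ((isOpen_slab t₀ t₁).measure_pos volume
    ⟨((t₀ + t₁) / 2, 0), ⟨⟨by linarith, by linarith⟩, mem_univ _⟩⟩).ne'

theorem inner_eq_sum (x y : Space d) : inner ℝ x y = ∑ i, x i * y i := by
  rw [PiLp.inner_apply]
  simp [mul_comm]

theorem act_apply (A : Matrix (Fin d) (Fin d) ℝ) (ξ : Space d) (i : Fin d) :
    act A ξ i = ∑ j, A i j * ξ j := by
  simp [act, Matrix.toLpLin_apply, Matrix.mulVec, dotProduct]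

/-- At a point where both bounds hold, a unit vector has pairing at least `lam > 0`, while `Lam`
times the pairing dominates a square. Positive dimension supplies the vector. -/
theorem IsElliptic.Lam_nonneg (hd : 0 < d) {t₀ t₁ : ℝ} (ht : t₀ < t₁)
    {A : TimePhase d → Matrix (Fin d) (Fin d) ℝ} {lam Lam : ℝ} (hlam : 0 < lam)
    (h : IsElliptic (slab d t₀ t₁) A lam Lam) : 0 ≤ Lam := by
  have : NeZero (volume.restrict (slab d t₀ t₁)) :=
    ⟨by simpa [Measure.restrict_eq_zero] using volume_slab_ne_zero ht⟩
  obtain ⟨z, h1, h2⟩ := (h.lower.and h.upper).exists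
  have h3 := h1 (EuclideanSpace.single ⟨0, hd⟩ 1)
  have h4 := h2 (EuclideanSpace.single ⟨0, hd⟩ 1)
  simp only [PiLp.norm_single, norm_one, one_pow, mul_one] at h3 h4
  by_contra hL
  push Not at hL
  nlinarith [sq_nonneg ‖act (A z) (EuclideanSpace.single ⟨0, hd⟩ 1)‖]

theorem le_half_add_of_sq_le {c x y : ℝ} (hx : 0 ≤ x) (hy : 0 ≤ y) (h : c ^ 2 ≤ x * y) :
    c ≤ (x + y) / 2 := by
  have : c ^ 2 ≤ ((x + y) / 2) ^ 2 := h.trans (by nlinarith [sq_nonneg (x - y)])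
  exact (le_abs_self c).trans (abs_le_of_sq_le_sq this (by positivity))

/-- The pointwise Young inequality behind `cost_bound`. -/
theorem young_pointwise {lam Lam : ℝ} (hlam : 0 < lam) (hLam : 0 ≤ Lam)
    {F g P J : Fin d → ℝ} {q q₂ r w₁ w₂ : ℝ} (hq₂ : q₂ ≤ -q ^ 2)
    (hr : 0 ≤ r) (hw₁ : 0 ≤ w₁) (hw₂ : 0 ≤ w₂)
    (hl : lam * ∑ i, g i ^ 2 ≤ ∑ i, F i * g i) (hu : ∑ i, F i ^ 2 ≤ Lam * ∑ i, F i * g i)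
    (hP : ∑ i, P i ^ 2 ≤ w₁ * r) (hJ : ∑ i, J i ^ 2 ≤ w₂ * r) :
    (∑ i, F i * P i * q) + (∑ i, F i * g i * (r * q₂)) - ∑ i, g i * J i * q
      ≤ (Lam * w₁ + 1 / lam * w₂) / 2 := by
  set X := ∑ i, F i * g i with hX
  have hg0 : 0 ≤ ∑ i, g i ^ 2 := Finset.sum_nonneg fun i _ => sq_nonneg _
  have hX0 : 0 ≤ X := (mul_nonneg hlam.le hg0).trans hl
  -- Cauchy–Schwarz and `|F|² ≤ Lam ⟨F, g⟩`. This uses half of `q² X r`; the current term below uses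
  -- the other half.
  have e1 : q * ∑ i, F i * P i ≤ (q ^ 2 * X * r + Lam * w₁) / 2 := by
    apply le_half_add_of_sq_le (by positivity) (by positivity)
    have h1 := Finset.sum_mul_sq_le_sq_mul_sq Finset.univ F P
    have h2 : (∑ i, F i ^ 2) * ∑ i, P i ^ 2 ≤ (Lam * X) * (w₁ * r) :=
      mul_le_mul hu hP (Finset.sum_nonneg fun i _ => sq_nonneg _) (by positivity)
    calc (q * ∑ i, F i * P i) ^ 2 = q ^ 2 * (∑ i, F i * P i) ^ 2 := by ring
      _ ≤ q ^ 2 * ((Lam * X) * (w₁ * r)) := by gcongr; exact h1.trans h2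
      _ = _ := by ring
  have e2 : -q * ∑ i, g i * J i ≤ (q ^ 2 * X * r + 1 / lam * w₂) / 2 := by
    apply le_half_add_of_sq_le (by positivity) (by positivity)
    have h1 := Finset.sum_mul_sq_le_sq_mul_sq Finset.univ g J
    have h0 : ∑ i, g i ^ 2 ≤ 1 / lam * X := by
      rw [one_div, ← div_eq_inv_mul, le_div_iff₀ hlam]; linarith
    have h2 : (∑ i, g i ^ 2) * ∑ i, J i ^ 2 ≤ (1 / lam * X) * (w₂ * r) :=
      mul_le_mul h0 hJ (Finset.sum_nonneg fun i _ => sq_nonneg _) (by positivity)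
    calc (-q * ∑ i, g i * J i) ^ 2 = q ^ 2 * (∑ i, g i * J i) ^ 2 := by ring
      _ ≤ q ^ 2 * ((1 / lam * X) * (w₂ * r)) := by gcongr; exact h1.trans h2
      _ = _ := by ring
  -- The concavity of the nonlinearity pays for both halves.
  have e3 : X * (r * q₂) ≤ -(q ^ 2 * X * r) := by
    have := mul_le_mul_of_nonneg_left hq₂ (mul_nonneg hX0 hr)
    nlinarith
  rw [← Finset.sum_mul, ← Finset.sum_mul, ← Finset.sum_mul, ← hX]
  linarith

/-- The main inequality for a supersolution `f`: testing `log f` with a density `ρ` and a current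
`J` costs at most the weighted Fisher information of `ρ` and the kinetic energy of `J`. -/
theorem cost_bound {A : TimePhase d → Matrix (Fin d) (Fin d) ℝ} {f : TimePhase d → ℝ}
    {lam Lam : ℝ} (hlam : 0 < lam) (hLam : 0 ≤ Lam)
    (hell : IsElliptic (slab d (1 / 4) 1) A lam Lam)
    (hsup : IsWeakSupersolution (slab d (1 / 4) 1) A f)
    (hpos : ∀ᵐ z ∂(volume.restrict (slab d (1 / 4) 1)), 0 < f z)
    {a b : ℝ} (hb : 0 < b) (hab : b < a)
    {ρ W₁ W₂ : TimePhase d → ℝ} {J : Fin d → TimePhase d → ℝ}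
    (hρ : ContDiff ℝ 1 ρ) (hρc : HasCompactSupport ρ) (hρK : tsupport ρ ⊆ slab d (1 / 4) 1)
    (hρ0 : ∀ z, 0 ≤ ρ z) (hJ : ∀ i, ContDiff ℝ 1 (J i)) (hJc : ∀ i, HasCompactSupport (J i))
    (hJK : ∀ i, tsupport (J i) ⊆ slab d (1 / 4) 1)
    (iW₁ : Integrable W₁) (iW₂ : Integrable W₂) (hW₁ : ∀ z, 0 ≤ W₁ z) (hW₂ : ∀ z, 0 ≤ W₂ z)
    (h1 : ∀ z, ∑ i, fderiv ℝ ρ z (dirV i) ^ 2 ≤ W₁ z * ρ z)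
    (h2 : ∀ z, ∑ i, J i z ^ 2 ≤ W₂ z * ρ z) :
    ∫ z, logQ a b (f z) * (fderiv ℝ ρ z (dirT z) + ∑ i, fderiv ℝ (J i) z (dirV i)) ≤
      (Lam * ∫ z, W₁ z) / 2 + (1 / lam * ∫ z, W₂ z) / 2 := by
  have ha : 0 < a := hb.trans hab
  set Q := slab d (1 / 4) 1 with hQ
  have oQ : IsOpen Q := isOpen_slab _ _
  obtain ⟨hfL, g, hgL, hgw, hs⟩ := hsup
  set K : Set (TimePhase d) := tsupport ρ ∪ ⋃ i, tsupport (J i) with hK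
  have cK : IsCompact K := IsCompact.union hρc (isCompact_iUnion fun i => hJc i)
  have KQ : K ⊆ Q := union_subset hρK (iUnion_subset hJK)
  -- The data are only locally `L²` in the slab. A compact thickening of the supports leaves room
  -- for mollification at scale `δ`, and cutting off with its indicator gives functions in `L²` of
  -- the whole space that agree with the original ones on all the test functions concerned.
  obtain ⟨δ, hδ, hδQ⟩ := cK.exists_cthickening_subset_open oQ KQ
  set K' := Metric.cthickening δ K with hK'
  have cK' : IsCompact K' := cK.cthickening
  have mK' : MeasurableSet K' := cK'.measurableSet
  have rle : volume.restrict K' ≤ volume.restrict Q := Measure.restrict_mono hδQ le_rfl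
  have lift : ∀ {p : TimePhase d → Prop}, (∀ᵐ z ∂(volume.restrict Q), p z) →
      ∀ᵐ z, z ∈ K' → p z := fun hp =>
    (ae_restrict_iff' mK').1 (ae_mono rle hp)
  set f0 : TimePhase d → ℝ := K'.indicator f with hf0
  set gi : Fin d → TimePhase d → ℝ := fun i => K'.indicator fun z => g z i with hgi
  set Fi : Fin d → TimePhase d → ℝ := fun i => K'.indicator fun z => act (A z) (g z) i with hFi
  have hf0L : MemLp f0 2 volume := (memLp_indicator_iff_restrict mK').2 (hfL K' cK' hδQ)
  have hgK : MemLp g 2 (volume.restrict K') := hgL K' cK' hδQ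
  have hgc : ∀ i, MemLp (fun z => g z i) 2 (volume.restrict K') := fun i =>
    hgK.mono ((EuclideanSpace.proj (𝕜 := ℝ) i).continuous.comp_aestronglyMeasurable hgK.1)
      (Eventually.of_forall fun z => PiLp.norm_apply_le _ _)
  have hgiL : ∀ i, MemLp (gi i) 2 volume := fun i =>
    (memLp_indicator_iff_restrict mK').2 (hgc i)
  -- From `|aξ|² ≤ Lam ⟨aξ, ξ⟩ ≤ Lam |aξ| |ξ|`; this puts the flux into `L²`.
  have hFb : ∀ᵐ z ∂(volume.restrict Q), ‖act (A z) (g z)‖ ≤ Lam * ‖g z‖ := by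
    filter_upwards [hell.upper] with z hz
    have h3 := hz (g z)
    have h4 : inner ℝ (act (A z) (g z)) (g z) ≤ ‖act (A z) (g z)‖ * ‖g z‖ := real_inner_le_norm _ _
    by_cases h0 : ‖act (A z) (g z)‖ = 0
    · rw [h0]; positivity
    · have h5 : 0 < ‖act (A z) (g z)‖ := lt_of_le_of_ne (norm_nonneg _) (Ne.symm h0)
      have h6 := h3.trans (mul_le_mul_of_nonneg_left h4 hLam)
      have h7 : ‖act (A z) (g z)‖ * ‖act (A z) (g z)‖ ≤ ‖act (A z) (g z)‖ * (Lam * ‖g z‖) := by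
        nlinarith
      exact le_of_mul_le_mul_left h7 h5
  have hFiL : ∀ i, MemLp (Fi i) 2 volume := by
    intro i
    refine (memLp_indicator_iff_restrict mK').2 ?_
    refine MemLp.of_le_mul (c := Lam) hgK ?_ ?_
    · have hA : ∀ j, AEMeasurable (fun z => A z i j) (volume.restrict K') := fun j =>
        (hell.aemeasurable i j).mono_measure rle
      have hm : AEMeasurable (fun z => ∑ j, A z i j * g z j) (volume.restrict K') :=
        Finset.aemeasurable_fun_sum _ fun j _ => (hA j).mul (hgc j).1.aemeasurable
      simpa [act_apply] using hm.aestronglyMeasurable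
    · filter_upwards [ae_mono rle hFb] with z hz
      exact (PiLp.norm_apply_le _ _).trans hz
  have hpos' : ∀ᵐ z, z ∈ K' → 0 < f z := lift hpos
  have htest : ∀ z ∈ K, ∀ φ : TimePhase d → ℝ, ContDiff ℝ ∞ φ → HasCompactSupport φ →
      (∀ y, δ < dist y z → φ y = 0) → tsupport φ ⊆ K' := by
    intro z hz φ _ _ hφ
    have : tsupport φ ⊆ Metric.closedBall z δ :=
      closure_minimal (fun y hy => by
        by_contra h
        exact hy (hφ y (by simpa using h))) Metric.isClosed_closedBall
    exact this.trans (Metric.closedBall_subset_cthickening hz δ)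
  have hd0 : ∀ φ : TimePhase d → ℝ, tsupport φ ⊆ K' → ∀ z ∉ K', ∀ e, fderiv ℝ φ z e = 0 := by
    intro φ hφ z hz e
    rw [eq_zero_of_notMem_of_tsupport_subset ((tsupport_fderiv_subset ℝ).trans hφ) hz]
    rfl
  have hR := renormalized hb hab (K := K) (f := f0) (F := Fi) (g := gi) hf0L ?_ hFiL hgiL hδ ?_ ?_
    (ρ := ρ) (J := J) hρ hρc subset_union_left hρ0 hJ hJc
    (fun i => (subset_iUnion (fun i => tsupport (J i)) i).trans subset_union_right)
  rotate_left
  · filter_upwards [hpos'] with z hz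
    by_cases h : z ∈ K'
    · simpa [hf0, h] using (hz h).le
    · simp [hf0, h]
  · intro z hz φ hφ hφc hφs i
    have hsub := htest z hz φ hφ hφc hφs
    have h3 := hgw φ ⟨hφ, hφc, hsub.trans hδQ⟩ (EuclideanSpace.single i 1)
    have e1 : ∫ y, f0 y * fderiv ℝ φ y (dirV i)
        = ∫ y, f y * fderiv ℝ φ y (0, 0, EuclideanSpace.single i 1) := by
      congr 1; ext y
      by_cases hy : y ∈ K'
      · simp [hf0, hy, dirV]
      · rw [hd0 φ hsub y hy, hd0 φ hsub y hy]; simp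
    have e2 : ∫ y, gi i y * φ y = ∫ y, inner ℝ (g y) (EuclideanSpace.single i 1) * φ y := by
      congr 1; ext y
      by_cases hy : y ∈ K'
      · simp [hgi, hy, EuclideanSpace.inner_single_right]
      · simp [eq_zero_of_notMem_of_tsupport_subset hsub hy]
    rw [e1, e2, h3]
  · intro z hz φ hφ hφc hφs hφ0
    have hsub := htest z hz φ hφ hφc hφs
    have h3 := hs φ ⟨hφ, hφc, hsub.trans hδQ⟩ hφ0
    have e1 : ∫ y, f0 y * fderiv ℝ φ y (dirT y)
        = ∫ y, f y * fderiv ℝ φ y (1, y.2.2, 0) := by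
      congr 1; ext y
      by_cases hy : y ∈ K'
      · simp [hf0, hy, dirT]
      · rw [hd0 φ hsub y hy, hd0 φ hsub y hy]; simp
    have cφ : ∀ e, Continuous fun y => fderiv ℝ φ y e := fun e =>
      (hφ.continuous_fderiv (by simp)).clm_apply continuous_const
    have e2 : ∑ i, ∫ y, Fi i y * fderiv ℝ φ y (dirV i)
        = ∫ y, fderiv ℝ φ y (0, 0, act (A y) (g y)) := by
      rw [← integral_finsetSum]
      · congr 1; ext y
        by_cases hy : y ∈ K'
        · have h4 : ((0, 0, act (A y) (g y)) : TimePhase d) = ∑ i, act (A y) (g y) i • dirV i := by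
            have h : act (A y) (g y)
                = ∑ i, act (A y) (g y) i • EuclideanSpace.single i (1 : ℝ) := by
              ext j
              simp [Pi.single_apply]
            ext
            · simp [Prod.fst_sum, dirV]
            · simp [Prod.fst_sum, Prod.snd_sum, dirV]
            · simp only [Prod.snd_sum, dirV, Prod.smul_mk]
              conv_lhs => rw [h]
          rw [h4, map_sum]
          simp [hFi, hy]
        · rw [hd0 φ hsub y hy]
          simp [hd0 φ hsub y hy]
      · intro i _
        exact (hFiL i).integrable_mul ((cφ _).memLp_of_hasCompactSupport (p := 2)
          (hφc.fderiv_apply (𝕜 := ℝ) _))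
    rw [e1, e2]
    exact h3
  have cd : ∀ (w : TimePhase d → ℝ), ContDiff ℝ 1 w → ∀ e, Continuous fun z => fderiv ℝ w z e :=
    fun w hw e => (hw.continuous_fderiv one_ne_zero).clm_apply continuous_const
  have hf00 : ∀ᵐ z, 0 ≤ f0 z := by
    filter_upwards [hpos'] with z hz
    by_cases h : z ∈ K'
    · simpa [hf0, h] using (hz h).le
    · simp [hf0, h]
  have q1m : AEStronglyMeasurable (fun z => logQ₁ a b (f0 z)) volume :=
    (measurable_logQ₁.comp_aemeasurable hf0L.1.aemeasurable).aestronglyMeasurable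
  have q1b : ∀ᵐ z, ‖logQ₁ a b (f0 z)‖ ≤ a := by
    filter_upwards [hf00] with z hz
    rw [Real.norm_of_nonneg (logQ₁_nonneg hb hab hz)]
    exact logQ₁_le hb hab hz
  have i1 : ∀ i, Integrable fun z => Fi i z * fderiv ℝ ρ z (dirV i) * logQ₁ a b (f0 z) := fun i =>
    ((hFiL i).integrable_mul ((cd ρ hρ _).memLp_of_hasCompactSupport (p := 2)
      (hρc.fderiv_apply (𝕜 := ℝ) _))).mul_bdd (c := a) q1m q1b
  have i3 : ∀ i, Integrable fun z => gi i z * J i z * logQ₁ a b (f0 z) := fun i =>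
    ((hgiL i).integrable_mul ((hJ i).continuous.memLp_of_hasCompactSupport (p := 2)
      (hJc i))).mul_bdd
      (c := a) q1m q1b
  obtain ⟨Mρ, hMρ⟩ := hρ.continuous.bounded_above_of_compact_support hρc
  have i2 : ∀ i, Integrable fun z => Fi i z * gi i z * (ρ z * logQ₂ a b (f0 z)) := fun i => by
    refine ((hFiL i).integrable_mul (hgiL i)).mul_bdd (c := Mρ * a ^ 2) ?_ ?_
    · exact hρ.continuous.aestronglyMeasurable.mul
        (measurable_logQ₂.comp_aemeasurable hf0L.1.aemeasurable).aestronglyMeasurable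
    · filter_upwards [hf00] with z hz
      rw [norm_mul]
      exact mul_le_mul (hMρ z) (abs_logQ₂_le hb hab hz) (norm_nonneg _)
        ((norm_nonneg _).trans (hMρ z))
  have eL : ∫ z, logQ a b (f0 z) * (fderiv ℝ ρ z (dirT z) + ∑ i, fderiv ℝ (J i) z (dirV i))
      = ∫ z, logQ a b (f z) * (fderiv ℝ ρ z (dirT z) + ∑ i, fderiv ℝ (J i) z (dirV i)) := by
    congr 1; ext z
    by_cases hz : z ∈ K'
    · simp [hf0, hz]
    · have hρs : tsupport ρ ⊆ K' := subset_union_left.trans (Metric.self_subset_cthickening K)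
      have hJs : ∀ i, tsupport (J i) ⊆ K' := fun i =>
        ((subset_iUnion (fun i => tsupport (J i)) i).trans subset_union_right).trans
          (Metric.self_subset_cthickening K)
      rw [hd0 ρ hρs z hz, Finset.sum_eq_zero fun i _ => hd0 (J i) (hJs i) z hz (dirV i)]
      simp
  rw [← eL]
  refine hR.trans ?_
  rw [← integral_finsetSum _ fun i _ => i1 i, ← integral_finsetSum _ fun i _ => i2 i,
    ← integral_finsetSum _ fun i _ => i3 i,
    ← integral_add (integrable_finsetSum _ fun i _ => i1 i) (integrable_finsetSum _ fun i _ => i2 i)]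
  have i12 : Integrable fun z => (∑ i, Fi i z * fderiv ℝ ρ z (dirV i) * logQ₁ a b (f0 z))
      + ∑ i, Fi i z * gi i z * (ρ z * logQ₂ a b (f0 z)) :=
    (integrable_finsetSum _ fun i _ => i1 i).add (integrable_finsetSum _ fun i _ => i2 i)
  rw [← integral_sub i12 (integrable_finsetSum _ fun i _ => i3 i)]
  have eW : (Lam * ∫ z, W₁ z) / 2 + (1 / lam * ∫ z, W₂ z) / 2
      = ∫ z, (Lam * W₁ z + 1 / lam * W₂ z) / 2 := by
    rw [integral_div, integral_add (iW₁.const_mul _) (iW₂.const_mul _), integral_const_mul,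
      integral_const_mul]
    ring
  rw [eW]
  apply integral_mono_ae (i12.sub (integrable_finsetSum _ fun i _ => i3 i))
    (((iW₁.const_mul _).add (iW₂.const_mul _)).div_const _)
  filter_upwards [hf00, lift hell.lower, lift hell.upper] with z h0 hl hu
  have hW0 : 0 ≤ (Lam * W₁ z + 1 / lam * W₂ z) / 2 := by
    have := hW₁ z; have := hW₂ z; positivity
  by_cases hz : z ∈ K'
  · refine young_pointwise hlam hLam (logQ₂_le hb hab h0) (hρ0 z) (hW₁ z) (hW₂ z) ?_ ?_ (h1 z) (h2 z)
    · have := hl hz (g z)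
      rw [inner_eq_sum, EuclideanSpace.real_norm_sq_eq] at this
      simpa [hgi, hFi, hz] using this
    · have := hu hz (g z)
      rw [inner_eq_sum, EuclideanSpace.real_norm_sq_eq] at this
      simpa [hgi, hFi, hz] using this
  · simpa [hgi, hFi, hz] using hW0

end Kolmogorov

/-! ### Sections in time and the trace at the final time. -/

namespace Kolmogorov

variable {d : ℕ}

theorem abs_logQ_sub_le {a b : ℝ} (hb : 0 < b) (hab : b < a) {u w : ℝ} (hu : 0 ≤ u) (hw : 0 ≤ w) :
    |logQ a b u - logQ a b w| ≤ a * |u - w| := by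
  have h : ∀ x y : ℝ, 0 ≤ x → 0 ≤ y → logQ a b x - logQ a b y ≤ a * |x - y| := by
    intro x y hx hy
    have h1 := logQ_concave hb hab hx hy
    have h2 : logQ₁ a b y * (x - y) ≤ a * |x - y| := by
      have h3 := logQ₁_nonneg hb hab hy
      calc _ ≤ logQ₁ a b y * |x - y| := by gcongr; exact le_abs_self _
        _ ≤ _ := by gcongr; exact logQ₁_le hb hab hy
    linarith
  rw [abs_le]
  have h1 := h u w hu hw
  have h2 := h w u hw hu
  rw [abs_sub_comm] at h2
  constructor <;> linarith

/-- For almost every time, the section of a function satisfying a property almost everywhere in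
the slab satisfies it almost everywhere. -/
theorem ae_section {t₀ t₁ : ℝ} {P : TimePhase d → Prop}
    (h : ∀ᵐ z ∂(volume.restrict (slab d t₀ t₁)), P z) :
    ∀ᵐ t : ℝ, t ∈ Ioo t₀ t₁ → ∀ᵐ p : Phase d, P (t, p) := by
  rw [ae_restrict_iff' (isOpen_slab _ _).measurableSet, Measure.volume_eq_prod] at h
  filter_upwards [Measure.ae_ae_of_ae_prod h] with t ht hT
  filter_upwards [ht] with p hp
  exact hp ⟨hT, mem_univ _⟩

/-- Fubini on countably many compact boxes whose time intervals exhaust the open one; on each of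
them `L²` is contained in `L¹`. -/
theorem ae_section_integrableOn {t₀ t₁ : ℝ} {f : TimePhase d → ℝ}
    (hf : IsL2Loc (slab d t₀ t₁) f) {B : Set (Phase d)} (hB : IsCompact B) :
    ∀ᵐ t : ℝ, t ∈ Ioo t₀ t₁ → IntegrableOn (fun p => f (t, p)) B := by
  have h1 : ∀ n : ℕ, ∀ᵐ t : ℝ, t ∈ Icc (t₀ + 1 / ((n : ℝ) + 1)) (t₁ - 1 / ((n : ℝ) + 1)) →
      IntegrableOn (fun p => f (t, p)) B := by
    intro n
    set I := Icc (t₀ + 1 / ((n : ℝ) + 1)) (t₁ - 1 / ((n : ℝ) + 1)) with hI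
    have cK : IsCompact (I ×ˢ B : Set (TimePhase d)) := isCompact_Icc.prod hB
    have hsub : (I ×ˢ B : Set (TimePhase d)) ⊆ slab d t₀ t₁ := by
      rintro ⟨t, p⟩ ⟨⟨h1, h2⟩, _⟩
      have : (0 : ℝ) < 1 / ((n : ℝ) + 1) := by positivity
      exact ⟨⟨by simp only at h1 ⊢; linarith, by simp only at h2 ⊢; linarith⟩, mem_univ _⟩
    have hm := hf _ cK hsub
    have : IsFiniteMeasure (volume.restrict (I ×ˢ B : Set (TimePhase d))) :=
      ⟨by simpa using cK.measure_lt_top⟩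
    have hi : Integrable f (volume.restrict (I ×ˢ B : Set (TimePhase d))) :=
      hm.integrable (by norm_num)
    rw [Measure.volume_eq_prod, ← Measure.prod_restrict] at hi
    have := hi.prod_right_ae
    rwa [ae_restrict_iff' measurableSet_Icc] at this
  filter_upwards [ae_all_iff.2 h1] with t ht hT
  have hl : Tendsto (fun n : ℕ => 1 / ((n : ℝ) + 1)) atTop (𝓝 0) :=
    tendsto_one_div_add_atTop_nhds_zero_nat
  have e1 : ∀ᶠ n : ℕ in atTop, 1 / ((n : ℝ) + 1) < t - t₀ :=
    hl.eventually_lt_const (by linarith [hT.1])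
  have e2 : ∀ᶠ n : ℕ in atTop, 1 / ((n : ℝ) + 1) < t₁ - t :=
    hl.eventually_lt_const (by linarith [hT.2])
  obtain ⟨n, hn1, hn2⟩ := (e1.and e2).exists
  exact ht n ⟨by linarith, by linarith⟩

theorem ae_eventually_of_ae {P : ℝ → Prop} {t₀ t₁ : ℝ} (ht : t₀ < t₁)
    (h : ∀ᵐ t : ℝ, t ∈ Ioo t₀ t₁ → P t) : ∀ᶠ t in 𝓝[<] t₁ ⊓ ae volume, P t := by
  have h1 : ∀ᶠ t in 𝓝[<] t₁ ⊓ ae volume, t ∈ Ioo t₀ t₁ :=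
    (inf_le_left : 𝓝[<] t₁ ⊓ ae volume ≤ 𝓝[<] t₁) (Ioo_mem_nhdsLT ht)
  have h2 : ∀ᶠ t in 𝓝[<] t₁ ⊓ ae volume, t ∈ Ioo t₀ t₁ → P t :=
    (inf_le_right : 𝓝[<] t₁ ⊓ ae (volume : Measure ℝ) ≤ ae volume) h
  filter_upwards [h1, h2] with t h1 h2 using h2 h1

/-- Left neighbourhoods have positive measure, so discarding a null set of times leaves some.
Without this, limits along the filter would carry no information. -/
theorem neBot_left_inf_ae (t₁ : ℝ) : (𝓝[<] t₁ ⊓ ae (volume : Measure ℝ)).NeBot := by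
  rw [Filter.inf_neBot_iff]
  intro s hs t ht
  obtain ⟨l, hl, hls⟩ := (mem_nhdsLT_iff_exists_Ioo_subset).1 hs
  have h1 : volume (Ioo l t₁ ∩ t) ≠ 0 := by
    rw [inter_comm, Measure.measure_inter_eq_of_ae]
    · simpa using hl
    · exact ht
  obtain ⟨x, hx⟩ := nonempty_of_measure_ne_zero h1
  exact ⟨x, hls hx.1, hx.2⟩

/-- Positivity against nonnegative test functions survives the distributional limit. Shrinking bumps
then recover the value at almost every point. -/
theorem trace_nonneg {f : TimePhase d → ℝ} {t₀ t₁ : ℝ} (ht : t₀ < t₁)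
    (hpos : ∀ᵐ z ∂(volume.restrict (slab d t₀ t₁)), 0 < f z) (htr : HasFinalTrace f t₁) :
    ∀ᵐ p : Phase d, 0 ≤ f (t₁, p) := by
  have key : ∀ φ : Phase d → ℝ, ContDiff ℝ ∞ φ → HasCompactSupport φ → (∀ p, 0 ≤ φ p) →
      0 ≤ ∫ p, f (t₁, p) * φ p := by
    intro φ hφ hc h0
    have := neBot_left_inf_ae t₁
    refine ge_of_tendsto (htr.2 φ hφ hc) ?_
    refine ae_eventually_of_ae ht ?_
    filter_upwards [ae_section hpos] with t h1 hT
    apply integral_nonneg_of_ae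
    filter_upwards [h1 hT] with p hp
    exact mul_nonneg hp.le (h0 p)
  let φ : ℕ → ContDiffBump (0 : Phase d) := fun n =>
    ⟨1 / ((n : ℝ) + 1), 2 / ((n : ℝ) + 1), by positivity, by gcongr; norm_num⟩
  have hconv := ContDiffBump.ae_convolution_tendsto_right_of_locallyIntegrable
    (φ := φ) (l := atTop) (K := 2) (g := fun p : Phase d => f (t₁, p)) (μ := volume) (by
      have : Tendsto (fun n : ℕ => 2 * (1 / ((n : ℝ) + 1))) atTop (𝓝 (2 * 0)) :=
        tendsto_one_div_add_atTop_nhds_zero_nat.const_mul 2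
      rw [mul_zero] at this
      refine this.congr fun n => ?_
      simp only [φ]; ring) (Eventually.of_forall fun n => by simp only [φ]; apply le_of_eq; ring)
      htr.1
  filter_upwards [hconv] with p hp
  refine ge_of_tendsto hp (Eventually.of_forall fun n => ?_)
  have h2 : convolution ((φ n).normed volume) (fun p : Phase d => f (t₁, p))
      (ContinuousLinearMap.lsmul ℝ ℝ) volume p
      = ∫ q, f (t₁, q) * (φ n).normed volume (p - q) := by
    rw [convolution_lsmul_swap]
    congr 1; ext q; simp [mul_comm]
  rw [h2]
  exact key _ ((φ n).contDiff_normed.comp (by fun_prop))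
    ((φ n).hasCompactSupport_normed.comp_homeomorph (Homeomorph.subLeft p))
    fun q => (φ n).nonneg_normed _

/-- Upper semicontinuity of `∫ log f(t, ·) φ` up to the final time. -/
theorem trace_logQ_le {f : TimePhase d → ℝ} {t₀ t₁ : ℝ} (ht : t₀ < t₁)
    (hfL : IsL2Loc (slab d t₀ t₁) f)
    (hpos : ∀ᵐ z ∂(volume.restrict (slab d t₀ t₁)), 0 < f z) (htr : HasFinalTrace f t₁)
    {a b : ℝ} (hb : 0 < b) (hab : b < a) {φ : Phase d → ℝ} (hφ : ContDiff ℝ ∞ φ)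
    (hφc : HasCompactSupport φ) (hφ0 : ∀ p, 0 ≤ φ p) {η : ℝ} (hη : 0 < η) :
    ∀ᶠ t in 𝓝[<] t₁ ⊓ ae volume,
      ∫ p, logQ a b (f (t, p)) * φ p ≤ (∫ p, logQ a b (f (t₁, p)) * φ p) + η := by
  have ha : 0 < a := hb.trans hab
  have hf1 := trace_nonneg ht hpos htr
  set B := tsupport φ with hB
  have cB : IsCompact B := hφc
  have mB : MeasurableSet B := cB.measurableSet
  set F : Phase d → ℝ := fun p => f (t₁, p) with hF
  have iF : IntegrableOn F B := htr.1.integrableOn_isCompact cB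
  obtain ⟨M, hM⟩ := hφ.continuous.bounded_above_of_compact_support hφc
  have hM0 : 0 ≤ M := (norm_nonneg _).trans (hM 0)
  set V : ℝ := (volume B).toReal with hV
  -- The bound covers two errors of size `a * (M * (s + s * V))`: `a` bounds the slope of `logQ`,
  -- `M` bounds `φ`, and `s + s * V` bounds the `L¹` distance on `B` between the trace and its
  -- smooth approximation.
  obtain ⟨s, hs, hs'⟩ : ∃ s > 0, 2 * (a * (M * (s + s * V))) < η / 2 := by
    have hc : Tendsto (fun s : ℝ => 2 * (a * (M * (s + s * V)))) (𝓝 0) (𝓝 0) := by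
      have : Continuous fun s : ℝ => 2 * (a * (M * (s + s * V))) := by fun_prop
      simpa using this.tendsto 0
    have h2 : ∀ᶠ s in 𝓝[>] (0 : ℝ), 2 * (a * (M * (s + s * V))) < η / 2 :=
      (hc.mono_left nhdsWithin_le_nhds).eventually_lt_const (by positivity)
    obtain ⟨s, h1, h2⟩ := (h2.and self_mem_nhdsWithin).exists
    exact ⟨s, h2, h1⟩
  have hFL : MemLp (B.indicator F) 1 volume := by
    rw [memLp_one_iff_integrable]; exact iF.integrable_indicator mB
  obtain ⟨g, hgc, hg, hgs⟩ := hFL.exist_eLpNorm_sub_le (by norm_num) le_rfl hs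
  -- The approximation `g` may change sign. The square root is smooth and nonnegative and differs
  -- from `|g|` by at most `s`.
  set w : Phase d → ℝ := fun p => Real.sqrt (g p ^ 2 + s ^ 2) with hw
  have hw0 : ∀ p, 0 ≤ w p := fun p => Real.sqrt_nonneg _
  have cw : ContDiff ℝ ∞ w := ((hg.pow 2).add contDiff_const).sqrt fun p => by positivity
  have hgB : ∫ p in B, |F p - g p| ≤ s := by
    have i1 : Integrable (fun p => B.indicator F p - g p) :=
      (memLp_one_iff_integrable.1 hFL).sub (hg.continuous.integrable_of_hasCompactSupport hgc)
    have h1 : ∫ p, |B.indicator F p - g p| ≤ s := by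
      rw [eLpNorm_one_eq_lintegral_enorm] at hgs
      have := integral_norm_eq_lintegral_enorm i1.1
      simp only [Real.norm_eq_abs] at this
      rw [this]
      exact ENNReal.toReal_le_of_le_ofReal hs.le hgs
    calc ∫ p in B, |F p - g p| = ∫ p in B, |B.indicator F p - g p| :=
          setIntegral_congr_fun mB fun p hp => by simp [hp]
      _ ≤ ∫ p, |B.indicator F p - g p| := setIntegral_le_integral i1.abs
          (Eventually.of_forall fun p => abs_nonneg _)
      _ ≤ s := h1
  have iwB : IntegrableOn w B := cw.continuous.continuousOn.integrableOn_compact cB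
  have igB : IntegrableOn g B := hg.continuous.continuousOn.integrableOn_compact cB
  have hwB : ∫ p in B, |F p - w p| ≤ s + s * V := by
    have hle : ∫ p in B, |F p - w p| ≤ ∫ p in B, (|F p - g p| + s) := by
      have : IsFiniteMeasure (volume.restrict B) := ⟨by simpa using cB.measure_lt_top⟩
      apply integral_mono_ae (iF.sub iwB).abs ((iF.sub igB).abs.add (integrable_const s))
      filter_upwards [ae_restrict_of_ae hf1] with p hp
      change 0 ≤ F p at hp
      change |F p - w p| ≤ |F p - g p| + s
      have h1 : w p ≤ |g p| + s := by
        rw [hw]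
        refine (Real.sqrt_le_left (by positivity)).2 ?_
        nlinarith [sq_abs (g p), abs_nonneg (g p)]
      have h2 : |g p| ≤ w p := by
        apply Real.le_sqrt_of_sq_le
        rw [sq_abs]; nlinarith
      have h3 : |(|g p| - F p)| ≤ |F p - g p| := by
        have h4 := abs_abs_sub_abs_le (g p) (F p)
        have h5 : |F p| = F p := abs_of_nonneg hp
        rw [h5, abs_sub_comm (g p)] at h4
        exact h4
      rw [abs_le] at h3 ⊢
      constructor <;> linarith [h3.1, h3.2]
    have : IsFiniteMeasure (volume.restrict B) := ⟨by simpa using cB.measure_lt_top⟩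
    have iab : IntegrableOn (fun p => |F p - g p|) B := (iF.sub igB).abs
    rw [integral_add iab (integrable_const s)] at hle
    simp only [integral_const, smul_eq_mul, measureReal_restrict_apply_univ] at hle
    rw [measureReal_def, ← hV, mul_comm] at hle
    linarith
  -- The slope of the tangent at `w`, weighted by `φ`. It is smooth because `w` is, hence an
  -- admissible test function. Concavity puts `logQ (f t)` below the tangent, which is affine in `f
  -- t`, so distributional convergence suffices.
  set ψ : Phase d → ℝ := fun p => logQ₁ a b (w p) * φ p with hψ
  have cψ : ContDiff ℝ ∞ ψ := (contDiff_logQ₁ ha hb cw hw0).mul hφ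
  have sψ : HasCompactSupport ψ := hφc.mul_left
  have ψ0 : ∀ p, p ∉ B → ψ p = 0 := fun p hp => by
    simp [hψ, image_eq_zero_of_notMem_tsupport hp]
  have ψb : ∀ p, |ψ p| ≤ a * M := fun p => by
    rw [hψ, abs_mul, abs_of_nonneg (logQ₁_nonneg hb hab (hw0 p))]
    exact mul_le_mul (logQ₁_le hb hab (hw0 p)) (hM p) (abs_nonneg _) ha.le
  have intB : ∀ {u : Phase d → ℝ}, IntegrableOn u B → Integrable fun p => u p * ψ p := by
    intro u hu
    have h1 : IntegrableOn (fun p => u p * ψ p) B :=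
      hu.mul_bdd (c := a * M) cψ.continuous.aestronglyMeasurable (Eventually.of_forall ψb)
    rw [← integrableOn_iff_integrable_of_support_subset (s := B)]
    · exact h1
    · intro p hp
      by_contra h
      exact hp (by simp [ψ0 p h])
  have intQ : ∀ {u : Phase d → ℝ}, IntegrableOn u B → (∀ᵐ p, 0 ≤ u p) →
      Integrable fun p => logQ a b (u p) * φ p := by
    intro u hu hu0
    have h1 : IntegrableOn (fun p => logQ a b (u p) * φ p) B := by
      have hφB : IntegrableOn φ B := (hφ.continuous.integrable_of_hasCompactSupport hφc).integrableOn
      refine hφB.bdd_mul (c := Real.log a - Real.log b)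
        (measurable_logQ.comp_aemeasurable hu.aemeasurable).aestronglyMeasurable ?_
      filter_upwards [ae_restrict_of_ae hu0] with p hp
      rw [Real.norm_of_nonneg (logQ_nonneg hb hab hp)]
      exact logQ_le hb hab hp
    rw [← integrableOn_iff_integrable_of_support_subset (s := B)]
    · exact h1
    · intro p hp
      by_contra h
      exact hp (by simp [image_eq_zero_of_notMem_tsupport h])
  have hlim := htr.2 ψ cψ sψ
  have hev : ∀ᶠ t in 𝓝[<] t₁ ⊓ ae volume, ∫ p, f (t, p) * ψ p < (∫ p, F p * ψ p) + η / 2 :=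
    hlim.eventually_lt_const (by linarith)
  have hbd : ∀ u : Phase d → ℝ, (∀ p ∉ B, u p = 0) → (∀ᵐ p, |u p| ≤ a * (M * |F p - w p|)) →
      ∫ p, u p ≤ a * (M * (s + s * V)) := by
    intro u hu1 hu2
    have e1 : ∫ p, u p = ∫ p in B, u p := by
      rw [setIntegral_eq_integral_of_forall_compl_eq_zero hu1]
    rw [e1]
    calc ∫ p in B, u p ≤ ∫ p in B, a * (M * |F p - w p|) := by
          by_cases hi : IntegrableOn u B
          · exact integral_mono_ae hi (((iF.sub iwB).abs.const_mul M).const_mul a)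
              (ae_restrict_of_ae (hu2.mono fun p hp => (le_abs_self _).trans hp))
          · rw [integral_undef hi]
            exact integral_nonneg fun p => by positivity
      _ = a * (M * ∫ p in B, |F p - w p|) := by
          rw [integral_const_mul, integral_const_mul]
      _ ≤ _ := by gcongr
  filter_upwards [hev, ae_eventually_of_ae ht (ae_section hpos),
    ae_eventually_of_ae ht (ae_section_integrableOn hfL cB)] with t h1 h2 h3
  have h2' : ∀ᵐ p : Phase d, 0 ≤ f (t, p) := h2.mono fun p hp => hp.le
  have s1 : ∫ p, logQ a b (f (t, p)) * φ p
      ≤ ∫ p, (logQ a b (w p) * φ p + (f (t, p) * ψ p - w p * ψ p)) := by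
    refine integral_mono_ae (intQ h3 h2') ((intQ iwB (Eventually.of_forall hw0)).add
      ((intB h3).sub (intB iwB))) ?_
    filter_upwards [h2'] with p hp
    have := mul_le_mul_of_nonneg_right (logQ_concave hb hab hp (hw0 p)) (hφ0 p)
    simp only [hψ]
    linarith
  have iwφ := intQ iwB (Eventually.of_forall hw0)
  have ifw : Integrable fun p => f (t, p) * ψ p - w p * ψ p := (intB h3).sub (intB iwB)
  rw [integral_add iwφ ifw, integral_sub (intB h3) (intB iwB)] at s1
  have s2 : (∫ p, F p * ψ p) - ∫ p, w p * ψ p ≤ a * (M * (s + s * V)) := by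
    rw [← integral_sub (intB iF) (intB iwB)]
    apply hbd
    · intro p hp; simp [ψ0 p hp]
    · refine Eventually.of_forall fun p => ?_
      rw [← sub_mul, abs_mul, mul_comm]
      calc |ψ p| * |F p - w p| ≤ (a * M) * |F p - w p| := by gcongr; exact ψb p
        _ = _ := by ring
  have s3 : (∫ p, logQ a b (w p) * φ p) - ∫ p, logQ a b (F p) * φ p ≤ a * (M * (s + s * V)) := by
    rw [← integral_sub iwφ (intQ iF hf1)]
    apply hbd
    · intro p hp; simp [image_eq_zero_of_notMem_tsupport hp]
    · filter_upwards [hf1] with p hp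
      rw [← sub_mul, abs_mul]
      have := abs_logQ_sub_le hb hab (hw0 p) hp
      rw [abs_sub_comm (w p)] at this
      calc _ ≤ (a * |F p - w p|) * M := by gcongr; exact hM p
        _ = _ := by ring
  linarith

end Kolmogorov

namespace Kolmogorov

variable {d : ℕ}

/-! ### Cutoff functions -/

/-- The cutoff is the square of a rescaled bump, so that `|∇ξ|²` is bounded by a small multiple of
`ξ` itself. This keeps the Fisher information of a truncated density under control. -/
theorem exists_cutoff (d : ℕ) : ∃ M : ℝ, 0 ≤ M ∧ ∀ R : ℝ, 0 < R → ∃ ξ : Phase d → ℝ,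
    ContDiff ℝ ∞ ξ ∧ HasCompactSupport ξ ∧ (∀ p, 0 ≤ ξ p) ∧ (∀ p, ξ p ≤ 1) ∧
    (∀ p, ‖p‖ ≤ R → ξ p = 1) ∧ (∀ p, ‖fderiv ℝ ξ p‖ ≤ M / R) ∧
    ∀ p, ‖fderiv ℝ ξ p‖ ^ 2 ≤ (M / R) ^ 2 * ξ p := by
  let χ : ContDiffBump (0 : Phase d) := ⟨1, 2, by norm_num, by norm_num⟩
  have hχ : ContDiff ℝ ∞ χ := χ.contDiff
  have hχ1 : ContDiff ℝ 1 χ := χ.contDiff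
  obtain ⟨M, hM⟩ := (hχ1.continuous_fderiv one_ne_zero).bounded_above_of_compact_support
    (χ.hasCompactSupport.fderiv (𝕜 := ℝ))
  have hM0 : 0 ≤ M := (norm_nonneg _).trans (hM 0)
  refine ⟨2 * M, by positivity, fun R hR => ⟨fun p => χ (R⁻¹ • p) ^ 2, ?_, ?_, ?_, ?_, ?_, ?_⟩⟩
  · exact (hχ.comp (contDiff_const_smul _)).pow 2
  · have h : HasCompactSupport fun p : Phase d => χ (R⁻¹ • p) :=
      χ.hasCompactSupport.comp_smul (inv_ne_zero hR.ne')
    exact h.comp_left (g := fun x : ℝ => x ^ 2) (by simp)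
  · exact fun p => sq_nonneg _
  · intro p
    have h0 := χ.nonneg (x := R⁻¹ • p)
    have h1 := χ.le_one (x := R⁻¹ • p)
    nlinarith
  · intro p hp
    change χ (R⁻¹ • p) ^ 2 = 1
    rw [χ.one_of_mem_closedBall, one_pow]
    rw [mem_closedBall_zero_iff, norm_smul, norm_inv, Real.norm_of_nonneg hR.le]
    change R⁻¹ * ‖p‖ ≤ 1
    rw [inv_mul_le_iff₀ hR]; simpa using hp
  · have hd : ∀ p, ‖fderiv ℝ (fun p : Phase d => χ (R⁻¹ • p) ^ 2) p‖
        ≤ 2 * M / R * χ (R⁻¹ • p) := by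
      intro p
      have h1 : HasFDerivAt χ (fderiv ℝ χ (R⁻¹ • p)) (R⁻¹ • p) :=
        ((hχ1.differentiable one_ne_zero) _).hasFDerivAt
      have h2 : HasFDerivAt (fun p : Phase d => R⁻¹ • p)
        (R⁻¹ • ContinuousLinearMap.id ℝ (Phase d)) p :=
        (R⁻¹ • ContinuousLinearMap.id ℝ (Phase d)).hasFDerivAt
      have h3 := (h1.comp p h2).pow 2
      have h4 : fderiv ℝ (fun p : Phase d => χ (R⁻¹ • p) ^ 2) p = _ := h3.fderiv
      have h0 := χ.nonneg (x := R⁻¹ • p)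
      have h5 : ‖(fderiv ℝ χ (R⁻¹ • p)).comp (R⁻¹ • ContinuousLinearMap.id ℝ (Phase d))‖
          ≤ M * R⁻¹ := by
        refine (ContinuousLinearMap.opNorm_comp_le _ _).trans ?_
        gcongr
        · exact hM _
        · rw [norm_smul, norm_inv, Real.norm_of_nonneg hR.le]
          exact mul_le_of_le_one_right (by positivity) ContinuousLinearMap.norm_id_le
      rw [h4, norm_smul]
      simp only [Function.comp_apply, Nat.add_one_sub_one, pow_one, nsmul_eq_mul, Nat.cast_ofNat]
      rw [Real.norm_of_nonneg (by positivity)]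
      calc _ ≤ 2 * χ (R⁻¹ • p) * (M * R⁻¹) := by gcongr
        _ = _ := by field_simp
    constructor
    · intro p
      refine (hd p).trans (mul_le_of_le_one_right (by positivity) χ.le_one)
    · intro p
      rw [← mul_pow]
      exact pow_le_pow_left₀ (norm_nonneg _) (hd p) 2

/-- Minus the derivative is a probability density on `[s₀, s₁]`; integrating against it averages
over times just before the final one. -/
theorem exists_time_cutoff {s₀ s₁ : ℝ} (h : s₀ < s₁) : ∃ θ : ℝ → ℝ, ContDiff ℝ ∞ θ ∧
    (∀ t, 0 ≤ θ t) ∧ (∀ t, θ t ≤ 1) ∧ (∀ t ≤ s₀, θ t = 1) ∧ (∀ t, s₁ ≤ t → θ t = 0) ∧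
    (∀ t, deriv θ t ≤ 0) ∧ (∀ t, t ∉ Icc s₀ s₁ → deriv θ t = 0) ∧ ∫ t, deriv θ t = -1 := by
  have hs : 0 < s₁ - s₀ := sub_pos.2 h
  set θ : ℝ → ℝ := fun t => 1 - Real.smoothTransition ((t - s₀) / (s₁ - s₀)) with hθ
  have cθ : ContDiff ℝ ∞ θ := contDiff_const.sub
    (Real.smoothTransition.contDiff.comp ((contDiff_id.sub contDiff_const).div_const _))
  have hlow : ∀ t ≤ s₀, θ t = 1 := fun t ht => by
    simp only [hθ]
    rw [Real.smoothTransition.zero_of_nonpos (div_nonpos_of_nonpos_of_nonneg (by linarith) hs.le),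
      sub_zero]
  have hhigh : ∀ t, s₁ ≤ t → θ t = 0 := fun t ht => by
    simp only [hθ]
    rw [Real.smoothTransition.one_of_one_le ((one_le_div hs).2 (by linarith)), sub_self]
  have hanti : Antitone θ := fun x y hxy => by
    simp only [hθ]
    have := Real.smoothTransition.monotone (a := (x - s₀) / (s₁ - s₀))
      (b := (y - s₀) / (s₁ - s₀)) (by gcongr)
    linarith
  have hout : ∀ t, t ∉ Icc s₀ s₁ → deriv θ t = 0 := by
    intro t ht
    rw [mem_Icc, not_and_or, not_le, not_le] at ht
    rcases ht with ht | ht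
    · have : θ =ᶠ[𝓝 t] fun _ => 1 := by
        filter_upwards [gt_mem_nhds ht] with x hx using hlow x hx.le
      rw [this.deriv_eq]; simp
    · have : θ =ᶠ[𝓝 t] fun _ => 0 := by
        filter_upwards [lt_mem_nhds ht] with x hx using hhigh x hx.le
      rw [this.deriv_eq]; simp
  have cd : Continuous (deriv θ) := cθ.continuous_deriv (by simp)
  refine ⟨θ, cθ, ?_, ?_, hlow, hhigh, fun t => hanti.deriv_nonpos, hout, ?_⟩
  · exact fun t => sub_nonneg.2 (Real.smoothTransition.le_one _)
  · exact fun t => by simp only [hθ]; linarith [Real.smoothTransition.nonneg ((t - s₀) / (s₁ - s₀))]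
  · have h1 := intervalIntegral.integral_deriv_eq_sub (a := s₀) (b := s₁) (f := θ)
      (fun x _ => (cθ.differentiable (by simp)) x) (cd.intervalIntegrable _ _)
    rw [hlow s₀ le_rfl, hhigh s₁ le_rfl, intervalIntegral.integral_of_le h.le,
      ← integral_Icc_eq_integral_Ioc,
      setIntegral_eq_integral_of_forall_compl_eq_zero fun t ht => hout t ht] at h1
    rw [h1]; norm_num

theorem contDiff_gaussWeight : ContDiff ℝ ∞ (gaussWeight (d := d)) := by
  unfold gaussWeight
  exact Real.contDiff_exp.comp (contDiff_const.mul
    (((contDiff_norm_sq ℝ).comp contDiff_fst).add ((contDiff_norm_sq ℝ).comp contDiff_snd)))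

theorem gaussWeight_pos (p : Phase d) : 0 < gaussWeight p := Real.exp_pos _

theorem integrable_gauss_space {c : ℝ} (hc : 0 < c) :
    Integrable fun x : Space d => Real.exp (-c * ‖x‖ ^ 2) := by
  by_contra h
  have h1 := GaussianFourier.integral_rexp_neg_mul_sq_norm (V := Space d) hc
  rw [integral_undef h] at h1
  have : 0 < (Real.pi / c) ^ ((Module.finrank ℝ (Space d) : ℝ) / 2) := by positivity
  linarith

theorem integrable_gauss {c : ℝ} (hc : 0 < c) :
    Integrable fun p : Phase d => Real.exp (-c * (‖p.1‖ ^ 2 + ‖p.2‖ ^ 2)) := by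
  have := (integrable_gauss_space (d := d) hc).mul_prod (integrable_gauss_space (d := d) hc)
  rw [Measure.volume_eq_prod]
  refine this.congr (Eventually.of_forall fun p => ?_)
  simp only
  rw [← Real.exp_add]; congr 1; ring

theorem integrable_gaussWeight : Integrable (gaussWeight (d := d)) :=
  integrable_gauss Real.pi_pos

theorem integral_gaussWeight : ∫ p : Phase d, gaussWeight p = 1 := by
  have h1 : ∀ p : Phase d, gaussWeight p
      = Real.exp (-Real.pi * ‖p.1‖ ^ 2) * Real.exp (-Real.pi * ‖p.2‖ ^ 2) := fun p => by
    rw [gaussWeight, ← Real.exp_add]; congr 1; ring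
  simp_rw [h1]
  rw [Measure.volume_eq_prod, integral_prod_mul (fun x : Space d => Real.exp (-Real.pi * ‖x‖ ^ 2))
    fun x : Space d => Real.exp (-Real.pi * ‖x‖ ^ 2),
    GaussianFourier.integral_rexp_neg_mul_sq_norm Real.pi_pos, div_self Real.pi_pos.ne',
    Real.one_rpow, one_mul]

/-! ### Density flows -/

/-- A density `ρ` with current `j` and source `β` on the time interval `(1/4, 1)`, which starts from
zero, ends in a multiple of the Gaussian weight, decays in phase space, and has integrable cost
densities `W₁` and `W₂`. -/
structure IsDensityFlow (ρ : TimePhase d → ℝ) (j : Fin d → TimePhase d → ℝ)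
    (β W₁ W₂ : TimePhase d → ℝ) (H : Phase d → ℝ) (m : ℝ) : Prop where
  contDiff : ContDiff ℝ 1 ρ
  contDiff_current : ∀ i, ContDiff ℝ 1 (j i)
  nonneg : ∀ z, 0 ≤ ρ z
  early : ∃ ts : ℝ, 1 / 4 < ts ∧ ∀ z : TimePhase d, z.1 ≤ ts → ρ z = 0 ∧ ∀ i, j i z = 0
  final : ∀ z : TimePhase d, 15 / 16 ≤ z.1 → z.1 ≤ 1 → ρ z = m * gaussWeight z.2
  eqn : ∀ z ∈ slab d (1 / 4) 1,
    fderiv ℝ ρ z (dirT z) + ∑ i, fderiv ℝ (j i) z (dirV i) = β z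
  source_nonneg : ∀ z, 0 ≤ β z
  source_int : Integrable β
  source_early : ∀ z : TimePhase d, 15 / 16 ≤ z.1 → β z = 0
  W₁_nonneg : ∀ z, 0 ≤ W₁ z
  W₂_nonneg : ∀ z, 0 ≤ W₂ z
  W₁_int : Integrable W₁
  W₂_int : Integrable W₂
  fisher : ∀ z ∈ slab d (1 / 4) 1, ∑ i, fderiv ℝ ρ z (dirV i) ^ 2 ≤ W₁ z * ρ z
  current : ∀ z ∈ slab d (1 / 4) 1, ∑ i, j i z ^ 2 ≤ W₂ z * ρ z
  H_int : Integrable H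
  decay : ∀ z ∈ slab d (1 / 4) 1, (1 + ‖z.2.2‖) * ρ z ≤ H z.2
  decay_current : ∀ z ∈ slab d (1 / 4) 1, ∀ i, |j i z| ≤ H z.2

theorem norm_dirV_snd (i : Fin d) : ‖((0, EuclideanSpace.single i 1) : Phase d)‖ = 1 := by
  simp [Prod.norm_def]

theorem sum_add_sq_le {ι : Type*} (s : Finset ι) (x y : ι → ℝ) :
    ∑ i ∈ s, (x i + y i) ^ 2 ≤ 2 * ∑ i ∈ s, x i ^ 2 + 2 * ∑ i ∈ s, y i ^ 2 := by
  rw [Finset.mul_sum, Finset.mul_sum, ← Finset.sum_add_distrib]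
  exact Finset.sum_le_sum fun i _ => by nlinarith [sq_nonneg (x i - y i)]

theorem integrableOn_slab_snd {H : Phase d → ℝ} (hH : Integrable H) (t₀ t₁ : ℝ) :
    IntegrableOn (fun z : TimePhase d => H z.2) (slab d t₀ t₁) := by
  rw [slab, IntegrableOn, Measure.volume_eq_prod, ← Measure.prod_restrict, Measure.restrict_univ]
  have : IsFiniteMeasure (volume.restrict (Ioo t₀ t₁)) := ⟨by simp⟩
  exact hH.comp_snd _

theorem setIntegral_slab_snd {t₀ t₁ : ℝ} (h : t₀ ≤ t₁) (H : Phase d → ℝ) :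
    ∫ z in slab d t₀ t₁, H z.2 = (t₁ - t₀) * ∫ p, H p := by
  rw [slab, Measure.volume_eq_prod, ← Measure.prod_restrict, Measure.restrict_univ]
  have h1 := integral_fun_snd (μ := volume.restrict (Ioo t₀ t₁))
    (ν := (volume : Measure (Phase d))) (f := H)
  rw [h1]
  simp [h]

theorem fderiv_cutoff {ξ : Phase d → ℝ} (hξ : ContDiff ℝ ∞ ξ) {θ : ℝ → ℝ} (hθ : ContDiff ℝ ∞ θ)
    (z e : TimePhase d) : fderiv ℝ (fun z : TimePhase d => ξ z.2 * θ z.1) z e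
      = deriv θ z.1 * e.1 * ξ z.2 + θ z.1 * fderiv ℝ ξ z.2 e.2 := by
  have h1 : HasFDerivAt (fun z : TimePhase d => ξ z.2)
      ((fderiv ℝ ξ z.2).comp (ContinuousLinearMap.snd ℝ ℝ (Phase d))) z :=
    ((hξ.differentiable (by simp)) z.2).hasFDerivAt.comp z hasFDerivAt_snd
  have h2 : HasFDerivAt (fun z : TimePhase d => θ z.1)
      ((fderiv ℝ θ z.1).comp (ContinuousLinearMap.fst ℝ ℝ (Phase d))) z :=
    ((hθ.differentiable (by simp)) z.1).hasFDerivAt.comp z hasFDerivAt_fst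
  have h3 : fderiv ℝ (fun z : TimePhase d => ξ z.2 * θ z.1) z = _ := (h1.mul h2).fderiv
  rw [h3]
  simp only [add_apply, FunLike.coe_smul, Pi.smul_apply, smul_eq_mul,
    ContinuousLinearMap.comp_apply, ContinuousLinearMap.coe_fst', ContinuousLinearMap.coe_snd']
  rw [← toSpanSingleton_deriv]
  simp only [ContinuousLinearMap.toSpanSingleton_apply, smul_eq_mul]
  ring

/-- The cost inequality for a density flow localized by cutoffs. -/
theorem IsDensityFlow.localized {A : TimePhase d → Matrix (Fin d) (Fin d) ℝ} {f : TimePhase d → ℝ}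
    {lam Lam : ℝ} (hlam : 0 < lam) (hLam : 0 ≤ Lam)
    (hell : IsElliptic (slab d (1 / 4) 1) A lam Lam)
    (hsup : IsWeakSupersolution (slab d (1 / 4) 1) A f)
    (hpos : ∀ᵐ z ∂(volume.restrict (slab d (1 / 4) 1)), 0 < f z)
    {a b : ℝ} (hb : 0 < b) (hab : b < a)
    {ρ β W₁ W₂ : TimePhase d → ℝ} {j : Fin d → TimePhase d → ℝ} {H : Phase d → ℝ} {m : ℝ}
    (hF : IsDensityFlow ρ j β W₁ W₂ H m)
    {N : ℝ} {ξ : Phase d → ℝ} (hξ : ContDiff ℝ ∞ ξ) (hξc : HasCompactSupport ξ)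
    (hξ0 : ∀ p, 0 ≤ ξ p) (hξ1 : ∀ p, ξ p ≤ 1) (hξd : ∀ p, ‖fderiv ℝ ξ p‖ ^ 2 ≤ N ^ 2 * ξ p)
    {θ : ℝ → ℝ} (hθ : ContDiff ℝ ∞ θ) (hθ0 : ∀ t, 0 ≤ θ t) (hθ1 : ∀ t, θ t ≤ 1)
    {s₁ : ℝ} (hs₁ : s₁ < 1) (hθs : ∀ t, s₁ ≤ t → θ t = 0) :
    ∫ z in slab d (1 / 4) 1, logQ a b (f z) * (ξ z.2 * θ z.1 * β z + θ z.1 *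
        (ρ z * fderiv ℝ ξ z.2 (z.2.2, 0) + ∑ i, j i z * fderiv ℝ ξ z.2 (0, EuclideanSpace.single i 1))
        + deriv θ z.1 * (ρ z * ξ z.2)) ≤
      Lam * ((∫ z, W₁ z) + d * N ^ 2 * ∫ p, H p) + 1 / lam * ∫ z, W₂ z := by
  obtain ⟨ts, hts, hearly⟩ := hF.early
  set S : Set (TimePhase d) := slab d (1 / 4) 1 with hS
  have mS : MeasurableSet S := (isOpen_slab _ _).measurableSet
  set c : TimePhase d → ℝ := fun z => ξ z.2 * θ z.1 with hc
  have cc : ContDiff ℝ 1 c := ((hξ.comp contDiff_snd).mul (hθ.comp contDiff_fst)).of_le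
    (by exact_mod_cast le_top)
  have c0 : ∀ z, 0 ≤ c z := fun z => mul_nonneg (hξ0 _) (hθ0 _)
  have dc : ∀ z e, fderiv ℝ c z e = deriv θ z.1 * e.1 * ξ z.2 + θ z.1 * fderiv ℝ ξ z.2 e.2 :=
    fderiv_cutoff hξ hθ
  set KS : Set (TimePhase d) := Icc ts s₁ ×ˢ tsupport ξ with hKS
  have cKS : IsCompact KS := isCompact_Icc.prod hξc
  have KSS : KS ⊆ S := by
    rintro ⟨t, p⟩ ⟨⟨h1, h2⟩, _⟩
    exact ⟨⟨by simp only at h1 ⊢; linarith, by simp only at h2 ⊢; linarith⟩, mem_univ _⟩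
  have supp : ∀ u : TimePhase d → ℝ, (∀ z : TimePhase d, z.1 ≤ ts → u z = 0) →
      tsupport (fun z => u z * c z) ⊆ KS := by
    intro u hu
    refine closure_minimal (fun z hz => ?_) cKS.isClosed
    rw [Function.mem_support] at hz
    refine ⟨⟨?_, ?_⟩, ?_⟩
    · by_contra h
      push Not at h
      exact hz (by rw [hu z h.le, zero_mul])
    · by_contra h
      push Not at h
      exact hz (by simp [hc, hθs _ h.le])
    · by_contra h
      exact hz (by simp [hc, image_eq_zero_of_notMem_tsupport h])
  have ρs := supp ρ fun z hz => (hearly z hz).1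
  have js := fun i => supp (j i) fun z hz => (hearly z hz).2 i
  have ρc : ContDiff ℝ 1 fun z => ρ z * c z := hF.contDiff.mul cc
  have jc : ∀ i, ContDiff ℝ 1 fun z => j i z * c z := fun i => (hF.contDiff_current i).mul cc
  have iH : Integrable (S.indicator fun z => H z.2) := by
    rw [integrable_indicator_iff mS]
    exact integrableOn_slab_snd hF.H_int _ _
  have eH : ∫ z, S.indicator (fun z => H z.2) z ≤ ∫ p, H p := by
    rw [integral_indicator mS, hS, setIntegral_slab_snd (by norm_num)]
    have hH0 : 0 ≤ ∫ p, H p := integral_nonneg fun p => by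
      have h2 : ((1 / 2, p) : TimePhase d) ∈ S := ⟨⟨by norm_num, by norm_num⟩, mem_univ _⟩
      refine le_trans ?_ (hF.decay _ h2)
      have := hF.nonneg (1 / 2, p)
      positivity
    linarith
  -- From `|∇ᵥ(ρc)|² ≤ 2c²|∇ᵥρ|² + 2ρ²|∇ᵥc|²`, with `ρ ≤ H` and `|∇ξ|² ≤ N² ξ`. The factor `2` is
  -- cancelled by the halves in `cost_bound`.
  set V₁ : TimePhase d → ℝ := fun z =>
    2 * W₁ z + 2 * d * N ^ 2 * S.indicator (fun z => H z.2) z with hV₁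
  have ρH : ∀ z ∈ S, ρ z ≤ H z.2 := fun z hz => by
    refine le_trans ?_ (hF.decay z hz)
    have := hF.nonneg z
    nlinarith [norm_nonneg z.2.2]
  have hV : ∀ z, 0 ≤ V₁ z := by
    intro z
    have h1 := hF.W₁_nonneg z
    have h2 : 0 ≤ S.indicator (fun z => H z.2) z :=
      indicator_nonneg (fun z hz => (hF.nonneg z).trans (ρH z hz)) z
    positivity
  have d0 : ∀ u : TimePhase d → ℝ, tsupport u ⊆ KS → ∀ z ∉ S, ∀ e, fderiv ℝ u z e = 0 := by
    intro u hu z hz e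
    rw [eq_zero_of_notMem_of_tsupport_subset ((tsupport_fderiv_subset ℝ).trans (hu.trans KSS)) hz]
    rfl
  have dm : ∀ u : TimePhase d → ℝ, ContDiff ℝ 1 u → ∀ z e, fderiv ℝ (fun z => u z * c z) z e
      = c z * fderiv ℝ u z e + u z * fderiv ℝ c z e := by
    intro u hu z e
    rw [fderiv_fun_mul ((hu.differentiable one_ne_zero) z) ((cc.differentiable one_ne_zero) z)]
    simp only [add_apply, FunLike.coe_smul, Pi.smul_apply, smul_eq_mul]
    ring
  have hmain := cost_bound hlam hLam hell hsup hpos hb hab (ρ := fun z => ρ z * c z)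
    (J := fun i z => j i z * c z) (W₁ := V₁) (W₂ := W₂) ρc (cKS.of_isClosed_subset
      (isClosed_tsupport _) ρs) (ρs.trans KSS) (fun z => mul_nonneg (hF.nonneg z) (c0 z)) jc
    (fun i => cKS.of_isClosed_subset (isClosed_tsupport _) (js i)) (fun i => (js i).trans KSS)
    ((hF.W₁_int.const_mul 2).add (iH.const_mul _)) hF.W₂_int hV hF.W₂_nonneg ?_ ?_
  · have e1 : ∫ z, V₁ z ≤ 2 * (∫ z, W₁ z) + 2 * d * N ^ 2 * ∫ p, H p := by
      rw [hV₁, integral_add (hF.W₁_int.const_mul 2) (iH.const_mul _), integral_const_mul,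
        integral_const_mul]
      gcongr
    -- Leibniz' rule: to `c β` the cutoff adds `ρ (∂ₜ + v·∇ₓ) c + J·∇ᵥ c`.
    have e2 : ∫ z, logQ a b (f z) * (fderiv ℝ (fun z => ρ z * c z) z (dirT z)
          + ∑ i, fderiv ℝ (fun z => j i z * c z) z (dirV i))
        = ∫ z in S, logQ a b (f z) * (ξ z.2 * θ z.1 * β z + θ z.1 *
        (ρ z * fderiv ℝ ξ z.2 (z.2.2, 0) + ∑ i, j i z * fderiv ℝ ξ z.2 (0, EuclideanSpace.single i 1))
        + deriv θ z.1 * (ρ z * ξ z.2)) := by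
      rw [← setIntegral_eq_integral_of_forall_compl_eq_zero (s := S)]
      · refine setIntegral_congr_fun mS fun z hz => ?_
        refine congrArg (logQ a b (f z) * ·) ?_
        have h1 : ∀ i, fderiv ℝ (fun z => j i z * c z) z (dirV i)
            = c z * fderiv ℝ (j i) z (dirV i)
              + θ z.1 * (j i z * fderiv ℝ ξ z.2 (0, EuclideanSpace.single i 1)) := by
          intro i
          rw [dm _ (hF.contDiff_current i), dc]
          simp only [dirV]
          ring
        simp_rw [h1]
        rw [dm _ hF.contDiff, dc, Finset.sum_add_distrib, ← Finset.mul_sum, ← Finset.mul_sum,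
          ← hF.eqn z hz]
        simp only [dirT, hc]
        ring
      · intro z hz
        rw [d0 _ ρs z hz, Finset.sum_eq_zero fun i _ => d0 _ (js i) z hz (dirV i)]
        simp
    rw [e2] at hmain
    refine hmain.trans ?_
    -- Only half of this term is produced; its sign allows the bound to be stated with the whole.
    have e3 : 0 ≤ 1 / lam * ∫ z, W₂ z :=
      mul_nonneg (by positivity) (integral_nonneg hF.W₂_nonneg)
    have e4 := mul_le_mul_of_nonneg_left e1 hLam
    linarith
  · intro z
    by_cases hz : z ∈ S
    · have h1 : ∀ i, fderiv ℝ (fun z => ρ z * c z) z (dirV i) = c z * fderiv ℝ ρ z (dirV i)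
          + ρ z * θ z.1 * fderiv ℝ ξ z.2 (0, EuclideanSpace.single i 1) := by
        intro i
        rw [dm _ hF.contDiff, dc]
        simp only [dirV]
        ring
      simp_rw [h1]
      refine (sum_add_sq_le _ _ _).trans ?_
      have hc1 : c z ≤ 1 := mul_le_one₀ (hξ1 _) (hθ0 _) (hθ1 _)
      have e1 : ∑ i, (c z * fderiv ℝ ρ z (dirV i)) ^ 2 ≤ c z * (W₁ z * ρ z) := by
        simp_rw [mul_pow]
        rw [← Finset.mul_sum]
        have h2 := hF.fisher z hz
        have h3 : c z ^ 2 ≤ c z := by nlinarith [c0 z]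
        exact mul_le_mul h3 h2 (Finset.sum_nonneg fun i _ => sq_nonneg _) (c0 z)
      have e2 : ∑ i : Fin d, (ρ z * θ z.1 * fderiv ℝ ξ z.2 (0, EuclideanSpace.single i 1)) ^ 2
          ≤ d * (ρ z * ρ z * (N ^ 2 * c z)) := by
        have h2 : ∀ i : Fin d, (ρ z * θ z.1 * fderiv ℝ ξ z.2 (0, EuclideanSpace.single i 1)) ^ 2
            ≤ ρ z * ρ z * (N ^ 2 * c z) := by
          intro i
          have h3 : (fderiv ℝ ξ z.2 (0, EuclideanSpace.single i 1)) ^ 2 ≤ N ^ 2 * ξ z.2 := by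
            refine le_trans ?_ (hξd z.2)
            rw [← sq_abs]
            refine pow_le_pow_left₀ (abs_nonneg _) ?_ 2
            have := (fderiv ℝ ξ z.2).le_opNorm (0, EuclideanSpace.single i 1)
            rwa [norm_dirV_snd, mul_one] at this
          have h4 : θ z.1 ^ 2 ≤ θ z.1 := by nlinarith [hθ0 z.1, hθ1 z.1]
          calc _ = ρ z * ρ z * (θ z.1 ^ 2 * (fderiv ℝ ξ z.2 (0, EuclideanSpace.single i 1)) ^ 2) := by
                ring
            _ ≤ ρ z * ρ z * (θ z.1 * (N ^ 2 * ξ z.2)) := by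
                have := hF.nonneg z
                gcongr
                exact hθ0 _
            _ = _ := by simp only [hc]; ring
        calc _ ≤ ∑ i : Fin d, ρ z * ρ z * (N ^ 2 * c z) := Finset.sum_le_sum fun i _ => h2 i
          _ = _ := by simp
      have e3 : ρ z * ρ z * (N ^ 2 * c z) ≤ H z.2 * ρ z * (N ^ 2 * c z) := by
        have := c0 z
        have := hF.nonneg z
        have := ρH z hz
        gcongr
      have e4 : (d : ℝ) * (ρ z * ρ z * (N ^ 2 * c z)) ≤ d * (H z.2 * ρ z * (N ^ 2 * c z)) := by
        gcongr
      simp only [hV₁, indicator_of_mem hz]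
      nlinarith
    · rw [Finset.sum_eq_zero]
      · rw [eq_zero_of_notMem_of_tsupport_subset (ρs.trans KSS) hz, mul_zero]
      · intro i _
        rw [d0 _ ρs z hz]; simp
  · intro z
    by_cases hz : z ∈ S
    · have hc1 : c z ≤ 1 := mul_le_one₀ (hξ1 _) (hθ0 _) (hθ1 _)
      have h2 := hF.current z hz
      have h3 : c z ^ 2 ≤ c z := by nlinarith [c0 z]
      simp_rw [mul_pow]
      rw [← Finset.sum_mul]
      calc _ ≤ (W₂ z * ρ z) * c z := mul_le_mul h2 h3 (sq_nonneg _)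
            (mul_nonneg (hF.W₂_nonneg z) (hF.nonneg z))
        _ = _ := by ring
    · rw [eq_zero_of_notMem_of_tsupport_subset (ρs.trans KSS) hz, mul_zero]
      apply le_of_eq
      apply Finset.sum_eq_zero
      intro i _
      rw [eq_zero_of_notMem_of_tsupport_subset ((js i).trans KSS) hz]
      simp

theorem IsDensityFlow.H_nonneg {ρ β W₁ W₂ : TimePhase d → ℝ} {j : Fin d → TimePhase d → ℝ}
    {H : Phase d → ℝ} {m : ℝ} (hF : IsDensityFlow ρ j β W₁ W₂ H m) (p : Phase d) : 0 ≤ H p := by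
  have h2 : ((1 / 2, p) : TimePhase d) ∈ slab d (1 / 4) 1 :=
    ⟨⟨by norm_num, by norm_num⟩, mem_univ _⟩
  refine le_trans ?_ (hF.decay _ h2)
  have := hF.nonneg (1 / 2, p)
  positivity

end Kolmogorov

/-! ### Removing the cutoffs from the cost inequality. -/

namespace Kolmogorov

variable {d : ℕ}

/-- The time cutoff drops from one to zero shortly before time `1`, when `ρ` already equals `m`
times the Gaussian weight. Its derivative averages `∫ logQ (f t) m γ ξ`, with `γ` the Gaussian
weight, over these times, and upper semicontinuity at the trace compares the average with the value
at time `1`. The space cutoff costs terms controlled by `N` and `N²`. -/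
theorem IsDensityFlow.truncated {A : TimePhase d → Matrix (Fin d) (Fin d) ℝ} {f : TimePhase d → ℝ}
    {lam Lam : ℝ} (hlam : 0 < lam) (hLam : 0 ≤ Lam)
    (hell : IsElliptic (slab d (1 / 4) 1) A lam Lam)
    (hsup : IsWeakSupersolution (slab d (1 / 4) 1) A f)
    (hpos : ∀ᵐ z ∂(volume.restrict (slab d (1 / 4) 1)), 0 < f z) (htr : HasFinalTrace f 1)
    (hfm : Measurable f) (hf0 : ∀ z, 0 ≤ f z) {a b : ℝ} (hb : 0 < b) (hab : b < a)
    {ρ β W₁ W₂ : TimePhase d → ℝ} {j : Fin d → TimePhase d → ℝ} {H : Phase d → ℝ} {m : ℝ}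
    (hF : IsDensityFlow ρ j β W₁ W₂ H m) (hm : 0 ≤ m)
    {N : ℝ} (hN : 0 ≤ N) {ξ : Phase d → ℝ} (hξ : ContDiff ℝ ∞ ξ) (hξc : HasCompactSupport ξ)
    (hξ0 : ∀ p, 0 ≤ ξ p) (hξ1 : ∀ p, ξ p ≤ 1) (hξn : ∀ p, ‖fderiv ℝ ξ p‖ ≤ N)
    (hξd : ∀ p, ‖fderiv ℝ ξ p‖ ^ 2 ≤ N ^ 2 * ξ p) {η : ℝ} (hη : 0 < η) :
    ∫ z in slab d (1 / 4) 1, logQ a b (f z) * (ξ z.2 * β z) ≤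
      m * (∫ p, logQ a b (f (1, p)) * gaussWeight p) + η
        + (Lam * d * N ^ 2 + (Real.log a - Real.log b) * (1 + d) * N) * (∫ p, H p)
        + (Lam * (∫ z, W₁ z) + 1 / lam * ∫ z, W₂ z) := by
  set L : ℝ := Real.log a - Real.log b with hL
  have ha : 0 < a := hb.trans hab
  set S : Set (TimePhase d) := slab d (1 / 4) 1 with hS
  have mS : MeasurableSet S := (isOpen_slab _ _).measurableSet
  have G0 : ∀ z, 0 ≤ logQ a b (f z) := fun z => logQ_nonneg hb hab (hf0 z)
  have Gle : ∀ z, logQ a b (f z) ≤ L := fun z => logQ_le hb hab (hf0 z)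
  have L0 : 0 ≤ L := (G0 0).trans (Gle 0)
  have mG : Measurable fun z => logQ a b (f z) := measurable_logQ.comp hfm
  have cγ : Continuous (gaussWeight (d := d)) := contDiff_gaussWeight.continuous
  set φ : Phase d → ℝ := fun p => m * gaussWeight p * ξ p with hφ
  have cφ : ContDiff ℝ ∞ φ := (contDiff_const.mul contDiff_gaussWeight).mul hξ
  have hφc : HasCompactSupport φ := hξc.mul_left
  have φ0 : ∀ p, 0 ≤ φ p := fun p => mul_nonneg (mul_nonneg hm (gaussWeight_pos p).le) (hξ0 p)
  set Bd : ℝ := ∫ p, logQ a b (f (1, p)) * φ p with hBd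
  have iGγ : Integrable fun p => logQ a b (f (1, p)) * gaussWeight p := by
    refine integrable_gaussWeight.bdd_mul (c := L)
      (mG.comp measurable_prodMk_left).aestronglyMeasurable (Eventually.of_forall fun p => ?_)
    rw [Real.norm_of_nonneg (G0 _)]
    exact Gle _
  have hBd' : Bd ≤ m * ∫ p, logQ a b (f (1, p)) * gaussWeight p := by
    rw [hBd, ← integral_const_mul]
    refine integral_mono_of_nonneg (Eventually.of_forall fun p => mul_nonneg (G0 _) (φ0 p))
      (iGγ.const_mul m) (Eventually.of_forall fun p => ?_)
    simp only [hφ]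
    have h1 : 0 ≤ m * (logQ a b (f (1, p)) * gaussWeight p) :=
      mul_nonneg hm (mul_nonneg (G0 _) (gaussWeight_pos p).le)
    nlinarith [hξ1 p]
  obtain ⟨U, hU, V, hV, hUV⟩ := mem_inf_iff_superset.1 (trace_logQ_le (by norm_num) hsup.1 hpos htr hb hab
    cφ hφc φ0 hη)
  obtain ⟨l, hl1, hl⟩ := (mem_nhdsLT_iff_exists_Ioo_subset' (show (0 : ℝ) < 1 by norm_num)).1 hU
  -- Late enough for three things: the trace estimate holds for almost all later times, the density
  -- has its final form, and the source has ended.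
  set s₀ : ℝ := (max l (15 / 16) + 1) / 2 with hs₀
  have hl1' : l < 1 := hl1
  have hmax : max l (15 / 16) < 1 := max_lt hl1' (by norm_num)
  have hs₀l : l < s₀ := by have := le_max_left l (15 / 16); linarith
  have hs₀b : 15 / 16 < s₀ := by have := le_max_right l (15 / 16); linarith
  have hs₀1 : s₀ < 1 := by linarith
  set s₁ : ℝ := (s₀ + 1) / 2 with hs₁
  have hs₀₁ : s₀ < s₁ := by linarith
  have hs₁1 : s₁ < 1 := by linarith
  obtain ⟨θ, cθ, θ0, θ1, θlow, θhigh, θd, θout, θint⟩ := exists_time_cutoff hs₀₁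
  have cdθ : Continuous (deriv θ) := cθ.continuous_deriv (by simp)
  have hloc := hF.localized hlam hLam hell hsup hpos hb hab hξ hξc hξ0 hξ1 hξd cθ θ0 θ1 hs₁1 θhigh
  set t1 : TimePhase d → ℝ := fun z => logQ a b (f z) * (ξ z.2 * β z) with ht1
  set t2 : TimePhase d → ℝ := fun z => logQ a b (f z) * (θ z.1 * (ρ z * fderiv ℝ ξ z.2 (z.2.2, 0)
    + ∑ i, j i z * fderiv ℝ ξ z.2 (0, EuclideanSpace.single i 1))) with ht2
  set t3 : TimePhase d → ℝ := fun z => logQ a b (f z) * (deriv θ z.1 * (ρ z * ξ z.2)) with ht3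
  have cξd : Continuous (fderiv ℝ ξ) := hξ.continuous_fderiv (by simp)
  have i1 : IntegrableOn t1 S := by
    refine Integrable.integrableOn ?_
    refine (hF.source_int.bdd_mul (c := 1) (hξ.continuous.comp continuous_snd).aestronglyMeasurable
      (Eventually.of_forall fun z => ?_)).bdd_mul (c := L) mG.aestronglyMeasurable
      (Eventually.of_forall fun z => ?_)
    · simp only [Function.comp_apply]
      rw [Real.norm_of_nonneg (hξ0 _)]; exact hξ1 _
    · rw [Real.norm_of_nonneg (G0 _)]; exact Gle _
  have b2 : ∀ z ∈ S, |t2 z| ≤ L * (1 + d) * N * H z.2 := by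
    intro z hz
    have H0 := hF.H_nonneg z.2
    have h1 : |ρ z * fderiv ℝ ξ z.2 (z.2.2, 0)| ≤ N * H z.2 := by
      have h2 := (fderiv ℝ ξ z.2).le_opNorm (z.2.2, 0)
      have h3 : ‖((z.2.2, 0) : Phase d)‖ = ‖z.2.2‖ := by simp [Prod.norm_def]
      rw [h3, Real.norm_eq_abs] at h2
      have h4 := hF.decay z hz
      have h5 := hF.nonneg z
      rw [abs_mul, abs_of_nonneg h5]
      calc _ ≤ ρ z * (N * ‖z.2.2‖) := by
            refine mul_le_mul_of_nonneg_left (h2.trans ?_) h5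
            exact mul_le_mul_of_nonneg_right (hξn _) (norm_nonneg _)
        _ = N * (‖z.2.2‖ * ρ z) := by ring
        _ ≤ N * H z.2 := by
            refine mul_le_mul_of_nonneg_left ?_ hN
            linarith
    have h2 : |∑ i, j i z * fderiv ℝ ξ z.2 (0, EuclideanSpace.single i 1)| ≤ d * (N * H z.2) := by
      refine (Finset.abs_sum_le_sum_abs _ _).trans ?_
      calc _ ≤ ∑ i : Fin d, N * H z.2 := by
            refine Finset.sum_le_sum fun i _ => ?_
            have h3 := (fderiv ℝ ξ z.2).le_opNorm (0, EuclideanSpace.single i 1)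
            rw [norm_dirV_snd, mul_one, Real.norm_eq_abs] at h3
            rw [abs_mul, mul_comm]
            exact mul_le_mul (h3.trans (hξn _)) (hF.decay_current z hz i) (abs_nonneg _) hN
        _ = _ := by simp
    simp only [ht2]
    rw [abs_mul, abs_mul, abs_of_nonneg (G0 z), abs_of_nonneg (θ0 _)]
    have h3 := (abs_add_le _ _).trans (add_le_add h1 h2)
    have h4 := mul_le_mul (θ1 z.1) h3 (abs_nonneg _) zero_le_one
    calc _ ≤ L * (1 * (N * H z.2 + d * (N * H z.2))) := 
          mul_le_mul (Gle z) h4 (mul_nonneg (θ0 _) (abs_nonneg _)) L0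
      _ = _ := by ring
  have m2 : Measurable t2 := by
    refine mG.mul (Continuous.measurable ?_)
    have h1 : Continuous fun z : TimePhase d => fderiv ℝ ξ z.2 (z.2.2, 0) :=
      (cξd.comp continuous_snd).clm_apply (by fun_prop)
    have h2 : ∀ i : Fin d, Continuous fun z : TimePhase d =>
        fderiv ℝ ξ z.2 (0, EuclideanSpace.single i 1) := fun i =>
      (cξd.comp continuous_snd).clm_apply continuous_const
    exact (cθ.continuous.comp continuous_fst).mul ((hF.contDiff.continuous.mul h1).add
      (continuous_finsetSum _ fun i _ => (hF.contDiff_current i).continuous.mul (h2 i)))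
  have iH : IntegrableOn (fun z : TimePhase d => L * (1 + d) * N * H z.2) S :=
    (integrableOn_slab_snd hF.H_int _ _).const_mul _
  have i2 : IntegrableOn t2 S :=
    Integrable.mono' iH m2.aestronglyMeasurable ((ae_restrict_iff' mS).2 (Eventually.of_forall b2))
  have e2 : -(L * (1 + d) * N * ∫ p, H p) ≤ ∫ z in S, t2 z := by
    have h1 : |∫ z in S, t2 z| ≤ ∫ z in S, L * (1 + d) * N * H z.2 := 
      (abs_integral_le_integral_abs).trans (setIntegral_mono_on i2.abs iH mS b2)
    rw [integral_const_mul, hS, setIntegral_slab_snd (by norm_num)] at h1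
    have h2 : 0 ≤ L * (1 + d) * N * ∫ p, H p :=
      mul_nonneg (by positivity) (integral_nonneg hF.H_nonneg)
    have h3 := neg_le_of_abs_le h1
    nlinarith
  have e3a : ∀ z, S.indicator t3 z = logQ a b (f z) * (deriv θ z.1 * φ z.2) := by
    intro z
    by_cases hz : z.1 ∈ Icc s₀ s₁
    · have hzS : z ∈ S := ⟨⟨by linarith [hz.1], by linarith [hz.2]⟩, mem_univ _⟩
      rw [indicator_of_mem hzS]
      simp only [ht3, hφ]
      rw [hF.final z (by linarith [hz.1]) (by linarith [hz.2])]
    · simp [indicator, ht3, θout _ hz]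
  have i3' : Integrable fun z : TimePhase d => logQ a b (f z) * (deriv θ z.1 * φ z.2) := by
    refine Integrable.bdd_mul (c := L) ?_ mG.aestronglyMeasurable
      (Eventually.of_forall fun z => by rw [Real.norm_of_nonneg (G0 _)]; exact Gle _)
    refine Continuous.integrable_of_hasCompactSupport ((cdθ.comp continuous_fst).mul
      (cφ.continuous.comp continuous_snd)) ?_
    refine HasCompactSupport.intro (isCompact_Icc.prod hφc) (K := Icc s₀ s₁ ×ˢ tsupport φ) ?_
    intro z hz
    rw [mem_prod, not_and_or] at hz
    rcases hz with hz | hz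
    · simp [θout _ hz]
    · simp [image_eq_zero_of_notMem_tsupport hz]
  have i3 : IntegrableOn t3 S := by
    rw [← integrable_indicator_iff mS]
    exact i3'.congr (Eventually.of_forall fun z => (e3a z).symm)
  have e3 : -(Bd + η) ≤ ∫ z in S, t3 z := by
    rw [← integral_indicator mS]
    simp_rw [e3a]
    rw [Measure.volume_eq_prod] at i3' ⊢
    rw [integral_prod _ i3']
    have h1 : -(Bd + η) = ∫ t, deriv θ t * (Bd + η) := by rw [integral_mul_const, θint]; ring
    rw [h1]
    have idθ : Integrable (deriv θ) := cdθ.integrable_of_hasCompactSupport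
      (HasCompactSupport.intro isCompact_Icc θout)
    refine integral_mono_ae (idθ.mul_const _) i3'.integral_prod_left ?_
    filter_upwards [hV] with t ht
    have h2 : ∫ p, logQ a b (f (t, p)) * (deriv θ t * φ p)
        = deriv θ t * ∫ p, logQ a b (f (t, p)) * φ p := by
      rw [← integral_const_mul]
      congr 1; ext p; ring
    beta_reduce
    rw [h2]
    by_cases htI : t ∈ Icc s₀ s₁
    -- The derivative of the cutoff is nonpositive, so the upper bound at time `t` becomes a lower
    -- bound for this term.
    · refine mul_le_mul_of_nonpos_left ?_ (θd t)
      exact hUV ⟨hl ⟨by linarith [htI.1], by linarith [htI.2]⟩, ht⟩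
    · rw [θout t htI]; simp
  have esum : ∫ z in S, logQ a b (f z) * (ξ z.2 * θ z.1 * β z + θ z.1 *
        (ρ z * fderiv ℝ ξ z.2 (z.2.2, 0) + ∑ i, j i z * fderiv ℝ ξ z.2 (0, EuclideanSpace.single i 1))
        + deriv θ z.1 * (ρ z * ξ z.2)) = (∫ z in S, t1 z) + (∫ z in S, t2 z) + ∫ z in S, t3 z := by
    have i12 : IntegrableOn (fun z => t1 z + t2 z) S := i1.add i2
    rw [← integral_add i1 i2, ← integral_add i12 i3]
    refine integral_congr_ae (Eventually.of_forall fun z => ?_)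
    simp only [ht1, ht2, ht3]
    -- Where the cutoff differs from one the source already vanishes.
    have h1 : θ z.1 * β z = β z := by
      rcases le_or_gt z.1 s₀ with h | h
      · rw [θlow _ h, one_mul]
      · rw [hF.source_early z (by linarith), mul_zero]
    rw [mul_assoc (ξ z.2), h1]
    ring
  rw [esum] at hloc
  change ∫ z in S, t1 z ≤ _
  nlinarith

/-- The cost inequality for a density flow. -/
theorem IsDensityFlow.cost_le {A : TimePhase d → Matrix (Fin d) (Fin d) ℝ} {f : TimePhase d → ℝ}
    {lam Lam : ℝ} (hlam : 0 < lam) (hLam : 0 ≤ Lam)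
    (hell : IsElliptic (slab d (1 / 4) 1) A lam Lam)
    (hsup : IsWeakSupersolution (slab d (1 / 4) 1) A f)
    (hpos : ∀ᵐ z ∂(volume.restrict (slab d (1 / 4) 1)), 0 < f z) (htr : HasFinalTrace f 1)
    (hfm : Measurable f) (hf0 : ∀ z, 0 ≤ f z) {a b : ℝ} (hb : 0 < b) (hab : b < a)
    {ρ β W₁ W₂ : TimePhase d → ℝ} {j : Fin d → TimePhase d → ℝ} {H : Phase d → ℝ} {m : ℝ}
    (hF : IsDensityFlow ρ j β W₁ W₂ H m) (hm : 0 ≤ m) :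
    ∫ z in slab d (1 / 4) 1, logQ a b (f z) * β z ≤
      m * (∫ p, logQ a b (f (1, p)) * gaussWeight p)
        + (Lam * (∫ z, W₁ z) + 1 / lam * ∫ z, W₂ z) := by
  obtain ⟨M, hM, hcut⟩ := exists_cutoff d
  choose ξ hξ hξc hξ0 hξ1 hξone hξn hξd using fun n : ℕ => hcut (n + 1) (by positivity)
  set L : ℝ := Real.log a - Real.log b with hL
  have G0 : ∀ z, 0 ≤ logQ a b (f z) := fun z => logQ_nonneg hb hab (hf0 z)
  have Gle : ∀ z, logQ a b (f z) ≤ L := fun z => logQ_le hb hab (hf0 z)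
  have mG : Measurable fun z => logQ a b (f z) := measurable_logQ.comp hfm
  have key := fun n : ℕ => hF.truncated hlam hLam hell hsup hpos htr hfm hf0 hb hab hm
    (N := M / (n + 1)) (by positivity) (hξ n) (hξc n) (hξ0 n) (hξ1 n) (hξn n) (hξd n)
    (η := 1 / ((n : ℝ) + 1)) (by positivity)
  have l0 : Tendsto (fun n : ℕ => 1 / ((n : ℝ) + 1)) atTop (𝓝 0) :=
    tendsto_one_div_add_atTop_nhds_zero_nat
  have l1 : Tendsto (fun n : ℕ => M / ((n : ℝ) + 1)) atTop (𝓝 0) := by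
    have := l0.const_mul M
    simpa [div_eq_mul_inv] using this
  refine le_of_tendsto_of_tendsto' (b := (atTop : Filter ℕ)) (f := fun n : ℕ =>
    ∫ z in slab d (1 / 4) 1, logQ a b (f z) * (ξ n z.2 * β z)) ?_ ?_ key
  · refine tendsto_integral_of_dominated_convergence (fun z => L * β z) ?_ ?_ ?_ ?_
    · intro n
      exact (mG.aestronglyMeasurable.mul (((hξ n).continuous.comp
        continuous_snd).aestronglyMeasurable.mul hF.source_int.1)).restrict
    · exact (hF.source_int.const_mul L).integrableOn
    · intro n
      refine Eventually.of_forall fun z => ?_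
      have h1 := hF.source_nonneg z
      rw [Real.norm_of_nonneg (mul_nonneg (G0 z) (mul_nonneg (hξ0 n _) h1))]
      exact mul_le_mul (Gle z) (mul_le_of_le_one_left h1 (hξ1 n _)) (mul_nonneg (hξ0 n _) h1)
        ((G0 z).trans (Gle z))
    · refine Eventually.of_forall fun z => tendsto_nhds_of_eventually_eq ?_
      obtain ⟨n₀, hn₀⟩ := exists_nat_ge ‖z.2‖
      filter_upwards [eventually_ge_atTop n₀] with n hn
      rw [hξone n z.2, one_mul]
      have : (n₀ : ℝ) ≤ n := by exact_mod_cast hn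
      linarith
  · have h1 : Tendsto (fun n : ℕ => m * (∫ p, logQ a b (f (1, p)) * gaussWeight p)
        + 1 / ((n : ℝ) + 1) + (Lam * d * (M / ((n : ℝ) + 1)) ^ 2
          + (Real.log a - Real.log b) * (1 + d) * (M / ((n : ℝ) + 1))) * (∫ p, H p)
        + (Lam * (∫ z, W₁ z) + 1 / lam * ∫ z, W₂ z)) atTop
        (𝓝 (m * (∫ p, logQ a b (f (1, p)) * gaussWeight p) + 0 + (Lam * d * 0 ^ 2
          + (Real.log a - Real.log b) * (1 + d) * 0) * (∫ p, H p)
        + (Lam * (∫ z, W₁ z) + 1 / lam * ∫ z, W₂ z))) :=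
      ((tendsto_const_nhds.add l0).add ((((l1.pow 2).const_mul _).add
        (l1.const_mul _)).mul_const _)).add_const _
    simpa using h1

end Kolmogorov

namespace Kolmogorov

variable {d : ℕ}

/-! ### Superposition of kernels -/

section Superposition

variable {Y Z : Type*} [NormedAddCommGroup Y] [NormedSpace ℝ Y] [FiniteDimensional ℝ Y]
  [NormedAddCommGroup Z] [NormedSpace ℝ Z] [MeasurableSpace Z] [BorelSpace Z]
  [FiniteDimensional ℝ Z] {μ : Measure Z} [IsFiniteMeasureOnCompacts μ]

omit [NormedSpace ℝ Z] [FiniteDimensional ℝ Z] in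
theorem integrable_superpose {α : Z → ℝ} (hα : Continuous α) (hαc : HasCompactSupport α)
    {k : Z → ℝ} (hk : Continuous k) : Integrable (fun q => α q * k q) μ :=
  (hα.mul hk).integrable_of_hasCompactSupport hαc.mul_right

omit [FiniteDimensional ℝ Z] in
theorem hasFDerivAt_superpose {K : Y × Z → ℝ} (hK : ContDiff ℝ 1 K) {α : Z → ℝ}
    (hα : Continuous α) (hαc : HasCompactSupport α) (z₀ : Y) :
    HasFDerivAt (fun z => ∫ q, α q * K (z, q) ∂μ)
      (∫ q, α q • (fderiv ℝ K (z₀, q)).comp (ContinuousLinearMap.inl ℝ Y Z) ∂μ) z₀ := by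
  have cK : Continuous (fderiv ℝ K) := hK.continuous_fderiv one_ne_zero
  set D : Y × Z → (Y →L[ℝ] ℝ) := fun w => (fderiv ℝ K w).comp (ContinuousLinearMap.inl ℝ Y Z)
  have cD : Continuous D := cK.clm_comp continuous_const
  -- The derivative is bounded on the compact product of a unit ball and the support of `α`, so a
  -- multiple of `|α|` dominates the differentiated integrand.
  obtain ⟨M, hM⟩ := ((isCompact_closedBall z₀ 1).prod hαc).exists_bound_of_continuousOn
    cD.continuousOn
  have hM' : ∀ z ∈ Metric.ball z₀ 1, ∀ q, ‖α q • D (z, q)‖ ≤ |α q| * M := by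
    intro z hz q
    rw [norm_smul, Real.norm_eq_abs]
    by_cases hq : q ∈ tsupport α
    · exact mul_le_mul_of_nonneg_left (hM (z, q) ⟨Metric.ball_subset_closedBall hz, hq⟩)
        (abs_nonneg _)
    · simp [image_eq_zero_of_notMem_tsupport hq]
  refine hasFDerivAt_integral_of_dominated_of_fderiv_le (𝕜 := ℝ) (s := Metric.ball z₀ 1)
    (bound := fun q => |α q| * M) (F' := fun z q => α q • D (z, q)) (Metric.ball_mem_nhds z₀ one_pos)
    ?_ ?_ ?_ ?_ ?_ ?_
  · exact Eventually.of_forall fun z =>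
      (integrable_superpose hα hαc (hK.continuous.comp (by fun_prop))).1
  · exact integrable_superpose hα hαc (hK.continuous.comp (by fun_prop))
  · exact (hα.smul (cD.comp (by fun_prop))).aestronglyMeasurable
  · exact Eventually.of_forall fun q z hz => hM' z hz q
  · exact ((hα.abs).integrable_of_hasCompactSupport
      (hαc.comp_left (g := fun x : ℝ => |x|) abs_zero)).mul_const M
  · refine Eventually.of_forall fun q z _ => ?_
    have h1 : HasFDerivAt (fun z : Y => (z, q)) (ContinuousLinearMap.inl ℝ Y Z) z :=
      hasFDerivAt_prodMk_left z q
    exact (((hK.differentiable one_ne_zero) (z, q)).hasFDerivAt.comp z h1).const_mul (α q)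

theorem contDiff_superpose {K : Y × Z → ℝ} (hK : ContDiff ℝ 1 K) {α : Z → ℝ}
    (hα : Continuous α) (hαc : HasCompactSupport α) :
    ContDiff ℝ 1 fun z => ∫ q, α q * K (z, q) ∂μ := by
  rw [contDiff_one_iff_fderiv]
  refine ⟨fun z => (hasFDerivAt_superpose hK hα hαc z).differentiableAt, ?_⟩
  have h1 : fderiv ℝ (fun z => ∫ q, α q * K (z, q) ∂μ) = fun z => ∫ q in tsupport α,
      α q • (fderiv ℝ K (z, q)).comp (ContinuousLinearMap.inl ℝ Y Z) ∂μ := by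
    ext1 z
    rw [(hasFDerivAt_superpose hK hα hαc z).fderiv,
      setIntegral_eq_integral_of_forall_compl_eq_zero]
    intro q hq
    rw [image_eq_zero_of_notMem_tsupport hq, zero_smul]
  rw [h1]
  refine continuous_parametric_integral_of_continuous ?_ hαc
  exact (hα.comp continuous_snd).smul
    ((hK.continuous_fderiv one_ne_zero).clm_comp continuous_const)

theorem fderiv_superpose {K : Y × Z → ℝ} (hK : ContDiff ℝ 1 K) {α : Z → ℝ}
    (hα : Continuous α) (hαc : HasCompactSupport α) (z e : Y) :
    fderiv ℝ (fun z => ∫ q, α q * K (z, q) ∂μ) z e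
      = ∫ q, α q * fderiv ℝ (fun z => K (z, q)) z e ∂μ := by
  have cK : Continuous (fderiv ℝ K) := hK.continuous_fderiv one_ne_zero
  rw [(hasFDerivAt_superpose hK hα hαc z).fderiv, ContinuousLinearMap.integral_apply]
  · congr 1
    ext q
    have h1 : HasFDerivAt (fun z : Y => (z, q)) (ContinuousLinearMap.inl ℝ Y Z) z :=
      hasFDerivAt_prodMk_left z q
    have h2 := ((hK.differentiable one_ne_zero) (z, q)).hasFDerivAt.comp z h1
    have h3 : fderiv ℝ (fun z => K (z, q)) z = _ := h2.fderiv
    rw [h3]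
    simp
  · refine Continuous.integrable_of_hasCompactSupport (hα.smul ?_) hαc.smul_right
    exact (cK.comp (by fun_prop)).clm_comp continuous_const

omit [FiniteDimensional ℝ Y] [MeasurableSpace Z] [BorelSpace Z] [FiniteDimensional ℝ Z] in
theorem continuous_fderiv_slice {K : Y × Z → ℝ} (hK : ContDiff ℝ 1 K) (z e : Y) :
    Continuous fun q => fderiv ℝ (fun z => K (z, q)) z e := by
  have h1 : ∀ q, fderiv ℝ (fun z => K (z, q)) z e = fderiv ℝ K (z, q) (e, 0) := by
    intro q
    have h1 : HasFDerivAt (fun z : Y => (z, q)) (ContinuousLinearMap.inl ℝ Y Z) z :=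
      hasFDerivAt_prodMk_left z q
    have h2 := ((hK.differentiable one_ne_zero) (z, q)).hasFDerivAt.comp z h1
    have h3 : fderiv ℝ (fun z => K (z, q)) z = _ := h2.fderiv
    rw [h3]
    simp
  simp_rw [h1]
  exact ((hK.continuous_fderiv one_ne_zero).comp (by fun_prop)).clm_apply continuous_const

end Superposition

/-- Cauchy–Schwarz for the weight `w`, read off from the discriminant of the nonnegative quadratic
polynomial `l ↦ ∫ w (s - l)²`. -/
theorem sq_integral_mul_le {X : Type*} [MeasurableSpace X] {μ : Measure X} {w s : X → ℝ}
    (hw : ∀ x, 0 ≤ w x) (i0 : Integrable w μ) (i1 : Integrable (fun x => w x * s x) μ)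
    (i2 : Integrable (fun x => w x * s x ^ 2) μ) :
    (∫ x, w x * s x ∂μ) ^ 2 ≤ (∫ x, w x * s x ^ 2 ∂μ) * ∫ x, w x ∂μ := by
  have h := discrim_le_zero (a := ∫ x, w x ∂μ) (b := -2 * ∫ x, w x * s x ∂μ)
    (c := ∫ x, w x * s x ^ 2 ∂μ) fun l => by
    have h1 : 0 ≤ ∫ x, w x * (s x - l) ^ 2 ∂μ :=
      integral_nonneg fun x => mul_nonneg (hw x) (sq_nonneg _)
    have h2 : ∀ x, w x * (s x - l) ^ 2 = (w x * s x ^ 2 + (-2 * l) * (w x * s x)) + l ^ 2 * w x :=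
      fun x => by ring
    simp_rw [h2] at h1
    have i3 : Integrable (fun x => w x * s x ^ 2 + (-2 * l) * (w x * s x)) μ :=
      i2.add (i1.const_mul _)
    rw [integral_add i3 (i0.const_mul _), integral_add i2 (i1.const_mul _), integral_const_mul,
      integral_const_mul] at h1
    nlinarith
  rw [discrim] at h
  nlinarith

end Kolmogorov

namespace Kolmogorov

variable {d : ℕ}

/-! ### The kernel

Gaussian densities which start from a point mass, follow the Kolmogorov fundamental solution up to
time `7/8`, and have become the standard Gaussian weight at time `15/16`. -/

/-- A smooth time switch from `0` (before `7/8`) to `1` (after `15/16`). -/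
def chi (τ : ℝ) : ℝ := Real.smoothTransition (16 * τ - 14)

theorem contDiff_chi : ContDiff ℝ ∞ chi :=
  Real.smoothTransition.contDiff.comp ((contDiff_const.mul contDiff_id).sub contDiff_const)

theorem chi_nonneg (τ : ℝ) : 0 ≤ chi τ := Real.smoothTransition.nonneg _

theorem chi_le_one (τ : ℝ) : chi τ ≤ 1 := Real.smoothTransition.le_one _

theorem chi_of_le {τ : ℝ} (h : τ ≤ 7 / 8) : chi τ = 0 :=
  Real.smoothTransition.zero_of_nonpos (by linarith)

theorem chi_of_ge {τ : ℝ} (h : 15 / 16 ≤ τ) : chi τ = 1 :=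
  Real.smoothTransition.one_of_one_le (by linarith)

theorem contDiff_deriv_chi : ContDiff ℝ ∞ (deriv chi) := by
  have := contDiff_chi.iterate_deriv 1
  simpa using this

theorem contDiff_deriv_deriv_chi : ContDiff ℝ ∞ (deriv (deriv chi)) := by
  have := contDiff_chi.iterate_deriv 2
  simpa using this

theorem hasDerivAt_chi (τ : ℝ) : HasDerivAt chi (deriv chi τ) τ :=
  (contDiff_chi.differentiable (by simp) τ).hasDerivAt

theorem hasDerivAt_deriv_chi (τ : ℝ) : HasDerivAt (deriv chi) (deriv (deriv chi) τ) τ :=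
  (contDiff_deriv_chi.differentiable (by simp) τ).hasDerivAt

theorem deriv_chi_of_le {τ : ℝ} (h : τ ≤ 7 / 8) : deriv chi τ = 0 := by
  refine IsLocalMin.deriv_eq_zero (Eventually.of_forall fun s => ?_)
  rw [chi_of_le h]; exact chi_nonneg s

theorem deriv_chi_of_ge {τ : ℝ} (h : 15 / 16 ≤ τ) : deriv chi τ = 0 := by
  refine IsLocalMax.deriv_eq_zero (Eventually.of_forall fun s => ?_)
  rw [chi_of_ge h]; exact chi_le_one s

theorem deriv_deriv_chi_of_lt {τ : ℝ} (h : τ < 7 / 8) : deriv (deriv chi) τ = 0 := by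
  have : deriv chi =ᶠ[𝓝 τ] fun _ => 0 := by
    filter_upwards [gt_mem_nhds h] with s hs using deriv_chi_of_le hs.le
  rw [this.deriv_eq]; simp

/-- Inverse variance in position. -/
def cx (τ t : ℝ) : ℝ := (1 - chi τ) * (3 / 2 * (τ - t)⁻¹ ^ 3) + chi τ * (2 * Real.pi)

/-- Time derivative of `cx`. -/
def cx₁ (τ t : ℝ) : ℝ :=
  -deriv chi τ * (3 / 2 * (τ - t)⁻¹ ^ 3) - (1 - chi τ) * (9 / 2 * (τ - t)⁻¹ ^ 4)
    + deriv chi τ * (2 * Real.pi)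

/-- Second time derivative of `cx`. -/
def cx₂ (τ t : ℝ) : ℝ :=
  -deriv (deriv chi) τ * (3 / 2 * (τ - t)⁻¹ ^ 3) + 2 * deriv chi τ * (9 / 2 * (τ - t)⁻¹ ^ 4)
    + (1 - chi τ) * (18 * (τ - t)⁻¹ ^ 5) + deriv (deriv chi) τ * (2 * Real.pi)

/-- Inverse conditional variance in velocity. -/
def cv (τ t : ℝ) : ℝ := (1 - chi τ) * (2 * (τ - t)⁻¹) + chi τ * (2 * Real.pi)

/-- Time derivative of `cv`. -/
def cv₁ (τ t : ℝ) : ℝ :=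
  -deriv chi τ * (2 * (τ - t)⁻¹) - (1 - chi τ) * (2 * (τ - t)⁻¹ ^ 2) + deriv chi τ * (2 * Real.pi)

/-- The slope of the conditional mean of the velocity. -/
def slope (τ t : ℝ) : ℝ := -cx₁ τ t / (2 * cx τ t)

/-- Time derivative of `slope`. -/
def slope₁ (τ t : ℝ) : ℝ := -(cx₂ τ t * cx τ t - cx₁ τ t ^ 2) / (2 * cx τ t ^ 2)

/-- Mean position. -/
def meanX (τ : ℝ) (q : TimePhase d) : Space d := (1 - chi τ) • (q.2.1 + (τ - q.1) • q.2.2)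

/-- Mean velocity. -/
def meanV (τ : ℝ) (q : TimePhase d) : Space d :=
  (1 - chi τ) • q.2.2 - deriv chi τ • (q.2.1 + (τ - q.1) • q.2.2)

/-- Mean acceleration. -/
def meanA (τ : ℝ) (q : TimePhase d) : Space d :=
  -(deriv (deriv chi) τ • (q.2.1 + (τ - q.1) • q.2.2)) - (2 * deriv chi τ) • q.2.2

/-- Deviation of the position from its mean. -/
def devX (z q : TimePhase d) : Space d := z.2.1 - meanX z.1 q

/-- Deviation of the velocity from its conditional mean. -/
def devV (z q : TimePhase d) : Space d := z.2.2 - meanV z.1 q - slope z.1 q.1 • devX z q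

/-- The logarithm of the kernel. -/
def logKern (z q : TimePhase d) : ℝ :=
  d / 2 * Real.log (cx z.1 q.1 * cv z.1 q.1) - d * Real.log (2 * Real.pi)
    - cx z.1 q.1 / 2 * ‖devX z q‖ ^ 2 - cv z.1 q.1 / 2 * ‖devV z q‖ ^ 2

/-- The Gaussian density at `z` of the mass started at `q`. -/
def kern (z q : TimePhase d) : ℝ := Real.exp (logKern z q)

/-- The acceleration field which transports `kern`. -/
def drift (z q : TimePhase d) : Space d :=
  meanA z.1 q + (slope₁ z.1 q.1 + slope z.1 q.1 ^ 2 - cx z.1 q.1 / cv z.1 q.1) • devX z q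
    + (slope z.1 q.1 - cv₁ z.1 q.1 / (2 * cv z.1 q.1)) • devV z q

theorem kern_pos (z q : TimePhase d) : 0 < kern z q := Real.exp_pos _

theorem cx_pos {τ t : ℝ} (h : t < τ) : 0 < cx τ t := by
  have hs : 0 < (τ - t)⁻¹ := inv_pos.2 (sub_pos.2 h)
  have h0 := chi_nonneg τ
  have h1 := chi_le_one τ
  have hp := Real.pi_pos
  unfold cx
  rcases h0.eq_or_lt with h2 | h2
  · rw [← h2]; simp only [sub_zero, one_mul, zero_mul, add_zero]; positivity
  · have : 0 ≤ 1 - chi τ := by linarith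
    positivity

theorem cv_pos {τ t : ℝ} (h : t < τ) : 0 < cv τ t := by
  have hs : 0 < (τ - t)⁻¹ := inv_pos.2 (sub_pos.2 h)
  have h0 := chi_nonneg τ
  have h1 := chi_le_one τ
  have hp := Real.pi_pos
  unfold cv
  rcases h0.eq_or_lt with h2 | h2
  · rw [← h2]; simp only [sub_zero, one_mul, zero_mul, add_zero]; positivity
  · have : 0 ≤ 1 - chi τ := by linarith
    positivity

theorem hasDerivAt_inv_sub {τ t : ℝ} (h : t < τ) :
    HasDerivAt (fun s => (s - t)⁻¹) (-(τ - t)⁻¹ ^ 2) τ := by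
  have := ((hasDerivAt_id τ).sub_const t).inv (sub_pos.2 h).ne'
  refine this.congr_deriv ?_
  simp only [id]
  field_simp

theorem hasDerivAt_cx {τ t : ℝ} (h : t < τ) : HasDerivAt (fun s => cx s t) (cx₁ τ t) τ := by
  have hs := hasDerivAt_inv_sub h
  refine ((((hasDerivAt_chi τ).const_sub 1).mul ((hs.pow 3).const_mul (3 / 2))).add
    ((hasDerivAt_chi τ).mul_const (2 * Real.pi))).congr_deriv ?_
  simp only [cx₁, Pi.pow_apply]
  push_cast
  ring

theorem hasDerivAt_cx₁ {τ t : ℝ} (h : t < τ) : HasDerivAt (fun s => cx₁ s t) (cx₂ τ t) τ := by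
  have hs := hasDerivAt_inv_sub h
  refine ((((hasDerivAt_deriv_chi τ).neg.mul ((hs.pow 3).const_mul (3 / 2))).sub
    (((hasDerivAt_chi τ).const_sub 1).mul ((hs.pow 4).const_mul (9 / 2)))).add
    ((hasDerivAt_deriv_chi τ).mul_const (2 * Real.pi))).congr_deriv ?_
  simp only [cx₂, Pi.pow_apply, Pi.neg_apply]
  push_cast
  ring

theorem hasDerivAt_cv {τ t : ℝ} (h : t < τ) : HasDerivAt (fun s => cv s t) (cv₁ τ t) τ := by
  have hs := hasDerivAt_inv_sub h
  refine ((((hasDerivAt_chi τ).const_sub 1).mul (hs.const_mul 2)).add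
    ((hasDerivAt_chi τ).mul_const (2 * Real.pi))).congr_deriv ?_
  simp only [cv₁]
  ring

theorem hasDerivAt_slope {τ t : ℝ} (h : t < τ) :
    HasDerivAt (fun s => slope s t) (slope₁ τ t) τ := by
  have h0 := cx_pos h
  refine ((hasDerivAt_cx₁ h).neg.div ((hasDerivAt_cx h).const_mul 2) (by positivity)).congr_deriv ?_
  simp only [slope₁, Pi.neg_apply]
  field_simp
  ring

theorem hasDerivAt_meanX (τ : ℝ) (q : TimePhase d) :
    HasDerivAt (fun s => meanX s q) (meanV τ q) τ := by
  have h1 : HasDerivAt (fun s : ℝ => q.2.1 + (s - q.1) • q.2.2) ((1 : ℝ) • q.2.2) τ :=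
    (((hasDerivAt_id τ).sub_const q.1).smul_const q.2.2).const_add q.2.1
  refine (((hasDerivAt_chi τ).const_sub 1).smul h1).congr_deriv ?_
  simp only [meanV, one_smul, neg_smul]
  abel

theorem hasDerivAt_meanV (τ : ℝ) (q : TimePhase d) :
    HasDerivAt (fun s => meanV s q) (meanA τ q) τ := by
  have h1 : HasDerivAt (fun s : ℝ => q.2.1 + (s - q.1) • q.2.2) ((1 : ℝ) • q.2.2) τ :=
    (((hasDerivAt_id τ).sub_const q.1).smul_const q.2.2).const_add q.2.1
  refine ((((hasDerivAt_chi τ).const_sub 1).smul_const q.2.2).sub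
    ((hasDerivAt_deriv_chi τ).smul h1)).congr_deriv ?_
  simp only [meanA, one_smul]
  module

/-- The derivative of `logKern` along the free transport. -/
theorem hasDerivAt_logKern_transport {z q : TimePhase d} (h : q.1 < z.1) :
    HasDerivAt (fun s : ℝ => logKern (z + s • dirT z) q)
      (-(d * (slope z.1 q.1 - cv₁ z.1 q.1 / (2 * cv z.1 q.1)))
        + cv z.1 q.1 * inner ℝ (drift z q) (devV z q)) 0 := by
  have pa := cx_pos h
  have pb := cv_pos h
  have ht : HasDerivAt (fun s : ℝ => z.1 + s) 1 0 := (hasDerivAt_id (0 : ℝ)).const_add z.1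
  have lift : ∀ {F : Type} [NormedAddCommGroup F] [NormedSpace ℝ F] {g : ℝ → F} {g' : F},
      HasDerivAt g g' z.1 → HasDerivAt (fun s : ℝ => g (z.1 + s)) g' 0 := by
    intro F _ _ g g' hg
    have h1 : HasDerivAt g g' (z.1 + 0) := by rwa [add_zero]
    exact h1.comp_const_add z.1 0
  have ha := lift (hasDerivAt_cx h)
  have hb := lift (hasDerivAt_cv h)
  have hk := lift (hasDerivAt_slope h)
  -- The mean velocity is the derivative of the mean position, so along free transport the position
  -- deviation changes at the rate of the velocity deviation.
  have hX : HasDerivAt (fun s : ℝ => devX (z + s • dirT z) q) (devV z q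
      + slope z.1 q.1 • devX z q) 0 := by
    have h1 : HasDerivAt (fun s : ℝ => z.2.1 + s • z.2.2) ((1 : ℝ) • z.2.2) 0 :=
      ((hasDerivAt_id (0 : ℝ)).smul_const z.2.2).const_add z.2.1
    have h2 := h1.sub (lift (hasDerivAt_meanX z.1 q))
    refine (h2.congr_deriv ?_).congr_of_eventuallyEq (Eventually.of_forall fun s => ?_)
    · simp only [devV]; module
    · simp [devX, dirT]
  have hV : HasDerivAt (fun s : ℝ => devV (z + s • dirT z) q) (-meanA z.1 q
      - slope₁ z.1 q.1 • devX z q - slope z.1 q.1 • (devV z q + slope z.1 q.1 • devX z q)) 0 := by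
    have h2 := ((lift (hasDerivAt_meanV z.1 q)).const_sub z.2.2).sub (hk.smul hX)
    refine (h2.congr_deriv ?_).congr_of_eventuallyEq (Eventually.of_forall fun s => ?_)
    · simp [dirT]
      module
    · simp [devV, dirT]
  have hl := ((ha.mul hb).log (by simpa using (mul_pos pa pb).ne')).const_mul ((d : ℝ) / 2)
  have hall := ((hl.sub_const (d * Real.log (2 * Real.pi))).sub
    ((ha.div_const 2).mul hX.norm_sq)).sub ((hb.div_const 2).mul hV.norm_sq)
  refine (hall.congr_deriv ?_).congr_of_eventuallyEq (Eventually.of_forall fun s => ?_)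
  -- The terms in `‖devX‖²` cancel exactly because `slope = -cx₁ / (2 cx)`. This is the choice for
  -- which no current in the position directions is needed; the mixed term is accounted for by the
  -- coefficient of `devX` in `drift`.
  · simp only [add_zero, zero_smul, drift, slope, inner_add_left, inner_add_right, inner_sub_right, inner_neg_right, inner_smul_left, inner_smul_right,
      real_inner_self_eq_norm_sq, Pi.mul_apply, RCLike.conj_to_real]
    rw [real_inner_comm (devV z q) (devX z q), real_inner_comm (meanA z.1 q) (devV z q)]
    field_simp
    ring
  · simp [logKern, dirT]

theorem hasDerivAt_devV_velocity (z q : TimePhase d) (i : Fin d) :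
    HasDerivAt (fun s : ℝ => devV (z + s • dirV i) q) (EuclideanSpace.single i 1) 0 := by
  have h1 : HasDerivAt (fun s : ℝ => z.2.2 + s • (EuclideanSpace.single i 1 : Space d))
      ((1 : ℝ) • EuclideanSpace.single i 1) 0 :=
    ((hasDerivAt_id (0 : ℝ)).smul_const _).const_add z.2.2
  have h2 := (h1.sub_const (meanV z.1 q)).sub_const (slope z.1 q.1 • devX z q)
  rw [one_smul] at h2
  refine h2.congr_of_eventuallyEq (Eventually.of_forall fun s => ?_)
  simp [devV, devX, dirV]

theorem hasDerivAt_logKern_velocity (z q : TimePhase d) (i : Fin d) :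
    HasDerivAt (fun s : ℝ => logKern (z + s • dirV i) q) (-(cv z.1 q.1 * devV z q i)) 0 := by
  have h1 := ((hasDerivAt_devV_velocity z q i).norm_sq.const_mul (cv z.1 q.1 / 2)).const_sub
    (d / 2 * Real.log (cx z.1 q.1 * cv z.1 q.1) - d * Real.log (2 * Real.pi)
      - cx z.1 q.1 / 2 * ‖devX z q‖ ^ 2)
  refine (h1.congr_deriv ?_).congr_of_eventuallyEq (Eventually.of_forall fun s => ?_)
  · simp [EuclideanSpace.inner_single_right]
    ring
  · simp [logKern, devX, dirV]

theorem hasDerivAt_drift_velocity (z q : TimePhase d) (i : Fin d) :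
    HasDerivAt (fun s : ℝ => drift (z + s • dirV i) q i)
      (slope z.1 q.1 - cv₁ z.1 q.1 / (2 * cv z.1 q.1)) 0 := by
  have h0 : HasDerivAt (fun s : ℝ => devV (z + s • dirV i) q i) 1 0 := by
    have h1 := (EuclideanSpace.proj i : Space d →L[ℝ] ℝ).hasFDerivAt.comp_hasDerivAt
      (0 : ℝ) (hasDerivAt_devV_velocity z q i)
    refine (h1.congr_deriv ?_)
    simp
  have h1 := (h0.const_mul (slope z.1 q.1 - cv₁ z.1 q.1 / (2 * cv z.1 q.1))).const_add
    (meanA z.1 q i + (slope₁ z.1 q.1 + slope z.1 q.1 ^ 2 - cx z.1 q.1 / cv z.1 q.1) * devX z q i)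
  rw [mul_one] at h1
  refine h1.congr_of_eventuallyEq (Eventually.of_forall fun s => ?_)
  simp [drift, devX, dirV]

end Kolmogorov

namespace Kolmogorov

variable {d : ℕ}

/-! ### Smoothness of the kernel at positive age. -/

section Smoothness

variable {w : TimePhase d × TimePhase d}

theorem contDiffAt_comp_time {g : ℝ → ℝ} (hg : ContDiff ℝ ∞ g) :
    ContDiffAt ℝ ∞ (fun w : TimePhase d × TimePhase d => g w.1.1) w :=
  (hg.comp (contDiff_fst.comp contDiff_fst)).contDiffAt

theorem contDiffAt_inv_sub (h : w.2.1 < w.1.1) :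
    ContDiffAt ℝ ∞ (fun w : TimePhase d × TimePhase d => (w.1.1 - w.2.1)⁻¹) w := by
  refine ContDiffAt.inv ?_ (sub_pos.2 h).ne'
  fun_prop

theorem contDiffAt_cx (h : w.2.1 < w.1.1) :
    ContDiffAt ℝ ∞ (fun w : TimePhase d × TimePhase d => cx w.1.1 w.2.1) w := by
  have h0 := contDiffAt_comp_time (w := w) contDiff_chi
  have h3 := contDiffAt_inv_sub h
  unfold cx
  fun_prop

theorem contDiffAt_cx₁ (h : w.2.1 < w.1.1) :
    ContDiffAt ℝ ∞ (fun w : TimePhase d × TimePhase d => cx₁ w.1.1 w.2.1) w := by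
  have h0 := contDiffAt_comp_time (w := w) contDiff_chi
  have h1 := contDiffAt_comp_time (w := w) contDiff_deriv_chi
  have h3 := contDiffAt_inv_sub h
  unfold cx₁
  fun_prop

theorem contDiffAt_cx₂ (h : w.2.1 < w.1.1) :
    ContDiffAt ℝ ∞ (fun w : TimePhase d × TimePhase d => cx₂ w.1.1 w.2.1) w := by
  have h0 := contDiffAt_comp_time (w := w) contDiff_chi
  have h1 := contDiffAt_comp_time (w := w) contDiff_deriv_chi
  have h2 := contDiffAt_comp_time (w := w) contDiff_deriv_deriv_chi
  have h3 := contDiffAt_inv_sub h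
  unfold cx₂
  fun_prop

theorem contDiffAt_cv (h : w.2.1 < w.1.1) :
    ContDiffAt ℝ ∞ (fun w : TimePhase d × TimePhase d => cv w.1.1 w.2.1) w := by
  have h0 := contDiffAt_comp_time (w := w) contDiff_chi
  have h3 := contDiffAt_inv_sub h
  unfold cv
  fun_prop

theorem contDiffAt_cv₁ (h : w.2.1 < w.1.1) :
    ContDiffAt ℝ ∞ (fun w : TimePhase d × TimePhase d => cv₁ w.1.1 w.2.1) w := by
  have h0 := contDiffAt_comp_time (w := w) contDiff_chi
  have h1 := contDiffAt_comp_time (w := w) contDiff_deriv_chi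
  have h3 := contDiffAt_inv_sub h
  unfold cv₁
  fun_prop

theorem contDiffAt_slope (h : w.2.1 < w.1.1) :
    ContDiffAt ℝ ∞ (fun w : TimePhase d × TimePhase d => slope w.1.1 w.2.1) w := by
  have h0 := cx_pos h
  exact (contDiffAt_cx₁ h).neg.div (contDiffAt_const.mul (contDiffAt_cx h)) (by positivity)

theorem contDiffAt_slope₁ (h : w.2.1 < w.1.1) :
    ContDiffAt ℝ ∞ (fun w : TimePhase d × TimePhase d => slope₁ w.1.1 w.2.1) w := by
  have h0 := cx_pos h
  exact (((contDiffAt_cx₂ h).mul (contDiffAt_cx h)).sub ((contDiffAt_cx₁ h).pow 2)).neg.div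
    (contDiffAt_const.mul ((contDiffAt_cx h).pow 2)) (by positivity)

theorem contDiffAt_meanX :
    ContDiffAt ℝ ∞ (fun w : TimePhase d × TimePhase d => meanX w.1.1 w.2) w := by
  have h0 := contDiffAt_comp_time (w := w) contDiff_chi
  unfold meanX
  fun_prop

theorem contDiffAt_meanV :
    ContDiffAt ℝ ∞ (fun w : TimePhase d × TimePhase d => meanV w.1.1 w.2) w := by
  have h0 := contDiffAt_comp_time (w := w) contDiff_chi
  have h1 := contDiffAt_comp_time (w := w) contDiff_deriv_chi
  unfold meanV
  fun_prop

theorem contDiffAt_meanA :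
    ContDiffAt ℝ ∞ (fun w : TimePhase d × TimePhase d => meanA w.1.1 w.2) w := by
  have h1 := contDiffAt_comp_time (w := w) contDiff_deriv_chi
  have h2 := contDiffAt_comp_time (w := w) contDiff_deriv_deriv_chi
  unfold meanA
  fun_prop

theorem contDiffAt_devX :
    ContDiffAt ℝ ∞ (fun w : TimePhase d × TimePhase d => devX w.1 w.2) w := by
  have h0 := contDiffAt_meanX (w := w)
  unfold devX
  fun_prop

theorem contDiffAt_devV (h : w.2.1 < w.1.1) :
    ContDiffAt ℝ ∞ (fun w : TimePhase d × TimePhase d => devV w.1 w.2) w := by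
  have h0 := contDiffAt_meanV (w := w)
  have h1 := contDiffAt_slope h
  have h2 := contDiffAt_devX (w := w)
  unfold devV
  fun_prop

theorem contDiffAt_logKern (h : w.2.1 < w.1.1) :
    ContDiffAt ℝ ∞ (fun w : TimePhase d × TimePhase d => logKern w.1 w.2) w := by
  have h1 := contDiffAt_cx h
  have h2 := contDiffAt_cv h
  have h3 := (contDiffAt_devX (w := w)).norm_sq ℝ
  have h4 := (contDiffAt_devV h).norm_sq ℝ
  have h5 := (h1.mul h2).log (mul_pos (cx_pos h) (cv_pos h)).ne'
  exact (((contDiffAt_const.mul h5).sub contDiffAt_const).sub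
    ((h1.div_const 2).mul h3)).sub ((h2.div_const 2).mul h4)

theorem contDiffAt_kern (h : w.2.1 < w.1.1) :
    ContDiffAt ℝ ∞ (fun w : TimePhase d × TimePhase d => kern w.1 w.2) w :=
  (contDiffAt_logKern h).exp

theorem contDiffAt_drift (h : w.2.1 < w.1.1) :
    ContDiffAt ℝ ∞ (fun w : TimePhase d × TimePhase d => drift w.1 w.2) w := by
  have h0 := contDiffAt_meanA (w := w)
  have h1 := contDiffAt_slope h
  have h2 := contDiffAt_slope₁ h
  have h3 := (contDiffAt_cx h).div (contDiffAt_cv h) (cv_pos h).ne'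
  have p := cv_pos h
  have h4 := (contDiffAt_cv₁ h).div (contDiffAt_const.mul (contDiffAt_cv h))
    (show 2 * cv w.1.1 w.2.1 ≠ 0 by positivity)
  exact (h0.add (((h2.add (h1.pow 2)).sub h3).smul contDiffAt_devX)).add
    ((h1.sub h4).smul (contDiffAt_devV h))

/-- The switch vanishes for all ages up to `ε > 0`, hence near every point where `F` may be
singular. -/
theorem contDiff_switch_mul {ε : ℝ} (hε : 0 < ε) {g : ℝ → ℝ} (hg : ContDiff ℝ ∞ g)
    (hg0 : ∀ s ≤ ε, g s = 0) {F : TimePhase d × TimePhase d → ℝ}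
    (hF : ∀ w : TimePhase d × TimePhase d, w.2.1 < w.1.1 → ContDiffAt ℝ ∞ F w) :
    ContDiff ℝ ∞ fun w : TimePhase d × TimePhase d => g (w.1.1 - w.2.1) * F w := by
  rw [contDiff_iff_contDiffAt]
  intro w
  rcases lt_or_ge (w.1.1 - w.2.1) ε with h | h
  · refine (contDiffAt_const (c := (0 : ℝ))).congr_of_eventuallyEq ?_
    have : ∀ᶠ w' : TimePhase d × TimePhase d in 𝓝 w, w'.1.1 - w'.2.1 < ε :=
      (isOpen_Iio.preimage (f := fun w' : TimePhase d × TimePhase d => w'.1.1 - w'.2.1)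
        (by fun_prop)).mem_nhds h
    filter_upwards [this] with w' hw'
    rw [hg0 _ hw'.le, zero_mul]
  · have h1 : ContDiffAt ℝ ∞ (fun w : TimePhase d × TimePhase d => w.1.1 - w.2.1) w := by fun_prop
    exact (hg.contDiffAt.comp w h1).mul (hF w (by linarith))

end Smoothness

/-- A smooth function which vanishes before `ε` and equals one after `2 ε`. -/
def switch (ε s : ℝ) : ℝ := Real.smoothTransition (s / ε - 1)

section Switch

variable {ε : ℝ}

theorem contDiff_switch : ContDiff ℝ ∞ (switch ε) :=
  Real.smoothTransition.contDiff.comp ((contDiff_id.div_const _).sub contDiff_const)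

theorem contDiff_deriv_switch : ContDiff ℝ ∞ (deriv (switch ε)) := by
  have := (contDiff_switch (ε := ε)).iterate_deriv 1
  simpa using this

theorem switch_nonneg (s : ℝ) : 0 ≤ switch ε s := Real.smoothTransition.nonneg _

theorem switch_le_one (s : ℝ) : switch ε s ≤ 1 := Real.smoothTransition.le_one _

theorem switch_of_le (hε : 0 < ε) {s : ℝ} (h : s ≤ ε) : switch ε s = 0 :=
  Real.smoothTransition.zero_of_nonpos (by rw [sub_nonpos, div_le_one hε]; exact h)

theorem switch_of_ge (hε : 0 < ε) {s : ℝ} (h : 2 * ε ≤ s) : switch ε s = 1 :=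
  Real.smoothTransition.one_of_one_le (by
    have : 2 ≤ s / ε := by rwa [le_div_iff₀ hε]
    linarith)

theorem deriv_switch_nonneg (hε : 0 < ε) (s : ℝ) : 0 ≤ deriv (switch ε) s := by
  refine Monotone.deriv_nonneg fun x y hxy => ?_
  exact Real.smoothTransition.monotone (by gcongr)

theorem deriv_switch_of_le (hε : 0 < ε) {s : ℝ} (h : s ≤ ε) : deriv (switch ε) s = 0 := by
  refine IsLocalMin.deriv_eq_zero (Eventually.of_forall fun r => ?_)
  rw [switch_of_le hε h]; exact switch_nonneg r

theorem deriv_switch_of_ge (hε : 0 < ε) {s : ℝ} (h : 2 * ε ≤ s) : deriv (switch ε) s = 0 := by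
  refine IsLocalMax.deriv_eq_zero (Eventually.of_forall fun r => ?_)
  rw [switch_of_ge hε h]; exact switch_le_one r

theorem deriv_switch (s : ℝ) :
    deriv (switch ε) s = ε⁻¹ * deriv (switch 1) (s / ε) := by
  have h1 : HasDerivAt (switch 1) (deriv (switch 1) (s / ε)) (s / ε) :=
    (contDiff_switch.differentiable (by simp) _).hasDerivAt
  have h2 := h1.comp s ((hasDerivAt_id s).div_const ε)
  have h3 : switch 1 ∘ (fun x => id x / ε) = switch ε := by
    ext r; simp [switch]
  have h4 : HasDerivAt (switch ε) (deriv (switch 1) (s / ε) * (1 / ε)) s := by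
    rw [← h3]; exact h2
  rw [h4.deriv]; ring

theorem integral_deriv_switch : ∫ s, deriv (switch 1) s = 1 := by
  have h1 := intervalIntegral.integral_deriv_eq_sub (a := 1) (b := 2) (f := switch 1)
    (fun x _ => (contDiff_switch.differentiable (by simp)) x)
    (contDiff_deriv_switch.continuous.intervalIntegrable _ _)
  rw [switch_of_le one_pos le_rfl, switch_of_ge one_pos (by norm_num),
    intervalIntegral.integral_of_le (by norm_num), ← integral_Icc_eq_integral_Ioc,
    setIntegral_eq_integral_of_forall_compl_eq_zero] at h1
  · rw [h1]; norm_num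
  · intro s hs
    rw [mem_Icc, not_and_or, not_le, not_le] at hs
    rcases hs with hs | hs
    · exact deriv_switch_of_le one_pos hs.le
    · exact deriv_switch_of_ge one_pos (by linarith)

end Switch

/-- Reduces derivatives of the kernel to derivatives along a line, also for the transport direction,
which is frozen at the base point. -/
theorem fderiv_apply_eq_of_hasDerivAt {F : TimePhase d → ℝ} {z e : TimePhase d} {c : ℝ}
    (hF : DifferentiableAt ℝ F z) (h : HasDerivAt (fun s : ℝ => F (z + s • e)) c 0) :
    fderiv ℝ F z e = c := by
  have h1 : HasDerivAt (fun s : ℝ => z + s • e) e 0 := by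
    simpa using ((hasDerivAt_id (0 : ℝ)).smul_const e).const_add z
  have h2 : HasFDerivAt F (fderiv ℝ F z) (z + (0 : ℝ) • e) := by simpa using hF.hasFDerivAt
  exact (h2.comp_hasDerivAt (0 : ℝ) h1).unique h

/-! ### The continuity equation for the kernel. -/

section KernelDerivatives

variable {z q : TimePhase d} {ε : ℝ}

theorem contDiff_switch_kern (hε : 0 < ε) : ContDiff ℝ ∞
    fun w : TimePhase d × TimePhase d => switch ε (w.1.1 - w.2.1) * kern w.1 w.2 :=
  contDiff_switch_mul hε contDiff_switch (fun _ => switch_of_le hε) fun _ => contDiffAt_kern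

theorem contDiff_switch_current (hε : 0 < ε) (i : Fin d) : ContDiff ℝ ∞
    fun w : TimePhase d × TimePhase d =>
      switch ε (w.1.1 - w.2.1) * (kern w.1 w.2 * drift w.1 w.2 i) :=
  contDiff_switch_mul hε contDiff_switch (fun _ => switch_of_le hε) fun w h => by
    have h1 := (EuclideanSpace.proj i : Space d →L[ℝ] ℝ).contDiff.contDiffAt.comp w
      (contDiffAt_drift h)
    exact (contDiffAt_kern h).mul h1

theorem contDiff_source (hε : 0 < ε) : ContDiff ℝ ∞
    fun w : TimePhase d × TimePhase d => deriv (switch ε) (w.1.1 - w.2.1) * kern w.1 w.2 :=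
  contDiff_switch_mul hε contDiff_deriv_switch (fun _ => deriv_switch_of_le hε)
    fun _ => contDiffAt_kern

theorem differentiableAt_slice {F : TimePhase d × TimePhase d → ℝ} (hF : ContDiff ℝ ∞ F)
    (z q : TimePhase d) : DifferentiableAt ℝ (fun z => F (z, q)) z :=
  (hF.comp (contDiff_id.prodMk contDiff_const)).differentiable (by simp) z

theorem fderiv_switch_kern_velocity (hε : 0 < ε) (z q : TimePhase d) (i : Fin d) :
    fderiv ℝ (fun z : TimePhase d => switch ε (z.1 - q.1) * kern z q) z (dirV i)
      = -(switch ε (z.1 - q.1) * (kern z q * (cv z.1 q.1 * devV z q i))) := by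
  refine fderiv_apply_eq_of_hasDerivAt (differentiableAt_slice (contDiff_switch_kern hε) z q) ?_
  have h1 := ((hasDerivAt_logKern_velocity z q i).exp).const_mul (switch ε (z.1 - q.1))
  refine (h1.congr_deriv ?_).congr_of_eventuallyEq (Eventually.of_forall fun s => ?_)
  · simp [kern]
  · simp [kern, dirV]

theorem fderiv_switch_current_velocity (hε : 0 < ε) (z q : TimePhase d) (i : Fin d) :
    fderiv ℝ (fun z : TimePhase d => switch ε (z.1 - q.1) * (kern z q * drift z q i)) z (dirV i)
      = switch ε (z.1 - q.1) * (kern z q * (slope z.1 q.1 - cv₁ z.1 q.1 / (2 * cv z.1 q.1)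
        - cv z.1 q.1 * devV z q i * drift z q i)) := by
  refine fderiv_apply_eq_of_hasDerivAt
    (differentiableAt_slice (contDiff_switch_current hε i) z q) ?_
  have h1 := (((hasDerivAt_logKern_velocity z q i).exp).mul
    (hasDerivAt_drift_velocity z q i)).const_mul (switch ε (z.1 - q.1))
  refine (h1.congr_deriv ?_).congr_of_eventuallyEq (Eventually.of_forall fun s => ?_)
  · simp [kern]
    left
    ring
  · simp [kern, dirV]

theorem fderiv_switch_kern_transport (hε : 0 < ε) (z q : TimePhase d) :
    fderiv ℝ (fun z : TimePhase d => switch ε (z.1 - q.1) * kern z q) z (dirT z)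
      = deriv (switch ε) (z.1 - q.1) * kern z q + switch ε (z.1 - q.1) * (kern z q *
      (-(d * (slope z.1 q.1 - cv₁ z.1 q.1 / (2 * cv z.1 q.1)))
        + cv z.1 q.1 * inner ℝ (drift z q) (devV z q))) := by
  -- At ages below `ε` the formulas for the coefficients need not be differentiable, but the product
  -- is locally zero.
  rcases lt_or_ge (z.1 - q.1) ε with h | h
  · have h0 : (fun z : TimePhase d => switch ε (z.1 - q.1) * kern z q) =ᶠ[𝓝 z] fun _ => 0 := by
      have : ∀ᶠ z' : TimePhase d in 𝓝 z, z'.1 - q.1 < ε :=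
        (isOpen_Iio.preimage (f := fun z' : TimePhase d => z'.1 - q.1) (by fun_prop)).mem_nhds h
      filter_upwards [this] with z' hz'
      rw [switch_of_le hε hz'.le, zero_mul]
    rw [h0.fderiv_eq, switch_of_le hε h.le, deriv_switch_of_le hε h.le]
    simp
  refine fderiv_apply_eq_of_hasDerivAt (differentiableAt_slice (contDiff_switch_kern hε) z q) ?_
  have h1 : HasDerivAt (switch ε) (deriv (switch ε) (z.1 - q.1)) (z.1 + 0 - q.1) := by
    rw [add_zero]
    exact (contDiff_switch.differentiable (by simp) _).hasDerivAt
  have h2 : HasDerivAt (fun s : ℝ => z.1 + s - q.1) 1 0 :=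
    ((hasDerivAt_id (0 : ℝ)).const_add z.1).sub_const q.1
  have h3 := (h1.comp (0 : ℝ) h2).mul (hasDerivAt_logKern_transport (by linarith : q.1 < z.1)).exp
  refine (h3.congr_deriv ?_).congr_of_eventuallyEq (Eventually.of_forall fun s => ?_)
  · simp [kern]
  · simp [kern, dirT]

/-- The continuity equation for the kernel. -/
theorem kern_continuity_equation (hε : 0 < ε) (z q : TimePhase d) :
    fderiv ℝ (fun z : TimePhase d => switch ε (z.1 - q.1) * kern z q) z (dirT z)
      + ∑ i, fderiv ℝ (fun z : TimePhase d => switch ε (z.1 - q.1) * (kern z q * drift z q i)) z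
          (dirV i) = deriv (switch ε) (z.1 - q.1) * kern z q := by
  simp_rw [fderiv_switch_current_velocity hε]
  -- The divergence of the drift cancels the change of the normalizing factor, and the two inner
  -- products of drift and velocity deviation cancel. Only the derivative of the switch survives.
  rw [fderiv_switch_kern_transport hε, ← Finset.mul_sum, ← Finset.mul_sum, Finset.sum_sub_distrib,
    inner_eq_sum, Finset.mul_sum]
  have : ∑ i, cv z.1 q.1 * devV z q i * drift z q i
      = ∑ i, cv z.1 q.1 * (drift z q i * devV z q i) :=
    Finset.sum_congr rfl fun i _ => by ring
  rw [this]
  simp only [Finset.sum_const, Finset.card_univ, Fintype.card_fin, nsmul_eq_mul]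
  ring

/-- Up to time `7/8` the drift is minus the logarithmic velocity gradient. -/
theorem drift_eq (h : q.1 < z.1) (hz : z.1 < 7 / 8) : drift z q = cv z.1 q.1 • devV z q := by
  have hs : z.1 - q.1 ≠ 0 := (sub_pos.2 h).ne'
  have e0 := chi_of_le hz.le
  have e1 := deriv_chi_of_le hz.le
  have e2 := deriv_deriv_chi_of_lt hz
  -- At age `s` the coefficients are those of Kolmogorov's fundamental solution: position variance
  -- `2s³/3`, covariance `s²`, conditional velocity variance `s/2` and slope `3/(2s)`. Both
  -- identities are rational identities in `s`.
  have k1 : slope₁ z.1 q.1 + slope z.1 q.1 ^ 2 - cx z.1 q.1 / cv z.1 q.1 = 0 := by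
    simp only [slope₁, slope, cx, cv, cx₁, cx₂, e0, e1, e2]
    field_simp
    ring
  have k2 : slope z.1 q.1 - cv₁ z.1 q.1 / (2 * cv z.1 q.1) = cv z.1 q.1 := by
    simp only [slope, cx, cv, cx₁, cv₁, e0, e1]
    field_simp
    ring
  rw [drift, k1, k2, meanA, e1, e2]
  simp

/-- After time `15/16` the kernel is the Gaussian weight. -/
theorem kern_eq_gaussWeight (hz : 15 / 16 ≤ z.1) : kern z q = gaussWeight z.2 := by
  have e0 := chi_of_ge hz
  have e1 := deriv_chi_of_ge hz
  have a1 : cx z.1 q.1 = 2 * Real.pi := by simp [cx, e0]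
  have b1 : cv z.1 q.1 = 2 * Real.pi := by simp [cv, e0]
  have s1 : slope z.1 q.1 = 0 := by simp [slope, cx₁, e0, e1]
  have x1 : devX z q = z.2.1 := by simp [devX, meanX, e0]
  have v1 : devV z q = z.2.2 := by simp [devV, meanV, e0, e1, s1]
  have hp : (2 * Real.pi) ≠ 0 := by positivity
  rw [kern, gaussWeight, logKern, a1, b1, x1, v1, Real.log_mul hp hp]
  congr 1
  ring

end KernelDerivatives

end Kolmogorov

namespace Kolmogorov

variable {d : ℕ}

/-! ### Gaussian bounds for the kernel -/

/-- A centred Gaussian on phase space. -/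
def gaussE (c : ℝ) (p : Phase d) : ℝ := Real.exp (-c * (‖p.1‖ ^ 2 + ‖p.2‖ ^ 2))

theorem gaussE_pos (c : ℝ) (p : Phase d) : 0 < gaussE c p := Real.exp_pos _

theorem sqrt_gaussE (c : ℝ) (p : Phase d) : √(gaussE c p) = gaussE (c / 2) p := by
  rw [Real.sqrt_eq_iff_mul_self_eq_of_pos (gaussE_pos _ _), gaussE, gaussE, ← Real.exp_add]
  congr 1; ring

/-- Pairs of times with age at least `δ` form a compact set on which the coefficients are
continuous. Smoothness is assumed on phase points and used with phase coordinates zero. -/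
theorem exists_coefficient_bound {δ : ℝ} (hδ : 0 < δ) {g : ℝ → ℝ → ℝ}
    (hg : ∀ w : TimePhase d × TimePhase d, w.2.1 < w.1.1 →
      ContDiffAt ℝ ∞ (fun w : TimePhase d × TimePhase d => g w.1.1 w.2.1) w) :
    ∃ M : ℝ, 0 ≤ M ∧ ∀ τ ∈ Icc (1 / 4 : ℝ) 1, ∀ t ∈ Icc (1 / 4 : ℝ) (3 / 4), δ ≤ τ - t →
      |g τ t| ≤ M := by
  set S : Set (ℝ × ℝ) := (Icc (1 / 4 : ℝ) 1 ×ˢ Icc (1 / 4 : ℝ) (3 / 4)) ∩ {r | δ ≤ r.1 - r.2}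
  have hS : IsCompact S := (isCompact_Icc.prod isCompact_Icc).inter_right
    (isClosed_le continuous_const (continuous_fst.sub continuous_snd))
  have hc : ContinuousOn (fun r : ℝ × ℝ => g r.1 r.2) S := by
    intro r hr
    have h1 : Continuous fun r : ℝ × ℝ => (((r.1, 0), (r.2, 0)) : TimePhase d × TimePhase d) := by
      fun_prop
    have h2 := (hg ((r.1, 0), (r.2, 0)) (by
      have : δ ≤ r.1 - r.2 := hr.2
      simp only
      linarith)).continuousAt
    exact (ContinuousAt.comp (f := fun r : ℝ × ℝ =>
      (((r.1, 0), (r.2, 0)) : TimePhase d × TimePhase d)) h2 h1.continuousAt).continuousWithinAt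
  obtain ⟨M, hM⟩ := hS.exists_bound_of_continuousOn hc
  refine ⟨max M 0, le_max_right _ _, fun τ hτ t ht h => ?_⟩
  exact (hM (τ, t) ⟨⟨hτ, ht⟩, h⟩).trans (le_max_left _ _)

theorem sq_norm_add_le (x y : Space d) : ‖x + y‖ ^ 2 ≤ 2 * ‖x‖ ^ 2 + 2 * ‖y‖ ^ 2 := by
  have h1 := norm_add_le x y
  have h2 := pow_le_pow_left₀ (norm_nonneg _) h1 2
  nlinarith [sq_nonneg (‖x‖ - ‖y‖)]

/-- Polynomial growth is absorbed by giving up half of the Gaussian exponent. -/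
theorem one_add_le_exp {c r : ℝ} (hc : 0 < c) (hr : 0 ≤ r) :
    (1 + r) * Real.exp (-c * r) ≤ (1 + 2 / c) * Real.exp (-(c / 2) * r) := by
  have h1 : Real.exp (-(c / 2) * r) = Real.exp (-c * r) * Real.exp (c / 2 * r) := by
    rw [← Real.exp_add]; congr 1; ring
  have h2 := Real.add_one_le_exp (c / 2 * r)
  have h3 : 1 + r ≤ (1 + 2 / c) * (c / 2 * r + 1) := by
    have : (1 + 2 / c) * (c / 2 * r + 1) = 1 + r + (c / 2 * r + 2 / c) := by
      field_simp; ring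
    rw [this]
    have : 0 ≤ c / 2 * r + 2 / c := by positivity
    linarith
  rw [h1]
  have h4 : 1 + r ≤ (1 + 2 / c) * Real.exp (c / 2 * r) :=
    h3.trans (mul_le_mul_of_nonneg_left h2 (by positivity))
  have h5 := mul_le_mul_of_nonneg_right h4 (Real.exp_pos (-c * r)).le
  linarith

/-- The set of pairs over which the kernel has uniform Gaussian bounds. -/
structure Admissible (δ R : ℝ) (z q : TimePhase d) : Prop where
  time : z.1 ∈ Icc (1 / 4 : ℝ) 1
  source_time : q.1 ∈ Icc (1 / 4 : ℝ) (3 / 4)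
  gap : δ ≤ z.1 - q.1
  source : ‖q.2‖ ≤ R

theorem exists_mean_bound (d : ℕ) {δ R : ℝ} (hδ : 0 < δ) (hR : 0 ≤ R) :
    ∃ M : ℝ, 0 < M ∧ ∀ z q : TimePhase d, Admissible δ R z q →
      ‖meanX z.1 q‖ ≤ M ∧ ‖meanV z.1 q‖ ≤ M ∧ ‖meanA z.1 q‖ ≤ M ∧ |slope z.1 q.1| ≤ M ∧
      |slope₁ z.1 q.1 + slope z.1 q.1 ^ 2 - cx z.1 q.1 / cv z.1 q.1| ≤ M ∧
      |slope z.1 q.1 - cv₁ z.1 q.1 / (2 * cv z.1 q.1)| ≤ M ∧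
      (cx z.1 q.1)⁻¹ ≤ M ∧ (cv z.1 q.1)⁻¹ ≤ M ∧ cv z.1 q.1 ≤ M ∧
      Real.log (cx z.1 q.1 * cv z.1 q.1) ≤ M := by
  obtain ⟨M₁, p₁, h₁⟩ := exists_coefficient_bound (d := d) hδ (g := slope)
    fun w h => contDiffAt_slope h
  obtain ⟨M₂, p₂, h₂⟩ := exists_coefficient_bound (d := d) hδ
    (g := fun τ t => slope₁ τ t + slope τ t ^ 2 - cx τ t / cv τ t) fun w h =>
      ((contDiffAt_slope₁ h).add ((contDiffAt_slope h).pow 2)).sub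
        ((contDiffAt_cx h).div (contDiffAt_cv h) (cv_pos h).ne')
  obtain ⟨M₃, p₃, h₃⟩ := exists_coefficient_bound (d := d) hδ
    (g := fun τ t => slope τ t - cv₁ τ t / (2 * cv τ t)) fun w h => by
      have p := cv_pos h
      exact (contDiffAt_slope h).sub ((contDiffAt_cv₁ h).div
        (contDiffAt_const.mul (contDiffAt_cv h)) (by positivity))
  obtain ⟨M₄, p₄, h₄⟩ := exists_coefficient_bound (d := d) hδ (g := fun τ t => (cx τ t)⁻¹)
    fun w h => (contDiffAt_cx h).inv (cx_pos h).ne'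
  obtain ⟨M₅, p₅, h₅⟩ := exists_coefficient_bound (d := d) hδ (g := fun τ t => (cv τ t)⁻¹)
    fun w h => (contDiffAt_cv h).inv (cv_pos h).ne'
  obtain ⟨M₆, p₆, h₆⟩ := exists_coefficient_bound (d := d) hδ (g := cv)
    fun w h => contDiffAt_cv h
  obtain ⟨M₇, p₇, h₇⟩ := exists_coefficient_bound (d := d) hδ
    (g := fun τ t => Real.log (cx τ t * cv τ t)) fun w h =>
      ((contDiffAt_cx h).mul (contDiffAt_cv h)).log (mul_pos (cx_pos h) (cv_pos h)).ne'
  obtain ⟨M₈, p₈, h₈⟩ := exists_coefficient_bound (d := d) hδ (g := fun τ _ => deriv chi τ)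
    fun w _ => contDiffAt_comp_time contDiff_deriv_chi
  obtain ⟨M₉, p₉, h₉⟩ := exists_coefficient_bound (d := d) hδ
    (g := fun τ _ => deriv (deriv chi) τ)
    fun w _ => contDiffAt_comp_time contDiff_deriv_deriv_chi
  refine ⟨1 + M₁ + M₂ + M₃ + M₄ + M₅ + M₆ + M₇ + (2 * R + (R + M₈ * (2 * R))
    + (M₉ * (2 * R) + 2 * M₈ * R)), by positivity, fun z q h => ?_⟩
  have k₁ := h₁ _ h.time _ h.source_time h.gap
  have k₂ := h₂ _ h.time _ h.source_time h.gap
  have k₃ := h₃ _ h.time _ h.source_time h.gap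
  have k₄ := (le_abs_self _).trans (h₄ _ h.time _ h.source_time h.gap)
  have k₅ := (le_abs_self _).trans (h₅ _ h.time _ h.source_time h.gap)
  have k₆ := (le_abs_self _).trans (h₆ _ h.time _ h.source_time h.gap)
  have k₇ := (le_abs_self _).trans (h₇ _ h.time _ h.source_time h.gap)
  have k₈ := h₈ _ h.time _ h.source_time h.gap
  have k₉ := h₉ _ h.time _ h.source_time h.gap
  have hp1 : ‖q.2.1‖ ≤ R := (norm_fst_le q.2).trans h.source
  have hp2 : ‖q.2.2‖ ≤ R := (norm_snd_le q.2).trans h.source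
  have hσ0 : 0 ≤ z.1 - q.1 := hδ.le.trans h.gap
  have hσ1 : z.1 - q.1 ≤ 1 := by have := h.time.2; have := h.source_time.1; linarith
  have hP : ‖q.2.1 + (z.1 - q.1) • q.2.2‖ ≤ 2 * R := by
    refine (norm_add_le _ _).trans ?_
    rw [norm_smul, Real.norm_of_nonneg hσ0]
    nlinarith [norm_nonneg q.2.2]
  have c0 := chi_nonneg z.1
  have c1 := chi_le_one z.1
  have n1 : ‖(1 - chi z.1 : ℝ)‖ ≤ 1 := by rw [Real.norm_of_nonneg (by linarith)]; linarith
  have a1 : ‖meanX z.1 q‖ ≤ 2 * R := by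
    rw [meanX, norm_smul]
    calc _ ≤ 1 * (2 * R) := mul_le_mul n1 hP (norm_nonneg _) zero_le_one
      _ = _ := one_mul _
  have a2 : ‖meanV z.1 q‖ ≤ R + M₈ * (2 * R) := by
    rw [meanV]
    refine (norm_sub_le _ _).trans ?_
    rw [norm_smul, norm_smul]
    refine add_le_add ?_ (mul_le_mul k₈ hP (norm_nonneg _) p₈)
    calc _ ≤ 1 * R := mul_le_mul n1 hp2 (norm_nonneg _) zero_le_one
      _ = _ := one_mul _
  have a3 : ‖meanA z.1 q‖ ≤ M₉ * (2 * R) + 2 * M₈ * R := by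
    rw [meanA]
    refine (norm_sub_le _ _).trans ?_
    rw [norm_neg, norm_smul, norm_smul, norm_mul, Real.norm_ofNat]
    refine add_le_add (mul_le_mul k₉ hP (norm_nonneg _) p₉) ?_
    exact mul_le_mul (mul_le_mul_of_nonneg_left k₈ (by norm_num)) hp2 (norm_nonneg _) (by positivity)
  have b1 : 0 ≤ M₈ * (2 * R) := by positivity
  have b2 : 0 ≤ M₉ * (2 * R) := by positivity
  have b3 : 0 ≤ 2 * M₈ * R := by positivity
  refine ⟨?_, ?_, ?_, ?_, ?_, ?_, ?_, ?_, ?_, ?_⟩ <;> linarith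

/-- The elementary estimate behind the Gaussian bound of the kernel. -/
theorem sq_add_sq_le_of_le {M x v X V : ℝ} (hv0 : 0 ≤ v)
    (hx : x ^ 2 ≤ 2 * X ^ 2 + 2 * M ^ 2) (hv : v ≤ V + (M + M * X)) :
    x ^ 2 + v ^ 2 ≤ (3 + 3 * M ^ 2) * (X ^ 2 + V ^ 2) + 5 * M ^ 2 := by
  have k2 := pow_le_pow_left₀ hv0 hv 2
  have : 0 ≤ M ^ 2 * V ^ 2 := by positivity
  nlinarith [sq_nonneg (V - M), sq_nonneg (V - M * X), sq_nonneg (M - M * X), sq_nonneg X]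

/-- The means and the slope are bounded, so the quadratic form in the deviations dominates a
multiple of `|x|² + |v|²` up to an additive constant. -/
theorem exists_kern_bound (d : ℕ) {δ R : ℝ} (hδ : 0 < δ) (hR : 0 ≤ R) :
    ∃ B c : ℝ, 0 < c ∧ ∀ z q : TimePhase d, Admissible δ R z q →
      kern z q ≤ Real.exp B * gaussE c z.2 := by
  obtain ⟨M, hM, hb⟩ := exists_mean_bound d hδ hR
  -- Chosen so that `c₁ * (3 + 3 * M ^ 2)` is `(2 * M)⁻¹`, a lower bound for half of each inverse
  -- variance.
  obtain ⟨c₁, hc₁⟩ : ∃ c₁ : ℝ, c₁ = (2 * M)⁻¹ / (3 + 3 * M ^ 2) := ⟨_, rfl⟩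
  have c₁pos : 0 < c₁ := by rw [hc₁]; positivity
  refine ⟨d / 2 * M + d * |Real.log (2 * Real.pi)| + c₁ * (5 * M ^ 2), c₁, c₁pos, fun z q h => ?_⟩
  obtain ⟨h1, h2, -, h4, -, -, h7, h8, -, h10⟩ := hb z q h
  have hlt : q.1 < z.1 := by have := h.gap; linarith
  have pa := cx_pos hlt
  have pb := cv_pos hlt
  have eX : z.2.1 = devX z q + meanX z.1 q := by simp [devX]
  have eV : z.2.2 = devV z q + (meanV z.1 q + slope z.1 q.1 • devX z q) := by
    simp only [devV]; abel
  have q1 : ‖z.2.1‖ ^ 2 ≤ 2 * ‖devX z q‖ ^ 2 + 2 * M ^ 2 := by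
    conv_lhs => rw [eX]
    refine (sq_norm_add_le _ _).trans ?_
    gcongr
  have hsl : ‖slope z.1 q.1 • devX z q‖ ≤ M * ‖devX z q‖ := by
    rw [norm_smul]; exact mul_le_mul_of_nonneg_right h4 (norm_nonneg _)
  have k1 : ‖z.2.2‖ ≤ ‖devV z q‖ + (M + M * ‖devX z q‖) := by
    conv_lhs => rw [eV]
    exact (norm_add_le _ _).trans (add_le_add le_rfl ((norm_add_le _ _).trans (add_le_add h2 hsl)))
  have q3 := mul_le_mul_of_nonneg_left (sq_add_sq_le_of_le (norm_nonneg _) q1 k1) c₁pos.le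
  have q4 : (2 * M)⁻¹ * (‖devX z q‖ ^ 2 + ‖devV z q‖ ^ 2)
      ≤ cx z.1 q.1 / 2 * ‖devX z q‖ ^ 2 + cv z.1 q.1 / 2 * ‖devV z q‖ ^ 2 := by
    have k1 : M⁻¹ ≤ cx z.1 q.1 := inv_le_of_inv_le₀ pa h7
    have k2 : M⁻¹ ≤ cv z.1 q.1 := inv_le_of_inv_le₀ pb h8
    have k3 : (2 * M)⁻¹ = M⁻¹ / 2 := by rw [mul_inv]; ring
    rw [k3, mul_add]
    gcongr
  have k2 : c₁ * (3 + 3 * M ^ 2) = (2 * M)⁻¹ := by rw [hc₁]; field_simp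
  have k3 : (d : ℝ) / 2 * Real.log (cx z.1 q.1 * cv z.1 q.1) ≤ d / 2 * M := by gcongr
  have k4 : -(d * Real.log (2 * Real.pi)) ≤ d * |Real.log (2 * Real.pi)| := by
    rw [← mul_neg]
    exact mul_le_mul_of_nonneg_left (neg_le_abs _) (Nat.cast_nonneg d)
  rw [mul_add c₁ ((3 + 3 * M ^ 2) * _), ← mul_assoc c₁, k2] at q3
  rw [kern, gaussE, ← Real.exp_add, Real.exp_le_exp, logKern]
  linarith

/-- Both fields are affine in `z` with coefficients that are bounded at ages at least `δ`. -/
theorem exists_drift_bound (d : ℕ) {δ R : ℝ} (hδ : 0 < δ) (hR : 0 ≤ R) :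
    ∃ D : ℝ, 1 ≤ D ∧ ∀ z q : TimePhase d, Admissible δ R z q →
      ‖drift z q‖ ≤ D * (1 + ‖z.2.1‖ + ‖z.2.2‖) ∧
      ‖cv z.1 q.1 • devV z q‖ ≤ D * (1 + ‖z.2.1‖ + ‖z.2.2‖) := by
  obtain ⟨M, hM, hb⟩ := exists_mean_bound d hδ hR
  have MM : 0 < M * M := by positivity
  refine ⟨1 + (M + M * (1 + M) + M * (1 + 2 * M + M * M)), ?_, fun z q h => ?_⟩
  · have : 0 ≤ M + M * (1 + M) + M * (1 + 2 * M + M * M) := by positivity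
    linarith
  obtain ⟨h1, h2, h3, h4, h5, h6, -, -, h9, -⟩ := hb z q h
  have hlt : q.1 < z.1 := by have := h.gap; linarith
  have pb := cv_pos hlt
  have x0 := norm_nonneg z.2.1
  have v0 := norm_nonneg z.2.2
  have nX : ‖devX z q‖ ≤ ‖z.2.1‖ + M := (norm_sub_le _ _).trans (add_le_add le_rfl h1)
  have hsl : ‖slope z.1 q.1 • devX z q‖ ≤ M * ‖devX z q‖ := by
    rw [norm_smul]; exact mul_le_mul_of_nonneg_right h4 (norm_nonneg _)
  have nV : ‖devV z q‖ ≤ ‖z.2.2‖ + M + M * (‖z.2.1‖ + M) := by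
    rw [devV]
    exact (norm_sub_le _ _).trans (add_le_add ((norm_sub_le _ _).trans (add_le_add le_rfl h2))
      (hsl.trans (mul_le_mul_of_nonneg_left nX hM.le)))
  obtain ⟨g, hg⟩ : ∃ g : ℝ, g = 1 + ‖z.2.1‖ + ‖z.2.2‖ := ⟨_, rfl⟩
  rw [← hg]
  have g0 : 1 ≤ g := by linarith
  have g1 : ‖devX z q‖ ≤ (1 + M) * g := by
    refine nX.trans ?_
    have := mul_le_mul_of_nonneg_left g0 hM.le
    linarith
  have g2 : ‖devV z q‖ ≤ (1 + 2 * M + M * M) * g := by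
    refine nV.trans ?_
    have k1 := mul_le_mul_of_nonneg_left g0 hM.le
    have k2 := mul_le_mul_of_nonneg_left g0 MM.le
    have k3 : M * ‖z.2.1‖ ≤ M * g := mul_le_mul_of_nonneg_left (by linarith) hM.le
    linarith
  have k2 := mul_le_mul h5 g1 (norm_nonneg _) hM.le
  have k3 := mul_le_mul h6 g2 (norm_nonneg _) hM.le
  have k4 : M ≤ M * g := le_mul_of_one_le_right hM.le g0
  constructor
  · have k1 := norm_add₃_le (a := meanA z.1 q)
      (b := (slope₁ z.1 q.1 + slope z.1 q.1 ^ 2 - cx z.1 q.1 / cv z.1 q.1) • devX z q)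
      (c := (slope z.1 q.1 - cv₁ z.1 q.1 / (2 * cv z.1 q.1)) • devV z q)
    rw [norm_smul, norm_smul, Real.norm_eq_abs, Real.norm_eq_abs] at k1
    rw [drift]
    linarith
  · rw [norm_smul, Real.norm_of_nonneg pb.le]
    have k3 := mul_le_mul h9 g2 (norm_nonneg _) hM.le
    have k5 : 0 ≤ M * ((1 + M) * g) := by positivity
    have k6 : 0 ≤ M * g := by positivity
    linarith

/-- Each left side is the kernel times a factor of at most quadratic growth. They will control the
decay of the density, the cost of the current and the Fisher information. -/
theorem exists_gaussian_bound (d : ℕ) {δ R : ℝ} (hδ : 0 < δ) (hR : 0 ≤ R) :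
    ∃ C c : ℝ, 0 < C ∧ 0 < c ∧ ∀ z q : TimePhase d, Admissible δ R z q →
      (1 + ‖z.2.2‖) ^ 2 * kern z q ≤ C * gaussE c z.2 ∧
      kern z q * ‖drift z q‖ ^ 2 ≤ C * gaussE c z.2 ∧
      kern z q * ‖cv z.1 q.1 • devV z q‖ ^ 2 ≤ C * gaussE c z.2 := by
  obtain ⟨B, c₁, c₁pos, hk⟩ := exists_kern_bound d hδ hR
  obtain ⟨D, D1, hD⟩ := exists_drift_bound d hδ hR
  refine ⟨3 * D ^ 2 * Real.exp B * (1 + 2 / c₁), c₁ / 2, by positivity, by positivity,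
    fun z q h => ?_⟩
  have q6 := hk z q h
  obtain ⟨g3, g4⟩ := hD z q h
  have x0 := norm_nonneg z.2.1
  have v0 := norm_nonneg z.2.2
  have key : ∀ y : ℝ, 0 ≤ y → y ≤ D * (1 + ‖z.2.1‖ + ‖z.2.2‖) → y ^ 2 * kern z q
      ≤ 3 * D ^ 2 * Real.exp B * (1 + 2 / c₁) * gaussE (c₁ / 2) z.2 := by
    intro y y0 hy
    have k1 : y ^ 2 ≤ 3 * D ^ 2 * (1 + (‖z.2.1‖ ^ 2 + ‖z.2.2‖ ^ 2)) := by
      refine (pow_le_pow_left₀ y0 hy 2).trans ?_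
      rw [mul_pow, mul_comm 3, mul_assoc]
      refine mul_le_mul_of_nonneg_left ?_ (sq_nonneg D)
      nlinarith [sq_nonneg (‖z.2.1‖ - 1), sq_nonneg (‖z.2.2‖ - 1), sq_nonneg (‖z.2.1‖ - ‖z.2.2‖)]
    calc _ ≤ 3 * D ^ 2 * (1 + (‖z.2.1‖ ^ 2 + ‖z.2.2‖ ^ 2)) * (Real.exp B * gaussE c₁ z.2) :=
          mul_le_mul k1 q6 (kern_pos _ _).le (by positivity)
      _ = 3 * D ^ 2 * Real.exp B * ((1 + (‖z.2.1‖ ^ 2 + ‖z.2.2‖ ^ 2))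
            * Real.exp (-c₁ * (‖z.2.1‖ ^ 2 + ‖z.2.2‖ ^ 2))) := by rw [gaussE]; ring
      _ ≤ 3 * D ^ 2 * Real.exp B * ((1 + 2 / c₁)
            * Real.exp (-(c₁ / 2) * (‖z.2.1‖ ^ 2 + ‖z.2.2‖ ^ 2))) :=
          mul_le_mul_of_nonneg_left (one_add_le_exp c₁pos (by positivity)) (by positivity)
      _ = _ := by rw [gaussE]; ring
  refine ⟨key _ (by positivity) ?_, ?_, ?_⟩
  · calc _ ≤ 1 * (1 + ‖z.2.1‖ + ‖z.2.2‖) := by linarith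
      _ ≤ _ := mul_le_mul_of_nonneg_right D1 (by linarith)
  · rw [mul_comm]; exact key _ (norm_nonneg _) g3
  · rw [mul_comm]; exact key _ (norm_nonneg _) g4

end Kolmogorov

namespace Kolmogorov

variable {d : ℕ}

/-! ### The kernel before the switching time as an image of the Gaussian weight -/

/-- The starting point for which the standardized deviation at `p` after time `σ` is `w`. -/
def start (σ : ℝ) (p w : Phase d) : Phase d :=
  (p.1 - (√(4 * Real.pi / 3) * (σ * √σ)) • w.1 - σ • (p.2
    - (3 / 2 * √(4 * Real.pi / 3) * √σ) • w.1 - (√Real.pi * √σ) • w.2),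
    p.2 - (3 / 2 * √(4 * Real.pi / 3) * √σ) • w.1 - (√Real.pi * √σ) • w.2)

theorem start_zero (p w : Phase d) : start 0 p w = p := by simp [start]

theorem continuous_start (p : Phase d) :
    Continuous fun r : ℝ × Phase d => start r.1 p r.2 := by
  unfold start
  fun_prop

/-- For fixed velocity the position is translated and reflected, then for fixed deviation the
velocity is; each substitution preserves Lebesgue measure. -/
theorem integral_shear {F : Phase d → ℝ} (hF : Continuous F) (hFc : HasCompactSupport F)
    (x v : Space d) (σ k : ℝ) :
    ∫ p, F p = ∫ X, ∫ Y, F (x - X - σ • (v - k • X - Y), v - k • X - Y) := by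
  have iF : Integrable F (volume.prod volume) := by
    rw [← Measure.volume_eq_prod]; exact hF.integrable_of_hasCompactSupport hFc
  have h1 : ∀ v' : Space d, ∫ x', F (x', v') = ∫ X, F (x - X - σ • v', v') := by
    intro v'
    rw [← integral_sub_left_eq_self (fun x' => F (x', v')) volume (x - σ • v')]
    congr 1; ext X; congr 2; abel
  have iG : Integrable (fun r : Space d × Space d => F (x - r.2 - σ • r.1, r.1))
      (volume.prod volume) := by
    rw [← Measure.volume_eq_prod]
    refine Continuous.integrable_of_hasCompactSupport (hF.comp (by fun_prop)) ?_
    have hc : Continuous fun p : Phase d => (p.2, x - p.1 - σ • p.2) := by fun_prop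
    refine HasCompactSupport.intro (hFc.image hc) fun r hr => ?_
    by_contra h
    refine hr ⟨_, subset_tsupport F h, ?_⟩
    simp only [Prod.ext_iff, true_and]
    abel
  have h2 : ∀ X : Space d, ∫ v', F (x - X - σ • v', v')
      = ∫ Y, F (x - X - σ • (v - k • X - Y), v - k • X - Y) := fun X =>
    (integral_sub_left_eq_self (fun v' => F (x - X - σ • v', v')) volume (v - k • X)).symm
  rw [Measure.volume_eq_prod, integral_prod_symm _ iF]
  simp_rw [h1]
  rw [integral_integral_swap iG]
  simp_rw [h2]

theorem integral_eq_rescale {A B : ℝ} (hA : 0 < A) (hB : 0 < B) {F : Phase d → ℝ}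
    (hF : Integrable fun w : Phase d => F (A • w.1, B • w.2)) :
    ∫ X, ∫ Y, F (X, Y) = A ^ d * B ^ d * ∫ w : Phase d, F (A • w.1, B • w.2) := by
  have h1 : ∀ {R : ℝ}, 0 < R → ∀ f : Space d → ℝ, ∫ x, f x = R ^ d * ∫ x, f (R • x) := by
    intro R hR f
    rw [Measure.integral_comp_smul, finrank_euclideanSpace_fin, smul_eq_mul,
      abs_of_pos (by positivity), ← mul_assoc, mul_inv_cancel₀ (by positivity), one_mul]
  rw [Measure.volume_eq_prod] at hF ⊢
  rw [integral_prod _ hF, h1 hA (fun X => ∫ Y, F (X, Y)), mul_assoc]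
  congr 1
  rw [← integral_const_mul]
  congr 1; ext X
  exact h1 hB fun Y => F (A • X, Y)

/-- Before time `7/8`, averages against the kernel are Gaussian averages. -/
theorem integral_kern_mul {z : TimePhase d} {t : ℝ} (ht : t < z.1) (hz : z.1 ≤ 7 / 8)
    {h : Phase d → ℝ} (hh : Continuous h) (hhc : HasCompactSupport h) :
    ∫ p, kern z (t, p) * h p = ∫ w, gaussWeight w * h (start (z.1 - t) z.2 w) := by
  set σ : ℝ := z.1 - t with hσ
  have σ0 : 0 < σ := sub_pos.2 ht
  have e0 := chi_of_le hz
  have e1 := deriv_chi_of_le hz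
  have ex : cx z.1 t = 3 / 2 * σ⁻¹ ^ 3 := by simp [cx, e0, hσ]
  have ev : cv z.1 t = 2 * σ⁻¹ := by simp [cv, e0, hσ]
  have es : slope z.1 t = 3 / 2 * σ⁻¹ := by
    simp only [slope, cx₁, ex, e0, e1, ← hσ]
    field_simp
    ring
  -- `A` and `B` are `√(2π)` times the standard deviations, from the variances `2σ³/3` and `σ/2`.
  -- The factor matches the weight `exp (-π |w|²)`, whose coordinates have variance `1/(2π)`.
  set A : ℝ := √(4 * Real.pi / 3) * (σ * √σ) with hA
  set B : ℝ := √Real.pi * √σ with hB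
  have sσ : √σ ^ 2 = σ := Real.sq_sqrt σ0.le
  have s1 : √(4 * Real.pi / 3) ^ 2 = 4 * Real.pi / 3 := Real.sq_sqrt (by positivity)
  have s2 : √Real.pi ^ 2 = Real.pi := Real.sq_sqrt (by positivity)
  have A0 : 0 < A := by positivity
  have B0 : 0 < B := by positivity
  have hA2 : A ^ 2 = 4 * Real.pi / 3 * σ ^ 3 := by
    rw [hA, mul_pow, mul_pow, s1, sσ]; ring
  have hB2 : B ^ 2 = Real.pi * σ := by rw [hB, mul_pow, s2, sσ]
  have hkA : 3 / 2 * σ⁻¹ * A = 3 / 2 * √(4 * Real.pi / 3) * √σ := by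
    rw [hA]; field_simp
  have hst : ∀ w : Phase d, start σ z.2 w = (z.2.1 - A • w.1 - σ • (z.2.2
      - (3 / 2 * σ⁻¹) • A • w.1 - B • w.2), z.2.2 - (3 / 2 * σ⁻¹) • A • w.1 - B • w.2) := by
    intro w
    rw [smul_smul, hkA]
    rfl
  have hk : ∀ w : Phase d, A ^ d * B ^ d * kern z (t, start σ z.2 w) = gaussWeight w := by
    intro w
    have x1 : devX z (t, start σ z.2 w) = A • w.1 := by
      simp only [devX, meanX, e0, hst, ← hσ]
      module
    have v1 : devV z (t, start σ z.2 w) = B • w.2 := by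
      rw [devV, x1]
      simp only [meanV, e0, e1, hst, es]
      module
    have hAB : A ^ d * B ^ d = Real.exp (d * Real.log A + d * Real.log B) := by
      rw [Real.exp_add, mul_comm (d : ℝ), mul_comm (d : ℝ), Real.exp_mul, Real.exp_log A0,
        Real.exp_mul, Real.exp_log B0, Real.rpow_natCast, Real.rpow_natCast]
    have hlog : Real.log (cx z.1 t * cv z.1 t)
        = 2 * Real.log (2 * Real.pi) - 2 * Real.log A - 2 * Real.log B := by
      have h2 : ∀ y : ℝ, 2 * Real.log y = Real.log (y ^ 2) := fun y => by
        rw [Real.log_pow]; norm_num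
      rw [h2, h2, h2, hA2, hB2, ← Real.log_div (by positivity) (by positivity),
        ← Real.log_div (by positivity) (by positivity), ex, ev]
      congr 1
      field_simp
      ring
    have k1 : cx z.1 t / 2 * ‖A • w.1‖ ^ 2 = Real.pi * ‖w.1‖ ^ 2 := by
      rw [norm_smul, mul_pow, Real.norm_eq_abs, sq_abs, hA2, ex]
      field_simp
      norm_num
    have k2 : cv z.1 t / 2 * ‖B • w.2‖ ^ 2 = Real.pi * ‖w.2‖ ^ 2 := by
      rw [norm_smul, mul_pow, Real.norm_eq_abs, sq_abs, hB2, ev]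
      field_simp
    rw [kern, hAB, gaussWeight, ← Real.exp_add, logKern, x1, v1]
    simp only
    rw [hlog, k1, k2]
    congr 1
    ring
  have ck : Continuous fun p : Phase d => kern z (t, p) := by
    rw [continuous_iff_continuousAt]
    intro p
    have h1 := (contDiffAt_kern (w := (z, (t, p))) ht).continuousAt
    exact ContinuousAt.comp (f := fun p : Phase d => (z, (t, p))) h1
      (by fun_prop : Continuous fun p : Phase d => (z, ((t, p) : TimePhase d))).continuousAt
  obtain ⟨M, hM⟩ := hh.bounded_above_of_compact_support hhc
  have ig : Integrable fun w => gaussWeight w * h (start σ z.2 w) := by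
    refine Integrable.mul_bdd (c := M) integrable_gaussWeight ?_ (Eventually.of_forall fun w => hM _)
    exact (hh.comp ((continuous_start z.2).comp (by fun_prop :
      Continuous fun w : Phase d => (σ, w)))).aestronglyMeasurable
  set F : Phase d → ℝ := fun w => kern z (t, (z.2.1 - w.1 - σ • (z.2.2
      - (3 / 2 * σ⁻¹) • w.1 - w.2), z.2.2 - (3 / 2 * σ⁻¹) • w.1 - w.2))
      * h (z.2.1 - w.1 - σ • (z.2.2
      - (3 / 2 * σ⁻¹) • w.1 - w.2), z.2.2 - (3 / 2 * σ⁻¹) • w.1 - w.2) with hF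
  have hFs : ∀ w : Phase d, F (A • w.1, B • w.2) = (A ^ d * B ^ d)⁻¹
      * (gaussWeight w * h (start σ z.2 w)) := by
    intro w
    have hAB : A ^ d * B ^ d ≠ 0 := by positivity
    rw [← hk w, mul_assoc, inv_mul_cancel_left₀ hAB, hst]
  rw [integral_shear (F := fun p => kern z (t, p) * h p) (ck.mul hh) hhc.mul_left z.2.1 z.2.2 σ
    (3 / 2 * σ⁻¹)]
  change ∫ X, ∫ Y, F (X, Y) = _
  rw [integral_eq_rescale A0 B0 (by simp_rw [hFs]; exact ig.const_mul _)]
  simp_rw [hFs]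
  rw [integral_const_mul, mul_inv_cancel_left₀ (by positivity)]

/-- The mass is taken over the starting points, not the end points. This is the mass that bounds a
superposition with weights at most one. -/
theorem integral_kern_mul_le_one {z : TimePhase d} {t : ℝ} (ht : t < z.1) (hz : z.1 ≤ 7 / 8)
    {h : Phase d → ℝ} (hh : Continuous h) (hhc : HasCompactSupport h) (h0 : ∀ p, 0 ≤ h p)
    (h1 : ∀ p, h p ≤ 1) : ∫ p, kern z (t, p) * h p ≤ 1 := by
  rw [integral_kern_mul ht hz hh hhc, ← integral_gaussWeight (d := d)]
  refine integral_mono_of_nonneg (Eventually.of_forall fun w =>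
    mul_nonneg (gaussWeight_pos w).le (h0 _)) integrable_gaussWeight
    (Eventually.of_forall fun w => mul_le_of_le_one_right (gaussWeight_pos w).le (h1 _))

theorem hasCompactSupport_slice {α : TimePhase d → ℝ} (hαc : HasCompactSupport α) (t : ℝ) :
    HasCompactSupport fun p => α (t, p) := by
  refine HasCompactSupport.intro (hαc.image continuous_snd) fun p hp => ?_
  by_contra h
  exact hp ⟨(t, p), subset_tsupport α h, rfl⟩

theorem continuous_smear {α : TimePhase d → ℝ} (hα : Continuous α) (z : TimePhase d) :
    Continuous fun r : ℝ × (ℝ × Phase d) =>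
      α (z.1 - r.1 * r.2.1, start (r.1 * r.2.1) z.2 r.2.2) := by
  have h1 : Continuous fun r : ℝ × (ℝ × Phase d) => start (r.1 * r.2.1) z.2 r.2.2 :=
    Continuous.comp (g := fun s : ℝ × Phase d => start s.1 z.2 s.2)
      (f := fun r : ℝ × (ℝ × Phase d) => (r.1 * r.2.1, r.2.2)) (continuous_start z.2) (by fun_prop)
  have h2 : Continuous fun r : ℝ × (ℝ × Phase d) => z.1 - r.1 * r.2.1 := by fun_prop
  exact hα.comp (h2.prodMk h1)

theorem hasCompactSupport_deriv_switch : HasCompactSupport (deriv (switch 1)) :=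
  HasCompactSupport.intro (isCompact_Icc (a := (1 : ℝ)) (b := 2)) fun s hs => by
    rw [mem_Icc, not_and_or, not_le, not_le] at hs
    rcases hs with hs | hs
    · exact deriv_switch_of_le one_pos hs.le
    · exact deriv_switch_of_ge one_pos (by linarith)

theorem integrable_profile : Integrable
    (fun r : ℝ × Phase d => deriv (switch 1) r.1 * gaussWeight r.2) := by
  rw [Measure.volume_eq_prod]
  exact (contDiff_deriv_switch.continuous.integrable_of_hasCompactSupport
    hasCompactSupport_deriv_switch).mul_prod integrable_gaussWeight

/-- The source smeared out by the kernel, in standardized variables. -/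
theorem source_eq {ε : ℝ} (hε : 0 < ε) {α : TimePhase d → ℝ} (hα : Continuous α)
    (hαc : HasCompactSupport α) {z : TimePhase d} (hz : z.1 ≤ 7 / 8) :
    ∫ q, α q * (deriv (switch ε) (z.1 - q.1) * kern z q)
      = ∫ r : ℝ × Phase d, deriv (switch 1) r.1 * gaussWeight r.2
          * α (z.1 - ε * r.1, start (ε * r.1) z.2 r.2) := by
  obtain ⟨M, hM⟩ := hα.bounded_above_of_compact_support hαc
  have i1 : Integrable (fun q => α q * (deriv (switch ε) (z.1 - q.1) * kern z q))
      ((volume : Measure ℝ).prod volume) := by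
    rw [← Measure.volume_eq_prod]
    exact integrable_superpose hα hαc ((contDiff_source hε).continuous.comp
      (continuous_const.prodMk continuous_id))
  have i2 : Integrable (fun r : ℝ × Phase d => deriv (switch 1) r.1 * gaussWeight r.2
      * α (z.1 - ε * r.1, start (ε * r.1) z.2 r.2)) ((volume : Measure ℝ).prod volume) := by
    rw [← Measure.volume_eq_prod]
    exact integrable_profile.mul_bdd (c := M) ((continuous_smear hα z).comp
      (Continuous.prodMk_right ε)).aestronglyMeasurable (Eventually.of_forall fun r => hM _)
  rw [Measure.volume_eq_prod, integral_prod _ i1, integral_prod _ i2]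
  have h1 : ∀ t, ∫ p, α (t, p) * (deriv (switch ε) (z.1 - t) * kern z (t, p))
      = (fun σ => deriv (switch ε) σ * ∫ w, gaussWeight w * α (z.1 - σ, start σ z.2 w))
        (z.1 - t) := by
    intro t
    simp only
    -- Mass cannot come from later times: there the derivative of the switch is zero.
    rcases lt_or_ge t z.1 with ht | ht
    · rw [sub_sub_cancel, ← integral_kern_mul ht hz (h := fun p => α (t, p))
        (hα.comp (by fun_prop)) (hasCompactSupport_slice hαc t), ← integral_const_mul]
      congr 1; ext p; ring
    · rw [deriv_switch_of_le hε (by linarith)]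
      simp
  simp_rw [h1]
  rw [integral_sub_left_eq_self (fun σ => deriv (switch ε) σ
    * ∫ w, gaussWeight w * α (z.1 - σ, start σ z.2 w)) volume z.1]
  have h2 := Measure.integral_comp_mul_left (fun σ => deriv (switch ε) σ
    * ∫ w, gaussWeight w * α (z.1 - σ, start σ z.2 w)) ε
  have h3 : ∫ σ, deriv (switch ε) σ * ∫ w, gaussWeight w * α (z.1 - σ, start σ z.2 w)
      = ε * ∫ s, deriv (switch ε) (ε * s)
        * ∫ w, gaussWeight w * α (z.1 - ε * s, start (ε * s) z.2 w) := by
    rw [h2, smul_eq_mul, abs_of_pos (by positivity), mul_inv_cancel_left₀ hε.ne']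
  rw [h3, ← integral_const_mul]
  congr 1; ext s
  rw [deriv_switch, mul_div_cancel_left₀ _ hε.ne', ← mul_assoc, mul_inv_cancel_left₀ hε.ne',
    ← integral_const_mul]
  congr 1; ext w; ring

/-- The smeared source converges to the source. -/
theorem tendsto_source {α : TimePhase d → ℝ} (hα : Continuous α) (hαc : HasCompactSupport α)
    {z : TimePhase d} (hz : z.1 ≤ 7 / 8) {ε : ℕ → ℝ} (hε : ∀ n, 0 < ε n)
    (hε0 : Tendsto ε atTop (𝓝 0)) :
    Tendsto (fun n => ∫ q, α q * (deriv (switch (ε n)) (z.1 - q.1) * kern z q)) atTop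
      (𝓝 (α z)) := by
  simp_rw [fun n => source_eq (hε n) hα hαc hz]
  obtain ⟨M, hM⟩ := hα.bounded_above_of_compact_support hαc
  -- The profile has mass one, so `α z` can be written as an integral against it. In standardized
  -- variables the integrand is continuous up to `ε = 0`, where the starting point is the point
  -- itself.
  have e1 : α z = ∫ r : ℝ × Phase d, deriv (switch 1) r.1 * gaussWeight r.2 * α z := by
    rw [integral_mul_const, Measure.volume_eq_prod, integral_prod_mul (deriv (switch 1)) gaussWeight,
      integral_deriv_switch, integral_gaussWeight]
    ring
  conv => rw [e1]
  refine tendsto_integral_of_dominated_convergence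
    (fun r => ‖deriv (switch 1) r.1 * gaussWeight r.2‖ * M) ?_
    (integrable_profile.norm.mul_const M) ?_ ?_
  · intro n
    exact integrable_profile.1.mul ((continuous_smear hα z).comp
      (Continuous.prodMk_right (ε n))).aestronglyMeasurable
  · intro n
    refine Eventually.of_forall fun r => ?_
    rw [norm_mul]
    exact mul_le_mul_of_nonneg_left (hM _) (norm_nonneg _)
  · refine Eventually.of_forall fun r => Tendsto.const_mul _ ?_
    have h1 := (((continuous_smear hα z).comp (Continuous.prodMk_left r)).tendsto 0).comp hε0
    simpa [Function.comp_def, start_zero] using h1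

end Kolmogorov

namespace Kolmogorov

variable {d : ℕ}

/-! ### Superpositions of the kernel -/

/-- Continuous compactly supported weights between zero and one, carried by
`[1/4, 3/4] × closedBall 0 R`. -/
structure IsSource (R : ℝ) (α : TimePhase d → ℝ) : Prop where
  continuous : Continuous α
  compact : HasCompactSupport α
  nonneg : ∀ q, 0 ≤ α q
  le_one : ∀ q, α q ≤ 1
  time : ∀ q, α q ≠ 0 → q.1 ∈ Icc (1 / 4 : ℝ) (3 / 4)
  space : ∀ q, α q ≠ 0 → ‖q.2‖ ≤ R

/-- The density generated by the source `α`, switched on after a delay `ε`. -/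
def dens (ε : ℝ) (α : TimePhase d → ℝ) (z : TimePhase d) : ℝ :=
  ∫ q, α q * (switch ε (z.1 - q.1) * kern z q)

/-- The current which transports `dens`. -/
def curr (ε : ℝ) (α : TimePhase d → ℝ) (i : Fin d) (z : TimePhase d) : ℝ :=
  ∫ q, α q * (switch ε (z.1 - q.1) * (kern z q * drift z q i))

/-- The delayed and smeared source. -/
def smear (ε : ℝ) (α : TimePhase d → ℝ) (z : TimePhase d) : ℝ :=
  ∫ q, α q * (deriv (switch ε) (z.1 - q.1) * kern z q)

section Superposed

variable {ε δ R : ℝ} {α : TimePhase d → ℝ} {z : TimePhase d}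

theorem IsSource.integrable (h : IsSource R α) : Integrable α :=
  h.continuous.integrable_of_hasCompactSupport h.compact

theorem IsSource.integrable_switch_mul (h : IsSource R α) (hε : 0 < ε) (z : TimePhase d)
    {F : TimePhase d × TimePhase d → ℝ}
    (hF : ∀ w : TimePhase d × TimePhase d, w.2.1 < w.1.1 → ContDiffAt ℝ ∞ F w) :
    Integrable fun q => α q * (switch ε (z.1 - q.1) * F (z, q)) :=
  integrable_superpose h.continuous h.compact ((contDiff_switch_mul hε contDiff_switch
    (fun _ => switch_of_le hε) hF).continuous.comp (Continuous.prodMk_right z))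

theorem contDiffAt_drift_apply (i : Fin d) (w : TimePhase d × TimePhase d) (h : w.2.1 < w.1.1) :
    ContDiffAt ℝ ∞ (fun w : TimePhase d × TimePhase d => drift w.1 w.2 i) w :=
  (EuclideanSpace.proj i : Space d →L[ℝ] ℝ).contDiff.contDiffAt.comp w (contDiffAt_drift h)

theorem contDiffAt_gradient_apply (i : Fin d) (w : TimePhase d × TimePhase d)
    (h : w.2.1 < w.1.1) : ContDiffAt ℝ ∞
      (fun w : TimePhase d × TimePhase d => (cv w.1.1 w.2.1 • devV w.1 w.2) i) w :=
  (EuclideanSpace.proj i : Space d →L[ℝ] ℝ).contDiff.contDiffAt.comp w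
    ((contDiffAt_cv h).smul (contDiffAt_devV h))

theorem IsSource.contDiff_dens (h : IsSource R α) (hε : 0 < ε) : ContDiff ℝ 1 (dens ε α) :=
  contDiff_superpose ((contDiff_switch_kern hε).of_le (by simp)) h.continuous h.compact

theorem IsSource.contDiff_curr (h : IsSource R α) (hε : 0 < ε) (i : Fin d) :
    ContDiff ℝ 1 (curr ε α i) :=
  contDiff_superpose ((contDiff_switch_current hε i).of_le (by simp)) h.continuous h.compact

theorem IsSource.contDiff_smear (h : IsSource R α) (hε : 0 < ε) : ContDiff ℝ 1 (smear ε α) :=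
  contDiff_superpose ((contDiff_source hε).of_le (by simp)) h.continuous h.compact

theorem IsSource.fderiv_dens_velocity (h : IsSource R α) (hε : 0 < ε) (z : TimePhase d)
    (i : Fin d) : fderiv ℝ (dens ε α) z (dirV i)
      = -∫ q, α q * (switch ε (z.1 - q.1) * (kern z q * (cv z.1 q.1 • devV z q) i)) := by
  have h1 := fderiv_superpose (μ := volume) ((contDiff_switch_kern (d := d) hε).of_le (by simp))
    h.continuous h.compact z (dirV i)
  change fderiv ℝ (dens ε α) z (dirV i) = _ at h1
  rw [h1, ← integral_neg]
  congr 1; ext q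
  have h2 := fderiv_switch_kern_velocity hε z q i
  simp only at h2 ⊢
  rw [h2]
  simp

theorem IsSource.continuity_equation (h : IsSource R α) (hε : 0 < ε) (z : TimePhase d) :
    fderiv ℝ (dens ε α) z (dirT z) + ∑ i, fderiv ℝ (curr ε α i) z (dirV i) = smear ε α z := by
  have c1 : ContDiff ℝ 1 fun w : TimePhase d × TimePhase d =>
      switch ε (w.1.1 - w.2.1) * kern w.1 w.2 := (contDiff_switch_kern hε).of_le (by simp)
  have c2 : ∀ i : Fin d, ContDiff ℝ 1 fun w : TimePhase d × TimePhase d =>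
      switch ε (w.1.1 - w.2.1) * (kern w.1 w.2 * drift w.1 w.2 i) :=
    fun i => (contDiff_switch_current hε i).of_le (by simp)
  have h1 := fderiv_superpose (μ := volume) c1 h.continuous h.compact z (dirT z)
  have h2 := fun i => fderiv_superpose (μ := volume) (c2 i) h.continuous h.compact z (dirV i)
  have i1 := integrable_superpose (μ := volume) h.continuous h.compact
    (continuous_fderiv_slice c1 z (dirT z))
  have i2 := fun i => integrable_superpose (μ := volume) h.continuous h.compact
    (continuous_fderiv_slice (c2 i) z (dirV i))
  change fderiv ℝ (dens ε α) z (dirT z) = _ at h1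
  change ∀ i, fderiv ℝ (curr ε α i) z (dirV i) = _ at h2
  simp_rw [h2]
  rw [h1, ← integral_finsetSum _ fun i _ => i2 i,
    ← integral_add i1 (integrable_finsetSum _ fun i _ => i2 i), smear]
  congr 1; ext q
  rw [← Finset.mul_sum, ← mul_add, kern_continuity_equation hε]

theorem IsSource.dens_nonneg (h : IsSource R α) (ε : ℝ) (z : TimePhase d) : 0 ≤ dens ε α z :=
  integral_nonneg fun q => mul_nonneg (h.nonneg q)
    (mul_nonneg (switch_nonneg _) (kern_pos _ _).le)

theorem IsSource.smear_nonneg (h : IsSource R α) (hε : 0 < ε) (z : TimePhase d) :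
    0 ≤ smear ε α z :=
  integral_nonneg fun q => mul_nonneg (h.nonneg q)
    (mul_nonneg (deriv_switch_nonneg hε _) (kern_pos _ _).le)

theorem IsSource.integral_eq_zero (h : IsSource R α) {g : ℝ → ℝ} {F : TimePhase d → ℝ}
    (hg : ∀ t ∈ Icc (1 / 4 : ℝ) (3 / 4), g (z.1 - t) = 0) :
    ∫ q, α q * (g (z.1 - q.1) * F q) = 0 := by
  rw [← integral_zero]
  congr 1; ext q
  by_cases hq : α q = 0
  · rw [hq, zero_mul]
  · rw [hg _ (h.time q hq), zero_mul, mul_zero]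

theorem IsSource.dens_early (h : IsSource R α) (hε : 0 < ε) (hz : z.1 ≤ 1 / 4 + ε) :
    dens ε α z = 0 :=
  h.integral_eq_zero fun t ht => switch_of_le hε (by linarith [ht.1])

theorem IsSource.curr_early (h : IsSource R α) (hε : 0 < ε) (hz : z.1 ≤ 1 / 4 + ε) (i : Fin d) :
    curr ε α i z = 0 :=
  h.integral_eq_zero fun t ht => switch_of_le hε (by linarith [ht.1])

theorem IsSource.smear_early (h : IsSource R α) (hε : 0 < ε) (hz : z.1 ≤ 1 / 4 + ε) :
    smear ε α z = 0 :=
  h.integral_eq_zero fun t ht => deriv_switch_of_le hε (by linarith [ht.1])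

theorem IsSource.smear_late (h : IsSource R α) (hε : 0 < ε) (hz : 3 / 4 + 2 * ε ≤ z.1) :
    smear ε α z = 0 :=
  h.integral_eq_zero fun t ht => deriv_switch_of_ge hε (by linarith [ht.2])

theorem IsSource.dens_final (h : IsSource R α) (hε : 0 < ε) (hz : 15 / 16 ≤ z.1)
    (hε' : 3 / 4 + 2 * ε ≤ z.1) : dens ε α z = (∫ q, α q) * gaussWeight z.2 := by
  rw [dens, ← integral_mul_const]
  congr 1; ext q
  by_cases hq : α q = 0
  · rw [hq, zero_mul, zero_mul]
  · rw [switch_of_ge hε (by linarith [(h.time q hq).2]), one_mul, kern_eq_gaussWeight hz]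

/-- Before time `7/8` the current is minus the velocity gradient of the density. -/
theorem IsSource.curr_eq (h : IsSource R α) (hε : 0 < ε) (hz : z.1 < 7 / 8) (i : Fin d) :
    curr ε α i z = -fderiv ℝ (dens ε α) z (dirV i) := by
  rw [h.fderiv_dens_velocity hε, neg_neg, curr]
  congr 1; ext q
  rcases le_or_gt (z.1 - q.1) ε with hq | hq
  · rw [switch_of_le hε hq, zero_mul, zero_mul]
  · rw [drift_eq (by linarith) hz]

/-- The source is at most one and lives on a time interval of length `1/2`; for each emission time
the kernel has mass at most one over the starting points. The bound keeps `√(ρ + κ)` below one in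
the dissipation estimate. -/
theorem IsSource.dens_le_half (h : IsSource R α) (hε : 0 < ε) (hz : z.1 ≤ 7 / 8) :
    dens ε α z ≤ 1 / 2 := by
  have i1 : Integrable (fun q => α q * (switch ε (z.1 - q.1) * kern z q))
      ((volume : Measure ℝ).prod volume) := by
    rw [← Measure.volume_eq_prod]
    exact h.integrable_switch_mul hε z (F := fun w => kern w.1 w.2) fun w => contDiffAt_kern
  rw [dens, Measure.volume_eq_prod, integral_prod _ i1]
  have h1 : ∫ t : ℝ, (Icc (1 / 4 : ℝ) (3 / 4)).indicator (fun _ => (1 : ℝ)) t = 1 / 2 := by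
    rw [integral_indicator measurableSet_Icc]
    simp
    norm_num
  rw [← h1]
  refine integral_mono_of_nonneg (Eventually.of_forall fun t => integral_nonneg fun p =>
    mul_nonneg (h.nonneg _) (mul_nonneg (switch_nonneg _) (kern_pos _ _).le)) ?_
    (Eventually.of_forall fun t => ?_)
  · rw [integrable_indicator_iff measurableSet_Icc]
    exact integrableOn_const (by simp)
  · by_cases ht : t ∈ Icc (1 / 4 : ℝ) (3 / 4)
    · simp only [indicator_of_mem ht]
      rcases le_or_gt z.1 t with hzt | hzt
      · simp [switch_of_le hε (show z.1 - t ≤ ε by linarith)]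
      · have h2 : ∀ p, α (t, p) * (switch ε (z.1 - t) * kern z (t, p))
            = switch ε (z.1 - t) * (kern z (t, p) * α (t, p)) := fun p => by ring
        simp_rw [h2]
        rw [integral_const_mul]
        refine mul_le_one₀ (switch_le_one _) (integral_nonneg fun p =>
          mul_nonneg (kern_pos _ _).le (h.nonneg _)) ?_
        exact integral_kern_mul_le_one hzt hz (h.continuous.comp (by fun_prop))
          (hasCompactSupport_slice h.compact t) (fun p => h.nonneg _) fun p => h.le_one _
    · have h2 : ∀ p, α (t, p) = 0 := fun p => by
        by_contra hp
        exact ht (h.time (t, p) hp)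
      rw [indicator_of_notMem ht]
      simp [h2]

/-- Uniform bounds transfer from the kernel to its superpositions. -/
theorem IsSource.integral_le (h : IsSource R α) (hε : 0 < ε) {F : TimePhase d × TimePhase d → ℝ}
    (hF : ∀ w : TimePhase d × TimePhase d, w.2.1 < w.1.1 → ContDiffAt ℝ ∞ F w)
    {z : TimePhase d} {M : ℝ} (hM : 0 ≤ M)
    (hb : ∀ q, α q ≠ 0 → switch ε (z.1 - q.1) ≠ 0 → F (z, q) ≤ M) :
    ∫ q, α q * (switch ε (z.1 - q.1) * F (z, q)) ≤ M * ∫ q, α q := by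
  rw [← integral_const_mul]
  refine integral_mono (h.integrable_switch_mul hε z hF) (h.integrable.const_mul M) fun q => ?_
  simp only
  by_cases hq : α q = 0
  · simp [hq]
  by_cases hs : switch ε (z.1 - q.1) = 0
  · rw [hs, zero_mul, mul_zero]
    exact mul_nonneg hM (h.nonneg q)
  · rw [mul_comm M]
    refine mul_le_mul_of_nonneg_left ?_ (h.nonneg q)
    calc _ ≤ switch ε (z.1 - q.1) * M := mul_le_mul_of_nonneg_left (hb q hq hs) (switch_nonneg _)
      _ ≤ M := mul_le_of_le_one_left hM (switch_le_one _)

/-- Cauchy–Schwarz for the measure with density `α · switch · kern`, of mass `dens`. It expresses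
that `|J|²/ρ` is convex, so costs of superpositions are bounded by superposed costs. -/
theorem IsSource.sum_sq_le (h : IsSource R α) (hε : 0 < ε)
    {G : TimePhase d × TimePhase d → Space d}
    (hG : ∀ i, ∀ w : TimePhase d × TimePhase d, w.2.1 < w.1.1 → ContDiffAt ℝ ∞ (fun w => G w i) w)
    {z : TimePhase d} {M : ℝ} (hM : 0 ≤ M)
    (hb : ∀ q, α q ≠ 0 → switch ε (z.1 - q.1) ≠ 0 → kern z q * ‖G (z, q)‖ ^ 2 ≤ M) :
    ∑ i, (∫ q, α q * (switch ε (z.1 - q.1) * (kern z q * G (z, q) i))) ^ 2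
      ≤ (M * ∫ q, α q) * dens ε α z := by
  have e0 : ∀ q, ∀ y : ℝ, α q * (switch ε (z.1 - q.1) * (kern z q * y))
      = α q * (switch ε (z.1 - q.1) * kern z q) * y := fun q y => by ring
  have cs : ∀ i, (∫ q, α q * (switch ε (z.1 - q.1) * (kern z q * G (z, q) i))) ^ 2
      ≤ (∫ q, α q * (switch ε (z.1 - q.1) * (kern z q * G (z, q) i ^ 2))) * dens ε α z := by
    intro i
    have i1 := h.integrable_switch_mul hε z (F := fun w => kern w.1 w.2) fun w => contDiffAt_kern
    have i2 := h.integrable_switch_mul hε z (F := fun w => kern w.1 w.2 * G w i)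
      fun w hw => (contDiffAt_kern hw).mul (hG i w hw)
    have i3 := h.integrable_switch_mul hε z (F := fun w => kern w.1 w.2 * G w i ^ 2)
      fun w hw => (contDiffAt_kern hw).mul ((hG i w hw).pow 2)
    simp only [e0] at i2 i3 ⊢
    exact sq_integral_mul_le (fun q => mul_nonneg (h.nonneg q)
      (mul_nonneg (switch_nonneg _) (kern_pos _ _).le)) i1 i2 i3
  refine (Finset.sum_le_sum fun i _ => cs i).trans ?_
  rw [← Finset.sum_mul]
  refine mul_le_mul_of_nonneg_right ?_ (h.dens_nonneg ε z)
  rw [← integral_finsetSum _ fun i _ => h.integrable_switch_mul hε z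
    (F := fun w => kern w.1 w.2 * G w i ^ 2)
      fun w hw => (contDiffAt_kern hw).mul ((hG i w hw).pow 2)]
  have e1 : ∀ q, ∑ i, α q * (switch ε (z.1 - q.1) * (kern z q * G (z, q) i ^ 2))
      = α q * (switch ε (z.1 - q.1) * (kern z q * ‖G (z, q)‖ ^ 2)) := fun q => by
    rw [← Finset.mul_sum, ← Finset.mul_sum, ← Finset.mul_sum, EuclideanSpace.real_norm_sq_eq]
  simp_rw [e1]
  refine h.integral_le hε (F := fun w => kern w.1 w.2 * ‖G w‖ ^ 2) (fun w hw => ?_) hM hb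
  have e2 : (fun w : TimePhase d × TimePhase d => ‖G w‖ ^ 2) = fun w => ∑ i, G w i ^ 2 := by
    ext w; rw [EuclideanSpace.real_norm_sq_eq]
  have h1 : ContDiffAt ℝ ∞ (fun w : TimePhase d × TimePhase d => ‖G w‖ ^ 2) w := by
    rw [e2]
    exact ContDiffAt.sum fun i _ => (hG i w hw).pow 2
  exact (contDiffAt_kern hw).mul h1

/-- The three Gaussian bounds for superpositions. -/
theorem IsSource.gaussian_bounds (h : IsSource R α) (hε : 0 < ε) {C c : ℝ} (hC : 0 < C)
    (hb : ∀ z q : TimePhase d, Admissible δ R z q →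
      (1 + ‖z.2.2‖) ^ 2 * kern z q ≤ C * gaussE c z.2 ∧
      kern z q * ‖drift z q‖ ^ 2 ≤ C * gaussE c z.2 ∧
      kern z q * ‖cv z.1 q.1 • devV z q‖ ^ 2 ≤ C * gaussE c z.2)
    {z : TimePhase d} (hz : z.1 ∈ Icc (1 / 4 : ℝ) 1)
    (hδ : ∀ t ∈ Icc (1 / 4 : ℝ) (3 / 4), switch ε (z.1 - t) ≠ 0 → δ ≤ z.1 - t) :
    (1 + ‖z.2.2‖) ^ 2 * dens ε α z ≤ C * gaussE c z.2 * ∫ q, α q ∧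
    ∑ i, curr ε α i z ^ 2 ≤ (C * gaussE c z.2 * ∫ q, α q) * dens ε α z ∧
    ∑ i, fderiv ℝ (dens ε α) z (dirV i) ^ 2 ≤ (C * gaussE c z.2 * ∫ q, α q) * dens ε α z := by
  have adm : ∀ q, α q ≠ 0 → switch ε (z.1 - q.1) ≠ 0 → Admissible δ R z q := fun q hq hs =>
    ⟨hz, h.time q hq, hδ _ (h.time q hq) hs, h.space q hq⟩
  have hM : 0 ≤ C * gaussE c z.2 := mul_nonneg hC.le (gaussE_pos _ _).le
  refine ⟨?_, ?_, ?_⟩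
  · have e1 : (1 + ‖z.2.2‖) ^ 2 * dens ε α z
        = ∫ q, α q * (switch ε (z.1 - q.1) * ((1 + ‖z.2.2‖) ^ 2 * kern z q)) := by
      rw [dens, ← integral_const_mul]
      congr 1; ext q; ring
    rw [e1]
    exact h.integral_le hε (F := fun w => (1 + ‖z.2.2‖) ^ 2 * kern w.1 w.2)
      (fun w hw => contDiffAt_const.mul (contDiffAt_kern hw)) hM
      fun q hq hs => (hb z q (adm q hq hs)).1
  · exact h.sum_sq_le hε (G := fun w => drift w.1 w.2) contDiffAt_drift_apply hM
      fun q hq hs => (hb z q (adm q hq hs)).2.1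
  · simp_rw [h.fderiv_dens_velocity hε, neg_sq]
    exact h.sum_sq_le hε (G := fun w => cv w.1.1 w.2.1 • devV w.1 w.2) contDiffAt_gradient_apply hM
      fun q hq hs => (hb z q (adm q hq hs)).2.2

theorem IsSource.integral_le_volume (h : IsSource R α) :
    ∫ q, α q ≤ volume.real (Icc (1 / 4 : ℝ) (3 / 4) ×ˢ Metric.closedBall (0 : Phase d) R) := by
  have hK : IsCompact (Icc (1 / 4 : ℝ) (3 / 4) ×ˢ Metric.closedBall (0 : Phase d) R) :=
    isCompact_Icc.prod (isCompact_closedBall _ _)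
  rw [← setIntegral_eq_integral_of_forall_compl_eq_zero
    (s := Icc (1 / 4 : ℝ) (3 / 4) ×ˢ Metric.closedBall (0 : Phase d) R)]
  · calc _ ≤ ∫ q in Icc (1 / 4 : ℝ) (3 / 4) ×ˢ Metric.closedBall (0 : Phase d) R, (1 : ℝ) :=
        integral_mono h.integrable.integrableOn (integrableOn_const hK.measure_lt_top.ne)
          fun q => h.le_one q
      _ = _ := by simp
  · intro q hq
    by_contra hα
    exact hq ⟨h.time q hα, mem_closedBall_zero_iff.2 (h.space q hα)⟩

end Superposed

end Kolmogorov

namespace Kolmogorov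

variable {d : ℕ}

/-! ### The Fisher information of superpositions -/

theorem hasDerivAt_sqrt_add {κ r : ℝ} (hκ : 0 < κ) (hr : 0 ≤ r) :
    HasDerivAt (fun r => √(r + κ) - √κ) ((2 * √(r + κ))⁻¹) r := by
  have h1 := (((hasDerivAt_id r).add_const κ).sqrt (by simp only [id]; positivity)).sub_const (√κ)
  simpa [one_div] using h1

theorem hasDerivAt_inv_sqrt_add {κ r : ℝ} (hκ : 0 < κ) (hr : 0 ≤ r) :
    HasDerivAt (fun r => (2 * √(r + κ))⁻¹) (-(4 * ((r + κ) * √(r + κ)))⁻¹) r := by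
  have h0 : 0 < √(r + κ) := Real.sqrt_pos.2 (by positivity)
  have h1 := ((((hasDerivAt_id r).add_const κ).sqrt (by simp only [id]; positivity)).const_mul
    2).inv (by simp only [id]; positivity)
  refine h1.congr_deriv ?_
  have h2 : √(r + κ) ^ 2 = r + κ := Real.sq_sqrt (by positivity)
  simp only [id]
  have h3 : (r + κ) * √(r + κ) = √(r + κ) ^ 3 := by rw [← h2]; rw [Real.sqrt_sq h0.le]; ring
  rw [h3]
  field_simp
  norm_num

/-- The pointwise form of the entropy dissipation. `D` is the sum of two divergences. -/
theorem dissipation_pointwise {κ r Tr B s' v' N K th dth xi : ℝ} {x J y : Fin d → ℝ} (hκ : 0 < κ)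
    (hr : 0 ≤ r) (hrκ : r + κ ≤ 1) (hB : 0 ≤ B) (hxi : 0 ≤ xi) (hxi1 : xi ≤ 1) (hth : 0 ≤ th)
    (hth1 : th ≤ 1) (hdth : dth ≤ 0) {DJ : Fin d → ℝ} (heq : Tr + ∑ i, DJ i = B)
    (hJ : th ≠ 0 → ∀ i, J i = -x i)
    (hE : -(dth * √r) ≤ s') (hv : √r * |v'| ≤ N * K) (hJK : ∀ i, |J i| ≤ K)
    (hy : ∀ i, |y i| ≤ N) :
    xi * th * (∑ i, x i ^ 2) / (r + κ) ≤ 4 * ((((2 * √(r + κ))⁻¹ * Tr) * (xi * th)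
        + (√(r + κ) - √κ) * (dth * xi + th * v')
        + ∑ i, ((-(4 * ((r + κ) * √(r + κ)))⁻¹ * x i * J i + (2 * √(r + κ))⁻¹ * DJ i) * (xi * th)
          + (2 * √(r + κ))⁻¹ * J i * (th * y i)))
      + (s' + N * (1 + d * (2 * √κ)⁻¹) * K)) := by
  have hrk : 0 < r + κ := by positivity
  set S : ℝ := √(r + κ) with hS
  have S0 : 0 < S := Real.sqrt_pos.2 hrk
  have S1 : S ≤ 1 := Real.sqrt_le_one.2 hrκ
  have κ0 : 0 < √κ := Real.sqrt_pos.2 hκ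
  have hκS : √κ ≤ S := Real.sqrt_le_sqrt (by linarith)
  have hSr : S - √κ ≤ √r := by
    rw [sub_le_iff_le_add]
    refine Real.sqrt_le_iff.2 ⟨by positivity, ?_⟩
    have h1 := Real.sq_sqrt hr
    have h2 := Real.sq_sqrt hκ.le
    have h3 := mul_nonneg (Real.sqrt_nonneg r) κ0.le
    nlinarith
  have hc0 : 0 ≤ xi * th := mul_nonneg hxi hth
  have hJ' : ∀ i, J i * th = -x i * th := by
    intro i
    by_cases h : th = 0
    · simp [h]
    · rw [hJ h i]
  have e1 : ∑ i, ((-(4 * ((r + κ) * S))⁻¹ * x i * J i + (2 * S)⁻¹ * DJ i) * (xi * th)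
          + (2 * S)⁻¹ * J i * (th * y i)) = (4 * ((r + κ) * S))⁻¹ * (xi * th) * (∑ i, x i ^ 2)
          + (2 * S)⁻¹ * (xi * th) * (∑ i, DJ i) + (2 * S)⁻¹ * th * ∑ i, J i * y i := by
    rw [Finset.mul_sum, Finset.mul_sum, Finset.mul_sum, ← Finset.sum_add_distrib,
      ← Finset.sum_add_distrib]
    refine Finset.sum_congr rfl fun i _ => ?_
    linear_combination (-(4 * ((r + κ) * S))⁻¹ * x i * xi) * hJ' i
  rw [e1]
  -- The two halves of the continuity equation recombine into the source, which enters with the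
  -- favourable sign.
  have a1 : (2 * S)⁻¹ * Tr * (xi * th) + (2 * S)⁻¹ * (xi * th) * (∑ i, DJ i)
      = (2 * S)⁻¹ * (xi * th) * B := by rw [← heq]; ring
  have a2 : 0 ≤ (2 * S)⁻¹ * (xi * th) * B := by positivity
  -- Since `r + κ ≤ 1`, one has `(r + κ)^(3/2) ≤ r + κ`, so the production of `√ρ` dominates the
  -- Fisher information. This is where the upper bound on the density is needed.
  have a3 : xi * th * (∑ i, x i ^ 2) / (r + κ)
      ≤ 4 * ((4 * ((r + κ) * S))⁻¹ * (xi * th) * (∑ i, x i ^ 2)) := by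
    have h1 : 0 ≤ ∑ i, x i ^ 2 := Finset.sum_nonneg fun i _ => sq_nonneg _
    have h2 : (r + κ)⁻¹ ≤ ((r + κ) * S)⁻¹ := by
      apply inv_anti₀ (by positivity)
      exact mul_le_of_le_one_right hrk.le S1
    have h3 : 4 * ((4 * ((r + κ) * S))⁻¹ * (xi * th) * (∑ i, x i ^ 2))
      = (xi * th * (∑ i, x i ^ 2)) * ((r + κ) * S)⁻¹ := by
      rw [mul_inv]; ring
    rw [h3, div_eq_mul_inv]
    exact mul_le_mul_of_nonneg_left h2 (by positivity)
  have a4 : -s' ≤ (S - √κ) * (dth * xi) := by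
    have h1 : -(dth * √r) ≥ -((S - √κ) * (dth * xi)) := by
      have h2 : (S - √κ) * xi ≤ √r := by
        calc _ ≤ (S - √κ) * 1 := mul_le_mul_of_nonneg_left hxi1 (by linarith)
          _ ≤ _ := by linarith
      nlinarith
    linarith
  have a5 : -(N * K) ≤ (S - √κ) * (th * v') := by
    have h1 : |(S - √κ) * (th * v')| ≤ N * K := by
      rw [abs_mul, abs_mul, abs_of_nonneg (by linarith : 0 ≤ S - √κ), abs_of_nonneg hth]
      refine le_trans ?_ hv
      refine mul_le_mul hSr ?_ (by positivity) (Real.sqrt_nonneg _)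
      exact mul_le_of_le_one_left (abs_nonneg _) hth1
    exact neg_le_of_abs_le h1
  have a6 : -(N * (d * (2 * √κ)⁻¹) * K) ≤ (2 * S)⁻¹ * th * ∑ i, J i * y i := by
    have h1 : |∑ i, J i * y i| ≤ d * (K * N) := by
      refine (Finset.abs_sum_le_sum_abs _ _).trans ?_
      calc _ ≤ ∑ i : Fin d, K * N := Finset.sum_le_sum fun i _ => by
            rw [abs_mul]
            exact mul_le_mul (hJK i) (hy i) (abs_nonneg _) ((abs_nonneg _).trans (hJK i))
        _ = _ := by simp
    have h2 : |(2 * S)⁻¹ * th * ∑ i, J i * y i| ≤ (2 * √κ)⁻¹ * (d * (K * N)) := by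
      rw [abs_mul, abs_of_nonneg (by positivity : 0 ≤ (2 * S)⁻¹ * th)]
      refine mul_le_mul ?_ h1 (abs_nonneg _) (by positivity)
      calc _ ≤ (2 * S)⁻¹ * 1 := by gcongr
        _ = (2 * S)⁻¹ := mul_one _
        _ ≤ _ := by gcongr
    have := neg_le_of_abs_le h2
    linarith
  linarith

end Kolmogorov

namespace Kolmogorov

variable {d : ℕ}

section Fisher

variable {ε R : ℝ} {α : TimePhase d → ℝ}

theorem integrable_gaussE {c : ℝ} (hc : 0 < c) : Integrable (gaussE (d := d) c) :=
  integrable_gauss hc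

theorem IsSource.gradient_early (h : IsSource R α) (hε : 0 < ε) {z : TimePhase d}
    (hz : z.1 ≤ 1 / 4 + ε) (i : Fin d) : fderiv ℝ (dens ε α) z (dirV i) = 0 := by
  rw [h.fderiv_dens_velocity hε, h.integral_eq_zero fun t ht => switch_of_le hε (by linarith [ht.1]),
    neg_zero]

/-- Integrable phase space majorants of the density and the current. -/
theorem IsSource.exists_majorant (h : IsSource R α) (hε : 0 < ε) (hR : 0 ≤ R) :
    ∃ H : Phase d → ℝ, Integrable H ∧ ∀ z : TimePhase d, z.1 ≤ 1 →
      √(dens ε α z) * (1 + ‖z.2.2‖) ≤ H z.2 ∧ (1 + ‖z.2.2‖) * dens ε α z ≤ H z.2 ∧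
      ∀ i, |curr ε α i z| ≤ H z.2 := by
  obtain ⟨C, c, hC, hc, hb⟩ := exists_gaussian_bound d hε hR
  set A : ℝ := ∫ q, α q with hA
  have A0 : 0 ≤ A := integral_nonneg h.nonneg
  refine ⟨fun p => √(C * A) * gaussE (c / 2) p + C * A * gaussE c p,
    ((integrable_gaussE (by positivity)).const_mul _).add ((integrable_gaussE hc).const_mul _),
    fun z hz => ?_⟩
  have g1 := (gaussE_pos (c / 2) z.2).le
  have g2 := (gaussE_pos c z.2).le
  have CA : 0 ≤ C * A := by positivity
  have ρ0 := h.dens_nonneg ε z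
  have v0 := norm_nonneg z.2.2
  rcases lt_or_ge z.1 (1 / 4) with hz' | hz'
  · have e1 := h.dens_early hε (by linarith : z.1 ≤ 1 / 4 + ε)
    have e2 := h.curr_early hε (by linarith : z.1 ≤ 1 / 4 + ε)
    refine ⟨?_, ?_, fun i => ?_⟩
    · rw [e1]; simp only [Real.sqrt_zero, zero_mul]; positivity
    · rw [e1]; simp only [mul_zero]; positivity
    · rw [e2]; simp only [abs_zero]; positivity
  obtain ⟨b1, b2, -⟩ := h.gaussian_bounds hε hC hb ⟨hz', hz⟩ fun t _ hs => by
    by_contra hlt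
    exact hs (switch_of_le hε (by linarith))
  set K : ℝ := C * gaussE c z.2 * A with hK
  have K0 : 0 ≤ K := by positivity
  have hρK : dens ε α z ≤ K := by
    refine le_trans ?_ b1
    have : 1 ≤ (1 + ‖z.2.2‖) ^ 2 := by nlinarith
    exact le_mul_of_one_le_left ρ0 this
  have e3 : K = C * A * gaussE c z.2 := by rw [hK]; ring
  have hsq : 0 ≤ √(C * A) * gaussE (c / 2) z.2 := by positivity
  refine ⟨?_, ?_, fun i => ?_⟩
  · have h1 : √(dens ε α z) * (1 + ‖z.2.2‖) = √((1 + ‖z.2.2‖) ^ 2 * dens ε α z) := by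
      rw [Real.sqrt_mul (by positivity), Real.sqrt_sq (by positivity), mul_comm]
    have h2 : √K = √(C * A) * gaussE (c / 2) z.2 := by
      rw [e3, Real.sqrt_mul CA, sqrt_gaussE]
    beta_reduce
    rw [h1]
    have h3 := Real.sqrt_le_sqrt b1
    rw [h2] at h3
    rw [e3] at K0
    linarith
  · beta_reduce
    rw [← e3]
    have : (1 + ‖z.2.2‖) * dens ε α z ≤ (1 + ‖z.2.2‖) ^ 2 * dens ε α z := by
      refine mul_le_mul_of_nonneg_right ?_ ρ0
      nlinarith
    linarith
  · beta_reduce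
    rw [← e3]
    have h1 : curr ε α i z ^ 2 ≤ K * K := by
      calc _ ≤ ∑ i, curr ε α i z ^ 2 :=
            Finset.single_le_sum (f := fun i => curr ε α i z ^ 2) (fun i _ => sq_nonneg _)
              (Finset.mem_univ i)
        _ ≤ K * dens ε α z := b2
        _ ≤ K * K := mul_le_mul_of_nonneg_left hρK K0
    have h2 : |curr ε α i z| ≤ K := abs_le_of_sq_le_sq (by nlinarith) K0
    linarith

/-- Production of the entropy `∫ √ρ`. A total divergence integrates to zero, so the Fisher
information is bounded by the term from the time cutoff, which averages `∫ √ρ` over times in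
`[13/16, 27/32]`, and by errors from the space cutoff. The shift by `κ` allows for zeros of the
density. -/
theorem IsSource.fisher_regularized (h : IsSource R α) (hε : 0 < ε)
    {E : Phase d → ℝ} (hE : Integrable E) (hE0 : ∀ p, 0 ≤ E p)
    (hEb : ∀ z : TimePhase d, z.1 ∈ Icc (13 / 16 : ℝ) (7 / 8) → √(dens ε α z) ≤ E z.2)
    {H : Phase d → ℝ} (hH : Integrable H)
    (hHb : ∀ z : TimePhase d, z.1 ≤ 1 → √(dens ε α z) * (1 + ‖z.2.2‖) ≤ H z.2 ∧
      (1 + ‖z.2.2‖) * dens ε α z ≤ H z.2 ∧ ∀ i, |curr ε α i z| ≤ H z.2)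
    {θ : ℝ → ℝ} (hθ : ContDiff ℝ ∞ θ) (hθ0 : ∀ t, 0 ≤ θ t) (hθ1 : ∀ t, θ t ≤ 1)
    (hθs : ∀ t, 27 / 32 ≤ t → θ t = 0) (hθd : ∀ t, deriv θ t ≤ 0)
    (hθo : ∀ t, t ∉ Icc (13 / 16 : ℝ) (27 / 32) → deriv θ t = 0) (hθi : ∫ t, deriv θ t = -1)
    {κ : ℝ} (hκ : 0 < κ) (hκ1 : κ ≤ 1 / 2)
    {N : ℝ} (hN : 0 ≤ N) {ξ : Phase d → ℝ} (hξ : ContDiff ℝ ∞ ξ) (hξc : HasCompactSupport ξ)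
    (hξ0 : ∀ p, 0 ≤ ξ p) (hξ1 : ∀ p, ξ p ≤ 1) (hξn : ∀ p, ‖fderiv ℝ ξ p‖ ≤ N) :
    ∫⁻ z, ENNReal.ofReal (ξ z.2 * θ z.1 * (∑ i, fderiv ℝ (dens ε α) z (dirV i) ^ 2)
        / (dens ε α z + κ)) ≤
      ENNReal.ofReal (4 * ((∫ p, E p) + N * (1 + d * (2 * √κ)⁻¹) * ∫ p, H p)) := by
  set ρ := dens ε α with hρ
  set J := curr ε α with hJ
  have ρ0 : ∀ z, 0 ≤ ρ z := h.dens_nonneg ε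
  have cρ : ContDiff ℝ 1 ρ := h.contDiff_dens hε
  have cJ : ∀ i, ContDiff ℝ 1 (J i) := h.contDiff_curr hε
  set c : TimePhase d → ℝ := fun z => ξ z.2 * θ z.1 with hc
  have cc : ContDiff ℝ 1 c := ((hξ.comp contDiff_snd).mul (hθ.comp contDiff_fst)).of_le
    (by exact_mod_cast le_top)
  have c0 : ∀ z, 0 ≤ c z := fun z => mul_nonneg (hξ0 _) (hθ0 _)
  have ρκ : ∀ z, 0 < ρ z + κ := fun z => add_pos_of_nonneg_of_pos (ρ0 z) hκ
  have sκ : ∀ z, 0 < √(ρ z + κ) := fun z => Real.sqrt_pos.2 (ρκ z)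
  -- The localized entropy density; `Q` is its current. Subtracting `√κ` makes `P` vanish where the
  -- density does.
  set P : TimePhase d → ℝ := fun z => (√(ρ z + κ) - √κ) * c z with hP
  set Q : Fin d → TimePhase d → ℝ := fun i z => (2 * √(ρ z + κ))⁻¹ * J i z * c z with hQ
  have cs : ContDiff ℝ 1 fun z => √(ρ z + κ) := (cρ.add contDiff_const).sqrt fun z => (ρκ z).ne'
  have ci : ContDiff ℝ 1 fun z => (2 * √(ρ z + κ))⁻¹ :=
    (contDiff_const.mul cs).inv fun z => (mul_pos two_pos (sκ z)).ne'
  have cP : ContDiff ℝ 1 P := (cs.sub contDiff_const).mul cc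
  have cQ : ∀ i, ContDiff ℝ 1 (Q i) := fun i => (ci.mul (cJ i)).mul cc
  set KS : Set (TimePhase d) := Icc (1 / 4 + ε) (27 / 32) ×ˢ tsupport ξ with hKS
  have cKS : IsCompact KS := isCompact_Icc.prod hξc
  have supp : ∀ u : TimePhase d → ℝ, (∀ z : TimePhase d, z.1 ≤ 1 / 4 + ε → u z = 0) →
      ∀ z ∉ KS, u z * c z = 0 := by
    intro u hu z hz
    rw [hKS, mem_prod, not_and_or, mem_Icc, not_and_or, not_le, not_le] at hz
    rcases hz with (hz | hz) | hz
    · rw [hu z hz.le, zero_mul]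
    · simp [hc, hθs _ hz.le]
    · simp [hc, image_eq_zero_of_notMem_tsupport hz]
  have tsub : ∀ u : TimePhase d → ℝ, (∀ z ∉ KS, u z = 0) → tsupport u ⊆ KS := fun u hu =>
    closure_minimal (fun z hz => by by_contra h'; exact hz (hu z h')) cKS.isClosed
  have sP : tsupport P ⊆ KS := tsub _ (supp _ fun z hz => by
    rw [hρ, h.dens_early hε hz, zero_add, sub_self])
  have sQ : ∀ i, tsupport (Q i) ⊆ KS := fun i => tsub _ (supp _ fun z hz => by
    rw [hJ, h.curr_early hε hz i, mul_zero])
  have kP : HasCompactSupport P := cKS.of_isClosed_subset (isClosed_tsupport _) sP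
  have kQ : ∀ i, HasCompactSupport (Q i) := fun i =>
    cKS.of_isClosed_subset (isClosed_tsupport _) (sQ i)
  have dP : ∀ z e, fderiv ℝ P z e = ((2 * √(ρ z + κ))⁻¹ * fderiv ℝ ρ z e) * c z
      + (√(ρ z + κ) - √κ) * fderiv ℝ c z e := by
    intro z e
    have h1 := (hasDerivAt_sqrt_add hκ (ρ0 z)).comp_hasFDerivAt z
      ((cρ.differentiable one_ne_zero) z).hasFDerivAt
    have h2 : fderiv ℝ P z = _ :=
      (h1.mul ((cc.differentiable one_ne_zero) z).hasFDerivAt).fderiv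
    rw [h2]
    simp only [add_apply, FunLike.coe_smul, Pi.smul_apply, smul_eq_mul, Function.comp_apply]
    ring
  have dQ : ∀ i z e, fderiv ℝ (Q i) z e = (-(4 * ((ρ z + κ) * √(ρ z + κ)))⁻¹ * fderiv ℝ ρ z e * J i z
      + (2 * √(ρ z + κ))⁻¹ * fderiv ℝ (J i) z e) * c z
      + (2 * √(ρ z + κ))⁻¹ * J i z * fderiv ℝ c z e := by
    intro i z e
    have h1 := (hasDerivAt_inv_sqrt_add hκ (ρ0 z)).comp_hasFDerivAt z
      ((cρ.differentiable one_ne_zero) z).hasFDerivAt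
    have h2 : fderiv ℝ (Q i) z = _ :=
      ((h1.mul (((cJ i).differentiable one_ne_zero) z).hasFDerivAt).mul
        ((cc.differentiable one_ne_zero) z).hasFDerivAt).fderiv
    rw [h2]
    simp only [add_apply, FunLike.coe_smul, Pi.smul_apply, smul_eq_mul, Function.comp_apply,
      Pi.mul_apply]
    ring
  set D : TimePhase d → ℝ := fun z => fderiv ℝ P z (dirT z) + ∑ i, fderiv ℝ (Q i) z (dirV i) with hD
  have iP : Integrable fun z => fderiv ℝ P z (dirT z) :=
    ((cP.continuous_fderiv one_ne_zero).clm_apply continuous_dirT).integrable_of_hasCompactSupport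
      ((kP.fderiv (𝕜 := ℝ)).mono fun z hz => by
        rw [Function.mem_support] at hz ⊢
        intro h0; rw [h0] at hz; exact hz rfl)
  have iQ : ∀ i, Integrable fun z => fderiv ℝ (Q i) z (dirV i) := fun i =>
    (((cQ i).continuous_fderiv one_ne_zero).clm_apply
      continuous_const).integrable_of_hasCompactSupport
      (((kQ i).fderiv (𝕜 := ℝ)).mono fun z hz => by
        rw [Function.mem_support] at hz ⊢
        intro h0; rw [h0] at hz; exact hz rfl)
  have iD : Integrable D := iP.add (integrable_finsetSum _ fun i _ => iQ i)
  have D0 : ∫ z, D z = 0 := by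
    rw [hD, integral_add iP (integrable_finsetSum _ fun i _ => iQ i),
      integral_finsetSum _ fun i _ => iQ i, integral_transport_eq_zero cP kP,
      Finset.sum_eq_zero fun i _ => integral_fderiv_eq_zero (cQ i) (kQ i) (dirV i), add_zero]
  have Dout : ∀ z ∉ KS, D z = 0 := by
    intro z hz
    have h1 : ∀ u : TimePhase d → ℝ, tsupport u ⊆ KS → fderiv ℝ u z = 0 := fun u hu =>
      eq_zero_of_notMem_of_tsupport_subset ((tsupport_fderiv_subset ℝ).trans hu) hz
    simp only [hD]
    rw [h1 P sP, Finset.sum_eq_zero fun i _ => by rw [h1 (Q i) (sQ i)]; rfl]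
    simp
  set g : TimePhase d → ℝ := fun z => ξ z.2 * θ z.1 * (∑ i, fderiv ℝ ρ z (dirV i) ^ 2)
    / (ρ z + κ) with hg
  have g0 : ∀ z, 0 ≤ g z := fun z => div_nonneg (mul_nonneg (c0 z)
    (Finset.sum_nonneg fun i _ => sq_nonneg _)) (ρκ z).le
  have gout : ∀ z ∉ KS, g z = 0 := by
    intro z hz
    have h1 := supp (fun z => ∑ i, fderiv ℝ ρ z (dirV i) ^ 2) (fun z hz => by
      simp [hρ, h.gradient_early hε hz]) z hz
    simp only [hg]
    rw [mul_comm] at h1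
    change ξ z.2 * θ z.1 * _ = 0 at h1
    rw [h1, zero_div]
  have cg : Continuous g := by
    refine Continuous.div (cc.continuous.mul (continuous_finsetSum _ fun i _ => ?_))
      (cρ.continuous.add continuous_const) fun z => (ρκ z).ne'
    exact ((cρ.continuous_fderiv one_ne_zero).clm_apply continuous_const).pow 2
  have ig : Integrable g := cg.integrable_of_hasCompactSupport
    (HasCompactSupport.intro cKS gout)
  have cdθ : Continuous (deriv θ) := hθ.continuous_deriv (by simp)
  have idθ : Integrable (deriv θ) := cdθ.integrable_of_hasCompactSupport
    (HasCompactSupport.intro isCompact_Icc hθo)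
  set S : Set (TimePhase d) := slab d (1 / 4) 1 with hS
  have mS : MeasurableSet S := (isOpen_slab _ _).measurableSet
  set F : ℝ := N * (1 + d * (2 * √κ)⁻¹) with hF
  have F0 : 0 ≤ F := by positivity
  have H0 : ∀ p, 0 ≤ H p := fun p =>
    (mul_nonneg (Real.sqrt_nonneg _) (by positivity)).trans (hHb (0, p) (by norm_num)).1
  have i1 : Integrable fun z : TimePhase d => -deriv θ z.1 * E z.2 := by
    rw [Measure.volume_eq_prod]; exact idθ.neg.mul_prod hE
  have i2 : Integrable (S.indicator fun z => F * H z.2) := by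
    rw [integrable_indicator_iff mS]
    exact (integrableOn_slab_snd hH _ _).const_mul F
  have key : ∀ z, g z ≤ 4 * (D z + (-deriv θ z.1 * E z.2 + S.indicator (fun z => F * H z.2) z)) := by
    intro z
    by_cases hz : z ∈ KS
    · obtain ⟨⟨hz1, hz2⟩, -⟩ := hz
      have hzS : z ∈ S := ⟨⟨by linarith, by linarith⟩, mem_univ _⟩
      obtain ⟨b1, -, b3⟩ := hHb z (by linarith)
      have v0 := norm_nonneg z.2.2
      rw [indicator_of_mem hzS]
      simp only [hg, hD, dP, dQ, hF]
      have dcT : fderiv ℝ c z (dirT z) = deriv θ z.1 * ξ z.2 + θ z.1 * fderiv ℝ ξ z.2 (z.2.2, 0) := by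
        rw [fderiv_cutoff hξ hθ]; simp [dirT]
      have dcV : ∀ i, fderiv ℝ c z (dirV i)
          = θ z.1 * fderiv ℝ ξ z.2 (0, EuclideanSpace.single i 1) := by
        intro i; rw [fderiv_cutoff hξ hθ]; simp [dirV]
      rw [dcT]
      simp_rw [dcV]
      refine dissipation_pointwise hκ (ρ0 z) ?_ (h.smear_nonneg hε z) (hξ0 _) (hξ1 _) (hθ0 _)
        (hθ1 _) (hθd _) (h.continuity_equation hε z) ?_ ?_ ?_ b3 ?_
      · have := h.dens_le_half hε (by linarith : z.1 ≤ 7 / 8)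
        linarith
      · exact fun _ i => h.curr_eq hε (by linarith) i
      · by_cases ht : z.1 ∈ Icc (13 / 16 : ℝ) (27 / 32)
        · have h1 := hEb z ⟨ht.1, by linarith [ht.2]⟩
          rw [← neg_mul]
          exact mul_le_mul_of_nonneg_left h1 (neg_nonneg.2 (hθd _))
        · rw [hθo _ ht]; simp
      · have h2 := (fderiv ℝ ξ z.2).le_opNorm (z.2.2, 0)
        have h3 : ‖((z.2.2, 0) : Phase d)‖ = ‖z.2.2‖ := by simp [Prod.norm_def]
        rw [h3, Real.norm_eq_abs] at h2
        have h4 := Real.sqrt_nonneg (ρ z)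
        calc _ ≤ √(ρ z) * (N * ‖z.2.2‖) := by
              refine mul_le_mul_of_nonneg_left (h2.trans ?_) h4
              exact mul_le_mul_of_nonneg_right (hξn _) v0
          _ = N * (√(ρ z) * ‖z.2.2‖) := by ring
          _ ≤ N * H z.2 := by
              refine mul_le_mul_of_nonneg_left ?_ hN
              linarith
      · intro i
        have h3 := (fderiv ℝ ξ z.2).le_opNorm (0, EuclideanSpace.single i 1)
        rw [norm_dirV_snd, mul_one, Real.norm_eq_abs] at h3
        exact h3.trans (hξn _)
    · rw [gout z hz, Dout z hz, zero_add]
      have h1 : 0 ≤ S.indicator (fun z => F * H z.2) z :=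
        indicator_nonneg (fun z _ => mul_nonneg F0 (H0 _)) z
      have h2 : 0 ≤ -deriv θ z.1 * E z.2 := mul_nonneg (neg_nonneg.2 (hθd _)) (hE0 _)
      positivity
  rw [← ofReal_integral_eq_lintegral_ofReal ig (Eventually.of_forall g0)]
  apply ENNReal.ofReal_le_ofReal
  have i12 : Integrable fun z : TimePhase d =>
      -deriv θ z.1 * E z.2 + S.indicator (fun z => F * H z.2) z := i1.add i2
  refine (integral_mono ig ((iD.add i12).const_mul 4) key).trans ?_
  -- The factor `3 / 4` is the length of the time interval of the slab.
  have e1 : ∫ z, 4 * (D z + (-deriv θ z.1 * E z.2 + S.indicator (fun z => F * H z.2) z))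
      = 4 * ((∫ p, E p) + 3 / 4 * (F * ∫ p, H p)) := by
    rw [integral_const_mul, integral_add iD i12, integral_add i1 i2, D0, zero_add,
      integral_indicator mS, integral_const_mul, hS, setIntegral_slab_snd (by norm_num),
      Measure.volume_eq_prod, integral_prod_mul (fun t => -deriv θ t) E, integral_neg, hθi]
    ring
  change ∫ z, 4 * (D z + (-deriv θ z.1 * E z.2 + S.indicator (fun z => F * H z.2) z)) ≤ _
  rw [e1]
  have : 0 ≤ F * ∫ p, H p := mul_nonneg F0 (integral_nonneg H0)
  linarith

/-- The Fisher information of the density up to time `13/16` is bounded by an integral of the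
density at later times. -/
theorem IsSource.fisher_early (h : IsSource R α) (hε : 0 < ε) (hR : 0 ≤ R)
    {E : Phase d → ℝ} (hE : Integrable E) (hE0 : ∀ p, 0 ≤ E p)
    (hEb : ∀ z : TimePhase d, z.1 ∈ Icc (13 / 16 : ℝ) (7 / 8) → √(dens ε α z) ≤ E z.2) :
    ∫⁻ z in {z : TimePhase d | z.1 ≤ 13 / 16},
      ENNReal.ofReal ((∑ i, fderiv ℝ (dens ε α) z (dirV i) ^ 2) / dens ε α z) ≤
      ENNReal.ofReal (4 * ∫ p, E p) := by
  obtain ⟨H, hH, hHb⟩ := h.exists_majorant hε hR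
  obtain ⟨M, hM, hcut⟩ := exists_cutoff d
  obtain ⟨θ, cθ, θ0, θ1, θlow, θhigh, θd, θout, θint⟩ :=
    exists_time_cutoff (show (13 / 16 : ℝ) < 27 / 32 by norm_num)
  -- The radius `(n + 2)²` is matched with the shift `κ n = (n + 2)⁻²` below: the worst error is of
  -- order `N / √κ`, that is, of order `1 / (n + 2)`.
  choose ξ hξ hξc hξ0 hξ1 hξone hξn hξd using fun n : ℕ =>
    hcut (((n : ℝ) + 2) ^ 2) (by positivity)
  set ρ := dens ε α with hρ
  have ρ0 : ∀ z, 0 ≤ ρ z := h.dens_nonneg ε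
  have cρ : ContDiff ℝ 1 ρ := h.contDiff_dens hε
  set κ : ℕ → ℝ := fun n => (1 / ((n : ℝ) + 2)) ^ 2 with hκ
  have κ0 : ∀ n, 0 < κ n := fun n => by positivity
  have κ1 : ∀ n, κ n ≤ 1 / 2 := fun n => by
    have h1 : (1 : ℝ) / ((n : ℝ) + 2) ≤ 1 / 2 := by
      apply one_div_le_one_div_of_le two_pos
      linarith [(Nat.cast_nonneg n : (0 : ℝ) ≤ n)]
    have h2 : (0 : ℝ) ≤ 1 / ((n : ℝ) + 2) := by positivity
    simp only [hκ]; nlinarith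
  have key := fun n : ℕ => h.fisher_regularized hε hE hE0 hEb hH hHb cθ θ0 θ1 θhigh θd θout θint
    (κ0 n) (κ1 n) (N := M / ((n : ℝ) + 2) ^ 2) (by positivity) (hξ n) (hξc n) (hξ0 n) (hξ1 n)
    (hξn n)
  set gn : ℕ → TimePhase d → ℝ≥0∞ := fun n z => ENNReal.ofReal (ξ n z.2 * θ z.1
    * (∑ i, fderiv ℝ ρ z (dirV i) ^ 2) / (ρ z + κ n)) with hgn
  have mg : Continuous fun z => ∑ i : Fin d, fderiv ℝ ρ z (dirV i) ^ 2 :=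
    continuous_finsetSum _ fun i _ =>
      ((cρ.continuous_fderiv one_ne_zero).clm_apply continuous_const).pow 2
  have hmeas : ∀ n, Measurable (gn n) := fun n => by
    refine ENNReal.measurable_ofReal.comp (Measurable.div ?_ ?_)
    · exact ((((hξ n).continuous.comp continuous_snd).mul (cθ.continuous.comp continuous_fst)).mul
        mg).measurable
    · exact (cρ.continuous.add continuous_const).measurable
  have l0 : Tendsto (fun n : ℕ => 1 / ((n : ℝ) + 2)) atTop (𝓝 0) := by
    have := (tendsto_one_div_add_atTop_nhds_zero_nat (𝕜 := ℝ)).comp (tendsto_add_atTop_nat 1)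
    refine this.congr fun n => ?_
    simp only [Function.comp_apply]
    push_cast
    ring_nf
  have lκ : Tendsto κ atTop (𝓝 0) := by
    have := l0.pow 2
    rwa [zero_pow two_ne_zero] at this
  -- The quotient with denominator zero is zero by convention, so the regularized quotients converge
  -- to it only if the gradient vanishes where the density does.
  have grad0 : ∀ z : TimePhase d, z.1 ≤ 13 / 16 → ρ z = 0 →
      ∑ i, fderiv ℝ ρ z (dirV i) ^ 2 = 0 := by
    intro z hz hρz
    rcases lt_or_ge z.1 (1 / 4) with hz' | hz'
    · exact Finset.sum_eq_zero fun i _ => by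
        rw [hρ, h.gradient_early hε (by linarith), zero_pow two_ne_zero]
    · obtain ⟨C, c, hC, hc, hb⟩ := exists_gaussian_bound d hε hR
      obtain ⟨-, -, b3⟩ := h.gaussian_bounds hε hC hb ⟨hz', by linarith⟩ fun t _ hs => by
        by_contra hlt
        exact hs (switch_of_le hε (by linarith))
      rw [← hρ, hρz, mul_zero] at b3
      exact le_antisymm b3 (Finset.sum_nonneg fun i _ => sq_nonneg _)
  have hlim : ∀ z : TimePhase d, z.1 ≤ 13 / 16 → ENNReal.ofReal
      ((∑ i, fderiv ℝ ρ z (dirV i) ^ 2) / ρ z) ≤ liminf (fun n => gn n z) atTop := by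
    intro z hz
    refine le_of_eq (Tendsto.liminf_eq ?_).symm
    refine (ENNReal.continuous_ofReal.tendsto _).comp ?_
    have h1 : Tendsto (fun n : ℕ => (∑ i, fderiv ℝ ρ z (dirV i) ^ 2) / (ρ z + κ n)) atTop
        (𝓝 ((∑ i, fderiv ℝ ρ z (dirV i) ^ 2) / ρ z)) := by
      by_cases hρz : ρ z = 0
      · simp [grad0 z hz hρz]
      · have := tendsto_const_nhds (x := ρ z) |>.add lκ
        rw [add_zero] at this
        exact tendsto_const_nhds.div this hρz
    refine h1.congr' ?_
    obtain ⟨n₀, hn₀⟩ := exists_nat_ge ‖z.2‖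
    filter_upwards [eventually_ge_atTop n₀] with n hn
    have hn' : (n₀ : ℝ) ≤ n := by exact_mod_cast hn
    rw [hξone n z.2 (by nlinarith [(Nat.cast_nonneg n : (0 : ℝ) ≤ n)]), θlow _ hz, one_mul, one_mul]
  calc _ ≤ ∫⁻ z in {z : TimePhase d | z.1 ≤ 13 / 16}, liminf (fun n => gn n z) atTop := by
        refine setLIntegral_mono' (measurableSet_le measurable_fst measurable_const) hlim
    _ ≤ ∫⁻ z, liminf (fun n => gn n z) atTop := setLIntegral_le_lintegral _ _
    _ ≤ liminf (fun n => ∫⁻ z, gn n z) atTop := lintegral_liminf_le hmeas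
    _ ≤ liminf (fun n : ℕ => ENNReal.ofReal (4 * ((∫ p, E p) + M / ((n : ℝ) + 2) ^ 2
          * (1 + d * (2 * √(κ n))⁻¹) * ∫ p, H p))) atTop := liminf_le_liminf
        (Eventually.of_forall key)
    _ = _ := by
        refine Tendsto.liminf_eq ((ENNReal.continuous_ofReal.tendsto _).comp ?_)
        have h1 : ∀ n : ℕ, M / ((n : ℝ) + 2) ^ 2 * (1 + d * (2 * √(κ n))⁻¹)
            = M * (1 / ((n : ℝ) + 2)) ^ 2 + M * d / 2 * (1 / ((n : ℝ) + 2)) := by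
          intro n
          simp only [hκ]
          rw [Real.sqrt_sq (by positivity)]
          field_simp
        simp_rw [h1]
        have h2 : Tendsto (fun n : ℕ => 4 * ((∫ p, E p) + (M * (1 / ((n : ℝ) + 2)) ^ 2
            + M * d / 2 * (1 / ((n : ℝ) + 2))) * ∫ p, H p)) atTop
            (𝓝 (4 * ((∫ p, E p) + (M * 0 ^ 2 + M * d / 2 * 0) * ∫ p, H p))) :=
          ((((l0.pow 2).const_mul M).add (l0.const_mul _)).mul_const _ |>.const_add _).const_mul 4
        simpa using h2

end Fisher

end Kolmogorov

namespace Kolmogorov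

variable {d : ℕ}

/-! ### Density flows generated by sources. -/

section Flow

variable {ε R : ℝ} {α : TimePhase d → ℝ}

theorem exists_deriv_switch_bound (hε : 0 < ε) :
    ∃ M : ℝ, 0 ≤ M ∧ ∀ s, deriv (switch ε) s ≤ M := by
  obtain ⟨M, hM⟩ := contDiff_deriv_switch.continuous.bounded_above_of_compact_support
    hasCompactSupport_deriv_switch
  have hM0 : 0 ≤ M := (norm_nonneg _).trans (hM 0)
  refine ⟨ε⁻¹ * M, by positivity, fun s => ?_⟩
  rw [deriv_switch]
  exact mul_le_mul_of_nonneg_left ((le_abs_self _).trans (hM _)) (by positivity)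

/-- At ages below `ε` the derivative of the switch vanishes, beyond that the kernel has a Gaussian
bound, and `ε ≤ 1/32` lets the smeared source end before time `1`. -/
theorem IsSource.integrable_smear (h : IsSource R α) (hε : 0 < ε) (hε1 : ε ≤ 1 / 32)
    (hR : 0 ≤ R) : Integrable (smear ε α) := by
  obtain ⟨C, c, hC, hc, hb⟩ := exists_gaussian_bound d hε hR
  obtain ⟨M, hM0, hM⟩ := exists_deriv_switch_bound hε
  set S : Set (TimePhase d) := slab d (1 / 4) 1 with hS
  have mS : MeasurableSet S := (isOpen_slab _ _).measurableSet
  have hi : Integrable (S.indicator fun z => M * (C * gaussE c z.2) * ∫ q, α q) := by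
    rw [integrable_indicator_iff mS]
    exact integrableOn_slab_snd (((integrable_gaussE hc).const_mul C).const_mul M |>.mul_const _) _ _
  refine hi.mono' (h.contDiff_smear hε).continuous.aestronglyMeasurable
    (Eventually.of_forall fun z => ?_)
  rw [Real.norm_of_nonneg (h.smear_nonneg hε z)]
  by_cases hz : z ∈ S
  · rw [indicator_of_mem hz, smear, ← integral_const_mul]
    refine integral_mono (integrable_superpose h.continuous h.compact
      ((contDiff_source hε).continuous.comp (Continuous.prodMk_right z)))
      (h.integrable.const_mul _) fun q => ?_
    simp only
    have hg := (gaussE_pos c z.2).le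
    by_cases hq : α q = 0
    · simp [hq]
    rw [mul_comm (M * _)]
    refine mul_le_mul_of_nonneg_left ?_ (h.nonneg q)
    rcases le_or_gt (z.1 - q.1) ε with hs | hs
    · rw [deriv_switch_of_le hε hs, zero_mul]; positivity
    · refine mul_le_mul (hM _) ?_ (kern_pos _ _).le hM0
      have hz1 := hz.1
      refine le_trans ?_ (hb z q ⟨⟨hz1.1.le, hz1.2.le⟩, h.time q hq, hs.le, h.space q hq⟩).1
      refine le_mul_of_one_le_left (kern_pos _ _).le ?_
      nlinarith [norm_nonneg z.2.2]
  · rw [indicator_of_notMem hz]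
    apply le_of_eq
    rcases le_or_gt z.1 (1 / 4) with hz' | hz'
    · exact h.smear_early hε (by linarith)
    · refine h.smear_late hε ?_
      by_contra hlt
      exact hz ⟨⟨hz', by linarith⟩, mem_univ _⟩

theorem integrable_of_lintegral_le {X : Type*} [MeasurableSpace X] {μ : Measure X} {W : X → ℝ}
    (hW : Measurable W) (hW0 : ∀ x, 0 ≤ W x) {C : ℝ} (hC : 0 ≤ C)
    (h : ∫⁻ x, ENNReal.ofReal (W x) ∂μ ≤ ENNReal.ofReal C) :
    Integrable W μ ∧ ∫ x, W x ∂μ ≤ C := by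
  refine ⟨⟨hW.aestronglyMeasurable, ?_⟩, ?_⟩
  · rw [hasFiniteIntegral_iff_ofReal (Eventually.of_forall hW0)]
    exact h.trans_lt ENNReal.ofReal_lt_top
  · rw [integral_eq_lintegral_of_nonneg_ae (Eventually.of_forall hW0) hW.aestronglyMeasurable]
    exact ENNReal.toReal_le_of_le_ofReal hC h

/-- A cost density is integrable if its early part is controlled and its late part has a Gaussian
majorant. -/
theorem lintegral_cost_le {X : TimePhase d → ℝ} {A B : ℝ} (hA : 0 ≤ A) {G : Phase d → ℝ}
    (hG : Integrable G) (hG0 : ∀ p, 0 ≤ G p) (hB : ∫ p, G p ≤ B)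
    (h1 : ∫⁻ z in {z : TimePhase d | z.1 ≤ 13 / 16}, ENNReal.ofReal (X z) ≤ ENNReal.ofReal A)
    (h2 : ∀ z ∈ slab d (1 / 4) 1, 13 / 16 < z.1 → X z ≤ G z.2) :
    ∫⁻ z, ENNReal.ofReal ((slab d (1 / 4) 1).indicator X z) ≤ ENNReal.ofReal (A + B) := by
  set S : Set (TimePhase d) := slab d (1 / 4) 1 with hS
  have mS : MeasurableSet S := (isOpen_slab _ _).measurableSet
  set T : Set (TimePhase d) := {z | z.1 ≤ 13 / 16} with hT
  have mT : MeasurableSet T := measurableSet_le measurable_fst measurable_const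
  have B0 : 0 ≤ B := (integral_nonneg hG0).trans hB
  rw [← lintegral_add_compl _ mT, ENNReal.ofReal_add hA B0]
  refine add_le_add ?_ ?_
  · refine le_trans (setLIntegral_mono' mT fun z _ => ?_) h1
    by_cases hz : z ∈ S
    · rw [indicator_of_mem hz]
    · rw [indicator_of_notMem hz]; simp
  · have h3 : ∀ z ∈ Tᶜ, ENNReal.ofReal (S.indicator X z)
        ≤ S.indicator (fun z => ENNReal.ofReal (G z.2)) z := by
      intro z hz
      by_cases hzS : z ∈ S
      · rw [indicator_of_mem hzS, indicator_of_mem hzS]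
        exact ENNReal.ofReal_le_ofReal (h2 z hzS (not_le.1 hz))
      · rw [indicator_of_notMem hzS]; simp
    refine (setLIntegral_mono' mT.compl h3).trans ((setLIntegral_le_lintegral _ _).trans ?_)
    rw [lintegral_indicator mS, ← ofReal_integral_eq_lintegral_ofReal
      (integrableOn_slab_snd hG _ _) (Eventually.of_forall fun z => hG0 z.2),
      setIntegral_slab_snd (by norm_num)]
    apply ENNReal.ofReal_le_ofReal
    have : 0 ≤ ∫ p, G p := integral_nonneg hG0
    linarith

/-- Every admissible source generates a density flow, with costs bounded in terms of `R` only. -/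
theorem exists_density_flow (d : ℕ) {R : ℝ} (hR : 0 ≤ R) :
    ∃ C₀ : ℝ, 0 ≤ C₀ ∧ ∀ ε : ℝ, 0 < ε → ε ≤ 1 / 32 → ∀ α : TimePhase d → ℝ, IsSource R α →
      ∃ (W₁ W₂ : TimePhase d → ℝ) (H : Phase d → ℝ),
        IsDensityFlow (dens ε α) (curr ε α) (smear ε α) W₁ W₂ H (∫ q, α q) ∧
        ∫ z, W₁ z ≤ C₀ ∧ ∫ z, W₂ z ≤ C₀ := by
  -- The gap `1/16` is `13/16 - 3/4`: after time `13/16` all emitted mass is at least this old, so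
  -- the constants do not depend on `ε`. Earlier times are left to the entropy estimate.
  obtain ⟨C, c, hC, hc, hb⟩ := exists_gaussian_bound d (show (0 : ℝ) < 1 / 16 by norm_num) hR
  set V : ℝ := volume.real (Icc (1 / 4 : ℝ) (3 / 4) ×ˢ Metric.closedBall (0 : Phase d) R) with hV
  have V0 : 0 ≤ V := measureReal_nonneg
  set E : Phase d → ℝ := fun p => √(C * V) * gaussE (c / 2) p with hE
  have E0 : ∀ p, 0 ≤ E p := fun p => mul_nonneg (Real.sqrt_nonneg _) (gaussE_pos _ _).le
  have iE : Integrable E := (integrable_gaussE (by positivity)).const_mul _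
  set G : Phase d → ℝ := fun p => C * V * gaussE c p with hG
  have G0 : ∀ p, 0 ≤ G p := fun p => mul_nonneg (by positivity) (gaussE_pos _ _).le
  have iG : Integrable G := (integrable_gaussE hc).const_mul _
  have sE : 0 ≤ 4 * ∫ p, E p := mul_nonneg (by norm_num) (integral_nonneg E0)
  have sG : 0 ≤ ∫ p, G p := integral_nonneg G0
  have hC0 : 0 ≤ 4 * (∫ p, E p) + ∫ p, G p := add_nonneg sE sG
  refine ⟨4 * (∫ p, E p) + ∫ p, G p, hC0, fun ε hε hε1 α h => ?_⟩
  obtain ⟨H, hH, hHb⟩ := h.exists_majorant hε hR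
  set ρ := dens ε α with hρ
  have ρ0 : ∀ z, 0 ≤ ρ z := h.dens_nonneg ε
  have cρ : ContDiff ℝ 1 ρ := h.contDiff_dens hε
  set S : Set (TimePhase d) := slab d (1 / 4) 1 with hS
  have mS : MeasurableSet S := (isOpen_slab _ _).measurableSet
  set X₁ : TimePhase d → ℝ := fun z => (∑ i, fderiv ℝ ρ z (dirV i) ^ 2) / ρ z with hX₁
  set X₂ : TimePhase d → ℝ := fun z => (∑ i, curr ε α i z ^ 2) / ρ z with hX₂
  have X₁0 : ∀ z, 0 ≤ X₁ z := fun z => div_nonneg (Finset.sum_nonneg fun i _ => sq_nonneg _) (ρ0 z)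
  have X₂0 : ∀ z, 0 ≤ X₂ z := fun z => div_nonneg (Finset.sum_nonneg fun i _ => sq_nonneg _) (ρ0 z)
  have mX₁ : Measurable X₁ := (continuous_finsetSum _ fun i _ =>
    ((cρ.continuous_fderiv one_ne_zero).clm_apply continuous_const).pow 2).measurable.div
      cρ.continuous.measurable
  have mX₂ : Measurable X₂ := (continuous_finsetSum _ fun i _ =>
    (h.contDiff_curr hε i).continuous.pow 2).measurable.div cρ.continuous.measurable
  have late : ∀ z : TimePhase d, 13 / 16 ≤ z.1 → z.1 ≤ 1 →
      (1 + ‖z.2.2‖) ^ 2 * ρ z ≤ G z.2 ∧ ∑ i, curr ε α i z ^ 2 ≤ G z.2 * ρ z ∧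
      ∑ i, fderiv ℝ ρ z (dirV i) ^ 2 ≤ G z.2 * ρ z := by
    intro z h1 h2
    obtain ⟨b1, b2, b3⟩ := h.gaussian_bounds hε hC hb (z := z) ⟨by linarith, h2⟩ fun t ht _ => by
      linarith [ht.2]
    have hA : C * gaussE c z.2 * ∫ q, α q ≤ G z.2 := by
      have h3 := h.integral_le_volume
      have h4 := (gaussE_pos c z.2).le
      calc _ ≤ C * gaussE c z.2 * V := by gcongr
        _ = _ := by simp only [hG]; ring
    exact ⟨b1.trans hA, b2.trans (mul_le_mul_of_nonneg_right hA (ρ0 z)),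
      b3.trans (mul_le_mul_of_nonneg_right hA (ρ0 z))⟩
  have early := h.fisher_early hε hR iE E0 fun z hz => by
    obtain ⟨b1, -, -⟩ := late z hz.1 (by linarith [hz.2])
    have h1 : ρ z ≤ G z.2 := by
      refine le_trans (le_mul_of_one_le_left (ρ0 z) ?_) b1
      nlinarith [norm_nonneg z.2.2]
    have h2 : E z.2 = √(G z.2) := by
      simp only [hE, hG]
      rw [Real.sqrt_mul (show 0 ≤ C * V by positivity) (gaussE c z.2), sqrt_gaussE]
    rw [h2]
    exact Real.sqrt_le_sqrt h1
  -- Before time `7/8` the current is minus the velocity gradient, so both early costs are the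
  -- Fisher information.
  have early₂ : ∫⁻ z in {z : TimePhase d | z.1 ≤ 13 / 16}, ENNReal.ofReal (X₂ z)
      ≤ ENNReal.ofReal (4 * ∫ p, E p) := by
    refine le_trans (le_of_eq ?_) early
    refine setLIntegral_congr_fun (measurableSet_le measurable_fst measurable_const) fun z hz => ?_
    have hz' : z.1 < 7 / 8 := by
      have : z.1 ≤ 13 / 16 := hz
      linarith
    simp only [hX₂, h.curr_eq hε hz', neg_sq, ← hρ]
  have le_of : ∀ {y r g : ℝ}, 0 ≤ r → 0 ≤ g → y ≤ g * r → y / r ≤ g := fun hr hg hy =>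
    div_le_of_le_mul₀ hr hg hy
  have c₁ := lintegral_cost_le (d := d) sE iG G0 le_rfl early fun z hz hz1 =>
    le_of (ρ0 z) (G0 _) (late z hz1.le hz.1.2.le).2.2
  have c₂ := lintegral_cost_le (d := d) sE iG G0 le_rfl early₂ fun z hz hz1 =>
    le_of (ρ0 z) (G0 _) (late z hz1.le hz.1.2.le).2.1
  obtain ⟨i₁, j₁⟩ := integrable_of_lintegral_le (mX₁.indicator mS)
    (indicator_nonneg fun z _ => X₁0 z) hC0 c₁
  obtain ⟨i₂, j₂⟩ := integrable_of_lintegral_le (mX₂.indicator mS)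
    (indicator_nonneg fun z _ => X₂0 z) hC0 c₂
  -- These constants depend on `ε`, which is harmless: they serve only to show that gradient and
  -- current vanish where the density does.
  obtain ⟨C', c', hC', hc', hb'⟩ := exists_gaussian_bound d hε hR
  have vanish : ∀ z ∈ S, ρ z = 0 → ∑ i, curr ε α i z ^ 2 ≤ 0 ∧
      ∑ i, fderiv ℝ ρ z (dirV i) ^ 2 ≤ 0 := by
    intro z hz hρz
    obtain ⟨-, b2, b3⟩ := h.gaussian_bounds hε hC' hb' ⟨hz.1.1.le, hz.1.2.le⟩ fun t _ hs => by
      by_contra hlt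
      exact hs (switch_of_le hε (by linarith))
    rw [← hρ, hρz, mul_zero] at b2 b3
    exact ⟨b2, b3⟩
  refine ⟨S.indicator X₁, S.indicator X₂, H, ?_, j₁, j₂⟩
  exact
    { contDiff := cρ
      contDiff_current := h.contDiff_curr hε
      nonneg := ρ0
      early := ⟨1 / 4 + ε, by linarith, fun z hz =>
        ⟨h.dens_early hε hz, fun i => h.curr_early hε hz i⟩⟩
      final := fun z hz _ => h.dens_final hε hz (by linarith)
      eqn := fun z _ => h.continuity_equation hε z
      source_nonneg := h.smear_nonneg hε
      source_int := h.integrable_smear hε hε1 hR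
      source_early := fun z hz => h.smear_late hε (by linarith)
      W₁_nonneg := indicator_nonneg fun z _ => X₁0 z
      W₂_nonneg := indicator_nonneg fun z _ => X₂0 z
      W₁_int := i₁
      W₂_int := i₂
      fisher := fun z hz => by
        rw [indicator_of_mem hz]
        by_cases hρz : ρ z = 0
        · rw [hρz, mul_zero]; exact (vanish z hz hρz).2
        · simp only [hX₁]
          rw [div_mul_cancel₀ _ hρz]
      current := fun z hz => by
        rw [indicator_of_mem hz]
        by_cases hρz : ρ z = 0
        · rw [hρz, mul_zero]; exact (vanish z hz hρz).1
        · simp only [hX₂]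
          rw [div_mul_cancel₀ _ hρz]
      H_int := hH
      decay := fun z hz => (hHb z hz.1.2.le).2.1
      decay_current := fun z hz => (hHb z hz.1.2.le).2.2 }

end Flow

end Kolmogorov

/-! ### The cost inequality on compact sets. -/

namespace Kolmogorov

variable {d : ℕ}

/-- Urysohn's lemma between `K` and an open neighbourhood of nearly the same measure, intersected
with the open cylinder. -/
theorem exists_source {R : ℝ} {K : Set (TimePhase d)} (hK : IsCompact K)
    (hKR : K ⊆ Ioo (1 / 4 : ℝ) (3 / 4) ×ˢ Metric.ball 0 R) {η : ℝ} (hη : 0 < η) :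
    ∃ α : TimePhase d → ℝ, IsSource R α ∧ (∀ z ∈ K, α z = 1) ∧
      ∫ z, α z ≤ volume.real K + η := by
  obtain ⟨U, hKU, hU, hUm⟩ := hK.exists_isOpen_lt_add (μ := volume)
    (ε := ENNReal.ofReal η) (by simpa using hη)
  set Ω : Set (TimePhase d) := Ioo (1 / 4 : ℝ) (3 / 4) ×ˢ Metric.ball 0 R with hΩ
  have oΩ : IsOpen Ω := isOpen_Ioo.prod Metric.isOpen_ball
  obtain ⟨α, h1, h0, hc, hI⟩ := exists_continuous_one_zero_of_isCompact hK
    (hU.inter oΩ).isClosed_compl (disjoint_compl_right_iff_subset.2 (subset_inter hKU hKR))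
  have hmem : ∀ q, α q ≠ 0 → q ∈ U ∩ Ω := fun q hq => by
    by_contra h
    exact hq (h0 h)
  refine ⟨α, ⟨α.continuous, hc, fun q => (hI q).1, fun q => (hI q).2,
    fun q hq => Ioo_subset_Icc_self (hmem q hq).2.1,
    fun q hq => (mem_ball_zero_iff.1 (hmem q hq).2.2).le⟩, fun z hz => h1 hz, ?_⟩
  have hUfin : volume U ≠ ⊤ := hUm.ne_top
  have e1 : ∫ z, α z ≤ volume.real U := by
    rw [← setIntegral_eq_integral_of_forall_compl_eq_zero (s := U)]
    · calc _ ≤ ∫ z in U, (1 : ℝ) :=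
          integral_mono (α.continuous.integrable_of_hasCompactSupport hc).integrableOn
            (integrableOn_const hUfin) fun z => (hI z).2
        _ = _ := by simp
    · intro z hz
      by_contra h
      exact hz (hmem z h).1
  refine e1.trans ?_
  rw [measureReal_def, measureReal_def]
  calc _ ≤ (volume K + ENNReal.ofReal η).toReal :=
        ENNReal.toReal_mono (by simp [hK.measure_lt_top.ne]) hUm.le
    _ = _ := by
        rw [ENNReal.toReal_add hK.measure_lt_top.ne ENNReal.ofReal_ne_top,
          ENNReal.toReal_ofReal hη.le]

/-- The cost inequality for compact sets, for measurable nonnegative representatives. -/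
theorem exists_compact_cost_le (d : ℕ) {R : ℝ} (hR : 0 ≤ R) : ∃ C₀ : ℝ, 0 ≤ C₀ ∧
    ∀ (A : TimePhase d → Matrix (Fin d) (Fin d) ℝ) (f : TimePhase d → ℝ) (lam Lam : ℝ),
    0 < lam → 0 ≤ Lam → IsElliptic (slab d (1 / 4) 1) A lam Lam →
    IsWeakSupersolution (slab d (1 / 4) 1) A f →
    (∀ᵐ z ∂(volume.restrict (slab d (1 / 4) 1)), 0 < f z) → HasFinalTrace f 1 →
    Measurable f → (∀ z, 0 ≤ f z) → ∀ a b : ℝ, 0 < b → b < a → ∀ K : Set (TimePhase d),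
    IsCompact K → K ⊆ Ioo (1 / 4 : ℝ) (3 / 4) ×ˢ Metric.ball 0 R →
    ∫ z in K, logQ a b (f z) ≤ volume.real K * (∫ p, logQ a b (f (1, p)) * gaussWeight p)
      + C₀ * (1 / lam + Lam) := by
  obtain ⟨C₀, hC₀, hflow⟩ := exists_density_flow d hR
  refine ⟨C₀, hC₀, ?_⟩
  intro A f lam Lam hlam hLam hell hsup hpos htr hfm hf0 a b hb hab K hK hKR
  have G0 : ∀ z, 0 ≤ logQ a b (f z) := fun z => logQ_nonneg hb hab (hf0 z)
  have Gle : ∀ z, logQ a b (f z) ≤ Real.log a - Real.log b := fun z => logQ_le hb hab (hf0 z)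
  have mG : Measurable fun z => logQ a b (f z) := measurable_logQ.comp hfm
  set S : Set (TimePhase d) := slab d (1 / 4) 1 with hS
  have mS : MeasurableSet S := (isOpen_slab _ _).measurableSet
  set Y : ℝ := ∫ p, logQ a b (f (1, p)) * gaussWeight p with hY
  have Y0 : 0 ≤ Y := integral_nonneg fun p => mul_nonneg (G0 _) (gaussWeight_pos p).le
  have hbd : ∀ u : TimePhase d → ℝ, Integrable u → Integrable fun z => logQ a b (f z) * u z :=
    fun u hu => hu.bdd_mul (c := Real.log a - Real.log b) mG.aestronglyMeasurable
      (Eventually.of_forall fun z => by rw [Real.norm_of_nonneg (G0 z)]; exact Gle z)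
  have step : ∀ α : TimePhase d → ℝ, IsSource R α →
      ∫ z in S, logQ a b (f z) * α z ≤ (∫ q, α q) * Y + C₀ * (1 / lam + Lam) := by
    intro α hα
    have hA : 0 ≤ ∫ q, α q := integral_nonneg hα.nonneg
    set ε : ℕ → ℝ := fun n => 1 / ((n : ℝ) + 1) / 32 with hε
    have ε0 : ∀ n, 0 < ε n := fun n => by positivity
    have ε1 : ∀ n, ε n ≤ 1 / 32 := fun n => by
      have : 1 / ((n : ℝ) + 1) ≤ 1 := by
        rw [div_le_one (by positivity)]
        linarith [(Nat.cast_nonneg n : (0 : ℝ) ≤ n)]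
      simp only [hε]
      linarith
    have εl : Tendsto ε atTop (𝓝 0) := by
      have := (tendsto_one_div_add_atTop_nhds_zero_nat (𝕜 := ℝ)).div_const 32
      rwa [zero_div] at this
    have key : ∀ n, ∫ z in S, logQ a b (f z) * smear (ε n) α z
        ≤ (∫ q, α q) * Y + C₀ * (1 / lam + Lam) := by
      intro n
      obtain ⟨W₁, W₂, H, hF, h1, h2⟩ := hflow (ε n) (ε0 n) (ε1 n) α hα
      refine (hF.cost_le hlam hLam hell hsup hpos htr hfm hf0 hb hab hA).trans ?_
      have h3 := mul_le_mul_of_nonneg_left h1 hLam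
      have h4 := mul_le_mul_of_nonneg_left h2 (show 0 ≤ 1 / lam by positivity)
      linarith
    have hlim : ∀ z, Tendsto (fun n => smear (ε n) α z) atTop (𝓝 (α z)) := by
      intro z
      rcases le_or_gt z.1 (7 / 8) with hz | hz
      · exact tendsto_source hα.continuous hα.compact hz ε0 εl
      · have h1 : α z = 0 := by
          by_contra h
          linarith [(hα.time z h).2]
        rw [h1]
        refine tendsto_const_nhds.congr fun n => ?_
        rw [hα.smear_late (ε0 n)]
        linarith [ε1 n]
    have B0 : 0 ≤ (∫ q, α q) * Y + C₀ * (1 / lam + Lam) := by positivity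
    have iS : ∀ n, IntegrableOn (fun z => logQ a b (f z) * smear (ε n) α z) S := fun n =>
      (hbd _ (hα.integrable_smear (ε0 n) (ε1 n) hR)).integrableOn
    -- The integrands are nonnegative, so Fatou's lemma passes to the limit of vanishing delay using
    -- pointwise convergence alone.
    rw [integral_eq_lintegral_of_nonneg_ae (Eventually.of_forall fun z =>
      mul_nonneg (G0 z) (hα.nonneg z)) (hbd _ hα.integrable).integrableOn.1]
    refine ENNReal.toReal_le_of_le_ofReal B0 ?_
    calc _ = ∫⁻ z in S, liminf (fun n => ENNReal.ofReal (logQ a b (f z) * smear (ε n) α z))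
            atTop := by
          refine lintegral_congr fun z => ?_
          exact (Tendsto.liminf_eq ((ENNReal.continuous_ofReal.tendsto _).comp
            ((hlim z).const_mul _))).symm
      _ ≤ liminf (fun n => ∫⁻ z in S, ENNReal.ofReal (logQ a b (f z) * smear (ε n) α z)) atTop :=
          lintegral_liminf_le fun n => ENNReal.measurable_ofReal.comp
            (mG.mul (hα.contDiff_smear (ε0 n)).continuous.measurable)
      _ ≤ liminf (fun _ : ℕ => ENNReal.ofReal ((∫ q, α q) * Y + C₀ * (1 / lam + Lam))) atTop := by
          refine liminf_le_liminf (Eventually.of_forall fun n => ?_)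
          rw [← ofReal_integral_eq_lintegral_ofReal (iS n) (Eventually.of_forall fun z =>
            mul_nonneg (G0 z) (hα.smear_nonneg (ε0 n) z))]
          exact ENNReal.ofReal_le_ofReal (key n)
      _ = _ := by simp
  -- Because `logQ` is nonnegative, the indicator of `K` may be enlarged to a source; the excess
  -- mass at time `1` costs at most `η * Y`.
  have fin : ∀ η : ℝ, 0 < η → ∫ z in K, logQ a b (f z)
      ≤ volume.real K * Y + C₀ * (1 / lam + Lam) + η * Y := by
    intro η hη
    obtain ⟨α, hα, hα1, hαi⟩ := exists_source hK hKR hη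
    have hKS : K ⊆ S := fun z hz => ⟨⟨(hKR hz).1.1, by linarith [(hKR hz).1.2]⟩, mem_univ _⟩
    calc _ = ∫ z in K, logQ a b (f z) * α z :=
          setIntegral_congr_fun hK.measurableSet fun z hz => by simp [hα1 z hz]
      _ ≤ ∫ z in S, logQ a b (f z) * α z := setIntegral_mono_set
          (hbd _ hα.integrable).integrableOn (Eventually.of_forall fun z =>
            mul_nonneg (G0 z) (hα.nonneg z)) hKS.eventuallyLE
      _ ≤ (∫ q, α q) * Y + C₀ * (1 / lam + Lam) := step α hα
      _ ≤ _ := by nlinarith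
  refine le_of_forall_pos_le_add fun η hη => ?_
  have h1 := fin (η / (Y + 1)) (by positivity)
  have h2 : η / (Y + 1) * Y ≤ η := by
    rw [div_mul_eq_mul_div, div_le_iff₀ (by positivity)]
    nlinarith
  linarith

end Kolmogorov

namespace Kolmogorov

variable {d : ℕ}

/-! ### Measurable nonnegative representatives -/

theorem IsL2Loc.aemeasurable {f : TimePhase d → ℝ} {t₀ t₁ : ℝ} (hf : IsL2Loc (slab d t₀ t₁) f) :
    AEMeasurable f (volume.restrict (slab d t₀ t₁)) := by
  have h1 : slab d t₀ t₁ = ⋃ n : ℕ, Icc (t₀ + 1 / ((n : ℝ) + 1)) (t₁ - 1 / ((n : ℝ) + 1))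
      ×ˢ Metric.closedBall (0 : Phase d) n := by
    ext z
    simp only [slab, mem_prod, mem_Ioo, mem_univ, and_true, mem_iUnion, mem_Icc,
      mem_closedBall_zero_iff]
    constructor
    · rintro ⟨h1, h2⟩
      have hl := tendsto_one_div_add_atTop_nhds_zero_nat (𝕜 := ℝ)
      have e1 : ∀ᶠ n : ℕ in atTop, 1 / ((n : ℝ) + 1) < z.1 - t₀ :=
        hl.eventually_lt_const (by linarith)
      have e2 : ∀ᶠ n : ℕ in atTop, 1 / ((n : ℝ) + 1) < t₁ - z.1 :=
        hl.eventually_lt_const (by linarith)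
      obtain ⟨N, hN⟩ := exists_nat_ge ‖z.2‖
      obtain ⟨n, ⟨hn1, hn2⟩, hn3⟩ := ((e1.and e2).and (eventually_ge_atTop N)).exists
      have : (N : ℝ) ≤ n := by exact_mod_cast hn3
      exact ⟨n, ⟨by linarith, by linarith⟩, by linarith⟩
    · rintro ⟨n, ⟨h1, h2⟩, -⟩
      have : (0 : ℝ) < 1 / ((n : ℝ) + 1) := by positivity
      exact ⟨by linarith, by linarith⟩
  rw [h1, aemeasurable_iUnion_iff]
  intro n
  refine (hf _ (isCompact_Icc.prod (isCompact_closedBall _ _)) ?_).1.aemeasurable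
  rw [h1]
  exact subset_iUnion (fun n : ℕ => Icc (t₀ + 1 / ((n : ℝ) + 1)) (t₁ - 1 / ((n : ℝ) + 1))
      ×ˢ Metric.closedBall (0 : Phase d) n) n

theorem IsWeakSupersolution.congr {Q : Set (TimePhase d)} (hQ : MeasurableSet Q)
    {A : TimePhase d → Matrix (Fin d) (Fin d) ℝ} {f f' : TimePhase d → ℝ}
    (h : IsWeakSupersolution Q A f) (hff' : f =ᵐ[volume.restrict Q] f') :
    IsWeakSupersolution Q A f' := by
  have key : ∀ φ : TimePhase d → ℝ, IsTestFunction Q φ → ∀ e : TimePhase d → TimePhase d,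
      ∫ z, f' z * fderiv ℝ φ z (e z) = ∫ z, f z * fderiv ℝ φ z (e z) := by
    intro φ hφ e
    refine integral_congr_ae ?_
    filter_upwards [(ae_restrict_iff' hQ).1 hff'] with z hz
    by_cases hzQ : z ∈ Q
    · rw [hz hzQ]
    · rw [eq_zero_of_notMem_of_tsupport_subset ((tsupport_fderiv_subset ℝ).trans hφ.supp) hzQ]
      simp
  obtain ⟨h1, g, h2, h3, h4⟩ := h
  refine ⟨fun K hK hKQ => (h1 K hK hKQ).ae_eq (ae_restrict_of_ae_restrict_of_subset hKQ hff'),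
    g, h2, fun φ hφ e => ?_, fun φ hφ hφ0 => ?_⟩
  · rw [← h3 φ hφ e]
    exact key φ hφ fun _ => (0, 0, e)
  · have h5 := key φ hφ fun z => (1, z.2.2, 0)
    rw [h5]
    exact h4 φ hφ hφ0

/-- A measurable nonnegative function with the same weak solution data. -/
theorem exists_representative {A : TimePhase d → Matrix (Fin d) (Fin d) ℝ} {f : TimePhase d → ℝ}
    {t₀ t₁ : ℝ} (ht : t₀ < t₁) (hsup : IsWeakSupersolution (slab d t₀ t₁) A f)
    (hpos : ∀ᵐ z ∂(volume.restrict (slab d t₀ t₁)), 0 < f z) (htr : HasFinalTrace f t₁) :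
    ∃ f' : TimePhase d → ℝ, Measurable f' ∧ (∀ z, 0 ≤ f' z) ∧
      f =ᵐ[volume.restrict (slab d t₀ t₁)] f' ∧ (∀ᵐ p : Phase d, f (t₁, p) = f' (t₁, p)) ∧
      IsWeakSupersolution (slab d t₀ t₁) A f' ∧
      (∀ᵐ z ∂(volume.restrict (slab d t₀ t₁)), 0 < f' z) ∧ HasFinalTrace f' t₁ := by
  have mS : MeasurableSet (slab d t₀ t₁) := (isOpen_slab _ _).measurableSet
  have hm := hsup.1.aemeasurable
  have hm1 := htr.1.aestronglyMeasurable.aemeasurable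
  set g := hm.mk f with hg
  set F := hm1.mk _ with hF
  classical
  -- The slice at the final time does not meet the open slab, so the trace can be prescribed there
  -- independently of the values inside.
  set f' : TimePhase d → ℝ := fun z => if z.1 = t₁ then max (F z.2) 0 else max (g z) 0 with hf'
  have e1 : f =ᵐ[volume.restrict (slab d t₀ t₁)] f' := by
    filter_upwards [hm.ae_eq_mk, hpos, ae_restrict_mem mS] with z h1 h2 h3
    have h4 : z.1 ≠ t₁ := h3.1.2.ne
    simp only [hf', if_neg h4]
    rw [← hg] at h1
    rw [← h1, max_eq_left h2.le]
  have e2 : ∀ᵐ p : Phase d, f (t₁, p) = f' (t₁, p) := by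
    filter_upwards [hm1.ae_eq_mk, trace_nonneg ht hpos htr] with p h1 h2
    simp only [hf', if_true]
    rw [← hF] at h1
    rw [← h1, max_eq_left h2]
  refine ⟨f', ?_, ?_, e1, e2, hsup.congr mS e1, ?_, ?_, ?_⟩
  · refine Measurable.ite (measurableSet_eq_fun measurable_fst measurable_const) ?_ ?_
    · exact (hm1.measurable_mk.comp measurable_snd).max measurable_const
    · exact hm.measurable_mk.max measurable_const
  · intro z
    simp only [hf']
    split_ifs <;> exact le_max_right _ _
  · filter_upwards [e1, hpos] with z h1 h2
    rwa [← h1]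
  · exact htr.1.congr e2
  · intro φ hφ hφc
    have h1 : ∫ p, f' (t₁, p) * φ p = ∫ p, f (t₁, p) * φ p :=
      integral_congr_ae (by filter_upwards [e2] with p hp; rw [hp])
    rw [h1]
    refine (htr.2 φ hφ hφc).congr' (ae_eventually_of_ae ht ?_)
    filter_upwards [ae_section e1] with t h2 hT
    exact integral_congr_ae (by filter_upwards [h2 hT] with p hp; rw [hp])

end Kolmogorov

namespace Kolmogorov

variable {d : ℕ}

/-! ### Gaussian means of the logarithm -/

theorem elog_of_pos {u : ℝ} (hu : 0 < u) : elog u = (Real.log u : EReal) := by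
  rw [elog, ENNReal.log_ofReal_of_pos hu]

theorem elog_of_nonpos {u : ℝ} (hu : u ≤ 0) : elog u = ⊥ := by
  rw [elog, ENNReal.log_ofReal, if_pos hu]

theorem measurable_elog : Measurable elog :=
  ENNReal.measurable_log.comp ENNReal.measurable_ofReal

theorem logMeanNeg_congr {F F' : Phase d → ℝ} (h : ∀ᵐ p, F p = F' p) :
    logMeanNeg F = logMeanNeg F' :=
  lintegral_congr_ae (h.mono fun p hp => by beta_reduce; rw [hp])

theorem logMeanPos_congr {F F' : Phase d → ℝ} (h : ∀ᵐ p, F p = F' p) :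
    logMeanPos F = logMeanPos F' :=
  lintegral_congr_ae (h.mono fun p hp => by beta_reduce; rw [hp])

theorem integrable_logQ_mul_gaussWeight {a b : ℝ} (hb : 0 < b) (hab : b < a) {F : Phase d → ℝ}
    (hF : Measurable F) (hF0 : ∀ p, 0 ≤ F p) :
    Integrable fun p => logQ a b (F p) * gaussWeight p := by
  refine Integrable.mono' (integrable_gaussWeight.const_mul (Real.log a - Real.log b))
    ((measurable_logQ.comp hF).aestronglyMeasurable.mul
      integrable_gaussWeight.aestronglyMeasurable) (Eventually.of_forall fun p => ?_)
  rw [Real.norm_of_nonneg (mul_nonneg (logQ_nonneg hb hab (hF0 p)) (gaussWeight_pos p).le)]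
  exact mul_le_mul_of_nonneg_right (logQ_le hb hab (hF0 p)) (gaussWeight_pos p).le

theorem tendsto_inv_nat_add_two :
    Tendsto (fun n : ℕ => ((n : ℝ) + 2)⁻¹) atTop (𝓝 0) :=
  (tendsto_atTop_add_const_right _ _ tendsto_natCast_atTop_atTop).inv_tendsto_atTop

theorem log_sub_log_one_add_mul {a u : ℝ} (ha : 0 < a) (hu : 0 ≤ u) :
    Real.log (1 + a * u) - Real.log a = Real.log (a⁻¹ + u) := by
  rw [← Real.log_div (by positivity) ha.ne']
  congr 1
  field_simp

/-- For `u > 0` the limit is `log (1 + u) - log u`, which exceeds `-log u`; for `u = 0` it is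
infinite, like the negative part. This is the pointwise input for Fatou's lemma. -/
theorem exists_tendsto_log_sub_logQ {u : ℝ} (hu : 0 ≤ u) :
    ∃ L : ℝ≥0∞, (-elog u).toENNReal ≤ L ∧
      Tendsto (fun n : ℕ => ENNReal.ofReal (Real.log ((n : ℝ) + 2) - logQ ((n : ℝ) + 2) 1 u))
        atTop (𝓝 L) := by
  rcases hu.eq_or_lt with rfl | hu
  · refine ⟨⊤, le_top, ENNReal.tendsto_ofReal_atTop.comp ?_⟩
    have h : Tendsto (fun n : ℕ => Real.log ((n : ℝ) + 2)) atTop atTop :=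
      Real.tendsto_log_atTop.comp
        (tendsto_atTop_add_const_right _ _ tendsto_natCast_atTop_atTop)
    exact h.congr fun n => by simp [logQ]
  · refine ⟨ENNReal.ofReal (Real.log (1 + u) - Real.log u), ?_,
      (ENNReal.continuous_ofReal.tendsto _).comp ?_⟩
    · rw [elog_of_pos hu, ← EReal.coe_neg, EReal.real_coe_toENNReal]
      exact ENNReal.ofReal_le_ofReal (by linarith [Real.log_nonneg (show 1 ≤ 1 + u by linarith)])
    · have h1 : Tendsto (fun n : ℕ => Real.log (((n : ℝ) + 2)⁻¹ + u)) atTop (𝓝 (Real.log u)) := by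
        refine Tendsto.log ?_ hu.ne'
        simpa using tendsto_inv_nat_add_two.add_const u
      refine (h1.const_sub (Real.log (1 + u))).congr fun n => ?_
      rw [← log_sub_log_one_add_mul (by positivity) hu.le, logQ, one_mul]
      ring

/-- The weight has mass one, so the hypothesis bounds the Gaussian integrals of the nonnegative
functions `log (n + 2) - logQ`. Fatou's lemma transfers the bound to the negative part of the
logarithm. -/
theorem logMeanNeg_lt_top {F : Phase d → ℝ} (hF : Measurable F) (hF0 : ∀ p, 0 ≤ F p) {M : ℝ}
    (hM : ∀ n : ℕ, Real.log ((n : ℝ) + 2)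
      - ∫ p, logQ ((n : ℝ) + 2) 1 (F p) * gaussWeight p ≤ M) :
    logMeanNeg F < ⊤ := by
  have hn : ∀ n : ℕ, (1 : ℝ) < (n : ℝ) + 2 := fun n => by
    have := n.cast_nonneg (α := ℝ)
    linarith
  set l : ℕ → Phase d → ℝ := fun n p => Real.log ((n : ℝ) + 2) - logQ ((n : ℝ) + 2) 1 (F p)
    with hl
  have l0 : ∀ n p, 0 ≤ l n p := fun n p => by
    have := logQ_le one_pos (hn n) (hF0 p)
    rw [Real.log_one] at this
    simp only [hl]
    linarith
  have hmeas : ∀ n, Measurable (l n) := fun n =>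
    (measurable_logQ.comp hF).const_sub _
  have hg : Measurable fun p : Phase d => gaussWeight p := by
    unfold gaussWeight
    fun_prop
  calc logMeanNeg F
      ≤ ∫⁻ p, liminf (fun n => ENNReal.ofReal (l n p) * ENNReal.ofReal (gaussWeight p)) atTop := by
        refine lintegral_mono fun p => ?_
        obtain ⟨L, h1, h2⟩ := exists_tendsto_log_sub_logQ (hF0 p)
        rw [(ENNReal.Tendsto.mul_const h2 (Or.inr ENNReal.ofReal_ne_top)).liminf_eq]
        gcongr
    _ ≤ liminf (fun n => ∫⁻ p, ENNReal.ofReal (l n p) * ENNReal.ofReal (gaussWeight p)) atTop :=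
        lintegral_liminf_le fun n => (hmeas n).ennreal_ofReal.mul hg.ennreal_ofReal
    _ ≤ liminf (fun _ : ℕ => ENNReal.ofReal M) atTop := by
        refine liminf_le_liminf (Eventually.of_forall fun n => ?_)
        have hi := integrable_logQ_mul_gaussWeight one_pos (hn n) hF hF0
        have hc := (integrable_gaussWeight (d := d)).const_mul (Real.log ((n : ℝ) + 2))
        have e : ∀ p, ENNReal.ofReal (l n p) * ENNReal.ofReal (gaussWeight p)
            = ENNReal.ofReal (Real.log ((n : ℝ) + 2) * gaussWeight p
              - logQ ((n : ℝ) + 2) 1 (F p) * gaussWeight p) := fun p => by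
          rw [← ENNReal.ofReal_mul (l0 n p)]
          congr 1
          simp only [hl]
          ring
        have hnn : ∀ p, 0 ≤ Real.log ((n : ℝ) + 2) * gaussWeight p
            - logQ ((n : ℝ) + 2) 1 (F p) * gaussWeight p := fun p => by
          have := mul_nonneg (l0 n p) (gaussWeight_pos p).le
          simp only [hl] at this
          linarith
        have hci : Integrable fun p => Real.log ((n : ℝ) + 2) * gaussWeight p
            - logQ ((n : ℝ) + 2) 1 (F p) * gaussWeight p := hc.sub hi
        rw [lintegral_congr e, ← ofReal_integral_eq_lintegral_ofReal hci
          (Eventually.of_forall hnn), integral_sub hc hi, integral_const_mul,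
          integral_gaussWeight, mul_one]
        exact ENNReal.ofReal_le_ofReal (hM n)
    _ = ENNReal.ofReal M := by simp
    _ < ⊤ := ENNReal.ofReal_lt_top

theorem ae_pos_of_logMeanNeg_lt_top {F : Phase d → ℝ} (hF : Measurable F)
    (hneg : logMeanNeg F < ⊤) : ∀ᵐ p, 0 < F p := by
  have hg : Measurable fun p : Phase d => gaussWeight p := by
    unfold gaussWeight
    fun_prop
  have hm : Measurable fun p => (-elog (F p)).toENNReal * ENNReal.ofReal (gaussWeight p) :=
    ((measurable_elog.comp hF).neg.ereal_toENNReal).mul hg.ennreal_ofReal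
  filter_upwards [ae_lt_top hm hneg.ne] with p hp
  by_contra h
  rw [elog_of_nonpos (not_lt.1 h), EReal.neg_bot, EReal.toENNReal_top,
    ENNReal.top_mul (by simpa using gaussWeight_pos p)] at hp
  exact hp.ne rfl

theorem logMean_eq_integral {F : Phase d → ℝ} (hF : Measurable F) (hneg : logMeanNeg F < ⊤)
    (hpos : logMeanPos F < ⊤) :
    Integrable (fun p => Real.log (F p) * gaussWeight p) ∧
      logMean F = ((∫ p, Real.log (F p) * gaussWeight p : ℝ) : EReal) := by
  have hg : Measurable fun p : Phase d => gaussWeight p := by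
    unfold gaussWeight
    fun_prop
  have hm : Measurable fun p => Real.log (F p) * gaussWeight p :=
    (Real.measurable_log.comp hF).mul hg
  have h0 := ae_pos_of_logMeanNeg_lt_top hF hneg
  have e1 : logMeanPos F = ∫⁻ p, ENNReal.ofReal (Real.log (F p) * gaussWeight p) := by
    refine lintegral_congr_ae (h0.mono fun p hp => ?_)
    beta_reduce
    rw [elog_of_pos hp, EReal.real_coe_toENNReal, ENNReal.ofReal_mul' (gaussWeight_pos p).le]
  have e2 : logMeanNeg F = ∫⁻ p, ENNReal.ofReal (-(Real.log (F p) * gaussWeight p)) := by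
    refine lintegral_congr_ae (h0.mono fun p hp => ?_)
    beta_reduce
    rw [elog_of_pos hp, ← EReal.coe_neg, EReal.real_coe_toENNReal, ← neg_mul,
      ENNReal.ofReal_mul' (gaussWeight_pos p).le]
  have hi : Integrable fun p => Real.log (F p) * gaussWeight p := by
    refine ⟨hm.aestronglyMeasurable, ?_⟩
    rw [hasFiniteIntegral_iff_norm]
    calc ∫⁻ p, ENNReal.ofReal ‖Real.log (F p) * gaussWeight p‖
        ≤ ∫⁻ p, (ENNReal.ofReal (Real.log (F p) * gaussWeight p)
          + ENNReal.ofReal (-(Real.log (F p) * gaussWeight p))) := by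
          refine lintegral_mono fun p => ?_
          rw [Real.norm_eq_abs]
          rcases abs_choice (Real.log (F p) * gaussWeight p) with h | h <;> rw [h]
          · exact le_self_add
          · exact le_add_self
      _ = logMeanPos F + logMeanNeg F := by
          rw [lintegral_add_left hm.ennreal_ofReal, e1, e2]
      _ < ⊤ := ENNReal.add_lt_top.2 ⟨hpos, hneg⟩
  refine ⟨hi, ?_⟩
  rw [integral_eq_lintegral_pos_part_sub_lintegral_neg_part hi, ← e1, ← e2, logMean,
    EReal.coe_sub, EReal.coe_ennreal_toReal hpos.ne, EReal.coe_ennreal_toReal hneg.ne]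

/-! ### Approximation of the logarithm -/

/-- The function `log ((ε + u) / (1 + ε u))` with `ε = 1 / (n + 2)`. -/
def logApprox (n : ℕ) (u : ℝ) : ℝ :=
  logQ ((n : ℝ) + 2) ((n : ℝ) + 2)⁻¹ u - Real.log ((n : ℝ) + 2)

theorem logApprox_eq (n : ℕ) {u : ℝ} (hu : 0 ≤ u) :
    logApprox n u = Real.log (((n : ℝ) + 2)⁻¹ + u) - Real.log (1 + ((n : ℝ) + 2)⁻¹ * u) := by
  rw [← log_sub_log_one_add_mul (by positivity) hu, logApprox, logQ]
  ring

theorem tendsto_logApprox {u : ℝ} (hu : 0 < u) :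
    Tendsto (fun n => logApprox n u) atTop (𝓝 (Real.log u)) := by
  have h1 : Tendsto (fun n : ℕ => Real.log (((n : ℝ) + 2)⁻¹ + u)) atTop (𝓝 (Real.log u)) := by
    refine Tendsto.log ?_ hu.ne'
    simpa using tendsto_inv_nat_add_two.add_const u
  have h2 : Tendsto (fun n : ℕ => Real.log (1 + ((n : ℝ) + 2)⁻¹ * u)) atTop (𝓝 0) := by
    rw [← Real.log_one]
    refine Tendsto.log ?_ one_ne_zero
    simpa using (tendsto_inv_nat_add_two.mul_const u).const_add 1
  have h3 := h1.sub h2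
  rw [sub_zero] at h3
  exact h3.congr fun n => (logApprox_eq n hu.le).symm

/-- For `0 < ε ≤ 1` the quotient `(ε + u) / (1 + ε u)` lies between `1` and `u`. This yields the
dominating function for the limit. -/
theorem abs_logApprox_le (n : ℕ) {u : ℝ} (hu : 0 < u) : |logApprox n u| ≤ |Real.log u| := by
  have e0 : 0 < ((n : ℝ) + 2)⁻¹ := by positivity
  have e1 : ((n : ℝ) + 2)⁻¹ ≤ 1 := inv_le_one_of_one_le₀ (by linarith [n.cast_nonneg (α := ℝ)])
  rw [logApprox_eq n hu.le]
  set ε := ((n : ℝ) + 2)⁻¹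
  have hd : 0 < 1 + ε * u := by positivity
  rcases le_total 1 u with h | h
  · have h1 : Real.log (1 + ε * u) ≤ Real.log (ε + u) := Real.log_le_log hd (by nlinarith)
    have h2 : Real.log (ε + u) ≤ Real.log (u * (1 + ε * u)) :=
      Real.log_le_log (by positivity) (by nlinarith [mul_le_mul h h zero_le_one hu.le])
    rw [Real.log_mul hu.ne' hd.ne'] at h2
    rw [abs_of_nonneg (by linarith), abs_of_nonneg (Real.log_nonneg h)]
    linarith
  · have h1 : Real.log (ε + u) ≤ Real.log (1 + ε * u) :=
      Real.log_le_log (by positivity) (by nlinarith)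
    have h2 : Real.log (u * (1 + ε * u)) ≤ Real.log (ε + u) :=
      Real.log_le_log (by positivity) (by nlinarith [mul_le_mul h h hu.le zero_le_one])
    rw [Real.log_mul hu.ne' hd.ne'] at h2
    rw [abs_of_nonpos (by linarith), abs_of_nonpos (Real.log_nonpos hu.le h)]
    linarith

theorem inv_nat_add_two_lt (n : ℕ) : ((n : ℝ) + 2)⁻¹ < (n : ℝ) + 2 :=
  (inv_lt_one_of_one_lt₀ (by linarith [n.cast_nonneg (α := ℝ)])).trans
    (by linarith [n.cast_nonneg (α := ℝ)])

theorem integrable_logApprox_mul_gaussWeight (n : ℕ) {F : Phase d → ℝ} (hF : Measurable F)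
    (hF0 : ∀ p, 0 ≤ F p) : Integrable fun p => logApprox n (F p) * gaussWeight p := by
  have h1 := integrable_logQ_mul_gaussWeight (a := (n : ℝ) + 2) (b := ((n : ℝ) + 2)⁻¹)
    (by positivity) (inv_nat_add_two_lt n) hF hF0
  refine (h1.sub (integrable_gaussWeight.const_mul (Real.log ((n : ℝ) + 2)))).congr
    (Eventually.of_forall fun p => ?_)
  simp only [Pi.sub_apply, logApprox]
  ring

theorem tendsto_integral_logApprox {F : Phase d → ℝ} (hF : Measurable F) (hF0 : ∀ p, 0 ≤ F p)
    (hpos : ∀ᵐ p, 0 < F p) (hi : Integrable fun p => Real.log (F p) * gaussWeight p) :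
    Tendsto (fun n => ∫ p, logApprox n (F p) * gaussWeight p) atTop
      (𝓝 (∫ p, Real.log (F p) * gaussWeight p)) := by
  refine tendsto_integral_of_dominated_convergence _
    (fun n => (integrable_logApprox_mul_gaussWeight n hF hF0).1) hi.norm
    (fun n => hpos.mono fun p hp => ?_) (hpos.mono fun p hp => (tendsto_logApprox hp).mul_const _)
  rw [norm_mul, norm_mul]
  exact mul_le_mul_of_nonneg_right (abs_logApprox_le n hp) (norm_nonneg _)

end Kolmogorov

namespace Kolmogorov

variable {d : ℕ}

/-! ### The weak-type estimate from the estimate on compact sets -/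

theorem innerRegular_volume : (volume : Measure (TimePhase d)).InnerRegular := by
  have : SigmaFinite (volume : Measure (TimePhase d)) := inferInstance
  infer_instance

section WeakType

variable {Ω : Set (TimePhase d)} {f : TimePhase d → ℝ} {B : ℝ}

theorem integrableOn_logQ {a b : ℝ} (hb : 0 < b) (hab : b < a) (hf : Measurable f)
    (hf0 : ∀ z, 0 ≤ f z) {K : Set (TimePhase d)} (hK : IsCompact K) :
    IntegrableOn (fun z => logQ a b (f z)) K := by
  refine Measure.integrableOn_of_bounded (M := Real.log a - Real.log b) hK.measure_lt_top.ne
    (measurable_logQ.comp hf).aestronglyMeasurable (Eventually.of_forall fun z => ?_)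
  rw [Real.norm_of_nonneg (logQ_nonneg hb hab (hf0 z))]
  exact logQ_le hb hab (hf0 z)

theorem measureReal_mul_logQ_le {a b : ℝ} (hb : 0 < b) (hab : b < a) (hf : Measurable f)
    (hf0 : ∀ z, 0 ≤ f z) {K : Set (TimePhase d)} (hK : IsCompact K) {κ : ℝ} (hκ : 0 ≤ κ)
    (h : ∀ z ∈ K, κ ≤ f z) :
    volume.real K * logQ a b κ ≤ ∫ z in K, logQ a b (f z) := by
  have := setIntegral_mono_on (integrableOn_const hK.measure_lt_top.ne)
    (integrableOn_logQ hb hab hf hf0 hK) hK.measurableSet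
    fun z hz => logQ_mono hb hab hκ (h z hz)
  rwa [setIntegral_const, smul_eq_mul] at this

/-- The sets `{f ≥ 1/(n + 1)}` exhaust `Ω` up to a null set, so one of them has positive measure,
and inner regularity supplies the compact set. -/
theorem exists_compact_subset_superlevel (hΩ : MeasurableSet Ω) (hΩ0 : volume Ω ≠ 0)
    (hf : Measurable f) (hpos : ∀ᵐ z ∂(volume.restrict Ω), 0 < f z) :
    ∃ κ : ℝ, 0 < κ ∧ ∃ K ⊆ Ω, IsCompact K ∧ 0 < volume.real K ∧ ∀ z ∈ K, κ ≤ f z := by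
  set S : ℕ → Set (TimePhase d) := fun n => Ω ∩ {z | 1 / ((n : ℝ) + 1) ≤ f z} with hS
  have mS : ∀ n, MeasurableSet (S n) := fun n =>
    hΩ.inter (measurableSet_le measurable_const hf)
  have hU : volume (⋃ n, S n) ≠ 0 := by
    intro h
    apply hΩ0
    rw [← nonpos_iff_eq_zero, ← h]
    refine measure_mono_ae ?_
    filter_upwards [(ae_restrict_iff' hΩ).1 hpos] with z hz hzΩ
    obtain ⟨n, hn⟩ := exists_nat_one_div_lt (hz hzΩ)
    exact mem_iUnion.2 ⟨n, hzΩ, hn.le⟩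
  obtain ⟨n, hn⟩ : ∃ n, volume (S n) ≠ 0 := by
    by_contra! h
    exact hU (measure_iUnion_null h)
  have := innerRegular_volume (d := d)
  obtain ⟨K, hKS, hK, hK0⟩ := (mS n).exists_lt_isCompact (pos_iff_ne_zero.2 hn)
  exact ⟨1 / ((n : ℝ) + 1), by positivity, K, hKS.trans inter_subset_left, hK,
    ENNReal.toReal_pos hK0.ne' hK.measure_lt_top.ne, fun z hz => (hKS hz).2⟩

variable (hf : Measurable f) (hf0 : ∀ z, 0 ≤ f z)
  (hB : ∀ a b : ℝ, 0 < b → b < a → ∀ K : Set (TimePhase d), IsCompact K → K ⊆ Ω →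
    ∫ z in K, logQ a b (f z) ≤ volume.real K * (∫ p, logQ a b (f (1, p)) * gaussWeight p) + B)

include hf hf0 hB

/-- On a compact set where `f ≥ κ` the estimate bounds the final mean of `logQ` from below by `logQ
κ` minus a constant. With `b = 1` and `a → ∞`, both sides grow like `log a`, and the difference
remains bounded. -/
theorem logMeanNeg_trace_lt_top (hΩ : MeasurableSet Ω) (hΩ0 : volume Ω ≠ 0)
    (hpos : ∀ᵐ z ∂(volume.restrict Ω), 0 < f z) :
    logMeanNeg (fun p => f (1, p)) < ⊤ := by
  obtain ⟨κ, hκ, K, hKΩ, hK, hK0, hKκ⟩ := exists_compact_subset_superlevel hΩ hΩ0 hf hpos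
  refine logMeanNeg_lt_top (hf.comp measurable_prodMk_left) (fun p => hf0 _)
    (M := Real.log (1 + 1 * κ) - Real.log κ + B / volume.real K) fun n => ?_
  have hn : (1 : ℝ) < (n : ℝ) + 2 := by linarith [n.cast_nonneg (α := ℝ)]
  have h1 := (measureReal_mul_logQ_le one_pos hn hf hf0 hK hκ.le hKκ).trans
    (hB _ _ one_pos hn K hK hKΩ)
  have h2 : logQ ((n : ℝ) + 2) 1 κ
      ≤ (∫ p, logQ ((n : ℝ) + 2) 1 (f (1, p)) * gaussWeight p) + B / volume.real K := by
    rw [← mul_le_mul_iff_right₀ hK0]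
    refine h1.trans_eq ?_
    field_simp
  have h3 : Real.log κ ≤ Real.log (1 + ((n : ℝ) + 2) * κ) - Real.log ((n : ℝ) + 2) := by
    rw [log_sub_log_one_add_mul (by positivity) hκ.le]
    exact Real.log_le_log hκ (by linarith [show 0 < ((n : ℝ) + 2)⁻¹ by positivity])
  rw [logQ] at h2
  linarith

/-- Take `b = 1/a` and `a → ∞`. The divergent constant `log a` cancels because both sides carry the
same mass `|K|`, and the limit reads `|K| (s + c) ≤ |K| c + B`. -/
theorem mul_volume_superlevel_compact_le (hneg : logMeanNeg (fun p => f (1, p)) < ⊤)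
    (hi : Integrable fun p => Real.log (f (1, p)) * gaussWeight p) {K : Set (TimePhase d)}
    (hK : IsCompact K) (hKΩ : K ⊆ Ω) {s : ℝ}
    (hs : ∀ z ∈ K, Real.exp (s + ∫ p, Real.log (f (1, p)) * gaussWeight p) ≤ f z) :
    s * volume.real K ≤ B := by
  set c := ∫ p, Real.log (f (1, p)) * gaussWeight p with hc
  have hF : Measurable fun p => f (1, p) := hf.comp measurable_prodMk_left
  have hF0 : ∀ p, 0 ≤ f (1, p) := fun p => hf0 _
  have key : ∀ n, volume.real K * logApprox n (Real.exp (s + c))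
      ≤ volume.real K * (∫ p, logApprox n (f (1, p)) * gaussWeight p) + B := by
    intro n
    have e0 : 0 < ((n : ℝ) + 2)⁻¹ := by positivity
    have h1 := (measureReal_mul_logQ_le e0 (inv_nat_add_two_lt n) hf hf0 hK
      (Real.exp_pos _).le hs).trans (hB _ _ e0 (inv_nat_add_two_lt n) K hK hKΩ)
    have h2 : ∫ p, logQ ((n : ℝ) + 2) ((n : ℝ) + 2)⁻¹ (f (1, p)) * gaussWeight p
        = (∫ p, logApprox n (f (1, p)) * gaussWeight p) + Real.log ((n : ℝ) + 2) := by
      have h3 := integral_add (integrable_logApprox_mul_gaussWeight n hF hF0)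
        (integrable_gaussWeight.const_mul (Real.log ((n : ℝ) + 2)))
      rw [integral_const_mul, integral_gaussWeight, mul_one] at h3
      rw [← h3]
      refine integral_congr_ae (Eventually.of_forall fun p => ?_)
      simp only [logApprox]
      ring
    rw [h2] at h1
    rw [logApprox]
    linarith
  have l1 := (tendsto_logApprox (Real.exp_pos (s + c))).const_mul (volume.real K)
  have l2 := ((tendsto_integral_logApprox hF hF0 (ae_pos_of_logMeanNeg_lt_top hF hneg) hi).const_mul
    (volume.real K)).add_const B
  have := le_of_tendsto_of_tendsto' l1 l2 key
  rw [Real.log_exp, ← hc] at this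
  linarith

theorem mul_volume_superlevel_le (hΩ : MeasurableSet Ω)
    (hneg : logMeanNeg (fun p => f (1, p)) < ⊤) {s : ℝ} (hs : 0 < s) :
    ENNReal.ofReal s * volume {z | z ∈ Ω ∧ (s : EReal) < elog (f z) - cMean f}
      ≤ ENNReal.ofReal B := by
  have hF : Measurable fun p => f (1, p) := hf.comp measurable_prodMk_left
  -- If the positive part has infinite integral, the mean is `⊤`, every difference with it is `⊥`,
  -- and the set is empty.
  rcases eq_or_ne (logMeanPos fun p => f (1, p)) ⊤ with hp | hp
  · have hc : cMean f = ⊤ := by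
      rw [cMean, logMean, hp, EReal.coe_ennreal_top,
        ← EReal.coe_ennreal_toReal hneg.ne, EReal.top_sub_coe]
    simp [hc]
  obtain ⟨hi, hc⟩ := logMean_eq_integral hF hneg hp.lt_top
  set c := ∫ p, Real.log (f (1, p)) * gaussWeight p with hcdef
  set S := Ω ∩ {z | Real.exp (s + c) < f z} with hS
  have mS : MeasurableSet S := hΩ.inter (measurableSet_lt measurable_const hf)
  have hsub : {z | z ∈ Ω ∧ (s : EReal) < elog (f z) - cMean f} ⊆ S := by
    rintro z ⟨hz, hz1⟩
    refine ⟨hz, ?_⟩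
    rw [cMean, hc] at hz1
    rcases (hf0 z).eq_or_lt with h0 | h0
    · rw [elog_of_nonpos h0.symm.le, EReal.bot_sub] at hz1
      exact absurd hz1 not_lt_bot
    · rw [elog_of_pos h0, ← EReal.coe_sub, EReal.coe_lt_coe_iff] at hz1
      rw [mem_ofPred_eq, ← Real.lt_log_iff_exp_lt h0]
      linarith
  refine (mul_le_mul_right (measure_mono hsub) _).trans ?_
  have := innerRegular_volume (d := d)
  -- Inner regularity reduces the superlevel set to compact sets, on which the estimate is known.
  rw [mS.measure_eq_iSup_isCompact]
  simp only [ENNReal.mul_iSup]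
  refine iSup_le fun K => iSup_le fun hKS => iSup_le fun hK => ?_
  have h1 := mul_volume_superlevel_compact_le hf hf0 hB hneg hi hK (hKS.trans inter_subset_left)
    fun z hz => (hKS hz).2.le
  rw [← ofReal_measureReal hK.measure_lt_top.ne, ← ENNReal.ofReal_mul hs.le]
  exact ENNReal.ofReal_le_ofReal h1

end WeakType

end Kolmogorov

end

theorem lemma3p1 (d : ℕ) (hd : 0 < d) (E : Set (Kolmogorov.Phase d))
    (hE : Bornology.IsBounded E) :
    ∃ C : ℝ, 0 < C ∧
      ∀ (lam Lam : ℝ) (a : Kolmogorov.TimePhase d → Matrix (Fin d) (Fin d) ℝ)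
        (f : Kolmogorov.TimePhase d → ℝ),
        0 < lam →
        Kolmogorov.IsElliptic (Kolmogorov.slab d (1 / 4) 1) a lam Lam →
        Kolmogorov.IsWeakSupersolution (Kolmogorov.slab d (1 / 4) 1) a f →
        (∀ᵐ z ∂(volume.restrict (Kolmogorov.slab d (1 / 4) 1)), 0 < f z) →
        Kolmogorov.HasFinalTrace f 1 →
        Kolmogorov.logMeanNeg (fun p => f (1, p)) < ⊤ ∧
        ∀ s : ℝ, 0 < s →
          ENNReal.ofReal s *
              volume {z : Kolmogorov.TimePhase d | z.1 ∈ Ioo (1 / 4 : ℝ) (3 / 4) ∧ z.2 ∈ E ∧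
                (s : EReal) < Kolmogorov.elog (f z) - Kolmogorov.cMean f} ≤
            ENNReal.ofReal (C * (1 / lam + Lam)) := by
  obtain ⟨R, hR, hER⟩ := hE.subset_ball_lt 0 0
  obtain ⟨C₀, hC₀, hC⟩ := Kolmogorov.exists_compact_cost_le d hR.le
  -- Adding one only makes the constant strictly positive.
  refine ⟨C₀ + 1, by positivity, fun lam Lam a f hlam hell hsup hpos htr => ?_⟩
  have hLam : 0 ≤ Lam := hell.Lam_nonneg hd (by norm_num) hlam
  obtain ⟨f', hm, h0, hff', hF, hsup', hpos', htr'⟩ :=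
    Kolmogorov.exists_representative (by norm_num) hsup hpos htr
  set Ω : Set (Kolmogorov.TimePhase d) := Ioo (1 / 4 : ℝ) (3 / 4) ×ˢ Metric.ball 0 R with hΩ
  have hΩo : IsOpen Ω := isOpen_Ioo.prod Metric.isOpen_ball
  have hΩ0 : volume Ω ≠ 0 := (hΩo.measure_pos volume
    ⟨(1 / 2, 0), by norm_num, Metric.mem_ball_self hR⟩).ne'
  have hΩs : Ω ⊆ Kolmogorov.slab d (1 / 4) 1 := fun z hz =>
    ⟨⟨hz.1.1, hz.1.2.trans (by norm_num)⟩, mem_univ _⟩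
  have hB := hC a f' lam Lam hlam hLam hell hsup' hpos' htr' hm h0
  have hneg := Kolmogorov.logMeanNeg_trace_lt_top hm h0 hB hΩo.measurableSet hΩ0
    (ae_restrict_of_ae_restrict_of_subset hΩs hpos')
  have hc : Kolmogorov.cMean f = Kolmogorov.cMean f' := by
    rw [Kolmogorov.cMean, Kolmogorov.cMean, Kolmogorov.logMean, Kolmogorov.logMean,
      Kolmogorov.logMeanPos_congr hF, Kolmogorov.logMeanNeg_congr hF]
  refine ⟨(Kolmogorov.logMeanNeg_congr hF).trans_lt hneg, fun s hs => ?_⟩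
  calc _ ≤ ENNReal.ofReal s * volume {z | z ∈ Ω ∧
          (s : EReal) < Kolmogorov.elog (f' z) - Kolmogorov.cMean f'} := by
        -- `E` and `f` need not be measurable. Up to a null set, the set in question lies in the
        -- superlevel set of the measurable representative over the larger cylinder.
        refine mul_le_mul_right (measure_mono_ae ?_) _
        filter_upwards [(ae_restrict_iff' hΩo.measurableSet).1
          (ae_restrict_of_ae_restrict_of_subset hΩs hff')] with z hz
        rintro ⟨h1, h2, h3⟩
        have hzΩ : z ∈ Ω := ⟨h1, hER h2⟩
        rw [hz hzΩ, hc] at h3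
        exact ⟨hzΩ, h3⟩
    _ ≤ ENNReal.ofReal (C₀ * (1 / lam + Lam)) :=
        Kolmogorov.mul_volume_superlevel_le hm h0 hB hΩo.measurableSet hneg hs
    _ ≤ ENNReal.ofReal ((C₀ + 1) * (1 / lam + Lam)) := by
        refine ENNReal.ofReal_le_ofReal (mul_le_mul_of_nonneg_right (by linarith) ?_)
        positivity
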